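/- Work over the field \(\mathbb F=\mathbb F_2\) with two elements. **Diagrams.** Let \(\mathcal D_T\) be an oriented planar diagram, in a disk, of a Conway tangle \(T\) (four ends), together with one dotted arc, such that: the two top ends point out of the disk and the two bottom ends point into it; the projection of \(T\) is connected; the dotted arc is parallel to the boundary of the open region at the bottom, i.e. it joins the strands at the two bottom ends; and the open region on the right is adjacent to exactly one crossing. Each crossing, and each arc, is drawn locally with two strands entering at the bottom and two leaving at the top; its top, left, bottom and right regions are denoted \(x_0^a,x_1^a,x_2^a,x_3^a\). The open regions of \(\mathcal D_T\) are denoted \(x_0,x_1,x_2,x_3\) in the same order. A crossing can be replaced by a dotted arc (the strands then run from bottom left to top left and from bottom right to top right) or by a thick arc (the two bottom ends are then joined, and so are the two top ends). The \(0\)-resolution of a positive crossing is dotted and its \(1\)-resolution thick; for a negative crossing it is the other way round. A complete resolution \(\mathcal D=\mathcal D_T(v)\), \(v\in\{0,1\}^n\), is obtained by resolving all \(n\) crossings; the dotted arc of \(\mathcal D_T\) is kept. **Rings.** Let \(\widetilde R\) be the quotient by \(x_0-x_1\) of the subring of \(\mathbb F[H,x_i : i \text{ a region of }\mathcal D_T]\)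 generated by \(H\) and all \(x_i-x_j\). It is an algebra over \(\widetilde R^\partial=\mathbb F[x,y,z]\) through \(x=x_0-x_2\), \(y=H-(x_3-x_0)\), \(z=x_2-x_3\), so that \(H=x+y+z\). All variables have internal degree \(-2\). **Factorizations.** Put \(\sigma_a=x^a_0+x^a_2-x^a_1-x^a_3\), and \((\lambda_a,\kappa_a)=(x_0^a-x_2^a,\,(H-(x_3^a-x_1^a))\sigma_a)\) for a dotted arc \(a\), \((\lambda_a,\kappa_a)=(H-(x_3^a-x_1^a),\,(x_0^a-x_2^a)\sigma_a)\) for a thick arc \(a\). Then \(\widetilde M(\mathcal D)\) is the tensor product over \(\widetilde R\), over all arcs \(a\) of \(\mathcal D\), of the factorizations \(i^1\widetilde R \underset{\kappa_a}{\overset{\lambda_a}{\rightleftarrows}} i^0\widetilde R\) (here \(i^k\) shifts the internal degree by \(k\)), regarded over \(\widetilde R^\partial\). Let \(\widetilde M(\mathcal D_0)=(i^1\widetilde R^\partial\underset{yz}{\overset{x}{\rightleftarrows}}\widetilde R^\partial)\) and \(\widetilde M(\mathcal D_1)=(i^1\widetilde R^\partial\underset{xz}{\overset{y}{\rightleftarrows}}\widetilde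 R^\partial)\). Let \(s_0:\widetilde M(\mathcal D_0)\to\widetilde M(\mathcal D_1)\) and \(s_1:\widetilde M(\mathcal D_1)\to\widetilde M(\mathcal D_0)\) be the maps given by \(1: i^1\widetilde R^\partial\to\widetilde R^\partial\) and \(z:\widetilde R^\partial\to i^1\widetilde R^\partial\), put \(s_2=s_0\), and let \(d_0=y\cdot\mathrm{id}\) on \(\widetilde M(\mathcal D_0)\), \(d_1=x\cdot\mathrm{id}\) on \(\widetilde M(\mathcal D_1)\). For a complete resolution \(\mathcal D\), let \(\varepsilon=\varepsilon(\mathcal D)=0\) if the strand at the bottom left end ends at the top left end, and \(\varepsilon=1\) otherwise (then it ends at the bottom right end); \(o(\mathcal D)=\mathcal D_{\varepsilon}\). Let \(V(\mathcal D)=\bigotimes_c i^1\mathbb F[H,y_c]/(y_c^2-Hy_c)\), over the closed components \(c\) of \(\mathcal D\) and with tensor products over \(\mathbb F[H]\); each factor has the basis \(1_c,y_c\). Let \(o^*\) be the open component at the top left end and \(o\) the other one. **Saddle maps.** If \(\mathcal D'\) differs from \(\mathcal D\) in the kind of a single arc, \(\mathcal S(\mathcal D,\mathcal D'):V(\mathcal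 D)\otimes_{\mathbb F[H]}\widetilde M(o(\mathcal D))\to V(\mathcal D')\otimes_{\mathbb F[H]}\widetilde M(o(\mathcal D'))\) is the following map, where the tensor factors of all closed components common to \(\mathcal D\) and \(\mathcal D'\) are mapped by the identity: \(\mathrm{id}\otimes s_{\varepsilon(\mathcal D)}\) if \(\varepsilon(\mathcal D)\ne\varepsilon(\mathcal D')\). Otherwise, with \(\varepsilon=\varepsilon(\mathcal D)\): if \(c_i,c_j\) merge to \(c_k\), it is \((1_i^*1_j^*1_k+y_i^*1_j^*y_k+1_i^*y_j^*y_k+H\,y_i^*y_j^*y_k)\otimes\mathrm{id}\); if \(c_i\) merges with \(o\), it is \(1_i^*\otimes\mathrm{id}+y_i^*\otimes s_{\varepsilon+1}s_\varepsilon\); if \(c_i\) merges with \(o^*\), it is \((1_i^*+H\,y_i^*)\otimes\mathrm{id}\); if \(c_k\) splits into \(c_i,c_j\), it is \((1_k^*y_i1_j+1_k^*1_iy_j+H\,1_k^*1_i1_j+y_k^*y_iy_j)\otimes\mathrm{id}\); if \(c_i\) splits from \(o\), it is \(1_i\otimes d_\varepsilon+y_i\otimes\mathrm{id}\); if \(c_i\)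 splits from \(o^*\), it is \(y_i\otimes\mathrm{id}\). A special deformation retract \(M\to N\) consists of degree-preserving homomorphisms \(p:M\to N\), \(\iota:N\to M\) and a map \(h:M\to M\) of degree \(3\) with \(p\iota=\mathrm{id}\), \(\mathrm{id}-\iota p=dh+hd\), \(h^2=0\), \(h\iota=0\), \(ph=0\). **Lemma.** For every complete resolution \(\mathcal D\) of \(\mathcal D_T\), \(\widetilde M(\mathcal D)\) and \(V(\mathcal D)\otimes_{\mathbb F[H]}\widetilde M(o(\mathcal D))\) are matrix factorizations over \(\widetilde R^\partial\) with potential \(xyz\) (with differentials of degree \(-3\)), and there are special deformation retracts \[\varphi_{\mathcal D}:\widetilde M(\mathcal D)\to V(\mathcal D)\otimes_{\mathbb F[H]}\widetilde M(o(\mathcal D))\] of matrix factorizations over \(\widetilde R^\partial\), one for each complete resolution, with the following property. Let \(\mathcal D=\mathcal D_T(v)\) and \(\mathcal D'=\mathcal D_T(v')\), where \(v'\) is obtained from \(v\) by changing one entry, at a crossing \(a\), from \(0\) to \(1\), and let \(f:\widetilde M(\mathcal D)\to\widetilde M(\mathcal D')\) be the edge map of the cube of resolutions, which is \(-1:i^1\widetilde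 R\to i^0\widetilde R\) and \(\sigma_a:i^0\widetilde R\to i^1\widetilde R\) in the tensor factor of \(a\) and the identity in all others. Then the induced map \(p_{\varphi_{\mathcal D'}}\circ f\circ\iota_{\varphi_{\mathcal D}}\) is equal to \(\mathcal S(\mathcal D,\mathcal D')\) up to homotopy of maps between matrix factorizations over \(\widetilde R^\partial\), i.e. up to \(dh+hd\) for an \(\widetilde R^\partial\)-linear map \(h\). -/

import Mathlib

open scoped TensorProduct

noncomputable section

namespace Delooping

/-! ## Planar diagrams -/

inductive Side
  | left
  | right
  deriving DecidableEq

instance : Fintype Side := ⟨{Side.left, Side.right}, fun s => by cases s <;> simp⟩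

inductive Dir
  | top
  | left
  | bottom
  | right
  deriving DecidableEq

/-- A dotted arc (elementary diagram `D₀`) or a thick arc (elementary diagram `D₁`). -/
inductive ArcKind
  | dotted
  | thick
  deriving DecidableEq

/-- The sign of a crossing. -/
inductive Sign
  | pos
  | neg
  deriving DecidableEq

/-- The oriented 4-valent graph in a disk with four ends that underlies a diagram, as a
combinatorial map. Each vertex `v : V` (a crossing or an arc) is drawn as in the elementary
diagrams: two strand ends enter it at the bottom (left and right), two leave it at the top (left
and right). The disk itself has two incoming ends at the bottom and two outgoing ends at the top.

An oriented edge runs from a *source* to a *target*. The sources are `inl (v, s)`, the strand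
leaving `v` at the top `s`, and `inr s`, the tangle end at the bottom `s` of the disk. The targets
are `inl (v, s)`, the strand entering `v` at the bottom `s`, and `inr s`, the tangle end at the
top `s` of the disk. -/
structure Gluing (V : Type*) where
  glue : ((V × Side) ⊕ Side) ≃ ((V × Side) ⊕ Side)

namespace Gluing

variable {V : Type*} (G : Gluing V)

/-- Edges are indexed by their sources. -/
abbrev Edge (_G : Gluing V) := (V × Side) ⊕ Side

/-- The edge leaving the vertex `v` at the top left or top right. -/
def outEdge (v : V) (s : Side) : G.Edge := Sum.inl (v, s)

/-- The edge entering the vertex `v` at the bottom left or bottom right. -/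
def inEdge (v : V) (s : Side) : G.Edge := G.glue.symm (Sum.inl (v, s))

/-- The edge at the bottom left or bottom right end of the tangle. -/
def bottomEnd (s : Side) : G.Edge := Sum.inr s

/-- The edge at the top left or top right end of the tangle. -/
def topEnd (s : Side) : G.Edge := G.glue.symm (Sum.inr s)

/-- Corners of the regions: `inl (v, i)` is the local region at the vertex `v` in direction `i`,
and `inr i` is the part of the disk next to the interval of its boundary in direction `i`. -/
abbrev Corner (_G : Gluing V) := (V × Dir) ⊕ Dir

/-- The corner to the left of an edge at its source. -/
def sourceLeft : G.Edge → G.Corner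
  | Sum.inl (v, Side.left) => Sum.inl (v, Dir.left)
  | Sum.inl (v, Side.right) => Sum.inl (v, Dir.top)
  | Sum.inr Side.left => Sum.inr Dir.left
  | Sum.inr Side.right => Sum.inr Dir.bottom

/-- The corner to the right of an edge at its source. -/
def sourceRight : G.Edge → G.Corner
  | Sum.inl (v, Side.left) => Sum.inl (v, Dir.top)
  | Sum.inl (v, Side.right) => Sum.inl (v, Dir.right)
  | Sum.inr Side.left => Sum.inr Dir.bottom
  | Sum.inr Side.right => Sum.inr Dir.right

/-- The corner to the left of an edge at its target. -/
def targetLeft : (V × Side) ⊕ Side → G.Corner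
  | Sum.inl (v, Side.left) => Sum.inl (v, Dir.left)
  | Sum.inl (v, Side.right) => Sum.inl (v, Dir.bottom)
  | Sum.inr Side.left => Sum.inr Dir.left
  | Sum.inr Side.right => Sum.inr Dir.top

/-- The corner to the right of an edge at its target. -/
def targetRight : (V × Side) ⊕ Side → G.Corner
  | Sum.inl (v, Side.left) => Sum.inl (v, Dir.bottom)
  | Sum.inl (v, Side.right) => Sum.inl (v, Dir.right)
  | Sum.inr Side.left => Sum.inr Dir.top
  | Sum.inr Side.right => Sum.inr Dir.right

/-- Two corners lie next to each other along one side of an edge. -/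
inductive Adjacent : G.Corner → G.Corner → Prop
  | left (e : G.Edge) : Adjacent (G.sourceLeft e) (G.targetLeft (G.glue e))
  | right (e : G.Edge) : Adjacent (G.sourceRight e) (G.targetRight (G.glue e))

/-- The regions of the diagram. -/
def Region := Quot G.Adjacent

/-- The region at the vertex `v` in direction `i`; the local labels `x₀, x₁, x₂, x₃` of an
elementary diagram are its top, left, bottom and right regions. -/
def regionAt (v : V) (i : Dir) : G.Region := Quot.mk _ (Sum.inl (v, i))

/-- The open regions; `x₀, x₁, x₂, x₃` are the top, left, bottom and right ones. -/
def openRegion (i : Dir) : G.Region := Quot.mk _ (Sum.inr i)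

/-- Euler's formula `#vertices - #edges + #faces = 2` on the sphere obtained by collapsing the
complement of the open disk to one further vertex: there are `|V| + 1` vertices and `2 |V| + 2`
edges. For a connected combinatorial map this says that its genus is `0`. -/
def Planar [Fintype V] : Prop := Nat.card G.Region = Fintype.card V + 3

/-! ### Edge rings -/

/-- The polynomial ring over `𝔽 = ℤ/2` in `H` (the variable `none`) and one variable for each
region. -/
abbrev RegionPoly := MvPolynomial (Option G.Region) (ZMod 2)

/-- The edge ring: the subring generated by `H` and all differences of region variables. -/
def edgeRing : Subalgebra (ZMod 2) G.RegionPoly :=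
  Algebra.adjoin (ZMod 2)
    ({MvPolynomial.X none} ∪
      {p | ∃ i j : G.Region, p = MvPolynomial.X (some i) - MvPolynomial.X (some j)})

/-- `H` in the edge ring. -/
def edgeH : G.edgeRing :=
  ⟨MvPolynomial.X none, Algebra.subset_adjoin (Or.inl rfl)⟩

/-- `x_i - x_j` in the edge ring. -/
def edgeDiff (i j : G.Region) : G.edgeRing :=
  ⟨MvPolynomial.X (some i) - MvPolynomial.X (some j), Algebra.subset_adjoin (Or.inr ⟨i, j, rfl⟩)⟩

/-- The reduced edge ring, in which `x₀ = x₁`. -/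
def ReducedRing : Type _ :=
  G.edgeRing ⧸ Ideal.span {G.edgeDiff (G.openRegion Dir.top) (G.openRegion Dir.left)}

instance : CommRing G.ReducedRing :=
  inferInstanceAs (CommRing (G.edgeRing ⧸
    Ideal.span {G.edgeDiff (G.openRegion Dir.top) (G.openRegion Dir.left)}))

instance : Algebra (ZMod 2) G.ReducedRing :=
  inferInstanceAs (Algebra (ZMod 2) (G.edgeRing ⧸
    Ideal.span {G.edgeDiff (G.openRegion Dir.top) (G.openRegion Dir.left)}))

/-- The quotient map from the edge ring to the reduced edge ring. -/
def toReduced : G.edgeRing →+* G.ReducedRing := Ideal.Quotient.mk _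

/-- `H` in the reduced edge ring. -/
def redH : G.ReducedRing := G.toReduced G.edgeH

/-- `x_i - x_j` in the reduced edge ring. -/
def diff (i j : G.Region) : G.ReducedRing := G.toReduced (G.edgeDiff i j)

/-- The elements of the reduced edge ring that are homogeneous of polynomial degree `k`, where
`H` and the region variables have degree `1`; their internal grading is `-2 * k`. -/
def redHomogeneous (k : ℕ) : Set G.ReducedRing :=
  {q | ∃ p : G.edgeRing, (p : G.RegionPoly).IsHomogeneous k ∧ G.toReduced p = q}

end Gluing

/-! ### The reduced boundary edge ring `𝔽[x, y, z]` -/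

/-- The reduced boundary edge ring `𝔽[x, y, z]`. -/
def BoundaryRing : Type := MvPolynomial (Fin 3) (ZMod 2)

instance : CommRing BoundaryRing := inferInstanceAs (CommRing (MvPolynomial (Fin 3) (ZMod 2)))

/-- `BoundaryRing` is the polynomial ring in three variables. -/
def BoundaryRing.equiv : BoundaryRing ≃+* MvPolynomial (Fin 3) (ZMod 2) := RingEquiv.refl _

def bx : BoundaryRing := BoundaryRing.equiv.symm (MvPolynomial.X 0)
def bY : BoundaryRing := BoundaryRing.equiv.symm (MvPolynomial.X 1)
def bz : BoundaryRing := BoundaryRing.equiv.symm (MvPolynomial.X 2)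

/-- `H = x + y + z` in the boundary ring. -/
def bH : BoundaryRing := bx + bY + bz

/-- The ring `𝔽[H]`. -/
abbrev FH := Polynomial (ZMod 2)

/-- `𝔽[x, y, z]` is an algebra over `𝔽[H]` through `H = x + y + z`. -/
instance : Algebra FH BoundaryRing :=
  (Polynomial.eval₂RingHom
    (BoundaryRing.equiv.symm.toRingHom.comp (MvPolynomial.C : ZMod 2 →+* _)) bH).toAlgebra

/-- The reduced edge ring is an algebra over the reduced boundary edge ring through
`x = x₀ - x₂`, `y = H - (x₃ - x₀)`, `z = x₂ - x₃`. -/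
instance {V : Type*} (G : Gluing V) : Algebra BoundaryRing G.ReducedRing :=
  ((MvPolynomial.aeval (R := ZMod 2)
    ![G.diff (G.openRegion Dir.top) (G.openRegion Dir.bottom),
      G.redH - G.diff (G.openRegion Dir.right) (G.openRegion Dir.top),
      G.diff (G.openRegion Dir.bottom) (G.openRegion Dir.right)]).toRingHom.comp
    BoundaryRing.equiv.toRingHom).toAlgebra

/-! ## Matrix factorizations -/

universe u

/-- A module over `S` with an `S`-linear endomorphism `d` and internally graded pieces. -/
structure Factorization (S : Type) [CommRing S] where
  carrier : Type u
  [addCommGroup : AddCommGroup carrier]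
  [module : Module S carrier]
  d : carrier →ₗ[S] carrier
  gr : ℤ → AddSubgroup carrier

attribute [instance] Factorization.addCommGroup Factorization.module

namespace Factorization

variable {S : Type} [CommRing S]

/-- `M` is a matrix factorization with potential `w`: `d² = w`, and `d` has internal degree
`-3`. -/
def IsMatrixFactorization (M : Factorization S) (w : S) : Prop :=
  M.d ∘ₗ M.d = w • LinearMap.id ∧ ∀ n, ∀ m ∈ M.gr n, M.d m ∈ M.gr (n - 3)

/-- A linear map that is homogeneous of internal degree `k`. -/
def HasDegree {M N : Factorization S} (f : M.carrier →ₗ[S] N.carrier) (k : ℤ) : Prop :=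
  ∀ n, ∀ m ∈ M.gr n, f m ∈ N.gr (n + k)

/-- The differential on the space of morphisms (in characteristic `2`). -/
def boundary {M N : Factorization S} (f : M.carrier →ₗ[S] N.carrier) :
    M.carrier →ₗ[S] N.carrier :=
  N.d ∘ₗ f + f ∘ₗ M.d

/-- Homotopy of morphisms. -/
def Homotopic {M N : Factorization S} (f g : M.carrier →ₗ[S] N.carrier) : Prop :=
  ∃ h : M.carrier →ₗ[S] N.carrier, f - g = boundary h

/-- A special deformation retract `M → N`: grading preserving homomorphisms `proj : M → N` and
`incl : N → M` with `proj ∘ incl = id`, and a homotopy `htpy` from `incl ∘ proj` to the identity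
satisfying the side conditions. -/
structure SpecialDeformationRetract (M N : Factorization S) where
  proj : M.carrier →ₗ[S] N.carrier
  incl : N.carrier →ₗ[S] M.carrier
  htpy : M.carrier →ₗ[S] M.carrier
  boundary_proj : boundary proj = 0
  boundary_incl : boundary incl = 0
  proj_degree : HasDegree proj 0
  incl_degree : HasDegree incl 0
  htpy_degree : HasDegree htpy 3
  proj_incl : proj ∘ₗ incl = LinearMap.id
  incl_proj : LinearMap.id - incl ∘ₗ proj = boundary htpy
  htpy_htpy : htpy ∘ₗ htpy = 0
  htpy_incl : htpy ∘ₗ incl = 0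
  proj_htpy : proj ∘ₗ htpy = 0

end Factorization

/-! ### The elementary factorizations over the boundary ring -/

/-- The map `R² → R²` that sends the copy `true` to the copy `false` by `α` and the copy `false`
to the copy `true` by `β`. The copy `true` is the one that is shifted to `i¹ R`. -/
def twoTerm (α β : BoundaryRing) : (Bool → BoundaryRing) →ₗ[BoundaryRing] (Bool → BoundaryRing) :=
  LinearMap.pi fun b =>
    (if b then β else α) • (LinearMap.proj (!b) : (Bool → BoundaryRing) →ₗ[BoundaryRing] _)

/-- The differential of `M̃(D₀)`, given by `x` and `yz`, or of `M̃(D₁)`, given by `y` and `xz`. -/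
def elementaryD : ArcKind → ((Bool → BoundaryRing) →ₗ[BoundaryRing] (Bool → BoundaryRing))
  | ArcKind.dotted => twoTerm bx (bY * bz)
  | ArcKind.thick => twoTerm bY (bx * bz)

/-- The saddle maps `s₀ : M̃(D₀) → M̃(D₁)` and `s₁ : M̃(D₁) → M̃(D₀)`; they are given by the same
matrix. -/
def saddle : ArcKind → ((Bool → BoundaryRing) →ₗ[BoundaryRing] (Bool → BoundaryRing))
  | ArcKind.dotted => twoTerm 1 bz
  | ArcKind.thick => twoTerm 1 bz

/-- The dot maps: `d₀`, multiplication by `y` on `M̃(D₀)`, and `d₁`, multiplication by `x` on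
`M̃(D₁)`. -/
def dot : ArcKind → ((Bool → BoundaryRing) →ₗ[BoundaryRing] (Bool → BoundaryRing))
  | ArcKind.dotted => bY • LinearMap.id
  | ArcKind.thick => bx • LinearMap.id

def ArcKind.other : ArcKind → ArcKind
  | ArcKind.dotted => ArcKind.thick
  | ArcKind.thick => ArcKind.dotted

/-! ### Crossingless diagrams -/

/-- A crossingless diagram, all of whose vertices are dotted or thick arcs. At a dotted arc the
strands run from bottom left to top left and from bottom right to top right; at a thick arc the
two bottom ends are joined, and so are the two top ends. -/
structure Crossingless (V : Type*) extends Gluing V where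
  kind : V → ArcKind

namespace Crossingless

section Components

variable {V : Type*} (D : Crossingless V)

/-- Two edges belong to the same strand at some arc. -/
inductive Joined : D.Edge → D.Edge → Prop
  | dotted (v : V) (s : Side) (h : D.kind v = ArcKind.dotted) :
      Joined (D.inEdge v s) (D.outEdge v s)
  | thickIn (v : V) (h : D.kind v = ArcKind.thick) :
      Joined (D.inEdge v Side.left) (D.inEdge v Side.right)
  | thickOut (v : V) (h : D.kind v = ArcKind.thick) :
      Joined (D.outEdge v Side.left) (D.outEdge v Side.right)

/-- The component of the diagram (without its arcs) that contains the edge `e`, as a set of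
edges. -/
def component (e : D.Edge) : Set D.Edge := {e' | Relation.EqvGen D.Joined e e'}

/-- The closed components. -/
def closedComponents : Set (Set D.Edge) :=
  {c | (∃ e, c = D.component e) ∧ ∀ s, D.bottomEnd s ∉ c ∧ D.topEnd s ∉ c}

/-- The special open component, which contains the marked tangle end at the top left. -/
def special : Set D.Edge := D.component (D.topEnd Side.left)

/-- The component `c` runs through the vertex `v`. -/
def Through (c : Set D.Edge) (v : V) : Prop := ∃ s, D.inEdge v s ∈ c ∨ D.outEdge v s ∈ c

open Classical in
/-- The kind of elementary diagram `o(D)`: the open strands are connected as in `D₀` if the bottom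
left end is connected to the top left end, and as in `D₁` otherwise. -/
def openKind : ArcKind :=
  if D.bottomEnd Side.left ∈ D.special then ArcKind.dotted else ArcKind.thick

end Components

/-! ### The matrix factorization of a crossingless diagram -/

section MatrixFactorization

variable {V : Type*} (D : Crossingless V)

/-- `x₀ + x₂ - x₁ - x₃` at the vertex `v`. -/
def altSum (G : Gluing V) (v : V) : G.ReducedRing :=
  G.diff (G.regionAt v Dir.top) (G.regionAt v Dir.left) +
    G.diff (G.regionAt v Dir.bottom) (G.regionAt v Dir.right)

/-- `x₀ - x₂` at a dotted arc, `H - (x₃ - x₁)` at a thick arc. -/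
def lam (v : V) : D.ReducedRing :=
  match D.kind v with
  | ArcKind.dotted => D.diff (D.regionAt v Dir.top) (D.regionAt v Dir.bottom)
  | ArcKind.thick => D.redH - D.diff (D.regionAt v Dir.right) (D.regionAt v Dir.left)

/-- `(H - (x₃ - x₁)) (x₀ + x₂ - x₁ - x₃)` at a dotted arc, `(x₀ - x₂) (x₀ + x₂ - x₁ - x₃)` at a
thick arc. -/
def kap (v : V) : D.ReducedRing :=
  match D.kind v with
  | ArcKind.dotted =>
      (D.redH - D.diff (D.regionAt v Dir.right) (D.regionAt v Dir.left)) * altSum D.toGluing v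
  | ArcKind.thick =>
      D.diff (D.regionAt v Dir.top) (D.regionAt v Dir.bottom) * altSum D.toGluing v

/-- The underlying module of the tensor product, over all vertices `v`, of the two-term
factorizations `i¹ R̃ ⇄ i⁰ R̃`. The tensor product is free on the functions `s : V → Bool`, where
`s v` is `true` if the generator `i¹ R̃` is chosen in the factor of `v`, and `false` if the
generator `i⁰ R̃` is chosen. -/
abbrev TensorModule (G : Gluing V) := (V → Bool) → G.ReducedRing

/-- The map on the tensor product that acts in the factor of `v` by `α` from `i¹ R̃` to `i⁰ R̃` and
by `β` from `i⁰ R̃` to `i¹ R̃`, and by the identity in all other factors. (There are no signs in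
characteristic `2`.) -/
def localMap [DecidableEq V] (G : Gluing V) (v : V) (α β : G.ReducedRing) :
    TensorModule G →ₗ[BoundaryRing] TensorModule G :=
  LinearMap.pi fun s =>
    LinearMap.mulLeft BoundaryRing (if s v then β else α) ∘ₗ
      LinearMap.proj (Function.update s v (!s v))

variable [Fintype V] [DecidableEq V]

/-- The reduced matrix factorization `M̃(D)`, over the reduced boundary edge ring. -/
def factorization : Factorization BoundaryRing where
  carrier := TensorModule D.toGluing
  d := ∑ v, localMap D.toGluing v (D.lam v) (D.kap v)
  gr n := AddSubgroup.closure
    {m | ∃ (s : V → Bool) (k : ℕ), ∃ r ∈ D.redHomogeneous k,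
      ((Finset.univ.filter fun v => s v = true).card : ℤ) - 2 * k = n ∧ m = Pi.single s r}

end MatrixFactorization

/-! ### The delooped factorization -/

section Deloop

/-- `y² - H y` over `𝔽[H]`. -/
def circlePoly : Polynomial FH :=
  Polynomial.X ^ 2 - Polynomial.C (Polynomial.X : FH) * Polynomial.X

theorem circlePoly_natDegree : circlePoly.natDegree = 2 := by
  unfold circlePoly
  compute_degree!

theorem circlePoly_monic : circlePoly.Monic := by
  unfold circlePoly
  monicity!

/-- `V(c) = 𝔽[H, y] / (y² - H y)`. -/
abbrev CircleModule := AdjoinRoot circlePoly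

/-- The basis `1, y` of `V(c)`. -/
def circleBasis : Module.Basis (Fin 2) FH CircleModule :=
  (AdjoinRoot.powerBasisAux' circlePoly_monic).reindex (finCongr circlePoly_natDegree)

variable {V : Type*} (D : Crossingless V)

/-- `V(D)`, the tensor product of `V(c)` over all closed components `c`. -/
abbrev CirclesModule := ⨂[FH] _c : D.closedComponents, CircleModule

variable [Fintype V]

/-- The basis of `V(D)` formed by the products of the `1_c` (where the index is `0`) and the `y_c`
(where the index is `1`). -/
def circlesBasis : Module.Basis (D.closedComponents → Fin 2) FH D.CirclesModule :=
  Basis.piTensorProduct fun _ => circleBasis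

open Classical in
/-- The matrix factorization `V(D) ⊗ M̃(o(D))` over the reduced boundary edge ring, with the tensor
product taken over `𝔽[H]` (and its factors written in the opposite order). In the grading, `V(c)`
is shifted so that `1_c` has internal degree `1` and `y_c` has internal degree `-1`. -/
def delooped : Factorization BoundaryRing where
  carrier := (Bool → BoundaryRing) ⊗[FH] D.CirclesModule
  d := TensorProduct.AlgebraTensorModule.map (elementaryD D.openKind) LinearMap.id
  gr n := AddSubgroup.closure
    {m | ∃ (b : Bool) (ε : D.closedComponents → Fin 2) (k : ℕ) (r : BoundaryRing),
      (BoundaryRing.equiv r).IsHomogeneous k ∧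
      (if b then 1 else 0) + ∑ c, (1 - 2 * ((ε c : ℕ) : ℤ)) - 2 * k = n ∧
      m = Pi.single b r ⊗ₜ[FH] D.circlesBasis ε}

/-! ### The explicit saddle maps -/

/-- The number of closed components of `D` that run through `v`. -/
def circlesAt (v : V) : ℕ := Nat.card {c : D.closedComponents // D.Through c v}

/-- The number of factors `y_c` in the basis element `ε` of `V(D)`, over the closed components `c`
that run through `v`. -/
def ysAt (v : V) (ε : D.closedComponents → Fin 2) : ℕ :=
  Nat.card {c : D.closedComponents // D.Through c v ∧ ε c = 1}

/-- The same crossing-free gluing with other arcs. -/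
def withKind (k : V → ArcKind) : Crossingless V := ⟨D.toGluing, k⟩

/-- Two basis elements of `V(D)` and `V(D')` have the same factors at all closed components that
are common to `D` and `D'`; these are the ones not involved in the saddle. -/
def Agree (k : V → ArcKind) (ε : D.closedComponents → Fin 2)
    (ε' : (D.withKind k).closedComponents → Fin 2) : Prop :=
  ∀ (c : Set D.Edge) (h : c ∈ D.closedComponents) (h' : c ∈ (D.withKind k).closedComponents),
    ε ⟨c, h⟩ = ε' ⟨c, h'⟩

open Classical in
/-- The component `M̃(o(D)) → M̃(o(D'))` of the saddle map from the basis element `ε` of `V(D)` to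
the basis element `ε'` of `V(D')`, where `D'` differs from `D` in the kind of the arc at `v` only.

If `ε` and `ε'` differ away from the saddle, it is zero. If `o(D)` and `o(D')` differ, it is the
saddle map `s₀` or `s₁`. Otherwise the cases are told apart by the numbers of closed components
of `D` and `D'` that run through `v`: two circles merge (`2, 1`), one circle splits (`1, 2`), a
circle merges with an open component (`1, 0`), a circle splits off an open component (`0, 1`). The
next two numbers count the factors `y` of `ε` and `ε'` at these circles. The open component that is
involved is the special one if and only if that one runs through `v`. -/
def saddleEntry (k : V → ArcKind) (v : V) (ε : D.closedComponents → Fin 2)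
    (ε' : (D.withKind k).closedComponents → Fin 2) :
    (Bool → BoundaryRing) →ₗ[BoundaryRing] (Bool → BoundaryRing) :=
  if ¬ D.Agree k ε ε' then 0
  else if D.openKind ≠ (D.withKind k).openKind then saddle D.openKind
  else
    match D.circlesAt v, (D.withKind k).circlesAt v, D.ysAt v ε, (D.withKind k).ysAt v ε' with
    | 2, 1, 0, 0 => LinearMap.id
    | 2, 1, 1, 1 => LinearMap.id
    | 2, 1, 2, 1 => bH • LinearMap.id
    | 1, 2, 0, 1 => LinearMap.id
    | 1, 2, 0, 0 => bH • LinearMap.id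
    | 1, 2, 1, 2 => LinearMap.id
    | 1, 0, 0, 0 => LinearMap.id
    | 1, 0, 1, 0 =>
        if D.Through D.special v then bH • LinearMap.id
        else saddle D.openKind.other ∘ₗ saddle D.openKind
    | 0, 1, 0, 0 => if D.Through D.special v then 0 else dot D.openKind
    | 0, 1, 0, 1 => LinearMap.id
    | _, _, _, _ => 0

open Classical in
/-- The explicit map `𝒮(D, D') : V(D) ⊗ M̃(o(D)) → V(D') ⊗ M̃(o(D'))`, where `D'` differs from `D`
in the kind of the arc at `v` only: the sum, over all basis elements `ε` and `ε'`, of the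
elementary matrices `V(D) → V(D')` tensored with the entries of the map. -/
def saddleMap (k : V → ArcKind) (v : V) :
    D.delooped.carrier →ₗ[BoundaryRing] (D.withKind k).delooped.carrier :=
  ∑ ε : D.closedComponents → Fin 2, ∑ ε' : (D.withKind k).closedComponents → Fin 2,
    TensorProduct.AlgebraTensorModule.map (D.saddleEntry k v ε ε')
      ((D.circlesBasis.coord ε).smulRight ((D.withKind k).circlesBasis ε'))

end Deloop

end Crossingless

/-! ## Tangle diagrams -/

/-- A diagram of a Conway tangle with crossings indexed by `C` and with one dotted arc. Its
vertices are the crossings `some c` and the arc `none`. All strands are oriented, such that the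
tangle ends at the top point out of the disk and those at the bottom point into it. At a positive
crossing the strand from bottom left to top right is the upper one, at a negative crossing the
strand from bottom right to top left. -/
structure TangleDiagram (C : Type*) extends Gluing (Option C) where
  sign : C → Sign

namespace TangleDiagram

variable {C : Type*} (T : TangleDiagram C)

/-- The edge `e` ends at the crossing `c`. -/
def EndsAt (e : T.Edge) (c : C) : Prop :=
  ∃ s, e = T.inEdge (some c) s ∨ e = T.outEdge (some c) s

/-- Two edges meet in the projection of the tangle: at a crossing, or at an endpoint of the dotted
arc, where one is the continuation of the other. -/
inductive Meets : T.Edge → T.Edge → Prop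
  | crossing (c : C) (e e' : T.Edge) (h : T.EndsAt e c) (h' : T.EndsAt e' c) : Meets e e'
  | strand (s : Side) : Meets (T.inEdge none s) (T.outEdge none s)

/-- The standing assumptions. -/
structure Standing [Fintype C] : Prop where
  /-- The diagram is drawn in the disk. -/
  planar : T.Planar
  /-- The projection of the tangle is connected. -/
  connected : ∀ e e' : T.Edge, Relation.EqvGen T.Meets e e'
  /-- The dotted arc is parallel to the boundary of the open region at the bottom: it connects the
  strands at the two bottom tangle ends. -/
  arc : ∀ s, T.glue (Sum.inr s) = Sum.inl (none, s)
  /-- The open region on the right is adjacent to a single crossing. -/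
  right : ∃! c : C, ∃ i, T.regionAt (some c) i = T.openRegion Dir.right

/-- The arc that replaces a crossing in its `0`-resolution (`false`) or `1`-resolution (`true`). -/
def resolveCrossing : Sign → Bool → ArcKind
  | Sign.pos, false => ArcKind.dotted
  | Sign.pos, true => ArcKind.thick
  | Sign.neg, false => ArcKind.thick
  | Sign.neg, true => ArcKind.dotted

/-- The kinds of the arcs in the complete resolution at the vertex `r` of the cube. -/
def resolvedKind (r : C → Bool) : Option C → ArcKind
  | none => ArcKind.dotted
  | some c => resolveCrossing (T.sign c) (r c)

/-- The complete resolution at the vertex `r` of the cube. -/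
def resolution (r : C → Bool) : Crossingless (Option C) := ⟨T.toGluing, T.resolvedKind r⟩

variable [Fintype C] [DecidableEq C]

/-- The edge map `M̃(D) → M̃(D')` of the cube of resolutions at the crossing `c`, where `r c = 0` and
`r' c = 1`: in the factor of `c` it is `-1` from `i¹ R̃` to `i⁰ R̃` and `x₀ + x₂ - x₁ - x₃` from
`i⁰ R̃` to `i¹ R̃`, for crossings of either sign. -/
def edgeMap (c : C) (r r' : C → Bool) :
    (T.resolution r).factorization.carrier →ₗ[BoundaryRing]
      (T.resolution r').factorization.carrier :=
  Crossingless.localMap T.toGluing (some c) (-1) (Crossingless.altSum T.toGluing (some c))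

end TangleDiagram

end Delooping

end

open scoped TensorProduct

noncomputable section

set_option linter.unusedSectionVars false

/-! Colour the regions like a checkerboard and give each edge the variable `edgeVar`: the difference
of its two regions, plus H if the region on its left has colour 1. Every entry of the tensor product
then has a meaning in terms of components. Two edges on the same strand at an arc `v` have variables
that differ by the linear entry `lam v`. If y, y' are the variables of the two strands at `v` and σ
= `altSum`, then `kap v` = (y + y')σ and σ = y + y' + H + `lam v`. Modulo the linear entries each
component thus has a single variable, equal to H on the open component at the top left and to z on
the other one, while `kap v` becomes (y² + Hy) + (y'² + Hy').

Consider the graph whose vertices are the components and whose edges are the arcs. It is connected;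
take a spanning tree and single out one of its arcs, the root, that separates the two open
components. The other arcs of the spanning tree, called `tree` in `Frame`, are as many as the closed
components. At each arc other than the root one entry β is cancelled: `kap` on the tree, `lam`
elsewhere. This is possible because the reduced edge ring is free over 𝔽[x,y,z] on the products of
powers of the β with square-free monomials in the variables of the circles (`Frame.basis`). They
span because the quadratic relations above reduce the square of a circle variable to linear terms.
They are independent because the ring is a polynomial ring in |V| + 2 variables, and a quadratic β
together with one square-free variable contributes to the Hilbert series like one linear variable.
Division by β with remainder, in this basis, is a partial inverse to multiplication by β, and the
resulting contractions combine to a special deformation retract (`contracts_koszul`,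
`Contracts.step`, `Frame.retract`). What survives is the factor of the root, with coefficients
spanned by the circle monomials. By telescoping along the cut between the open components its linear
entry becomes x or y (`coeff_lam_root_mul`), and its other entry is then forced by the potential xyz
(`coeff_kap_root_mul`).

For the edge maps no explicit inclusion is computed. Edge maps are linear over the reduced edge
ring, have degree -1, and going forth and back is multiplication by σ. Linearity determines the
induced map, modulo the entries of the differentials, by its values on a generator 1
(`mkResidue_transfer_basis`). If the number of circles drops by one, or if the open strands are
reconnected, the degree allows only 0 or the generator as the relevant value, and 0 is excluded
since σ does not vanish at x = y = 0 (`transfer_generator`). If a circle is created, the map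
backwards is of the former kind, so 1 goes to σ = y + y' + H, the coproduct of 1. The explicit
saddle maps have the same values. Finally, the entries outside the expected pattern vanish by parity
of degrees, and a closed map of that pattern whose entries lie in the ideal of the entries of the
differentials is null-homotopic (`homotopic_of_openKind_eq`, `homotopic_of_openKind_ne`). -/

namespace Delooping

/-! ## Regions, connectedness and the checkerboard colouring -/

namespace Gluing

variable {V : Type*} (G : Gluing V)

/-- The region to the left of an edge. -/
def leftRegion (e : G.Edge) : G.Region := Quot.mk _ (G.sourceLeft e)

/-- The region to the right of an edge. -/
def rightRegion (e : G.Edge) : G.Region := Quot.mk _ (G.sourceRight e)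

theorem leftRegion_eq_target (e : G.Edge) :
    G.leftRegion e = Quot.mk _ (G.targetLeft (G.glue e)) :=
  Quot.sound (Adjacent.left e)

theorem rightRegion_eq_target (e : G.Edge) :
    G.rightRegion e = Quot.mk _ (G.targetRight (G.glue e)) :=
  Quot.sound (Adjacent.right e)

theorem leftRegion_outEdge_left (v : V) :
    G.leftRegion (G.outEdge v Side.left) = G.regionAt v Dir.left := rfl
theorem leftRegion_outEdge_right (v : V) :
    G.leftRegion (G.outEdge v Side.right) = G.regionAt v Dir.top := rfl
theorem rightRegion_outEdge_left (v : V) :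
    G.rightRegion (G.outEdge v Side.left) = G.regionAt v Dir.top := rfl
theorem rightRegion_outEdge_right (v : V) :
    G.rightRegion (G.outEdge v Side.right) = G.regionAt v Dir.right := rfl
theorem leftRegion_inEdge_left (v : V) :
    G.leftRegion (G.inEdge v Side.left) = G.regionAt v Dir.left := by
  rw [leftRegion_eq_target, inEdge, Equiv.apply_symm_apply]; rfl
theorem leftRegion_inEdge_right (v : V) :
    G.leftRegion (G.inEdge v Side.right) = G.regionAt v Dir.bottom := by
  rw [leftRegion_eq_target, inEdge, Equiv.apply_symm_apply]; rfl
theorem rightRegion_inEdge_left (v : V) :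
    G.rightRegion (G.inEdge v Side.left) = G.regionAt v Dir.bottom := by
  rw [rightRegion_eq_target, inEdge, Equiv.apply_symm_apply]; rfl
theorem rightRegion_inEdge_right (v : V) :
    G.rightRegion (G.inEdge v Side.right) = G.regionAt v Dir.right := by
  rw [rightRegion_eq_target, inEdge, Equiv.apply_symm_apply]; rfl
theorem leftRegion_bottomEnd_left :
    G.leftRegion (G.bottomEnd Side.left) = G.openRegion Dir.left := rfl
theorem leftRegion_bottomEnd_right :
    G.leftRegion (G.bottomEnd Side.right) = G.openRegion Dir.bottom := rfl
theorem rightRegion_bottomEnd_left :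
    G.rightRegion (G.bottomEnd Side.left) = G.openRegion Dir.bottom := rfl
theorem rightRegion_bottomEnd_right :
    G.rightRegion (G.bottomEnd Side.right) = G.openRegion Dir.right := rfl
theorem leftRegion_topEnd_left :
    G.leftRegion (G.topEnd Side.left) = G.openRegion Dir.left := by
  rw [leftRegion_eq_target, topEnd, Equiv.apply_symm_apply]; rfl
theorem leftRegion_topEnd_right :
    G.leftRegion (G.topEnd Side.right) = G.openRegion Dir.top := by
  rw [leftRegion_eq_target, topEnd, Equiv.apply_symm_apply]; rfl
theorem rightRegion_topEnd_left :
    G.rightRegion (G.topEnd Side.left) = G.openRegion Dir.top := by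
  rw [rightRegion_eq_target, topEnd, Equiv.apply_symm_apply]; rfl
theorem rightRegion_topEnd_right :
    G.rightRegion (G.topEnd Side.right) = G.openRegion Dir.right := by
  rw [rightRegion_eq_target, topEnd, Equiv.apply_symm_apply]; rfl

/-- The edge `e` ends at the vertex `v`. -/
def Incident (e : G.Edge) (v : V) : Prop := ∃ s, e = G.inEdge v s ∨ e = G.outEdge v s

/-- The graph obtained from the diagram by forgetting the boundary of the disk is connected. -/
def Linked : Prop :=
  ∀ e e' : G.Edge, Relation.EqvGen (fun e e' => ∃ v, G.Incident e v ∧ G.Incident e' v) e e'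

variable {G}

/-- A function on edges that is constant at each vertex is constant. -/
theorem Linked.eq_of_incident (hG : G.Linked) {α : Type*} (f : G.Edge → α)
    (hf : ∀ v e e', G.Incident e v → G.Incident e' v → f e = f e') (e e' : G.Edge) :
    f e = f e' := by
  induction hG e e' with
  | rel _ _ h => obtain ⟨v, h, h'⟩ := h; exact hf v _ _ h h'
  | refl _ => rfl
  | symm _ _ _ ih => exact ih.symm
  | trans _ _ _ _ _ ih ih' => exact ih.trans ih'

/-- A function on regions that takes the same value on both sides of each edge is constant. -/
theorem Linked.region_eq (hG : G.Linked) {α : Type*} (f : G.Region → α)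
    (hf : ∀ e, f (G.leftRegion e) = f (G.rightRegion e)) (i j : G.Region) : f i = f j := by
  have key : ∀ e e', f (G.leftRegion e) = f (G.leftRegion e') := by
    apply hG.eq_of_incident (fun e => f (G.leftRegion e))
    intro v
    have h1 := hf (G.outEdge v Side.left)
    have h2 := hf (G.outEdge v Side.right)
    have h3 := hf (G.inEdge v Side.left)
    rw [leftRegion_outEdge_left, rightRegion_outEdge_left] at h1
    rw [leftRegion_outEdge_right, rightRegion_outEdge_right] at h2
    rw [leftRegion_inEdge_left, rightRegion_inEdge_left] at h3
    have key : ∀ e, G.Incident e v → f (G.leftRegion e) = f (G.regionAt v Dir.left) := by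
      rintro e ⟨_ | _, rfl | rfl⟩
      · rw [leftRegion_inEdge_left]
      · rw [leftRegion_outEdge_left]
      · rw [leftRegion_inEdge_right, h3]
      · rw [leftRegion_outEdge_right, h1]
    intro e e' he he'
    rw [key e he, key e' he']
  have all : ∀ i : G.Region, ∃ e, f i = f (G.leftRegion e) := by
    intro i
    induction i using Quot.ind with | _ c
    rcases c with ⟨v, _ | _ | _ | _⟩ | (_ | _ | _ | _)
    · exact ⟨G.outEdge v Side.right, rfl⟩
    · exact ⟨G.outEdge v Side.left, rfl⟩
    · exact ⟨G.inEdge v Side.right, by rw [leftRegion_inEdge_right]; rfl⟩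
    · exact ⟨G.outEdge v Side.right, by rw [hf]; rfl⟩
    · exact ⟨G.topEnd Side.right, by rw [leftRegion_topEnd_right]; rfl⟩
    · exact ⟨G.bottomEnd Side.left, rfl⟩
    · exact ⟨G.bottomEnd Side.right, rfl⟩
    · exact ⟨G.bottomEnd Side.right, by rw [hf]; rfl⟩
  obtain ⟨e, he⟩ := all i
  obtain ⟨e', he'⟩ := all j
  rw [he, he', key e e']

theorem sum_side {A : Type*} [AddCommMonoid A] (f : Side → A) :
    ∑ s, f s = f Side.left + f Side.right := by
  have : (Finset.univ : Finset Side) = {Side.left, Side.right} := rfl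
  rw [this, Finset.sum_pair (by decide)]

variable (G) in
theorem sum_edge_source [Fintype V] {A : Type*} [AddCommMonoid A] (f : G.Edge → A) :
    ∑ e, f e = ∑ v, (f (G.outEdge v Side.left) + f (G.outEdge v Side.right)) +
      (f (G.bottomEnd Side.left) + f (G.bottomEnd Side.right)) := by
  rw [Fintype.sum_sum_type, Fintype.sum_prod_type, sum_side]
  simp only [sum_side]
  rfl

variable (G) in
theorem sum_edge_target [Fintype V] {A : Type*} [AddCommMonoid A] (f : G.Edge → A) :
    ∑ e, f e = ∑ v, (f (G.inEdge v Side.left) + f (G.inEdge v Side.right)) +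
      (f (G.topEnd Side.left) + f (G.topEnd Side.right)) := by
  rw [← Equiv.sum_comp G.glue.symm f, Fintype.sum_sum_type, Fintype.sum_prod_type, sum_side]
  simp only [sum_side]
  rfl

/-! ### The checkerboard colouring, from a count of dimensions over 𝔽₂. -/

section Colouring

variable [Fintype V] [DecidableEq V]

variable (G) in
/-- The sum of an edge function over the four edge ends at each vertex. -/
def vertexSum : (G.Edge → ZMod 2) →ₗ[ZMod 2] (V → ZMod 2) where
  toFun f v := f (G.inEdge v Side.left) + f (G.inEdge v Side.right) +
    f (G.outEdge v Side.left) + f (G.outEdge v Side.right)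
  map_add' f g := by ext v; simp only [Pi.add_apply]; ring
  map_smul' c f := by ext v; simp only [Pi.smul_apply, smul_eq_mul, RingHom.id_apply]; ring

theorem vertexSum_apply (f : G.Edge → ZMod 2) (v : V) :
    G.vertexSum f v = f (G.inEdge v Side.left) + f (G.inEdge v Side.right) +
      f (G.outEdge v Side.left) + f (G.outEdge v Side.right) := rfl

variable (G) in
/-- The difference of a region function across each edge. -/
def edgeDifference : (G.Region → ZMod 2) →ₗ[ZMod 2] (G.Edge → ZMod 2) where
  toFun f e := f (G.leftRegion e) + f (G.rightRegion e)
  map_add' f g := by ext v; simp only [Pi.add_apply]; ring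
  map_smul' c f := by ext v; simp only [Pi.smul_apply, smul_eq_mul, RingHom.id_apply]; ring

theorem vertexSum_edgeDifference (f : G.Region → ZMod 2) :
    G.vertexSum (G.edgeDifference f) = 0 := by
  ext v
  simp only [vertexSum, edgeDifference, LinearMap.coe_mk, AddHom.coe_mk, Pi.zero_apply,
    leftRegion_inEdge_left, leftRegion_inEdge_right, rightRegion_inEdge_left,
    rightRegion_inEdge_right, leftRegion_outEdge_left, leftRegion_outEdge_right,
    rightRegion_outEdge_left, rightRegion_outEdge_right]
  generalize f (G.regionAt v Dir.left) = a
  generalize f (G.regionAt v Dir.right) = b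
  generalize f (G.regionAt v Dir.top) = c
  generalize f (G.regionAt v Dir.bottom) = d
  revert a b c d
  decide

/-- The endpoints of the edge `e`, as a function on the vertices. -/
theorem vertexSum_single_outEdge (v : V) (s : Side) :
    ∃ u : V → ZMod 2, G.vertexSum (Pi.single (G.outEdge v s) 1) = Pi.single v 1 + u ∧
      u = (Sum.elim (fun w => Pi.single w.1 1) (fun _ => 0) (G.glue (G.outEdge v s)) :
        V → ZMod 2) := by
  refine ⟨_, ?_, rfl⟩
  ext w
  have hin : ∀ s', (Pi.single (G.outEdge v s) 1 : G.Edge → ZMod 2) (G.inEdge w s') =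
      if G.glue (G.outEdge v s) = Sum.inl (w, s') then 1 else 0 := by
    intro s'
    rw [Pi.single_apply, inEdge]
    exact if_congr ((Equiv.symm_apply_eq _).trans eq_comm) rfl rfl
  have hout : (Pi.single (G.outEdge v s) 1 : G.Edge → ZMod 2) (G.outEdge w Side.left) +
      (Pi.single (G.outEdge v s) 1 : G.Edge → ZMod 2) (G.outEdge w Side.right) =
      (Pi.single v 1 : V → ZMod 2) w := by
    simp only [Pi.single_apply, outEdge, Sum.inl.injEq, Prod.mk.injEq]
    by_cases h : w = v <;> cases s <;> simp [h]
  rw [vertexSum_apply, Pi.add_apply]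
  rw [add_assoc (_ + _), hout, hin, hin, add_comm]
  congr 1
  rcases G.glue (G.outEdge v s) with ⟨w', s'⟩ | s'
  · simp only [Sum.elim_inl, Pi.single_apply, Sum.inl.injEq, Prod.mk.injEq]
    by_cases h : w = w'
    · cases s' <;> simp [h]
    · simp [h, Ne.symm h]
  · simp

theorem vertexSum_single_bottomEnd (s : Side) :
    G.vertexSum (Pi.single (G.bottomEnd s) 1) =
      (Sum.elim (fun w => Pi.single w.1 1) (fun _ => 0) (G.glue (G.bottomEnd s)) :
        V → ZMod 2) := by
  ext w
  have hin : ∀ s', (Pi.single (G.bottomEnd s) 1 : G.Edge → ZMod 2) (G.inEdge w s') =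
      if G.glue (G.bottomEnd s) = Sum.inl (w, s') then 1 else 0 := by
    intro s'
    rw [Pi.single_apply, inEdge]
    exact if_congr ((Equiv.symm_apply_eq _).trans eq_comm) rfl rfl
  rw [vertexSum_apply]
  rw [hin, hin]
  have hout : ∀ s', (Pi.single (G.bottomEnd s) 1 : G.Edge → ZMod 2) (G.outEdge w s') = 0 := by
    intro s'
    simp [outEdge, bottomEnd]
  rw [hout, hout]
  rcases G.glue (G.bottomEnd s) with ⟨w', s'⟩ | s'
  · simp only [Sum.elim_inl, Pi.single_apply, Sum.inl.injEq, Prod.mk.injEq]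
    by_cases h : w = w'
    · cases s' <;> simp [h]
    · simp [h, Ne.symm h]
  · simp

/-- An edge joining v and w has boundary v + w, so if the unit vector of one lies in the range, so
does that of the other. The edge at the bottom left end has at most one endpoint, which therefore
lies in the range, and connectedness spreads this to all vertices. -/
theorem Linked.vertexSum_surjective (hG : G.Linked) : Function.Surjective G.vertexSum := by
  set L := LinearMap.range G.vertexSum with hL
  have hedge : ∀ e e' : G.Edge,
      ((∀ v, G.Incident e v → (Pi.single v 1 : V → ZMod 2) ∈ L)) =
        (∀ v, G.Incident e' v → (Pi.single v 1 : V → ZMod 2) ∈ L) := by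
    refine hG.eq_of_incident (fun e => ∀ v, G.Incident e v → (Pi.single v 1 : V → ZMod 2) ∈ L) ?_
    have key : ∀ (e : G.Edge) (v w : V), G.Incident e v → G.Incident e w →
        (Pi.single v 1 : V → ZMod 2) ∈ L → (Pi.single w 1 : V → ZMod 2) ∈ L := by
      have aux : ∀ (v w : V) (s s' : Side), G.outEdge v s = G.inEdge w s' →
          (Pi.single v 1 + Pi.single w 1 : V → ZMod 2) ∈ L := by
        intro v w s s' h
        obtain ⟨u, hu, hu'⟩ := G.vertexSum_single_outEdge v s
        rw [h, inEdge, Equiv.apply_symm_apply] at hu'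
        exact ⟨_, by rw [hu, hu']; rfl⟩
      rintro e v w ⟨s, rfl | rfl⟩ ⟨s', h | h⟩ hv
      · have := G.glue.symm.injective h
        simp only [Sum.inl.injEq, Prod.mk.injEq] at this
        rwa [← this.1]
      · have := L.sub_mem (aux w v s' s h.symm) hv
        simpa using this
      · have := L.sub_mem (aux v w s s' h) hv
        simpa using this
      · have h := Sum.inl.inj h
        simp only [Prod.mk.injEq] at h
        rwa [← h.1]
    intro v e e' he he'
    have := fun hv : (Pi.single v 1 : V → ZMod 2) ∈ L => fun w hw => key e v w he hw hv
    apply propext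
    exact ⟨fun h w hw => key e' v w he' hw (h v he), fun h w hw => key e v w he hw (h v he')⟩
  have hbase : ∀ v, G.Incident (G.bottomEnd Side.left) v →
      (Pi.single v 1 : V → ZMod 2) ∈ L := by
    rintro v ⟨s, h | h⟩
    · refine ⟨_, (G.vertexSum_single_bottomEnd Side.left).trans ?_⟩
      rw [h, inEdge, Equiv.apply_symm_apply]; rfl
    · cases h
  have hall : ∀ v, (Pi.single v 1 : V → ZMod 2) ∈ L := fun v =>
    (hedge (G.bottomEnd Side.left) (G.outEdge v Side.left)).mp hbase v ⟨_, Or.inr rfl⟩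
  rw [← LinearMap.range_eq_top, eq_top_iff]
  intro f _
  rw [show f = ∑ v, f v • (Pi.single v 1 : V → ZMod 2) by
    ext w; simp [Finset.sum_apply, Pi.single_apply]]
  exact Submodule.sum_mem _ fun v _ => Submodule.smul_mem _ _ (hall v)

instance : Fintype Dir :=
  ⟨{Dir.top, Dir.left, Dir.bottom, Dir.right}, fun i => by cases i <;> simp⟩

instance : Finite G.Region := by unfold Region; infer_instance

theorem card_edge : Fintype.card G.Edge = 2 * Fintype.card V + 2 := by
  have : Fintype.card Side = 2 := rfl
  rw [Fintype.card_sum, Fintype.card_prod, this, mul_comm]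

/-- The regions of a connected planar diagram have a checkerboard colouring. -/
theorem exists_colouring (hG : G.Linked) (hP : G.Planar) :
    ∃ col : G.Region → ZMod 2, col (G.openRegion Dir.top) = 0 ∧
      ∀ e, col (G.leftRegion e) + col (G.rightRegion e) = 1 := by
  classical
  have : Fintype G.Region := Fintype.ofFinite _
  have hker : Module.finrank (ZMod 2) (LinearMap.ker G.edgeDifference) ≤ 1 := by
    refine finrank_le_one ⟨fun _ => 1, ?_⟩ ?_
    · ext e; exact CharTwo.add_self_eq_zero (1 : ZMod 2)
    · rintro ⟨f, hf⟩
      refine ⟨f (G.openRegion Dir.top), Subtype.ext (funext fun i => ?_)⟩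
      have := hG.region_eq f (fun e => CharTwo.add_eq_zero.mp (congrFun hf e))
        (G.openRegion Dir.top) i
      simp [this]
  -- By planarity the range of `edgeDifference` has dimension at least (|V| + 3) - 1, and the kernel
  -- of `vertexSum` has dimension (2|V| + 2) - |V|. Hence the inclusion of the range in the kernel
  -- is an equality: the first cohomology of the sphere vanishes.
  have h1 := LinearMap.finrank_range_add_finrank_ker G.edgeDifference
  have h2 := LinearMap.finrank_range_add_finrank_ker G.vertexSum
  rw [LinearMap.range_eq_top.mpr hG.vertexSum_surjective, finrank_top, Module.finrank_pi,
    Module.finrank_pi, card_edge] at h2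
  rw [Module.finrank_pi, ← Nat.card_eq_fintype_card, hP] at h1
  have hle : LinearMap.range G.edgeDifference ≤ LinearMap.ker G.vertexSum := by
    rintro _ ⟨f, rfl⟩
    exact vertexSum_edgeDifference f
  have heq := Submodule.eq_of_le_of_finrank_le hle (by omega)
  -- Each vertex has four edge ends, an even number. A preimage of the constant 1 under
  -- `edgeDifference` is a colouring, up to normalisation at the top region.
  have hone : (fun _ => 1 : G.Edge → ZMod 2) ∈ LinearMap.ker G.vertexSum := by
    ext v
    change (1 + 1 + 1 + 1 : ZMod 2) = 0
    decide
  rw [← heq] at hone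
  obtain ⟨f, hf⟩ := hone
  refine ⟨fun i => f i + f (G.openRegion Dir.top), CharTwo.add_self_eq_zero _, fun e => ?_⟩
  have := congrFun hf e
  change f (G.leftRegion e) + f (G.rightRegion e) = 1 at this
  rw [add_add_add_comm, CharTwo.add_self_eq_zero, add_zero, this]

end Colouring

end Gluing

/-! ## The reduced edge ring as a polynomial ring -/

namespace Gluing

variable {V : Type*} (G : Gluing V)

/-- The regions other than the open regions at the top and on the left. -/
abbrev FreeRegion := {i : G.Region // i ≠ G.openRegion Dir.top ∧ i ≠ G.openRegion Dir.left}

/-- The polynomial ring in `H` and the variables of the free regions. -/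
abbrev FreePoly := MvPolynomial (Option G.FreeRegion) (ZMod 2)

open Classical in
/-- The image of a variable when those of the top and left open regions are set to zero. -/
def regionVar : Option G.Region → G.FreePoly
  | none => MvPolynomial.X none
  | some i => if h : i ≠ G.openRegion Dir.top ∧ i ≠ G.openRegion Dir.left then
      MvPolynomial.X (some ⟨i, h⟩) else 0

/-- The substitution that sets the variables of the top and left open regions to zero. -/
def evalRegion : G.RegionPoly →ₐ[ZMod 2] G.FreePoly := MvPolynomial.aeval G.regionVar

theorem evalRegion_X_none : G.evalRegion (MvPolynomial.X none) = MvPolynomial.X none := by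
  simp [evalRegion, regionVar]

theorem evalRegion_X_free (i : G.FreeRegion) :
    G.evalRegion (MvPolynomial.X (some i.1)) = MvPolynomial.X (some i) := by
  have := i.2
  simp only [evalRegion, MvPolynomial.aeval_X, regionVar]
  rw [dif_pos this]

theorem evalRegion_X_top : G.evalRegion (MvPolynomial.X (some (G.openRegion Dir.top))) = 0 := by
  simp [evalRegion, regionVar]

theorem evalRegion_X_left : G.evalRegion (MvPolynomial.X (some (G.openRegion Dir.left))) = 0 := by
  simp [evalRegion, regionVar]

theorem isHomogeneous_evalRegion {p : G.RegionPoly} {k : ℕ} (hp : p.IsHomogeneous k) :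
    (G.evalRegion p).IsHomogeneous k := by
  have := hp.aeval (n := 1) G.regionVar (by
      rintro (_ | i)
      · exact MvPolynomial.isHomogeneous_X _ _
      · rw [regionVar]
        split_ifs
        · exact MvPolynomial.isHomogeneous_X _ _
        · exact MvPolynomial.isHomogeneous_zero _ _ _)
  rwa [one_mul] at this

/-- The map from the reduced edge ring to the polynomial ring. -/
def toFreePoly : G.ReducedRing →ₐ[ZMod 2] G.FreePoly :=
  Ideal.Quotient.liftₐ
    (Ideal.span {G.edgeDiff (G.openRegion Dir.top) (G.openRegion Dir.left)})
    (G.evalRegion.comp G.edgeRing.val) (by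
      intro a ha
      have : Ideal.span {G.edgeDiff (G.openRegion Dir.top) (G.openRegion Dir.left)} ≤
          RingHom.ker (G.evalRegion.comp G.edgeRing.val) := by
        rw [Ideal.span_le, Set.singleton_subset_iff]
        change G.evalRegion (_ - _) = 0
        rw [map_sub, evalRegion_X_top, evalRegion_X_left, sub_zero]
      exact this ha)

theorem toFreePoly_toReduced (p : G.edgeRing) :
    G.toFreePoly (G.toReduced p) = G.evalRegion (p : G.RegionPoly) := rfl

/-- The difference of a region variable and the variable of the top region. -/
def xi (i : G.Region) : G.ReducedRing := G.diff i (G.openRegion Dir.top)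

/-- The inverse substitution, to the edge ring. -/
def liftEdge : G.FreePoly →ₐ[ZMod 2] G.edgeRing :=
  MvPolynomial.aeval fun o => match o with
    | none => G.edgeH
    | some i => G.edgeDiff i.1 (G.openRegion Dir.top)

/-- The quotient map as an algebra homomorphism. -/
def toReducedₐ : G.edgeRing →ₐ[ZMod 2] G.ReducedRing := Ideal.Quotient.mkₐ _ _

theorem toReducedₐ_apply (p : G.edgeRing) : G.toReducedₐ p = G.toReduced p := rfl

/-- The map from the polynomial ring to the reduced edge ring. -/
def ofFreePoly : G.FreePoly →ₐ[ZMod 2] G.ReducedRing := G.toReducedₐ.comp G.liftEdge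

theorem isHomogeneous_liftEdge {p : G.FreePoly} {k : ℕ} (hp : p.IsHomogeneous k) :
    ((G.liftEdge p : G.edgeRing) : G.RegionPoly).IsHomogeneous k := by
  have := hp.aeval (n := 1) (fun o => ((match o with
    | none => G.edgeH
    | some i => G.edgeDiff i.1 (G.openRegion Dir.top) : G.edgeRing) : G.RegionPoly)) (by
      rintro (_ | i)
      · exact MvPolynomial.isHomogeneous_X _ _
      · exact (MvPolynomial.isHomogeneous_X _ _).sub (MvPolynomial.isHomogeneous_X _ _))
  rw [one_mul] at this
  convert this
  change (G.edgeRing.val.comp G.liftEdge) p = _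
  congr 1
  apply MvPolynomial.algHom_ext
  rintro (_ | i) <;> simp [liftEdge]

theorem edgeDiff_add (i j k : G.Region) : G.edgeDiff i j + G.edgeDiff j k = G.edgeDiff i k := by
  apply Subtype.ext
  exact sub_add_sub_cancel _ _ _

theorem diff_add (i j k : G.Region) : G.diff i j + G.diff j k = G.diff i k := by
  rw [diff, diff, ← map_add, edgeDiff_add, diff]

theorem diff_self (i : G.Region) : G.diff i i = 0 := by
  have := G.diff_add i i i
  simpa using this

theorem diff_top_left : G.diff (G.openRegion Dir.top) (G.openRegion Dir.left) = 0 :=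
  Ideal.Quotient.eq_zero_iff_mem.mpr (Ideal.subset_span rfl)

theorem two_eq_zero : (2 : G.ReducedRing) = 0 := by
  have h : (2 : ZMod 2) = 0 := by decide
  rw [← map_ofNat (algebraMap (ZMod 2) G.ReducedRing) 2, h, map_zero]

theorem add_self (a : G.ReducedRing) : a + a = 0 := by
  rw [← two_mul, two_eq_zero, zero_mul]

theorem neg_eq (a : G.ReducedRing) : -a = a := neg_eq_of_add_eq_zero_left (G.add_self a)

theorem sub_eq (a b : G.ReducedRing) : a - b = a + b := by rw [sub_eq_add_neg, neg_eq]

theorem diff_eq (i j : G.Region) : G.diff i j = G.xi i + G.xi j := by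
  have h := G.diff_add i (G.openRegion Dir.top) j
  have h' := G.diff_add j (G.openRegion Dir.top) j
  rw [diff_self] at h'
  rw [xi, xi, ← h, eq_neg_of_add_eq_zero_right h', neg_eq]

theorem xi_top : G.xi (G.openRegion Dir.top) = 0 := G.diff_self _

theorem xi_left : G.xi (G.openRegion Dir.left) = 0 := by
  have := G.diff_top_left
  rwa [diff_eq, xi_top, zero_add] at this

/-- In characteristic 2 each difference is a sum of two `xi`, so H and the `xi` generate the ring.
Scalars need no separate case beyond 0 and 1. -/
theorem reduced_induction {P : G.ReducedRing → Prop} (hH : P G.redH) (hxi : ∀ i, P (G.xi i))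
    (hzero : P 0) (hone : P 1) (hadd : ∀ a b, P a → P b → P (a + b))
    (hmul : ∀ a b, P a → P b → P (a * b)) (a : G.ReducedRing) : P a := by
  obtain ⟨⟨p, hp⟩, rfl⟩ := Ideal.Quotient.mk_surjective a
  change P (G.toReduced ⟨p, hp⟩)
  refine Algebra.adjoin_induction (p := fun p hp => P (G.toReduced ⟨p, hp⟩)) ?_ ?_ ?_ ?_ hp
  · rintro p (rfl | ⟨i, j, rfl⟩)
    · exact hH
    · change P (G.diff i j)
      rw [diff_eq]
      exact hadd _ _ (hxi i) (hxi j)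
  · intro r
    change P (G.toReducedₐ (algebraMap _ _ r))
    rw [AlgHom.commutes]
    fin_cases r
    · change P (algebraMap _ _ (0 : ZMod 2)); rwa [map_zero]
    · change P (algebraMap _ _ (1 : ZMod 2)); rwa [map_one]
  · intro p q hp hq h h'
    exact hadd _ _ h h'
  · intro p q hp hq h h'
    exact hmul _ _ h h'

theorem ofFreePoly_X_none : G.ofFreePoly (MvPolynomial.X none) = G.redH := by
  simp [ofFreePoly, liftEdge, toReducedₐ_apply, redH]

theorem ofFreePoly_X_some (i : G.FreeRegion) :
    G.ofFreePoly (MvPolynomial.X (some i)) = G.xi i.1 := by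
  simp [ofFreePoly, liftEdge, toReducedₐ_apply, xi, diff]

theorem toFreePoly_redH : G.toFreePoly G.redH = MvPolynomial.X none := by
  rw [redH, toFreePoly_toReduced]
  exact G.evalRegion_X_none

theorem toFreePoly_xi (i : G.Region) :
    G.toFreePoly (G.xi i) = G.evalRegion (MvPolynomial.X (some i)) := by
  rw [xi, diff, toFreePoly_toReduced]
  change G.evalRegion (_ - _) = _
  rw [map_sub, evalRegion_X_top, sub_zero]

/-- The reduced edge ring is a polynomial ring. -/
def polyEquiv : G.ReducedRing ≃ₐ[ZMod 2] G.FreePoly :=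
  AlgEquiv.ofAlgHom G.toFreePoly G.ofFreePoly
    (by
      apply MvPolynomial.algHom_ext
      rintro (_ | i)
      · simp [ofFreePoly_X_none, toFreePoly_redH]
      · simp [ofFreePoly_X_some, toFreePoly_xi, evalRegion_X_free])
    (by
      ext a
      change G.ofFreePoly (G.toFreePoly a) = a
      refine G.reduced_induction (P := fun a => G.ofFreePoly (G.toFreePoly a) = a)
        ?_ ?_ ?_ ?_ ?_ ?_ a
      · rw [toFreePoly_redH, ofFreePoly_X_none]
      · intro i
        rw [toFreePoly_xi]
        by_cases h : i ≠ G.openRegion Dir.top ∧ i ≠ G.openRegion Dir.left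
        · rw [show i = (⟨i, h⟩ : G.FreeRegion).1 from rfl, evalRegion_X_free, ofFreePoly_X_some]
        · rw [not_and_or, not_not, not_not] at h
          rcases h with rfl | rfl
          · rw [evalRegion_X_top, map_zero, xi_top]
          · rw [evalRegion_X_left, map_zero, xi_left]
      · simp
      · simp
      · intro a b ha hb; simp [ha, hb]
      · intro a b ha hb; simp [ha, hb])

/-- The substitutions in both directions preserve the degree, so having a homogeneous lift to the
edge ring is the same as being homogeneous in the polynomial ring. -/
theorem mem_redHomogeneous_iff {k : ℕ} {a : G.ReducedRing} :
    a ∈ G.redHomogeneous k ↔ (G.polyEquiv a).IsHomogeneous k := by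
  constructor
  · rintro ⟨p, hp, rfl⟩
    exact G.isHomogeneous_evalRegion hp
  · intro h
    refine ⟨G.liftEdge (G.polyEquiv a), G.isHomogeneous_liftEdge h, ?_⟩
    exact G.polyEquiv.symm_apply_apply a

theorem redHomogeneous_zero (k : ℕ) : (0 : G.ReducedRing) ∈ G.redHomogeneous k := by
  rw [mem_redHomogeneous_iff, map_zero]; exact MvPolynomial.isHomogeneous_zero _ _ _

theorem redHomogeneous_one : (1 : G.ReducedRing) ∈ G.redHomogeneous 0 := by
  rw [mem_redHomogeneous_iff, map_one]; exact MvPolynomial.isHomogeneous_one _ _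

variable {G}

theorem redHomogeneous_add {k : ℕ} {a b : G.ReducedRing} (ha : a ∈ G.redHomogeneous k)
    (hb : b ∈ G.redHomogeneous k) : a + b ∈ G.redHomogeneous k := by
  rw [mem_redHomogeneous_iff] at *; rw [map_add]; exact ha.add hb

theorem redHomogeneous_mul {k l : ℕ} {a b : G.ReducedRing} (ha : a ∈ G.redHomogeneous k)
    (hb : b ∈ G.redHomogeneous l) : a * b ∈ G.redHomogeneous (k + l) := by
  rw [mem_redHomogeneous_iff] at *; rw [map_mul]; exact ha.mul hb

theorem redHomogeneous_pow {k : ℕ} {a : G.ReducedRing} (ha : a ∈ G.redHomogeneous k) (n : ℕ) :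
    a ^ n ∈ G.redHomogeneous (k * n) := by
  rw [mem_redHomogeneous_iff] at *; rw [map_pow]; exact ha.pow n

theorem redHomogeneous_prod {ι : Type*} (s : Finset ι) (f : ι → G.ReducedRing) (n : ι → ℕ)
    (h : ∀ i ∈ s, f i ∈ G.redHomogeneous (n i)) :
    ∏ i ∈ s, f i ∈ G.redHomogeneous (∑ i ∈ s, n i) := by
  rw [mem_redHomogeneous_iff, map_prod]
  exact MvPolynomial.IsHomogeneous.prod _ _ _ fun i hi => G.mem_redHomogeneous_iff.mp (h i hi)

variable (G)

theorem redH_mem : G.redH ∈ G.redHomogeneous 1 :=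
  ⟨G.edgeH, MvPolynomial.isHomogeneous_X _ _, rfl⟩

theorem diff_mem (i j : G.Region) : G.diff i j ∈ G.redHomogeneous 1 :=
  ⟨G.edgeDiff i j, (MvPolynomial.isHomogeneous_X _ _).sub (MvPolynomial.isHomogeneous_X _ _), rfl⟩

theorem xi_mem (i : G.Region) : G.xi i ∈ G.redHomogeneous 1 := G.diff_mem _ _

instance : Nontrivial G.ReducedRing := G.polyEquiv.toEquiv.nontrivial

instance : CharP G.ReducedRing 2 := charP_of_injective_algebraMap' (ZMod 2) 2

/-! ### The boundary variables in the reduced edge ring -/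

theorem algebraMap_apply (s : BoundaryRing) :
    algebraMap BoundaryRing G.ReducedRing s = MvPolynomial.aeval (R := ZMod 2)
    ![G.diff (G.openRegion Dir.top) (G.openRegion Dir.bottom),
      G.redH - G.diff (G.openRegion Dir.right) (G.openRegion Dir.top),
      G.diff (G.openRegion Dir.bottom) (G.openRegion Dir.right)] (BoundaryRing.equiv s) := rfl

theorem algebraMap_bx : algebraMap BoundaryRing G.ReducedRing bx =
    G.xi (G.openRegion Dir.bottom) := by
  rw [algebraMap_apply, bx, RingEquiv.apply_symm_apply, MvPolynomial.aeval_X]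
  simp [diff_eq, xi_top]

theorem algebraMap_bY : algebraMap BoundaryRing G.ReducedRing bY =
    G.redH + G.xi (G.openRegion Dir.right) := by
  rw [algebraMap_apply, bY, RingEquiv.apply_symm_apply, MvPolynomial.aeval_X]
  simp [diff_eq, xi_top, sub_eq]

theorem algebraMap_bz : algebraMap BoundaryRing G.ReducedRing bz =
    G.xi (G.openRegion Dir.bottom) + G.xi (G.openRegion Dir.right) := by
  rw [algebraMap_apply, bz, RingEquiv.apply_symm_apply, MvPolynomial.aeval_X]
  simp [diff_eq]

theorem algebraMap_bH : algebraMap BoundaryRing G.ReducedRing bH = G.redH := by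
  rw [bH, map_add, map_add, algebraMap_bx, algebraMap_bY, algebraMap_bz]
  linear_combination (G.xi (G.openRegion Dir.bottom) + G.xi (G.openRegion Dir.right)) *
    G.two_eq_zero

theorem algebraMap_mem_redHomogeneous {s : BoundaryRing} {k : ℕ}
    (hs : (BoundaryRing.equiv s).IsHomogeneous k) :
    algebraMap BoundaryRing G.ReducedRing s ∈ G.redHomogeneous k := by
  rw [mem_redHomogeneous_iff, algebraMap_apply]
  have := hs.aeval (S := ZMod 2) (n := 1) (fun i => G.polyEquiv (![G.diff (G.openRegion Dir.top)
      (G.openRegion Dir.bottom),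
      G.redH - G.diff (G.openRegion Dir.right) (G.openRegion Dir.top),
      G.diff (G.openRegion Dir.bottom) (G.openRegion Dir.right)] i)) (by
    intro i
    rw [← mem_redHomogeneous_iff]
    fin_cases i
    · exact G.diff_mem _ _
    · change G.redH - G.diff _ _ ∈ _
      rw [sub_eq]
      exact redHomogeneous_add G.redH_mem (G.diff_mem _ _)
    · exact G.diff_mem _ _)
  rw [one_mul] at this
  convert this
  rw [MvPolynomial.aeval_def, MvPolynomial.aeval_def, MvPolynomial.eval₂_eq',
    MvPolynomial.eval₂_eq', map_sum]
  simp

theorem smul_mem_redHomogeneous {s : BoundaryRing} {a : G.ReducedRing} {k l : ℕ}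
    (hs : (BoundaryRing.equiv s).IsHomogeneous k) (ha : a ∈ G.redHomogeneous l) :
    s • a ∈ G.redHomogeneous (k + l) := by
  rw [Algebra.smul_def]
  exact redHomogeneous_mul (G.algebraMap_mem_redHomogeneous hs) ha

end Gluing

/-! ## Edge variables -/

/-- A checkerboard colouring of the regions. -/
structure Gluing.Colouring {V : Type*} (G : Gluing V) where
  col : G.Region → ZMod 2
  col_top : col (G.openRegion Dir.top) = 0
  col_edge : ∀ e, col (G.leftRegion e) + col (G.rightRegion e) = 1

namespace Gluing

theorem nonempty_colouring {V : Type*} [Fintype V] [DecidableEq V] {G : Gluing V}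
    (hG : G.Linked) (hP : G.Planar) : Nonempty G.Colouring :=
  let ⟨col, h, h'⟩ := exists_colouring hG hP
  ⟨⟨col, h, h'⟩⟩

namespace Colouring

variable {V : Type*} {G : Gluing V} (κ : G.Colouring)

/-- `H` on the regions of colour `1`, and `0` on the others. -/
def tone (i : G.Region) : G.ReducedRing := algebraMap (ZMod 2) _ (κ.col i) * G.redH

/-- This is the purpose of the tones: the colours on the two sides of an edge differ, so reversing
the direction of an edge changes its variable by H, the involution y ↦ y + H. -/
theorem tone_edge (e : G.Edge) : κ.tone (G.leftRegion e) + κ.tone (G.rightRegion e) = G.redH := by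
  rw [tone, tone, ← add_mul, ← map_add, κ.col_edge, map_one, one_mul]

/-- The variable of an edge, by which it acts on the factor of its component. -/
def edgeVar (e : G.Edge) : G.ReducedRing :=
  G.xi (G.leftRegion e) + G.xi (G.rightRegion e) + κ.tone (G.leftRegion e)

theorem tone_mem (i : G.Region) : κ.tone i ∈ G.redHomogeneous 1 := by
  rw [tone]
  generalize κ.col i = c
  fin_cases c
  · change algebraMap _ _ (0 : ZMod 2) * _ ∈ _
    rw [map_zero, zero_mul]; exact G.redHomogeneous_zero 1
  · change algebraMap _ _ (1 : ZMod 2) * _ ∈ _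
    rw [map_one, one_mul]; exact G.redH_mem

theorem edgeVar_mem (e : G.Edge) : κ.edgeVar e ∈ G.redHomogeneous 1 :=
  redHomogeneous_add (redHomogeneous_add (G.xi_mem _) (G.xi_mem _)) (κ.tone_mem _)

theorem col_left : κ.col (G.openRegion Dir.left) = 1 := by
  have h := κ.col_edge (G.topEnd Side.left)
  rwa [leftRegion_topEnd_left, rightRegion_topEnd_left, κ.col_top, add_zero] at h

theorem col_bottom : κ.col (G.openRegion Dir.bottom) = 0 := by
  have h := κ.col_edge (G.bottomEnd Side.left)
  rw [leftRegion_bottomEnd_left, rightRegion_bottomEnd_left, κ.col_left] at h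
  simpa using h

/-- The special component carries H; this is why a circle that merges with it sends y to H. -/
theorem edgeVar_topEnd_left : κ.edgeVar (G.topEnd Side.left) = G.redH := by
  rw [edgeVar, leftRegion_topEnd_left, rightRegion_topEnd_left, xi_left, xi_top, tone,
    κ.col_left, map_one, one_mul, zero_add, zero_add]

theorem edgeVar_topEnd_right :
    κ.edgeVar (G.topEnd Side.right) = G.xi (G.openRegion Dir.right) := by
  rw [edgeVar, leftRegion_topEnd_right, rightRegion_topEnd_right, xi_top, tone,
    κ.col_top, map_zero, zero_mul, zero_add, add_zero]

theorem edgeVar_bottomEnd_left :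
    κ.edgeVar (G.bottomEnd Side.left) = G.xi (G.openRegion Dir.bottom) + G.redH := by
  rw [edgeVar, leftRegion_bottomEnd_left, rightRegion_bottomEnd_left, xi_left, tone,
    κ.col_left, map_one, one_mul, zero_add]

/-- The other open component carries z, the scalar by which the composite of two saddles of open
strands acts. -/
theorem edgeVar_bottomEnd_right : κ.edgeVar (G.bottomEnd Side.right) =
    algebraMap BoundaryRing G.ReducedRing bz := by
  rw [edgeVar, leftRegion_bottomEnd_right, rightRegion_bottomEnd_right, tone,
    κ.col_bottom, map_zero, zero_mul, add_zero, algebraMap_bz]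

section Vertex

variable (v : V)

theorem edgeVar_outEdge_left : κ.edgeVar (G.outEdge v Side.left) =
    G.xi (G.regionAt v Dir.left) + G.xi (G.regionAt v Dir.top) +
      κ.tone (G.regionAt v Dir.left) := rfl
theorem edgeVar_outEdge_right : κ.edgeVar (G.outEdge v Side.right) =
    G.xi (G.regionAt v Dir.top) + G.xi (G.regionAt v Dir.right) +
      κ.tone (G.regionAt v Dir.top) := rfl
theorem edgeVar_inEdge_left : κ.edgeVar (G.inEdge v Side.left) =
    G.xi (G.regionAt v Dir.left) + G.xi (G.regionAt v Dir.bottom) +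
      κ.tone (G.regionAt v Dir.left) := by
  rw [edgeVar, leftRegion_inEdge_left, rightRegion_inEdge_left]
theorem edgeVar_inEdge_right : κ.edgeVar (G.inEdge v Side.right) =
    G.xi (G.regionAt v Dir.bottom) + G.xi (G.regionAt v Dir.right) +
      κ.tone (G.regionAt v Dir.bottom) := by
  rw [edgeVar, leftRegion_inEdge_right, rightRegion_inEdge_right]

theorem tone_left_add_top :
    κ.tone (G.regionAt v Dir.left) + κ.tone (G.regionAt v Dir.top) = G.redH :=
  κ.tone_edge (G.outEdge v Side.left)
theorem tone_left_add_bottom :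
    κ.tone (G.regionAt v Dir.left) + κ.tone (G.regionAt v Dir.bottom) = G.redH := by
  have := κ.tone_edge (G.inEdge v Side.left)
  rwa [leftRegion_inEdge_left, rightRegion_inEdge_left] at this

theorem col_left_add_top :
    κ.col (G.regionAt v Dir.left) + κ.col (G.regionAt v Dir.top) = 1 :=
  κ.col_edge (G.outEdge v Side.left)
theorem col_left_add_bottom :
    κ.col (G.regionAt v Dir.left) + κ.col (G.regionAt v Dir.bottom) = 1 := by
  have := κ.col_edge (G.inEdge v Side.left)
  rwa [leftRegion_inEdge_left, rightRegion_inEdge_left] at this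

end Vertex

end Colouring

end Gluing

namespace Crossingless

open Gluing

variable {V : Type*} (D : Crossingless V)

theorem kind_eq (v : V) : D.kind v = ArcKind.dotted ∨ D.kind v = ArcKind.thick := by
  cases D.kind v <;> simp

theorem altSum_eq (G : Gluing V) (v : V) : altSum G v =
    G.xi (G.regionAt v Dir.top) + G.xi (G.regionAt v Dir.left) +
      (G.xi (G.regionAt v Dir.bottom) + G.xi (G.regionAt v Dir.right)) := by
  rw [altSum, diff_eq, diff_eq]

variable {D}

theorem lam_dotted {v : V} (h : D.kind v = ArcKind.dotted) :
    D.lam v = D.xi (D.regionAt v Dir.top) + D.xi (D.regionAt v Dir.bottom) := by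
  rw [lam, h]; exact D.diff_eq _ _

theorem lam_thick {v : V} (h : D.kind v = ArcKind.thick) :
    D.lam v = D.redH + D.xi (D.regionAt v Dir.right) + D.xi (D.regionAt v Dir.left) := by
  rw [lam, h]; dsimp only; rw [sub_eq, diff_eq, add_assoc]

theorem kap_dotted {v : V} (h : D.kind v = ArcKind.dotted) :
    D.kap v = (D.redH + D.xi (D.regionAt v Dir.right) + D.xi (D.regionAt v Dir.left)) *
      altSum D.toGluing v := by
  rw [kap, h]; dsimp only; rw [sub_eq, diff_eq, add_assoc]

theorem kap_thick {v : V} (h : D.kind v = ArcKind.thick) :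
    D.kap v = (D.xi (D.regionAt v Dir.top) + D.xi (D.regionAt v Dir.bottom)) *
      altSum D.toGluing v := by
  rw [kap, h]; dsimp only; rw [diff_eq]

variable (D)

/-- An edge on the first of the two strands at a vertex. -/
def firstStrand (v : V) : D.Edge := D.inEdge v Side.left

/-- An edge on the second of the two strands at a vertex. -/
def secondStrand (v : V) : D.Edge :=
  match D.kind v with
  | ArcKind.dotted => D.inEdge v Side.right
  | ArcKind.thick => D.outEdge v Side.left

theorem lam_mem (v : V) : D.lam v ∈ D.redHomogeneous 1 := by
  rcases D.kind_eq v with h | h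
  · rw [lam_dotted h]; exact redHomogeneous_add (D.xi_mem _) (D.xi_mem _)
  · rw [lam_thick h]
    exact redHomogeneous_add (redHomogeneous_add D.redH_mem (D.xi_mem _)) (D.xi_mem _)

theorem altSum_mem (G : Gluing V) (v : V) : altSum G v ∈ G.redHomogeneous 1 := by
  rw [altSum_eq]
  exact redHomogeneous_add (redHomogeneous_add (G.xi_mem _) (G.xi_mem _))
    (redHomogeneous_add (G.xi_mem _) (G.xi_mem _))

theorem kap_mem (v : V) : D.kap v ∈ D.redHomogeneous 2 := by
  rcases D.kind_eq v with h | h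
  · rw [kap_dotted h]
    exact redHomogeneous_mul (redHomogeneous_add (redHomogeneous_add D.redH_mem (D.xi_mem _))
      (D.xi_mem _)) (altSum_mem _ _)
  · rw [kap_thick h]
    exact redHomogeneous_mul (redHomogeneous_add (D.xi_mem _) (D.xi_mem _)) (altSum_mem _ _)

section EdgeVar

variable (κ : D.toGluing.Colouring)

/-- Modulo `lam v` this is y + y' + H, the coproduct of 1 in 𝔽[H,y]/(y² - Hy). All the saddle
formulas come from this identity. -/
theorem altSum_eq_edgeVar (v : V) : altSum D.toGluing v =
    κ.edgeVar (D.firstStrand v) + κ.edgeVar (D.secondStrand v) + D.redH + D.lam v := by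
  have h2 := D.two_eq_zero
  have h1 := κ.tone_left_add_bottom v
  rcases D.kind_eq v with h | h
  · rw [lam_dotted h, firstStrand, secondStrand, h, altSum_eq, κ.edgeVar_inEdge_left]
    dsimp only
    rw [κ.edgeVar_inEdge_right]
    grind
  · rw [lam_thick h, firstStrand, secondStrand, h, altSum_eq, κ.edgeVar_inEdge_left]
    dsimp only
    rw [κ.edgeVar_outEdge_left]
    grind

/-- Together with `altSum_eq_edgeVar`: modulo `lam v`, the entry is (y + y')(y + y' + H) = (y² + Hy)
+ (y'² + Hy'), so that killing it identifies the values of y² + Hy on the two strands. -/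
theorem kap_eq_edgeVar (v : V) : D.kap v =
    (κ.edgeVar (D.firstStrand v) + κ.edgeVar (D.secondStrand v)) * altSum D.toGluing v := by
  have h2 := D.two_eq_zero
  have h1 := κ.tone_left_add_bottom v
  rcases D.kind_eq v with h | h
  · rw [kap_dotted h, firstStrand, secondStrand, h, κ.edgeVar_inEdge_left]
    dsimp only
    rw [κ.edgeVar_inEdge_right]
    congr 1
    grind
  · rw [kap_thick h, firstStrand, secondStrand, h, κ.edgeVar_inEdge_left]
    dsimp only
    rw [κ.edgeVar_outEdge_left]
    congr 1
    grind

/-- The strand keeps its direction and the regions on its left at the two edges have the same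
colour, so the tones cancel. At a thick arc the direction is reversed and the tones add up to the H
that occurs in `lam`. -/
theorem edgeVar_in_add_out {v : V} (h : D.kind v = ArcKind.dotted) (s : Side) :
    κ.edgeVar (D.inEdge v s) + κ.edgeVar (D.outEdge v s) = D.lam v := by
  have h2 := D.two_eq_zero
  have h1 := κ.tone_left_add_bottom v
  have h3 := κ.tone_left_add_top v
  rw [lam_dotted h]
  cases s
  · rw [κ.edgeVar_inEdge_left, κ.edgeVar_outEdge_left]; grind
  · rw [κ.edgeVar_inEdge_right, κ.edgeVar_outEdge_right]; grind

theorem edgeVar_in_add_in {v : V} (h : D.kind v = ArcKind.thick) :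
    κ.edgeVar (D.inEdge v Side.left) + κ.edgeVar (D.inEdge v Side.right) = D.lam v := by
  have h2 := D.two_eq_zero
  have h1 := κ.tone_left_add_bottom v
  rw [lam_thick h, κ.edgeVar_inEdge_left, κ.edgeVar_inEdge_right]; grind

theorem edgeVar_out_add_out {v : V} (h : D.kind v = ArcKind.thick) :
    κ.edgeVar (D.outEdge v Side.left) + κ.edgeVar (D.outEdge v Side.right) = D.lam v := by
  have h2 := D.two_eq_zero
  have h1 := κ.tone_left_add_top v
  rw [lam_thick h, κ.edgeVar_outEdge_left, κ.edgeVar_outEdge_right]; grind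

theorem exists_lam_of_joined {e e' : D.Edge} (h : D.Joined e e') :
    ∃ v, κ.edgeVar e + κ.edgeVar e' = D.lam v := by
  cases h with
  | dotted v s h => exact ⟨v, D.edgeVar_in_add_out κ h s⟩
  | thickIn v h => exact ⟨v, D.edgeVar_in_add_in κ h⟩
  | thickOut v h => exact ⟨v, D.edgeVar_out_add_out κ h⟩

end EdgeVar

/-- The contributions of the vertices to the potential add up to that of the boundary. -/
theorem sum_lam_mul_kap [Fintype V] :
    ∑ v, D.lam v * D.kap v = algebraMap BoundaryRing D.ReducedRing (bx * bY * bz) := by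
  have h2 := D.two_eq_zero
  -- The product `lam v * kap v` does not depend on the kind of the arc. It is the sum of this cubic
  -- in the two adjacent regions over the four edge ends at `v`, so every edge counts once at its
  -- source and once at its target, and only the ends of the tangle survive in characteristic 2.
  let g : D.Edge → D.ReducedRing := fun e =>
    D.xi (D.leftRegion e) * (D.xi (D.leftRegion e) + D.xi (D.rightRegion e)) *
      (D.redH + D.xi (D.rightRegion e))
  have hv : ∀ v, D.lam v * D.kap v =
      (g (D.outEdge v Side.left) + g (D.outEdge v Side.right)) +
      (g (D.inEdge v Side.left) + g (D.inEdge v Side.right)) := by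
    intro v
    have h : D.lam v * D.kap v =
        (D.xi (D.regionAt v Dir.top) + D.xi (D.regionAt v Dir.bottom)) *
        (D.redH + D.xi (D.regionAt v Dir.right) + D.xi (D.regionAt v Dir.left)) *
        altSum D.toGluing v := by
      rcases D.kind_eq v with h | h
      · rw [lam_dotted h, kap_dotted h]; ring
      · rw [lam_thick h, kap_thick h]; ring
    rw [h, altSum_eq]
    simp only [g, leftRegion_inEdge_left, leftRegion_inEdge_right, rightRegion_inEdge_left,
      rightRegion_inEdge_right, leftRegion_outEdge_left, leftRegion_outEdge_right,
      rightRegion_outEdge_left, rightRegion_outEdge_right]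
    grind
  rw [Finset.sum_congr rfl fun v _ => hv v, Finset.sum_add_distrib]
  have hs := D.sum_edge_source g
  have ht := D.sum_edge_target g
  have hb : g (D.bottomEnd Side.left) + g (D.bottomEnd Side.right) +
      (g (D.topEnd Side.left) + g (D.topEnd Side.right)) =
      algebraMap BoundaryRing D.ReducedRing (bx * bY * bz) := by
    simp only [map_mul, algebraMap_bx, algebraMap_bY, algebraMap_bz, g, leftRegion_bottomEnd_left,
      leftRegion_bottomEnd_right, rightRegion_bottomEnd_left, rightRegion_bottomEnd_right,
      leftRegion_topEnd_left, leftRegion_topEnd_right, rightRegion_topEnd_left,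
      rightRegion_topEnd_right, xi_left, xi_top]
    grind
  rw [← hb]
  grind

end Crossingless

/-! ## Components -/

namespace Crossingless

open Gluing

variable {V : Type*} (D : Crossingless V)

/-- A function on edges that is constant on components. -/
def Invariant {α : Type*} (g : D.Edge → α) : Prop := ∀ e e', D.Joined e e' → g e = g e'

variable {D}

theorem Invariant.eq_of_eqvGen {α : Type*} {g : D.Edge → α} (hg : D.Invariant g) {e e' : D.Edge}
    (h : Relation.EqvGen D.Joined e e') : g e = g e' := by
  induction h with
  | rel _ _ h => exact hg _ _ h
  | refl _ => rfl
  | symm _ _ _ ih => exact ih.symm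
  | trans _ _ _ _ _ ih ih' => exact ih.trans ih'

theorem Invariant.eq_of_mem {α : Type*} {g : D.Edge → α} (hg : D.Invariant g) {e e' : D.Edge}
    (h : e' ∈ D.component e) : g e = g e' := hg.eq_of_eqvGen h

theorem self_mem_component (e : D.Edge) : e ∈ D.component e := Relation.EqvGen.refl e

theorem mem_component_comm {e e' : D.Edge} : e' ∈ D.component e ↔ e ∈ D.component e' :=
  ⟨Relation.EqvGen.symm _ _, Relation.EqvGen.symm _ _⟩

theorem component_eq {e e' : D.Edge} (h : e' ∈ D.component e) :
    D.component e' = D.component e := by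
  ext x
  exact ⟨fun hx => Relation.EqvGen.trans _ _ _ h hx,
    fun hx => Relation.EqvGen.trans _ _ _ (Relation.EqvGen.symm _ _ h) hx⟩

theorem invariant_component : D.Invariant D.component := fun _ _ h =>
  (component_eq (Relation.EqvGen.rel _ _ h)).symm

open Classical in
/-- The characteristic function of a component is invariant. -/
theorem invariant_indicator {α : Type*} (a b : α) (e : D.Edge) :
    D.Invariant (fun e' => if e' ∈ D.component e then a else b) := by
  intro e₁ e₂ h
  have h1 := component_eq (Relation.EqvGen.rel _ _ h)
  refine if_congr ?_ rfl rfl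
  rw [mem_component_comm, mem_component_comm (e' := e₂)]
  rw [h1]

/-- An invariant function takes at most two values at a vertex, one on each strand. -/
theorem Invariant.incident_eq {α : Type*} {g : D.Edge → α} (hg : D.Invariant g) {v : V}
    {e : D.Edge} (he : D.Incident e v) :
    g e = g (D.firstStrand v) ∨ g e = g (D.secondStrand v) := by
  rcases D.kind_eq v with h | h
  · rw [firstStrand, secondStrand, h]
    have := fun s => hg _ _ (Joined.dotted v s h)
    rcases he with ⟨_ | _, rfl | rfl⟩
    · exact Or.inl rfl
    · exact Or.inl (this _).symm
    · exact Or.inr rfl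
    · exact Or.inr (this _).symm
  · rw [firstStrand, secondStrand, h]
    rcases he with ⟨_ | _, rfl | rfl⟩
    · exact Or.inl rfl
    · exact Or.inr rfl
    · exact Or.inl (hg _ _ (Joined.thickIn v h)).symm
    · exact Or.inr (hg _ _ (Joined.thickOut v h)).symm

/-- If an invariant function takes the same value on the two strands at each vertex, then it is
constant. -/
theorem Invariant.const (hL : D.Linked) {α : Type*} {g : D.Edge → α} (hg : D.Invariant g)
    (h : ∀ v, g (D.firstStrand v) = g (D.secondStrand v)) (e e' : D.Edge) : g e = g e' := by
  refine hL.eq_of_incident g ?_ e e'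
  intro v e e' he he'
  rcases hg.incident_eq he with h1 | h1 <;> rcases hg.incident_eq he' with h2 | h2 <;>
    rw [h1, h2] <;> simp [h v]

/-! ### The open components -/

section Sign

variable [Fintype V]

/-- The ends of a component, counted with signs. -/
theorem Invariant.sum_ends (κ : D.toGluing.Colouring) {g : D.Edge → ℤ} (hg : D.Invariant g) :
    g (D.bottomEnd Side.left) + g (D.topEnd Side.right) =
      g (D.bottomEnd Side.right) + g (D.topEnd Side.left) := by
  classical
  -- Weight an edge by the colour on its left. Two edges joined at a dotted arc, one entering and
  -- one leaving, have equal weights; two joined at a thick arc, both entering or both leaving, have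
  -- opposite ones. In both cases they cancel between the counts by sources and by targets.
  let sg : D.Region → ℤ := fun i => if κ.col i = 1 then 1 else -1
  have hz : ∀ a b : ZMod 2, a + b = 1 →
      (if b = 1 then 1 else -1 : ℤ) = -(if a = 1 then 1 else -1 : ℤ) := by decide
  have hs := D.sum_edge_source (fun e => g e * sg (D.leftRegion e))
  have ht := D.sum_edge_target (fun e => g e * sg (D.leftRegion e))
  have hv : ∀ v, g (D.outEdge v Side.left) * sg (D.leftRegion (D.outEdge v Side.left)) +
      g (D.outEdge v Side.right) * sg (D.leftRegion (D.outEdge v Side.right)) =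
      g (D.inEdge v Side.left) * sg (D.leftRegion (D.inEdge v Side.left)) +
      g (D.inEdge v Side.right) * sg (D.leftRegion (D.inEdge v Side.right)) := by
    intro v
    have h1 : sg (D.regionAt v Dir.top) = - sg (D.regionAt v Dir.left) :=
      hz _ _ (κ.col_left_add_top v)
    have h2 : sg (D.regionAt v Dir.bottom) = - sg (D.regionAt v Dir.left) :=
      hz _ _ (κ.col_left_add_bottom v)
    rw [leftRegion_inEdge_left, leftRegion_inEdge_right, leftRegion_outEdge_left,
      leftRegion_outEdge_right, h1, h2]
    rcases D.kind_eq v with h | h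
    · rw [hg _ _ (Joined.dotted v Side.left h), hg _ _ (Joined.dotted v Side.right h)]
    · rw [hg _ _ (Joined.thickIn v h), hg _ _ (Joined.thickOut v h)]; ring
  simp only [hv] at hs
  rw [hs] at ht
  have ht := add_left_cancel ht
  have h1 : sg (D.openRegion Dir.left) = 1 := by simp [sg, κ.col_left]
  have h2 : sg (D.openRegion Dir.top) = -1 := by simp [sg, κ.col_top]
  have h3 : sg (D.openRegion Dir.bottom) = -1 := by simp [sg, κ.col_bottom]
  rw [leftRegion_bottomEnd_left, leftRegion_bottomEnd_right, leftRegion_topEnd_left,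
    leftRegion_topEnd_right, h1, h2, h3] at ht
  linarith

end Sign

/-- The opposite side. -/
def _root_.Delooping.Side.other : Side → Side
  | Side.left => Side.right
  | Side.right => Side.left

variable (D) in
/-- The next edge along a component, which is oriented such that the region on its left has
colour `1`. -/
def next (κ : D.toGluing.Colouring) (e : D.Edge) : Option D.Edge :=
  if κ.col (D.leftRegion e) = 1 then
    match D.glue e with
    | Sum.inl (v, s) => some (match D.kind v with
      | ArcKind.dotted => D.outEdge v s
      | ArcKind.thick => D.inEdge v s.other)
    | Sum.inr _ => none
  else
    match e with
    | Sum.inl (v, s) => some (match D.kind v with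
      | ArcKind.dotted => D.inEdge v s
      | ArcKind.thick => D.outEdge v s.other)
    | Sum.inr _ => none

theorem next_inEdge (κ : D.toGluing.Colouring) {v : V} {s : Side} (h : κ.col (D.leftRegion (D.inEdge v s)) = 1) :
    D.next κ (D.inEdge v s) = some (match D.kind v with
      | ArcKind.dotted => D.outEdge v s
      | ArcKind.thick => D.inEdge v s.other) := by
  have : D.glue (D.inEdge v s) = Sum.inl (v, s) := D.glue.apply_symm_apply _
  unfold next; rw [if_pos h, this]

theorem next_outEdge (κ : D.toGluing.Colouring) {v : V} {s : Side} (h : κ.col (D.leftRegion (D.outEdge v s)) ≠ 1) :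
    D.next κ (D.outEdge v s) = some (match D.kind v with
      | ArcKind.dotted => D.inEdge v s
      | ArcKind.thick => D.outEdge v s.other) := by
  unfold next; rw [if_neg h]; rfl

theorem next_topEnd_left (κ : D.toGluing.Colouring) : D.next κ (D.topEnd Side.left) = none := by
  have : D.glue (D.topEnd Side.left) = Sum.inr Side.left := D.glue.apply_symm_apply _
  unfold next; rw [leftRegion_topEnd_left, if_pos κ.col_left, this]

theorem next_bottomEnd_right (κ : D.toGluing.Colouring) : D.next κ (D.bottomEnd Side.right) = none := by
  unfold next; rw [leftRegion_bottomEnd_right, κ.col_bottom, if_neg (by decide)]; rfl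

/-- The orientation with colour 1 on the left follows the diagram on edges with colour 1 on their
left and runs against it on the others. It is consistent through both kinds of arcs, so one of two
joined edges is the successor of the other. -/
theorem next_of_joined (κ : D.toGluing.Colouring) {e e' : D.Edge} (h : D.Joined e e') :
    D.next κ e = some e' ∨ D.next κ e' = some e := by
  have hz : ∀ a b : ZMod 2, a + b = 1 → (b = 1 ↔ ¬ a = 1) := by decide
  cases h with
  | dotted v s h =>
    have hl : κ.col (D.leftRegion (D.outEdge v s)) = κ.col (D.leftRegion (D.inEdge v s)) := by
      have h1 := κ.col_left_add_top v
      have h2 := κ.col_left_add_bottom v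
      cases s
      · rw [leftRegion_inEdge_left, leftRegion_outEdge_left]
      · rw [leftRegion_inEdge_right, leftRegion_outEdge_right]
        exact add_left_cancel (h1.trans h2.symm)
    by_cases hc : κ.col (D.leftRegion (D.inEdge v s)) = 1
    · left; rw [next_inEdge κ hc, h]
    · right; rw [next_outEdge κ (by rwa [hl]), h]
  | thickIn v h =>
    have h2 := hz _ _ (κ.col_left_add_bottom v)
    rw [← leftRegion_inEdge_left, ← leftRegion_inEdge_right] at h2
    by_cases hc : κ.col (D.leftRegion (D.inEdge v Side.left)) = 1
    · left; rw [next_inEdge κ hc, h]; rfl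
    · right; rw [next_inEdge κ (h2.mpr hc), h]; rfl
  | thickOut v h =>
    have h2 := hz _ _ (κ.col_left_add_top v)
    rw [← leftRegion_outEdge_left, ← leftRegion_outEdge_right] at h2
    by_cases hc : κ.col (D.leftRegion (D.outEdge v Side.left)) = 1
    · right; rw [next_outEdge κ (by rw [Ne, h2, not_not]; exact hc), h]; rfl
    · left; rw [next_outEdge κ hc, h]; rfl

/-- The open component at the bottom right is not the special one. -/
theorem bottomEnd_right_notMem_special (κ : D.toGluing.Colouring) : D.bottomEnd Side.right ∉ D.special := by
  intro hmem
  -- Reaching the top left end along successors is constant on components: the only step that could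
  -- lose it would start at that end, which has no successor. The bottom right end has no successor
  -- either, so it could only reach the top left end by being equal to it, and the colours on the
  -- left of these two edges differ.
  have hinv : D.Invariant
      (fun e => Relation.ReflTransGen (fun a b => D.next κ a = some b) e (D.topEnd Side.left)) := by
    have key : ∀ a b, D.next κ a = some b →
        (Relation.ReflTransGen (fun a b => D.next κ a = some b) a (D.topEnd Side.left) ↔
          Relation.ReflTransGen (fun a b => D.next κ a = some b) b (D.topEnd Side.left)) := by
      intro a b hab
      refine ⟨fun h => ?_, fun h => Relation.ReflTransGen.head hab h⟩
      rcases Relation.ReflTransGen.cases_head h with rfl | ⟨c, hc, h⟩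
      · rw [next_topEnd_left] at hab; cases hab
      · rw [hab] at hc; cases hc; exact h
    intro e e' h
    rcases next_of_joined κ h with h | h
    · exact propext (key _ _ h)
    · exact propext (key _ _ h).symm
  have h := (hinv.eq_of_mem hmem).mp Relation.ReflTransGen.refl
  rcases Relation.ReflTransGen.cases_head h with h | ⟨c, hc, h⟩
  · have h1 := κ.col_left
    rw [← leftRegion_topEnd_left, ← h, leftRegion_bottomEnd_right, κ.col_bottom] at h1
    exact absurd h1 (by decide)
  · rw [next_bottomEnd_right] at hc; cases hc

theorem bottomEnd_left_mem_special (h : D.openKind = ArcKind.dotted) :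
    D.bottomEnd Side.left ∈ D.special := by
  rw [openKind] at h
  by_contra h'
  rw [if_neg h'] at h
  cases h

theorem bottomEnd_left_notMem_special (h : D.openKind = ArcKind.thick) :
    D.bottomEnd Side.left ∉ D.special := by
  rw [openKind] at h
  intro h'
  rw [if_pos h'] at h
  cases h

variable [Fintype V]

/-- In the signed count `sum_ends`, the ends at the bottom left and top right balance those at the
bottom right and top left. The special component contains the top left end and not the bottom right
one, hence exactly one of the other two. The next two lemmas use the same count. -/
theorem topEnd_right_mem_special (κ : D.toGluing.Colouring) (h : D.openKind = ArcKind.thick) :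
    D.topEnd Side.right ∈ D.special := by
  classical
  have := (invariant_indicator (1 : ℤ) 0 (D.topEnd Side.left)).sum_ends κ
  rw [if_pos (self_mem_component _), ← special, if_neg (bottomEnd_left_notMem_special h),
    if_neg (bottomEnd_right_notMem_special κ)] at this
  by_contra h'
  rw [if_neg h'] at this
  omega

theorem topEnd_right_mem (κ : D.toGluing.Colouring) (h : D.openKind = ArcKind.dotted) :
    D.topEnd Side.right ∈ D.component (D.bottomEnd Side.right) := by
  classical
  have := (invariant_indicator (1 : ℤ) 0 (D.bottomEnd Side.right)).sum_ends κ
  have hn := bottomEnd_right_notMem_special κ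
  have hl : D.topEnd Side.left ∉ D.component (D.bottomEnd Side.right) := fun h =>
    hn (mem_component_comm.mp h)
  have hb : D.bottomEnd Side.left ∉ D.component (D.bottomEnd Side.right) := by
    intro h'
    apply hn
    rw [special, ← component_eq (bottomEnd_left_mem_special h)]
    exact mem_component_comm.mp h'
  rw [if_pos (self_mem_component _), if_neg hl, if_neg hb] at this
  by_contra h'
  rw [if_neg h'] at this
  omega

theorem bottomEnd_left_mem (κ : D.toGluing.Colouring) (h : D.openKind = ArcKind.thick) :
    D.bottomEnd Side.left ∈ D.component (D.bottomEnd Side.right) := by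
  classical
  have := (invariant_indicator (1 : ℤ) 0 (D.bottomEnd Side.right)).sum_ends κ
  have hn := bottomEnd_right_notMem_special κ
  have hl : D.topEnd Side.left ∉ D.component (D.bottomEnd Side.right) := fun h =>
    hn (mem_component_comm.mp h)
  have hb : D.topEnd Side.right ∉ D.component (D.bottomEnd Side.right) := by
    intro h'
    apply hn
    rw [special, ← component_eq (topEnd_right_mem_special κ h)]
    exact mem_component_comm.mp h'
  rw [if_pos (self_mem_component _), if_neg hl, if_neg hb] at this
  by_contra h'
  rw [if_neg h'] at this
  omega

/-- Each end lies on the special component or on the one at the bottom right. -/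
theorem end_mem (κ : D.toGluing.Colouring) (s : Side) :
    (D.bottomEnd s ∈ D.special ∨ D.bottomEnd s ∈ D.component (D.bottomEnd Side.right)) ∧
    (D.topEnd s ∈ D.special ∨ D.topEnd s ∈ D.component (D.bottomEnd Side.right)) := by
  rcases h : D.openKind with _ | _
  · cases s
    · exact ⟨Or.inl (bottomEnd_left_mem_special h), Or.inl (self_mem_component _)⟩
    · exact ⟨Or.inr (self_mem_component _), Or.inr (topEnd_right_mem κ h)⟩
  · cases s
    · exact ⟨Or.inr (bottomEnd_left_mem κ h), Or.inl (self_mem_component _)⟩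
    · exact ⟨Or.inr (self_mem_component _), Or.inl (topEnd_right_mem_special κ h)⟩

/-- A component is closed unless it is one of the two open components. -/
theorem component_mem_closedComponents (κ : D.toGluing.Colouring) {e : D.Edge} (h : D.topEnd Side.left ∉ D.component e)
    (h' : D.bottomEnd Side.right ∉ D.component e) : D.component e ∈ D.closedComponents := by
  have key : ∀ x, x ∈ D.component e →
      ¬ (x ∈ D.special ∨ x ∈ D.component (D.bottomEnd Side.right)) := by
    rintro x hx (hx' | hx')
    · apply h
      rw [← component_eq hx]
      exact mem_component_comm.mp hx'
    · apply h'
      rw [← component_eq hx]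
      exact mem_component_comm.mp hx'
  exact ⟨⟨e, rfl⟩, fun s => ⟨fun hx => key _ hx (end_mem κ s).1,
    fun hx => key _ hx (end_mem κ s).2⟩⟩

theorem eq_component_of_mem_closed {c : Set D.Edge} (hc : c ∈ D.closedComponents) {e : D.Edge}
    (he : e ∈ c) : c = D.component e := by
  obtain ⟨⟨e', rfl⟩, _⟩ := hc
  exact (component_eq he).symm

/-! ### Telescoping -/

/-- The first entry of the differential of `M̃(o(D))`. -/
def _root_.Delooping.ArcKind.fst : ArcKind → BoundaryRing
  | ArcKind.dotted => bx
  | ArcKind.thick => bY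

/-- The second entry of the differential of `M̃(o(D))`. -/
def _root_.Delooping.ArcKind.snd : ArcKind → BoundaryRing
  | ArcKind.dotted => bY * bz
  | ArcKind.thick => bx * bz

/-- Summation by parts. Counting `g e • edgeVar e` over all edges by sources and by targets gives
zero in characteristic 2. At each vertex the four terms combine to the difference of `g` across the
arc times `lam`, since `g` is constant along strands, and the four tangle ends contribute x or y. -/
theorem Invariant.sum_smul_lam (κ : D.toGluing.Colouring) {g : D.Edge → ZMod 2} (hg : D.Invariant g) :
    ∑ v, (g (D.firstStrand v) + g (D.secondStrand v)) • D.lam v =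
      (g (D.topEnd Side.left) + g (D.bottomEnd Side.right)) •
        algebraMap BoundaryRing D.ReducedRing D.openKind.fst := by
  have h2 := D.two_eq_zero
  let f : D.Edge → D.ReducedRing := fun e => g e • κ.edgeVar e
  have hs := D.sum_edge_source f
  have ht := D.sum_edge_target f
  have hv : ∀ v, (g (D.firstStrand v) + g (D.secondStrand v)) • D.lam v =
      (f (D.outEdge v Side.left) + f (D.outEdge v Side.right)) +
      (f (D.inEdge v Side.left) + f (D.inEdge v Side.right)) := by
    intro v
    rcases D.kind_eq v with h | h
    · rw [firstStrand, secondStrand, h]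
      dsimp only [f]
      rw [add_smul, ← hg _ _ (Joined.dotted v Side.left h), ← hg _ _ (Joined.dotted v Side.right h)]
      nth_rewrite 1 [← D.edgeVar_in_add_out κ h Side.left]
      rw [← D.edgeVar_in_add_out κ h Side.right]
      simp only [smul_add]
      abel
    · rw [firstStrand, secondStrand, h]
      dsimp only [f]
      rw [add_smul, ← hg _ _ (Joined.thickIn v h), ← hg _ _ (Joined.thickOut v h)]
      nth_rewrite 1 [← D.edgeVar_in_add_in κ h]
      rw [← D.edgeVar_out_add_out κ h]
      simp only [smul_add]
      abel
  have hb : f (D.bottomEnd Side.left) + f (D.bottomEnd Side.right) +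
      (f (D.topEnd Side.left) + f (D.topEnd Side.right)) =
      (g (D.topEnd Side.left) + g (D.bottomEnd Side.right)) •
        algebraMap BoundaryRing D.ReducedRing D.openKind.fst := by
    dsimp only [f]
    rcases h : D.openKind with _ | _
    · rw [← hg.eq_of_mem (bottomEnd_left_mem_special h), ← hg.eq_of_mem (topEnd_right_mem κ h),
        ArcKind.fst, algebraMap_bx, κ.edgeVar_topEnd_left, κ.edgeVar_bottomEnd_left,
        κ.edgeVar_bottomEnd_right, κ.edgeVar_topEnd_right, algebraMap_bz]
      simp only [Algebra.smul_def, map_add]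
      grind
    · rw [← hg.eq_of_mem (bottomEnd_left_mem κ h),
        ← hg.eq_of_mem (topEnd_right_mem_special κ h),
        ArcKind.fst, algebraMap_bY, κ.edgeVar_topEnd_left, κ.edgeVar_bottomEnd_left,
        κ.edgeVar_bottomEnd_right, κ.edgeVar_topEnd_right, algebraMap_bz]
      simp only [Algebra.smul_def, map_add]
      grind
  rw [← hb, Finset.sum_congr rfl fun v _ => hv v, Finset.sum_add_distrib]
  have h3 := D.add_self (∑ e, f e)
  grind

/-! ### Frames -/

/-- An edge on a component. -/
def _root_.Delooping.Gluing.rep {V : Type*} (G : Gluing V) (c : Set G.Edge) : G.Edge :=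
  Classical.epsilon (h := ⟨G.bottomEnd Side.left⟩) (· ∈ c)

theorem rep_mem {c : Set D.Edge} (hc : c ∈ D.closedComponents) : D.rep c ∈ c := by
  obtain ⟨⟨e, rfl⟩, _⟩ := hc
  exact Classical.epsilon_spec (p := (· ∈ D.component e)) ⟨e, self_mem_component e⟩

theorem component_rep {c : Set D.Edge} (hc : c ∈ D.closedComponents) :
    D.component (D.rep c) = c := (eq_component_of_mem_closed hc (rep_mem hc)).symm

variable (D) in
/-- A set of arcs, called the tree, that restricts the invariant functions vanishing on the open
components faithfully and freely, together with one further arc, the root, that separates the two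
open components in the complement of the tree. -/
structure Frame where
  tree : Finset V
  faithful : ∀ g : D.Edge → ZMod 2, D.Invariant g → g (D.topEnd Side.left) = 0 →
    g (D.bottomEnd Side.right) = 0 →
    (∀ a ∈ tree, g (D.firstStrand a) = g (D.secondStrand a)) → g = 0
  dual : V → D.Edge → ZMod 2
  dual_invariant : ∀ a ∈ tree, D.Invariant (dual a)
  dual_top : ∀ a ∈ tree, dual a (D.topEnd Side.left) = 0
  dual_bottom : ∀ a ∈ tree, dual a (D.bottomEnd Side.right) = 0
  dual_self : ∀ a ∈ tree, dual a (D.firstStrand a) + dual a (D.secondStrand a) = 1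
  dual_other : ∀ a ∈ tree, ∀ b ∈ tree, b ≠ a →
    dual a (D.firstStrand b) + dual a (D.secondStrand b) = 0
  cut : D.Edge → ZMod 2
  cut_invariant : D.Invariant cut
  cut_top : cut (D.topEnd Side.left) = 1
  cut_bottom : cut (D.bottomEnd Side.right) = 0
  cut_tree : ∀ a ∈ tree, cut (D.firstStrand a) + cut (D.secondStrand a) = 0
  root : V
  cut_root : cut (D.firstStrand root) + cut (D.secondStrand root) = 1

/-- In the graph with the components as vertices and the arcs as edges, a minimal faithful set of
arcs is a spanning forest of two trees, one at each open component. Removing an arc of it cuts off a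
set of closed components, whose characteristic function is the dual; the cut is the characteristic
function of the tree at the special component, and by connectedness some arc leaves that tree. -/
theorem nonempty_frame (κ : D.toGluing.Colouring) [DecidableEq V] (hL : D.Linked) : Nonempty D.Frame := by
  classical
  have hz : ∀ a b : ZMod 2, a ≠ b → a + b = 1 := by decide
  let P : Set (Finset V) := {t | ∀ g : D.Edge → ZMod 2, D.Invariant g →
    g (D.topEnd Side.left) = 0 → g (D.bottomEnd Side.right) = 0 →
    (∀ a ∈ t, g (D.firstStrand a) = g (D.secondStrand a)) → g = 0}
  have hP : P.Nonempty := ⟨Finset.univ, fun g hg h _ h' => funext fun e =>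
    (hg.const hL (fun v => h' v (Finset.mem_univ v)) e _).trans h⟩
  obtain ⟨t, ht, hmin⟩ := (wellFounded_lt (α := Finset V)).has_min P hP
  have hex : ∀ a ∈ t, ∃ f : D.Edge → ZMod 2, D.Invariant f ∧ f (D.topEnd Side.left) = 0 ∧
      f (D.bottomEnd Side.right) = 0 ∧ f (D.firstStrand a) + f (D.secondStrand a) = 1 ∧
      ∀ b ∈ t, b ≠ a → f (D.firstStrand b) + f (D.secondStrand b) = 0 := by
    intro a ha
    -- By minimality, `t` without `a` misses some nonzero function; faithfulness of `t` makes that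
    -- function differ on the two strands at `a`.
    have hn : ¬ t.erase a ∈ P := fun h => hmin _ h (Finset.erase_ssubset ha)
    simp only [P, Set.mem_ofPred_eq, not_forall] at hn
    obtain ⟨f, hf, h1, h2, h3, h4⟩ := hn
    refine ⟨f, hf, h1, h2, hz _ _ fun h => h4 (ht f hf h1 h2 fun b hb => ?_), fun b hb hne => ?_⟩
    · by_cases hba : b = a
      · rw [hba, h]
      · exact h3 b (Finset.mem_erase.mpr ⟨hba, hb⟩)
    · rw [h3 b (Finset.mem_erase.mpr ⟨hne, hb⟩)]
      exact CharTwo.add_self_eq_zero _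
  choose! dual d1 d2 d3 d4 d5 using hex
  let χ : D.Edge → ZMod 2 := fun e => if e ∈ D.special then 1 else 0
  have hχ : D.Invariant χ := invariant_indicator 1 0 _
  -- The characteristic function of the special component, corrected by the duals so as to become
  -- constant along every arc of the tree. The duals vanish on the open components, so the values
  -- there are unchanged.
  let cut : D.Edge → ZMod 2 := fun e =>
    χ e + ∑ a ∈ t, (χ (D.firstStrand a) + χ (D.secondStrand a)) * dual a e
  have c1 : D.Invariant cut := by
    intro e e' h
    simp only [cut]
    rw [hχ e e' h]
    congr 1
    exact Finset.sum_congr rfl fun a ha => by rw [d1 a ha e e' h]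
  have c2 : cut (D.topEnd Side.left) = 1 := by
    simp only [cut, χ]
    rw [special, if_pos (self_mem_component _), Finset.sum_eq_zero, add_zero]
    intro a ha
    rw [d2 a ha, mul_zero]
  have c3 : cut (D.bottomEnd Side.right) = 0 := by
    simp only [cut, χ]
    rw [if_neg (bottomEnd_right_notMem_special κ), Finset.sum_eq_zero, add_zero]
    intro a ha
    rw [d3 a ha, mul_zero]
  have c4 : ∀ b ∈ t, cut (D.firstStrand b) + cut (D.secondStrand b) = 0 := by
    intro b hb
    simp only [cut]
    rw [add_add_add_comm, ← Finset.sum_add_distrib, Finset.sum_eq_single b, ← mul_add, d4 b hb,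
      mul_one]
    · exact CharTwo.add_self_eq_zero _
    · intro a ha hab
      rw [← mul_add, d5 a ha b hb hab.symm, mul_zero]
    · exact fun h => absurd hb h
  have hroot : ∃ v, cut (D.firstStrand v) + cut (D.secondStrand v) = 1 := by
    by_contra! h
    have := c1.const hL (fun v => by
      by_contra hne
      exact h v (hz _ _ hne)) (D.topEnd Side.left) (D.bottomEnd Side.right)
    rw [c2, c3] at this
    exact absurd this (by decide)
  obtain ⟨root, hroot⟩ := hroot
  exact ⟨⟨t, ht, dual, d1, d2, d3, d4, d5, cut, c1, c2, c3, c4, root, hroot⟩⟩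

namespace Frame

variable (F : D.Frame)

theorem root_notMem : F.root ∉ F.tree := by
  intro h
  have := F.cut_tree _ h
  rw [F.cut_root] at this
  exact absurd this (by decide)

/-- A module valued invariant function that vanishes on the open components and is constant along
the arcs of the tree vanishes. -/
theorem vanish {Z : Type*} [AddCommGroup Z] [Module (ZMod 2) Z] (φ : D.Edge → Z)
    (hφ : D.Invariant φ) (h1 : φ (D.topEnd Side.left) = 0) (h2 : φ (D.bottomEnd Side.right) = 0)
    (h3 : ∀ a ∈ F.tree, φ (D.firstStrand a) = φ (D.secondStrand a)) (e : D.Edge) : φ e = 0 := by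
  rw [← Module.forall_dual_apply_eq_zero_iff (ZMod 2)]
  intro f
  refine congrFun (F.faithful (fun e => f (φ e)) (fun e e' h => ?_) ?_ ?_ ?_) e
  · exact congrArg f (hφ e e' h)
  · rw [h1, map_zero]
  · rw [h2, map_zero]
  · intro a ha
    rw [h3 a ha]

/-- The 𝔽₂-space of invariant functions that vanish on the open components is counted twice. Its
elements are determined freely by their differences along the tree, and also freely by their values
on the closed components. -/
theorem card_tree (κ : D.toGluing.Colouring) : F.tree.card = Nat.card D.closedComponents := by
  classical
  have : Fintype D.closedComponents := Fintype.ofFinite _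
  let G₀ := {g : D.Edge → ZMod 2 // D.Invariant g ∧ g (D.topEnd Side.left) = 0 ∧
    g (D.bottomEnd Side.right) = 0}
  let A : G₀ → F.tree → ZMod 2 := fun g a => g.1 (D.firstStrand a) + g.1 (D.secondStrand a)
  let B : G₀ → D.closedComponents → ZMod 2 := fun g c => g.1 (D.rep c.1)
  have hA : Function.Bijective A := by
    constructor
    · intro g g' h
      apply Subtype.ext
      have := F.faithful (fun e => g.1 e + g'.1 e)
        (fun e e' h => congrArg₂ (· + ·) (g.2.1 e e' h) (g'.2.1 e e' h))
        (by rw [g.2.2.1, g'.2.2.1, add_zero]) (by rw [g.2.2.2, g'.2.2.2, add_zero])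
        (fun a ha => by
          have h := congrFun h ⟨a, ha⟩
          simp only [A] at h
          generalize g.1 (D.firstStrand a) = x1 at *
          generalize g.1 (D.secondStrand a) = x2 at *
          generalize g'.1 (D.firstStrand a) = x3 at *
          generalize g'.1 (D.secondStrand a) = x4 at *
          revert x1 x2 x3 x4
          decide)
      funext e
      exact CharTwo.add_eq_zero.mp (congrFun this e)
    · intro u
      refine ⟨⟨fun e => ∑ a : F.tree, u a * F.dual a e, ?_, ?_, ?_⟩, ?_⟩
      · intro e e' h
        exact Finset.sum_congr rfl fun a _ => by rw [F.dual_invariant a a.2 e e' h]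
      · exact Finset.sum_eq_zero fun a _ => by rw [F.dual_top a a.2, mul_zero]
      · exact Finset.sum_eq_zero fun a _ => by rw [F.dual_bottom a a.2, mul_zero]
      · funext b
        simp only [A]
        rw [← Finset.sum_add_distrib, Finset.sum_eq_single b, ← mul_add, F.dual_self b b.2,
          mul_one]
        · intro a _ hab
          rw [← mul_add, F.dual_other a a.2 b b.2 (fun h => hab (Subtype.ext h.symm)), mul_zero]
        · exact fun h => absurd (Finset.mem_univ _) h
  have hB : Function.Bijective B := by
    constructor
    · intro g g' h
      apply Subtype.ext
      funext e
      by_cases h1 : D.topEnd Side.left ∈ D.component e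
      · rw [g.2.1.eq_of_mem h1, g'.2.1.eq_of_mem h1, g.2.2.1, g'.2.2.1]
      by_cases h2 : D.bottomEnd Side.right ∈ D.component e
      · rw [g.2.1.eq_of_mem h2, g'.2.1.eq_of_mem h2, g.2.2.2, g'.2.2.2]
      have hc := component_mem_closedComponents κ h1 h2
      have := congrFun h ⟨_, hc⟩
      simp only [B] at this
      rwa [← g.2.1.eq_of_mem (rep_mem hc), ← g'.2.1.eq_of_mem (rep_mem hc)] at this
    · intro u
      refine ⟨⟨fun e => if h : D.component e ∈ D.closedComponents then u ⟨_, h⟩ else 0,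
        ?_, ?_, ?_⟩, ?_⟩
      · intro e e' h
        have := invariant_component e e' h
        simp only [this]
      · refine dif_neg ?_
        intro h
        exact (h.2 Side.left).2 (self_mem_component _)
      · refine dif_neg ?_
        intro h
        exact (h.2 Side.right).1 (self_mem_component _)
      · funext c
        simp only [B, component_rep c.2]
        rw [dif_pos c.2]
  have h1 := Nat.card_congr (Equiv.ofBijective A hA)
  have h2 := Nat.card_congr (Equiv.ofBijective B hB)
  rw [h1] at h2
  simp only [Nat.card_eq_fintype_card, Fintype.card_fun, ZMod.card, Fintype.card_coe] at h2
  rw [Nat.card_eq_fintype_card]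
  exact Nat.pow_right_injective le_rfl h2

end Frame

end Crossingless

/-! ## A graded dimension count -/

section GradedCount

variable {F : Type*} [Field F] {ι : Type*}

/-- A surjective endomorphism of a free module that preserves a grading with finite pieces is
injective. -/
theorem injective_of_surjective_of_graded (deg : ι → ℕ) (hfin : ∀ n, {i | deg i ≤ n}.Finite)
    (f : (ι →₀ F) →ₗ[F] (ι →₀ F))
    (hf : ∀ i, f (Finsupp.single i 1) ∈ Finsupp.supported F F {j | deg j = deg i})
    (hsurj : Function.Surjective f) : Function.Injective f := by
  have hmap : ∀ (s : Set ℕ), ∀ u ∈ Finsupp.supported F F {i | deg i ∈ s},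
      f u ∈ Finsupp.supported F F {i | deg i ∈ s} := by
    intro s u hu
    rw [Finsupp.supported_eq_span_single] at hu
    refine Submodule.span_induction ?_ ?_ ?_ ?_ hu
    · rintro _ ⟨i, hi, rfl⟩
      refine Finsupp.supported_mono ?_ (hf i)
      intro j hj
      change deg j ∈ s
      rw [show deg j = deg i from hj]
      exact hi
    · rw [map_zero]; exact Submodule.zero_mem _
    · intro a b _ _ ha hb; rw [map_add]; exact Submodule.add_mem _ ha hb
    · intro c a _ ha; rw [map_smul]; exact Submodule.smul_mem _ _ ha
  have hU : ∀ n, Function.Injective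
      (f.restrict (hmap (Set.Iic n)) : Finsupp.supported F F {i | deg i ∈ Set.Iic n} →ₗ[F]
        Finsupp.supported F F {i | deg i ∈ Set.Iic n}) := by
    intro n
    have : Finite {i | deg i ∈ Set.Iic n} := (hfin n).to_subtype
    have : FiniteDimensional F (Finsupp.supported F F {i | deg i ∈ Set.Iic n}) :=
      Module.Finite.equiv (Finsupp.supportedEquivFinsupp _).symm
    refine (LinearMap.injective_iff_surjective (K := F)
      (V := Finsupp.supported F F {i | deg i ∈ Set.Iic n})).mpr ?_
    rintro ⟨w, hw⟩
    obtain ⟨u, rfl⟩ := hsurj w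
    classical
    -- The part of a preimage in degrees above `n` is mapped into degrees above `n`, and as a
    -- difference of two elements of degree at most `n` also into those. Its image is therefore
    -- zero, and it can be dropped.
    set u₁ := u.filter (fun i => deg i ∈ Set.Iic n) with hu₁
    set u₂ := u.filter (fun i => ¬ deg i ∈ Set.Iic n) with hu₂
    have hu : u = u₁ + u₂ := (Finsupp.filter_add_filter_not u _).symm
    have h1 : u₁ ∈ Finsupp.supported F F {i | deg i ∈ Set.Iic n} := by
      intro i hi
      rw [hu₁, Finsupp.support_filter] at hi
      exact (Finset.mem_filter.mp hi).2
    have h2 : u₂ ∈ Finsupp.supported F F {i | deg i ∈ (Set.Iic n)ᶜ} := by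
      intro i hi
      rw [hu₂, Finsupp.support_filter] at hi
      exact (Finset.mem_filter.mp hi).2
    have h3 : f u₂ = 0 := by
      have ha := hmap _ _ h2
      have hb : f u₂ ∈ Finsupp.supported F F {i | deg i ∈ Set.Iic n} := by
        have : f u₂ = f u - f u₁ := by rw [hu, map_add]; abel
        rw [this]
        exact Submodule.sub_mem _ hw (hmap _ _ h1)
      have hd : Disjoint {i | deg i ∈ Set.Iic n} {i | deg i ∈ (Set.Iic n)ᶜ} := by
        rw [Set.disjoint_left]; intro i hi hi'; exact hi' hi
      exact (Submodule.disjoint_def.mp (Finsupp.disjoint_supported_supported hd)) _ hb ha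
    refine ⟨⟨u₁, h1⟩, Subtype.ext ?_⟩
    change f u₁ = f u
    rw [hu, map_add, h3, add_zero]
  rw [injective_iff_map_eq_zero]
  intro u hu
  have hmem : u ∈ Finsupp.supported F F {i | deg i ∈ Set.Iic (u.support.sup deg)} := by
    intro i hi
    exact Finset.le_sup (f := deg) hi
  have := hU _ (a₁ := ⟨u, hmem⟩) (a₂ := 0) (Subtype.ext (by
    rw [map_zero]; exact hu))
  exact congrArg Subtype.val this

/-- A surjective graded map to a polynomial ring is injective if the dimensions of the graded
pieces of its source are not larger than those of the polynomial ring. -/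
theorem injective_of_surjective_of_isHomogeneous {X : Type*} [Finite X] (deg : ι → ℕ)
    (f : (ι →₀ F) →ₗ[F] MvPolynomial X F)
    (hf : ∀ i, (f (Finsupp.single i 1)).IsHomogeneous (deg i))
    (hsurj : Function.Surjective f) (τ : ι → X →₀ ℕ) (hτ : Function.Injective τ)
    (hdeg : ∀ i, (τ i).degree = deg i) : Function.Injective f := by
  classical
  -- This sends the monomial `τ i` back to `i` and all monomials outside the range of `τ` to zero.
  -- It is graded and surjective, so the previous lemma applies to its composite with `f`.
  let t : MvPolynomial X F →ₗ[F] (ι →₀ F) := (MvPolynomial.basisMonomials X F).constr F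
    fun d => if h : ∃ i, τ i = d then Finsupp.single h.choose 1 else 0
  have htmon : ∀ d, t (MvPolynomial.monomial d 1) =
      if h : ∃ i, τ i = d then Finsupp.single h.choose 1 else 0 := by
    intro d
    have := (MvPolynomial.basisMonomials X F).constr_basis F
      (fun d => if h : ∃ i, τ i = d then Finsupp.single h.choose (1 : F) else 0) d
    rwa [MvPolynomial.coe_basisMonomials] at this
  have htτ : ∀ i, t (MvPolynomial.monomial (τ i) 1) = Finsupp.single i 1 := by
    intro i
    have h : ∃ j, τ j = τ i := ⟨i, rfl⟩
    rw [htmon, dif_pos h, hτ h.choose_spec]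
  have ht : Function.Surjective t := by
    intro u
    induction u using Finsupp.induction_linear with
    | zero => exact ⟨0, map_zero _⟩
    | add u w hu hw =>
      obtain ⟨p, rfl⟩ := hu
      obtain ⟨q, rfl⟩ := hw
      exact ⟨p + q, map_add _ _ _⟩
    | single i c =>
      refine ⟨c • MvPolynomial.monomial (τ i) 1, ?_⟩
      rw [map_smul, htτ, Finsupp.smul_single, smul_eq_mul, mul_one]
  have hfin : ∀ n, {i | deg i ≤ n}.Finite := by
    intro n
    refine Set.Finite.of_finite_image (f := τ) ?_ hτ.injOn
    refine (Finsupp.finite_of_degree_le (σ := X) n).subset ?_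
    rintro _ ⟨i, hi, rfl⟩
    exact (hdeg i).le.trans hi
  have hdegt : ∀ (p : MvPolynomial X F) n, p.IsHomogeneous n →
      t p ∈ Finsupp.supported F F {j | deg j = n} := by
    intro p n hp
    rw [p.as_sum, map_sum]
    refine Submodule.sum_mem _ fun d hd => ?_
    have hd' : d.degree = n := by
      by_contra hne
      exact MvPolynomial.mem_support_iff.mp hd (hp.coeff_eq_zero hne)
    rw [show MvPolynomial.monomial d (MvPolynomial.coeff d p) =
      MvPolynomial.coeff d p • MvPolynomial.monomial d (1 : F) by
        rw [MvPolynomial.smul_monomial, smul_eq_mul, mul_one], map_smul, htmon]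
    refine Submodule.smul_mem _ _ ?_
    split_ifs with h
    · refine Finsupp.single_mem_supported F 1 ?_
      change deg h.choose = n
      rw [← hdeg, h.choose_spec, hd']
    · exact Submodule.zero_mem _
  have := injective_of_surjective_of_graded deg hfin (t ∘ₗ f) (fun i => hdegt _ _ (hf i))
    (ht.comp hsurj)
  exact Function.Injective.of_comp (f := t) this

end GradedCount

/-! ## A basis of the reduced edge ring over the boundary ring -/

namespace Crossingless

open Gluing

variable {V : Type*} [Fintype V] {D : Crossingless V}

instance : Fintype D.closedComponents := Fintype.ofFinite _

/-- The variable of a closed component. -/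
def _root_.Delooping.Gluing.Colouring.circleVar {V : Type*} {G : Gluing V} (κ : G.Colouring)
    (c : Set G.Edge) : G.ReducedRing := κ.edgeVar (G.rep c)

namespace Frame

variable [DecidableEq V] (F : D.Frame)

/-- The arcs other than the root. -/
abbrev Arc := {v : V // v ≠ F.root}

/-- The entry of the differential at an arc that is used to eliminate it. -/
def beta (j : F.Arc) : D.ReducedRing := if j.1 ∈ F.tree then D.kap j else D.lam j

/-- The polynomial degree of `beta`. -/
def betaDeg (j : F.Arc) : ℕ := if j.1 ∈ F.tree then 2 else 1

theorem beta_mem (j : F.Arc) : F.beta j ∈ D.redHomogeneous (F.betaDeg j) := by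
  rw [beta, betaDeg]
  split_ifs
  · exact D.kap_mem _
  · exact D.lam_mem _

theorem beta_tree {a : V} (ha : a ∈ F.tree) :
    F.beta ⟨a, fun h => F.root_notMem (h ▸ ha)⟩ = D.kap a := if_pos ha

theorem beta_notMem {a : V} (ha : a ∉ F.tree) (h : a ≠ F.root) : F.beta ⟨a, h⟩ = D.lam a :=
  if_neg ha

/-! ### The linear entries -/

/-- Telescoping with the cut: tree arcs have coefficient 0 and the root has coefficient 1. Only a
subspace over 𝔽₂ is required, because the lemma is applied to the kernel of a coefficient map as
well as to subalgebras and ideals. -/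
theorem lam_root_add_mem (κ : D.toGluing.Colouring) (L : Submodule (ZMod 2) D.ReducedRing)
    (hL : ∀ v ∉ F.tree, v ≠ F.root → D.lam v ∈ L) :
    D.lam F.root + algebraMap BoundaryRing _ D.openKind.fst ∈ L := by
  have h := F.cut_invariant.sum_smul_lam κ
  rw [F.cut_top, F.cut_bottom, add_zero, one_smul] at h
  rw [← h, ← Finset.add_sum_erase _ _ (Finset.mem_univ F.root), F.cut_root, one_smul,
    ← add_assoc, D.add_self, zero_add]
  refine Submodule.sum_mem _ fun v hv => ?_
  by_cases ht : v ∈ F.tree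
  · rw [F.cut_tree v ht, zero_smul]; exact L.zero_mem
  · exact L.smul_mem _ (hL v ht (Finset.ne_of_mem_erase hv))

/-- Telescoping with the function dual to a tree arc expresses its linear entry by those of arcs
outside the tree. For the root, the cut does so up to x or y. -/
theorem lam_mem_of_mem (κ : D.toGluing.Colouring) (L : Submodule (ZMod 2) D.ReducedRing)
    (hL : ∀ v ∉ F.tree, v ≠ F.root → D.lam v ∈ L)
    (hp : algebraMap BoundaryRing _ D.openKind.fst ∈ L) (v : V) : D.lam v ∈ L := by
  have hroot : D.lam F.root ∈ L := by
    have := L.sub_mem (F.lam_root_add_mem κ L hL) hp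
    rwa [add_sub_cancel_right] at this
  have hnot : ∀ v ∉ F.tree, D.lam v ∈ L := fun v hv => by
    by_cases h : v = F.root
    · rwa [h]
    · exact hL v hv h
  by_cases hv : v ∈ F.tree
  · have h := (F.dual_invariant v hv).sum_smul_lam κ
    rw [F.dual_top v hv, F.dual_bottom v hv, add_zero, zero_smul,
      ← Finset.add_sum_erase _ _ (Finset.mem_univ v), F.dual_self v hv, one_smul] at h
    rw [eq_neg_of_add_eq_zero_left h]
    refine L.neg_mem (Submodule.sum_mem _ fun b hb => ?_)
    by_cases ht : b ∈ F.tree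
    · rw [F.dual_other v hv b ht (Finset.ne_of_mem_erase hb), zero_smul]; exact L.zero_mem
    · exact L.smul_mem _ (hnot b ht)
  · exact hnot v hv

theorem edgeVar_add_mem (κ : D.toGluing.Colouring) (L : Submodule (ZMod 2) D.ReducedRing) (hL : ∀ v, D.lam v ∈ L)
    {e e' : D.Edge} (h : e' ∈ D.component e) : κ.edgeVar e + κ.edgeVar e' ∈ L := by
  have hinv : D.Invariant (fun e => (L.mkQ (κ.edgeVar e))) := by
    intro e e' h
    obtain ⟨v, hv⟩ := D.exists_lam_of_joined κ h
    change L.mkQ _ = L.mkQ _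
    rw [← sub_eq_zero, ← map_sub, D.sub_eq, hv]
    exact (Submodule.Quotient.mk_eq_zero L).mpr (hL v)
  have := hinv.eq_of_mem h
  change L.mkQ _ = L.mkQ _ at this
  rw [← sub_eq_zero, ← map_sub, D.sub_eq] at this
  exact (Submodule.Quotient.mk_eq_zero L).mp this

/-! ### Spanning -/

/-- The subalgebra generated by the eliminating entries. -/
def betaAlg : Subalgebra BoundaryRing D.ReducedRing :=
  Algebra.adjoin BoundaryRing (Set.range F.beta)

theorem beta_mem_betaAlg (j : F.Arc) : F.beta j ∈ F.betaAlg :=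
  Algebra.subset_adjoin ⟨j, rfl⟩

theorem lam_mem_betaAlg (κ : D.toGluing.Colouring) (v : V) : D.lam v ∈ F.betaAlg := by
  refine F.lam_mem_of_mem κ
    (AddSubgroup.toZModSubmodule 2 F.betaAlg.toSubring.toAddSubgroup) ?_ ?_ v
  · intro v hv h
    have := F.beta_mem_betaAlg ⟨v, h⟩
    rwa [F.beta_notMem hv h] at this
  · exact F.betaAlg.algebraMap_mem _

variable (κ : D.toGluing.Colouring)

/-- The module over `betaAlg` generated by `1` and the variables of the closed components. -/
def linMod : Submodule F.betaAlg D.ReducedRing :=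
  Submodule.span F.betaAlg ({1} ∪ Set.range fun c : D.closedComponents => κ.circleVar c.1)

theorem mem_linMod {a : D.ReducedRing} (ha : a ∈ F.betaAlg) : a ∈ F.linMod κ := by
  have := (F.linMod κ).smul_mem ⟨a, ha⟩ (Submodule.subset_span (Or.inl rfl))
  rwa [Subalgebra.smul_def, smul_eq_mul, mul_one] at this

theorem mul_mem_linMod {a b : D.ReducedRing} (ha : a ∈ F.betaAlg) (hb : b ∈ F.linMod κ) :
    a * b ∈ F.linMod κ := (F.linMod κ).smul_mem ⟨a, ha⟩ hb

theorem edgeVar_mem_linMod (e : D.Edge) : κ.edgeVar e ∈ F.linMod κ := by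
  have key : ∀ {e e' : D.Edge}, e' ∈ D.component e → κ.edgeVar e' ∈ F.linMod κ →
      κ.edgeVar e ∈ F.linMod κ := by
    intro e e' h h'
    have hm : κ.edgeVar e + κ.edgeVar e' ∈ F.betaAlg := edgeVar_add_mem κ
      (AddSubgroup.toZModSubmodule 2 F.betaAlg.toSubring.toAddSubgroup)
      (F.lam_mem_betaAlg κ) h
    have := (F.linMod κ).sub_mem (F.mem_linMod κ hm) h'
    rwa [add_sub_cancel_right] at this
  by_cases h1 : D.topEnd Side.left ∈ D.component e
  · refine key h1 ?_
    rw [κ.edgeVar_topEnd_left, ← algebraMap_bH]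
    exact F.mem_linMod κ (F.betaAlg.algebraMap_mem _)
  by_cases h2 : D.bottomEnd Side.right ∈ D.component e
  · refine key h2 ?_
    rw [κ.edgeVar_bottomEnd_right]
    exact F.mem_linMod κ (F.betaAlg.algebraMap_mem _)
  have hc := component_mem_closedComponents κ h1 h2
  exact key (rep_mem hc) (Submodule.subset_span (Or.inr ⟨⟨_, hc⟩, rfl⟩))

theorem redH_mem_betaAlg : D.redH ∈ F.betaAlg := by
  rw [← algebraMap_bH]; exact F.betaAlg.algebraMap_mem _

/-- As a function of the edge modulo `linMod`, y² + Hy is invariant, since it changes by λ² + Hλ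
where λ is a linear entry. It vanishes on both open components, where y is H or z, and is constant
along the tree, where the difference is `kap` up to multiples of `lam`. `Frame.vanish` then gives
zero on all components. -/
theorem edgeVar_sq_mem_linMod (e : D.Edge) :
    κ.edgeVar e ^ 2 + D.redH * κ.edgeVar e ∈ F.linMod κ := by
  have h2 := D.two_eq_zero
  let L : Submodule (ZMod 2) D.ReducedRing :=
    AddSubgroup.toZModSubmodule 2 (F.linMod κ).toAddSubgroup
  have hmk : ∀ a b : D.ReducedRing, a + b ∈ F.linMod κ → L.mkQ a = L.mkQ b := by
    intro a b h
    rw [← sub_eq_zero, ← map_sub, D.sub_eq]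
    exact (Submodule.Quotient.mk_eq_zero L).mpr h
  have hmk0 : ∀ a : D.ReducedRing, a ∈ F.linMod κ → L.mkQ a = 0 := fun a h =>
    (Submodule.Quotient.mk_eq_zero L).mpr h
  have := F.vanish (fun e => L.mkQ (κ.edgeVar e ^ 2 + D.redH * κ.edgeVar e)) ?_ ?_ ?_ ?_ e
  · exact (Submodule.Quotient.mk_eq_zero L).mp this
  · intro e e' h
    obtain ⟨v, hv⟩ := D.exists_lam_of_joined κ h
    apply hmk
    have : κ.edgeVar e ^ 2 + D.redH * κ.edgeVar e + (κ.edgeVar e' ^ 2 + D.redH * κ.edgeVar e') =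
        D.lam v * D.lam v + D.redH * D.lam v := by rw [← hv]; grind
    rw [this]
    exact F.mem_linMod κ (F.betaAlg.add_mem
      (F.betaAlg.mul_mem (F.lam_mem_betaAlg κ v) (F.lam_mem_betaAlg κ v))
      (F.betaAlg.mul_mem F.redH_mem_betaAlg (F.lam_mem_betaAlg κ v)))
  · apply hmk0
    rw [κ.edgeVar_topEnd_left]
    have : D.redH ^ 2 + D.redH * D.redH = 0 := by grind
    rw [this]
    exact (F.linMod κ).zero_mem
  · apply hmk0
    rw [κ.edgeVar_bottomEnd_right, ← map_pow]
    exact F.mem_linMod κ (F.betaAlg.add_mem (F.betaAlg.algebraMap_mem _)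
      (F.betaAlg.mul_mem F.redH_mem_betaAlg (F.betaAlg.algebraMap_mem _)))
  · intro a ha
    apply hmk
    have hk := D.kap_eq_edgeVar κ a
    have hs := D.altSum_eq_edgeVar κ a
    have : κ.edgeVar (D.firstStrand a) ^ 2 + D.redH * κ.edgeVar (D.firstStrand a) +
        (κ.edgeVar (D.secondStrand a) ^ 2 + D.redH * κ.edgeVar (D.secondStrand a)) =
        D.kap a + D.lam a * (κ.edgeVar (D.firstStrand a) + κ.edgeVar (D.secondStrand a)) := by
      rw [hk, hs]; grind
    rw [this]
    refine (F.linMod κ).add_mem (F.mem_linMod κ ?_) (F.mul_mem_linMod κ (F.lam_mem_betaAlg κ a)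
      ((F.linMod κ).add_mem (F.edgeVar_mem_linMod κ _) (F.edgeVar_mem_linMod κ _)))
    rw [← F.beta_tree ha]
    exact F.beta_mem_betaAlg _

/-- The square of the variable of a closed component is linear in these variables. -/
theorem circleVar_sq_mem_linMod (c : D.closedComponents) :
    κ.circleVar c.1 ^ 2 ∈ F.linMod κ := by
  have := (F.linMod κ).sub_mem (F.edgeVar_sq_mem_linMod κ (D.rep c.1))
    (F.mul_mem_linMod κ F.redH_mem_betaAlg (F.edgeVar_mem_linMod κ (D.rep c.1)))
  rwa [add_sub_cancel_right] at this

/-- The reduced edge ring is generated over `betaAlg` by the variables of the components. -/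
theorem adjoin_circleVar (hL : D.Linked) : Algebra.adjoin F.betaAlg
    (Set.range fun c : D.closedComponents => κ.circleVar c.1) = ⊤ := by
  set A := Algebra.adjoin F.betaAlg
    (Set.range fun c : D.closedComponents => κ.circleVar c.1) with hA
  have hlin : ∀ a ∈ F.linMod κ, a ∈ A := by
    intro a ha
    have : F.linMod κ ≤ A.toSubmodule := by
      rw [linMod, Submodule.span_le]
      rintro _ (rfl | ⟨c, rfl⟩)
      · exact A.one_mem
      · exact Algebra.subset_adjoin ⟨c, rfl⟩
    exact this ha
  have hH : D.redH ∈ A := hlin _ (F.mem_linMod κ F.redH_mem_betaAlg)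
  have htone : ∀ i, κ.tone i ∈ A := by
    intro i
    rw [Colouring.tone]
    generalize κ.col i = x
    fin_cases x
    · change algebraMap (ZMod 2) _ 0 * _ ∈ _
      rw [map_zero, zero_mul]; exact A.zero_mem
    · change algebraMap (ZMod 2) _ 1 * _ ∈ _
      rw [map_one, one_mul]; exact hH
  have hxi : ∀ i, D.xi i ∈ A := by
    intro i
    have := hL.region_eq (fun i => A.toSubmodule.mkQ (D.xi i)) (fun e => by
      rw [← sub_eq_zero, ← map_sub, D.sub_eq]
      refine (Submodule.Quotient.mk_eq_zero _).mpr ?_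
      have h := A.sub_mem (hlin _ (F.edgeVar_mem_linMod κ e)) (htone (D.leftRegion e))
      rwa [Colouring.edgeVar, add_sub_cancel_right] at h) i (D.openRegion Dir.top)
    rw [D.xi_top, map_zero] at this
    exact (Submodule.Quotient.mk_eq_zero _).mp this
  rw [eq_top_iff]
  intro a _
  exact D.reduced_induction (P := fun a => a ∈ A) hH hxi A.zero_mem A.one_mem
    (fun _ _ => A.add_mem) (fun _ _ => A.mul_mem) a

/-- The products of the variables of distinct closed components. -/
def circleMon (ε : D.closedComponents → Fin 2) : D.ReducedRing :=
  ∏ c, κ.circleVar c.1 ^ (ε c : ℕ)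

/-- Induction on the total degree in the circle variables: an exponent of at least 2 is lowered by
rewriting the square as a combination of 1 and single circle variables. -/
theorem span_circleMon (hL : D.Linked) :
    Submodule.span F.betaAlg (Set.range (circleMon (D := D) κ)) = ⊤ := by
  classical
  set T := Submodule.span F.betaAlg (Set.range (circleMon (D := D) κ)) with hT
  have hmon : ∀ (N : ℕ) (n : D.closedComponents → ℕ), ∑ c, n c = N →
      ∏ c, κ.circleVar c.1 ^ n c ∈ T := by
    intro N
    induction N using Nat.strong_induction_on with
    | _ N ih =>
      intro n hn
      by_cases h : ∀ c, n c < 2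
      · exact Submodule.subset_span ⟨fun c => ⟨n c, h c⟩, rfl⟩
      · push Not at h
        obtain ⟨c, hc⟩ := h
        let n' := Function.update n c (n c - 2)
        have hsum : ∑ c, n' c + 2 = N := by
          rw [← hn, ← Finset.add_sum_erase _ n (Finset.mem_univ c),
            ← Finset.add_sum_erase _ n' (Finset.mem_univ c)]
          have : ∑ x ∈ Finset.univ.erase c, n' x = ∑ x ∈ Finset.univ.erase c, n x :=
            Finset.sum_congr rfl fun x hx =>
              Function.update_of_ne (Finset.ne_of_mem_erase hx) _ _
          rw [this, show n' c = n c - 2 from Function.update_self _ _ _]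
          omega
        have hprod : ∏ c, κ.circleVar c.1 ^ n c =
            κ.circleVar c.1 ^ 2 * ∏ c, κ.circleVar c.1 ^ n' c := by
          rw [← Finset.mul_prod_erase _ _ (Finset.mem_univ c),
            ← Finset.mul_prod_erase _ (fun c => κ.circleVar c.1 ^ n' c) (Finset.mem_univ c)]
          have : ∏ x ∈ Finset.univ.erase c, κ.circleVar x.1 ^ n' x =
              ∏ x ∈ Finset.univ.erase c, κ.circleVar x.1 ^ n x :=
            Finset.prod_congr rfl fun x hx => by
              rw [show n' x = n x from Function.update_of_ne (Finset.ne_of_mem_erase hx) _ _]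
          rw [this, show n' c = n c - 2 from Function.update_self _ _ _, ← mul_assoc, ← pow_add]
          congr 2
          omega
        rw [hprod]
        -- The remaining product has degree N - 2, and a linear factor raises it to at most N - 1,
        -- so that the induction hypothesis covers every term.
        have key : ∀ a ∈ F.linMod κ, a * ∏ c, κ.circleVar c.1 ^ n' c ∈ T := by
          intro a ha
          refine Submodule.span_induction ?_ ?_ ?_ ?_ ha
          · rintro _ (rfl | ⟨d, rfl⟩)
            · rw [one_mul]
              exact ih _ (by omega) n' rfl
            · have : κ.circleVar d.1 * ∏ c, κ.circleVar c.1 ^ n' c =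
                  ∏ c : D.closedComponents, κ.circleVar c.1 ^ (n' + (Pi.single d 1 : D.closedComponents → ℕ)) c := by
                rw [← Finset.mul_prod_erase _ _ (Finset.mem_univ d),
                  ← Finset.mul_prod_erase _ (fun c : D.closedComponents =>
                    κ.circleVar c.1 ^ (n' + (Pi.single d 1 : D.closedComponents → ℕ)) c)
                    (Finset.mem_univ d)]
                have h1 : ∏ x ∈ Finset.univ.erase d, κ.circleVar x.1 ^ (n' + (Pi.single d 1 : D.closedComponents → ℕ)) x =
                    ∏ x ∈ Finset.univ.erase d, κ.circleVar x.1 ^ n' x :=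
                  Finset.prod_congr rfl fun x hx => by
                    rw [Pi.add_apply, Pi.single_eq_of_ne (Finset.ne_of_mem_erase hx), add_zero]
                rw [h1, Pi.add_apply, Pi.single_eq_same, pow_succ]
                ring
              change κ.circleVar d.1 * _ ∈ T
              rw [this]
              refine ih (∑ c, n' c + 1) (by omega) _ ?_
              simp only [Pi.add_apply, Finset.sum_add_distrib, Finset.sum_pi_single',
                Finset.mem_univ, if_true]
          · rw [zero_mul]; exact T.zero_mem
          · intro a b _ _ ha hb; rw [add_mul]; exact T.add_mem ha hb
          · intro s a _ ha
            rw [smul_mul_assoc]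
            exact T.smul_mem _ ha
        exact key _ (F.circleVar_sq_mem_linMod κ c)
  rw [eq_top_iff]
  intro a _
  have ha : a ∈ Algebra.adjoin F.betaAlg
      (Set.range fun c : D.closedComponents => κ.circleVar c.1) := by
    rw [F.adjoin_circleVar κ hL]; trivial
  rw [Algebra.adjoin_range_eq_range_aeval] at ha
  obtain ⟨p, rfl⟩ := ha
  change MvPolynomial.aeval _ p ∈ T
  rw [MvPolynomial.aeval_def, MvPolynomial.eval₂_eq']
  refine Submodule.sum_mem _ fun d _ => ?_
  rw [← Algebra.smul_def]
  exact T.smul_mem _ (hmon _ d rfl)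

/-- The monomials in the eliminating entries times the products of circle variables. -/
def mon (i : (F.Arc →₀ ℕ) × (D.closedComponents → Fin 2)) : D.ReducedRing :=
  (∏ j, F.beta j ^ i.1 j) * circleMon κ i.2

theorem beta_mul_mon (j : F.Arc) (i : (F.Arc →₀ ℕ) × (D.closedComponents → Fin 2)) :
    F.beta j * F.mon κ i = F.mon κ (i.1 + Finsupp.single j 1, i.2) := by
  rw [mon, mon, ← mul_assoc]
  congr 1
  dsimp only
  rw [← Finset.mul_prod_erase _ _ (Finset.mem_univ j),
    ← Finset.mul_prod_erase _ (fun l => F.beta l ^ (i.1 + Finsupp.single j 1 : F.Arc →₀ ℕ) l)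
      (Finset.mem_univ j)]
  have h1 : ∏ x ∈ Finset.univ.erase j, F.beta x ^ (i.1 + Finsupp.single j 1 : F.Arc →₀ ℕ) x =
      ∏ x ∈ Finset.univ.erase j, F.beta x ^ i.1 x :=
    Finset.prod_congr rfl fun x hx => by
      rw [Finsupp.add_apply, Finsupp.single_eq_of_ne (Finset.ne_of_mem_erase hx), add_zero]
  rw [h1, Finsupp.add_apply, Finsupp.single_eq_same, pow_succ]
  ring

theorem span_mon (hL : D.Linked) : Submodule.span BoundaryRing (Set.range (F.mon κ)) = ⊤ := by
  set T := Submodule.span BoundaryRing (Set.range (F.mon κ)) with hT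
  have hbeta : ∀ j, ∀ t ∈ T, F.beta j * t ∈ T := by
    intro j t ht
    refine Submodule.span_induction ?_ ?_ ?_ ?_ ht
    · rintro _ ⟨i, rfl⟩
      rw [beta_mul_mon]
      exact Submodule.subset_span ⟨_, rfl⟩
    · rw [mul_zero]; exact T.zero_mem
    · intro a b _ _ ha hb; rw [mul_add]; exact T.add_mem ha hb
    · intro s a _ ha; rw [mul_smul_comm]; exact T.smul_mem _ ha
  have halg : ∀ s ∈ F.betaAlg, ∀ t ∈ T, s * t ∈ T := by
    intro s hs
    refine Algebra.adjoin_induction (p := fun s _ => ∀ t ∈ T, s * t ∈ T) ?_ ?_ ?_ ?_ hs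
    · rintro _ ⟨j, rfl⟩
      exact hbeta j
    · intro r t ht
      rw [← Algebra.smul_def]
      exact T.smul_mem _ ht
    · intro a b _ _ ha hb t ht
      rw [add_mul]; exact T.add_mem (ha t ht) (hb t ht)
    · intro a b _ _ ha hb t ht
      rw [mul_assoc]; exact ha _ (hb t ht)
  rw [eq_top_iff]
  intro a _
  have ha : a ∈ Submodule.span F.betaAlg (Set.range (circleMon (D := D) κ)) := by
    rw [F.span_circleMon κ hL]; trivial
  refine Submodule.span_induction ?_ T.zero_mem (fun _ _ _ _ => T.add_mem) ?_ ha
  · rintro _ ⟨ε, rfl⟩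
    refine Submodule.subset_span ⟨(0, ε), ?_⟩
    simp [mon]
  · intro s a _ ha
    exact halg s s.2 a ha

end Frame

end Crossingless

/-! ### Linear independence of the monomials, by counting degrees. -/

namespace Crossingless

open Gluing

variable {V : Type*} [Fintype V] {D : Crossingless V}

/-- There are |V| + 3 regions, two of which have their variables set to zero, and H is one further
variable. The total |V| + 2 equals the three boundary variables plus one for each arc other than the
root, as the comparison of Hilbert series requires. -/
theorem _root_.Delooping.Gluing.card_free_add_one {G : Gluing V} (κ : G.Colouring)
    (hP : G.Planar) : Nat.card (Option G.FreeRegion) = Fintype.card V + 2 := by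
  classical
  have : Fintype G.Region := Fintype.ofFinite _
  have hne : G.openRegion Dir.top ≠ G.openRegion Dir.left := by
    intro h
    have h1 := κ.col_left
    rw [← h, κ.col_top] at h1
    exact absurd h1 (by decide)
  rw [Planar, Nat.card_eq_fintype_card] at hP
  rw [Nat.card_eq_fintype_card, Fintype.card_option, Fintype.card_subtype]
  have : (Finset.univ.filter fun i => i ≠ G.openRegion Dir.top ∧ i ≠ G.openRegion Dir.left) =
      (Finset.univ.erase (G.openRegion Dir.top)).erase (G.openRegion Dir.left) := by
    ext i; simp [and_comm]
  rw [this, Finset.card_erase_of_mem (by simp [hne.symm]), Finset.card_erase_of_mem (by simp),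
    Finset.card_univ, hP]
  rfl

namespace Frame

variable [DecidableEq V] (F : D.Frame) (κ : D.toGluing.Colouring)

/-- The polynomial degree of a monomial. -/
def monDeg (i : (F.Arc →₀ ℕ) × (D.closedComponents → Fin 2)) : ℕ :=
  ∑ j, F.betaDeg j * i.1 j + ∑ c, (i.2 c : ℕ)

theorem circleMon_mem (ε : D.closedComponents → Fin 2) :
    circleMon κ ε ∈ D.redHomogeneous (∑ c, (ε c : ℕ)) := by
  refine redHomogeneous_prod _ _ _ fun c _ => ?_
  have := redHomogeneous_pow (κ.edgeVar_mem (D.rep c.1)) (ε c : ℕ)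
  rwa [one_mul] at this

theorem mon_mem (i : (F.Arc →₀ ℕ) × (D.closedComponents → Fin 2)) :
    F.mon κ i ∈ D.redHomogeneous (F.monDeg i) :=
  redHomogeneous_mul (redHomogeneous_prod _ _ _ fun j _ => redHomogeneous_pow (F.beta_mem j) _)
    (circleMon_mem κ i.2)

/-- The exponents of all variables. -/
abbrev Index := (Fin 3 →₀ ℕ) × (F.Arc →₀ ℕ) × (D.closedComponents → Fin 2)

/-- The expansion of coefficients in the boundary ring into monomials. -/
def expand : (F.Index →₀ ZMod 2) →+
    ((F.Arc →₀ ℕ) × (D.closedComponents → Fin 2) →₀ BoundaryRing) :=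
  Finsupp.liftAddHom fun i => (Finsupp.singleAddHom i.2).comp
    (BoundaryRing.equiv.symm.toAddMonoidHom.comp
      (MvPolynomial.monomial (R := ZMod 2) i.1).toAddMonoidHom)

theorem expand_single (i : F.Index) (c : ZMod 2) : F.expand (Finsupp.single i c) =
    Finsupp.single i.2 (BoundaryRing.equiv.symm (MvPolynomial.monomial i.1 c)) := by
  rw [expand, Finsupp.liftAddHom_apply_single]; rfl

theorem expand_surjective : Function.Surjective F.expand := by
  intro u
  induction u using Finsupp.induction_linear with
  | zero => exact ⟨0, map_zero _⟩
  | add u w hu hw =>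
    obtain ⟨p, rfl⟩ := hu
    obtain ⟨q, rfl⟩ := hw
    exact ⟨p + q, map_add _ _ _⟩
  | single i s =>
    rw [← BoundaryRing.equiv.symm_apply_apply s]
    induction BoundaryRing.equiv s using MvPolynomial.induction_on' with
    | monomial n a => exact ⟨_, F.expand_single (n, i) a⟩
    | add p q hp hq =>
      obtain ⟨p', hp'⟩ := hp
      obtain ⟨q', hq'⟩ := hq
      exact ⟨p' + q', by rw [map_add, hp', hq', map_add, Finsupp.single_add]⟩

/-- The evaluation of a combination of monomials in the free polynomial ring. -/
def evalMon : (F.Index →₀ ZMod 2) →ₗ[ZMod 2] D.FreePoly :=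
  D.polyEquiv.toLinearMap ∘ₗ AddMonoidHom.toZModLinearMap 2
    ((Finsupp.linearCombination BoundaryRing (F.mon κ)).toAddMonoidHom.comp F.expand)

theorem evalMon_apply (u : F.Index →₀ ZMod 2) : F.evalMon κ u =
    D.polyEquiv (Finsupp.linearCombination BoundaryRing (F.mon κ) (F.expand u)) := rfl

/-- The total degree of a monomial. -/
def indexDeg (i : F.Index) : ℕ := i.1.degree + F.monDeg i.2

theorem evalMon_single (i : F.Index) : F.evalMon κ (Finsupp.single i 1) =
    D.polyEquiv (BoundaryRing.equiv.symm (MvPolynomial.monomial i.1 1) • F.mon κ i.2) := by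
  rw [evalMon_apply, expand_single, Finsupp.linearCombination_single]

theorem isHomogeneous_monomial (n : Fin 3 →₀ ℕ) :
    (BoundaryRing.equiv (BoundaryRing.equiv.symm (MvPolynomial.monomial n 1))).IsHomogeneous
      n.degree := by
  rw [RingEquiv.apply_symm_apply]
  exact MvPolynomial.isHomogeneous_monomial _ rfl

theorem isHomogeneous_evalMon (i : F.Index) :
    (F.evalMon κ (Finsupp.single i 1)).IsHomogeneous (F.indexDeg i) := by
  rw [evalMon_single, ← mem_redHomogeneous_iff]
  exact D.smul_mem_redHomogeneous (isHomogeneous_monomial _) (F.mon_mem κ _)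

variable {κ} in
theorem evalMon_surjective (hL : D.Linked) : Function.Surjective (F.evalMon κ) := by
  have h : Function.Surjective (Finsupp.linearCombination BoundaryRing (F.mon κ)) := by
    rw [← LinearMap.range_eq_top, Finsupp.range_linearCombination, F.span_mon κ hL]
  exact D.polyEquiv.surjective.comp (h.comp F.expand_surjective)

variable {κ} in
theorem evalMon_injective (hL : D.Linked) (hP : D.Planar) : Function.Injective (F.evalMon κ) := by
  have hcard : Nat.card (Option D.FreeRegion) = Nat.card (Fin 3 ⊕ F.Arc) := by
    rw [card_free_add_one κ hP, Nat.card_sum, Nat.card_fin, Nat.card_eq_fintype_card,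
      Fintype.card_subtype_compl, Fintype.card_subtype_eq]
    have : 0 < Fintype.card V := Fintype.card_pos_iff.mpr ⟨F.root⟩
    omega
  have : Finite (Option D.FreeRegion) := inferInstance
  have : Fintype (Option D.FreeRegion) := Fintype.ofFinite _
  let σ : Option D.FreeRegion ≃ Fin 3 ⊕ F.Arc := Fintype.equivOfCardEq (by
    rwa [Nat.card_eq_fintype_card, Nat.card_eq_fintype_card] at hcard)
  -- An arbitrary matching of tree arcs with closed components; only the equality of the numbers
  -- matters.
  let θ : F.tree ≃ D.closedComponents := Fintype.equivOfCardEq (by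
    rw [Fintype.card_coe, F.card_tree κ, Nat.card_eq_fintype_card])
  -- Division by 2 with remainder, n = 2q + ε: the power q of a quadratic entry and the exponent ε
  -- of the matched circle variable are encoded in the exponent of one linear variable. This is
  -- injective and preserves the degree.
  let τ' : F.Index → Fin 3 ⊕ F.Arc → ℕ := fun i => Sum.elim i.1 fun j =>
    if h : j.1 ∈ F.tree then 2 * i.2.1 j + (i.2.2 (θ ⟨j.1, h⟩) : ℕ) else i.2.1 j
  let τ : F.Index → Option D.FreeRegion →₀ ℕ := fun i =>
    Finsupp.equivFunOnFinite.symm (τ' i ∘ σ)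
  refine injective_of_surjective_of_isHomogeneous F.indexDeg (F.evalMon κ)
    (F.isHomogeneous_evalMon κ) (F.evalMon_surjective hL) τ ?_ ?_
  · intro i i' h
    have h' : τ' i = τ' i' := by
      have := Finsupp.equivFunOnFinite.symm.injective h
      exact σ.surjective.injective_comp_right this
    have h1 : i.1 = i'.1 := Finsupp.ext fun a => congrFun h' (Sum.inl a)
    have h2 : ∀ j : F.Arc, (if h : j.1 ∈ F.tree then 2 * i.2.1 j + (i.2.2 (θ ⟨j.1, h⟩) : ℕ)
        else i.2.1 j) = (if h : j.1 ∈ F.tree then 2 * i'.2.1 j + (i'.2.2 (θ ⟨j.1, h⟩) : ℕ)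
        else i'.2.1 j) := fun j => congrFun h' (Sum.inr j)
    have h3 : i.2.1 = i'.2.1 := by
      ext j
      have := h2 j
      split_ifs at this with ht
      · have := (i.2.2 (θ ⟨j.1, ht⟩)).2
        have := (i'.2.2 (θ ⟨j.1, ht⟩)).2
        omega
      · exact this
    have h4 : i.2.2 = i'.2.2 := by
      ext c
      obtain ⟨⟨a, ha⟩, rfl⟩ := θ.surjective c
      have := h2 ⟨a, fun h => F.root_notMem (h ▸ ha)⟩
      rw [dif_pos ha, dif_pos ha, h3] at this
      exact Nat.add_left_cancel this
    exact Prod.ext h1 (Prod.ext h3 h4)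
  · intro i
    rw [Finsupp.degree_eq_sum]
    have : ∀ x, τ i x = τ' i (σ x) := fun x => rfl
    simp only [this]
    rw [Equiv.sum_comp σ (τ' i), Fintype.sum_sum_type, indexDeg, Finsupp.degree_eq_sum, monDeg]
    congr 1
    have hsplit : ∀ j : F.Arc, τ' i (Sum.inr j) = F.betaDeg j * i.2.1 j +
        if h : j.1 ∈ F.tree then (i.2.2 (θ ⟨j.1, h⟩) : ℕ) else 0 := by
      intro j
      simp only [τ', Sum.elim_inr, betaDeg]
      split_ifs <;> ring
    rw [Finset.sum_congr rfl fun j _ => hsplit j, Finset.sum_add_distrib]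
    congr 1
    rw [← Equiv.sum_comp θ]
    symm
    refine Finset.sum_of_injOn (fun a : F.tree => (⟨a.1, fun h => F.root_notMem (h ▸ a.2)⟩ : F.Arc))
      ?_ ?_ ?_ ?_
    · intro a _ b _ h
      exact Subtype.ext (congrArg (fun x : F.Arc => x.1) h)
    · intro a _; simp
    · intro j _ hj
      rw [dif_neg]
      intro h
      exact hj ⟨⟨j.1, h⟩, by simp, rfl⟩
    · intro a _
      rw [dif_pos a.2]

/-- The reduced edge ring is free over the boundary ring. -/
def basis (hL : D.Linked) (hP : D.Planar) :
    Module.Basis ((F.Arc →₀ ℕ) × (D.closedComponents → Fin 2)) BoundaryRing D.ReducedRing :=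
  Module.Basis.mk (v := F.mon κ) (by
    rw [LinearIndependent]
    intro u w h
    obtain ⟨u, rfl⟩ := F.expand_surjective u
    obtain ⟨w, rfl⟩ := F.expand_surjective w
    exact congrArg _ (F.evalMon_injective (κ := κ) hL hP (congrArg D.polyEquiv h)))
    (F.span_mon κ hL).ge

theorem basis_apply (hL : D.Linked) (hP : D.Planar)
    (i : (F.Arc →₀ ℕ) × (D.closedComponents → Fin 2)) : F.basis κ hL hP i = F.mon κ i :=
  Module.Basis.mk_apply _ _ _

/-- Homogeneous elements are sums of homogeneous multiples of monomials. -/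
theorem mem_closure_of_homogeneous (hL : D.Linked) {a : D.ReducedRing} {k : ℕ}
    (ha : a ∈ D.redHomogeneous k) :
    a ∈ AddSubgroup.closure {b | ∃ (s : BoundaryRing) (l : ℕ) (i : _),
      (BoundaryRing.equiv s).IsHomogeneous l ∧ l + F.monDeg i = k ∧ b = s • F.mon κ i} := by
  obtain ⟨u, hu⟩ := F.evalMon_surjective (κ := κ) hL (D.polyEquiv a)
  rw [mem_redHomogeneous_iff] at ha
  have h1 : D.polyEquiv a =
      u.sum fun i c => c • MvPolynomial.homogeneousComponent k (F.evalMon κ (Finsupp.single i 1)) := by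
    rw [← MvPolynomial.homogeneousComponent_eq_self ha, ← hu]
    conv_lhs => rw [← Finsupp.sum_single u]
    rw [Finsupp.sum, map_sum, map_sum, Finsupp.sum]
    refine Finset.sum_congr rfl fun i _ => ?_
    rw [← map_smul, ← map_smul, Finsupp.smul_single, smul_eq_mul, mul_one]
  have h2 := congrArg D.polyEquiv.symm h1
  rw [AlgEquiv.symm_apply_apply, Finsupp.sum, map_sum] at h2
  rw [h2]
  refine AddSubgroup.sum_mem _ fun i _ => ?_
  rw [map_smul]
  have hmem : D.polyEquiv.symm (MvPolynomial.homogeneousComponent k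
      (F.evalMon κ (Finsupp.single i 1))) ∈
      AddSubgroup.closure {b | ∃ (s : BoundaryRing) (l : ℕ) (i : _),
      (BoundaryRing.equiv s).IsHomogeneous l ∧ l + F.monDeg i = k ∧ b = s • F.mon κ i} := by
    rw [MvPolynomial.homogeneousComponent_of_mem (F.isHomogeneous_evalMon κ i)]
    split_ifs with h
    · rw [evalMon_single, AlgEquiv.symm_apply_apply]
      exact AddSubgroup.subset_closure ⟨_, _, _, isHomogeneous_monomial _, h.symm, rfl⟩
    · rw [map_zero]; exact AddSubgroup.zero_mem _
  generalize u i = c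
  fin_cases c
  · change (0 : ZMod 2) • _ ∈ _
    rw [zero_smul]; exact AddSubgroup.zero_mem _
  · change (1 : ZMod 2) • _ ∈ _
    rw [one_smul]; exact hmem

end Frame

end Crossingless

/-! ## Successive cancellation -/

section Cancellation

variable {A ι : Type*} [Ring A]

/-- A homotopy `h` from the identity to a projection, related to the simpler projection `E`. -/
structure Contracts (d h E : A) : Prop where
  sq : h * h = 0
  mul_d_mul : h * d * h = h
  proj_mul : E * h = 0
  mul_proj : h * E = 0
  idem : E * E = E
  proj_d : E * d * E = E * d
  homotopy : (1 - d * h - h * d) * E = 1 - d * h - h * d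

namespace Contracts

variable {d h E : A}

theorem proj_d_mul (H : Contracts d h E) : E * d * h = 0 := by
  rw [← H.proj_d, mul_assoc, H.proj_mul, mul_zero]

theorem proj_mul_homotopy (H : Contracts d h E) : E * (1 - d * h - h * d) = E := by
  have h1 := H.proj_d_mul
  have h2 := H.proj_mul
  rw [mul_sub, mul_sub, mul_one, ← mul_assoc, h1, ← mul_assoc, h2]
  simp

theorem mul_homotopy (H : Contracts d h E) : h * (1 - d * h - h * d) = 0 := by
  rw [mul_sub, mul_sub, mul_one, ← mul_assoc, H.mul_d_mul, ← mul_assoc, H.sq]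
  simp

theorem homotopy_mul (H : Contracts d h E) : (1 - d * h - h * d) * h = 0 := by
  rw [sub_mul, sub_mul, one_mul, mul_assoc, H.sq, H.mul_d_mul]
  simp

/-- The square of `d` need not vanish; it is enough that it is central, as the potential is. -/
theorem commute_d (hd : ∀ a, d * d * a = a * (d * d)) :
    (1 - d * h - h * d) * d = d * (1 - d * h - h * d) := by
  have := hd h
  simp only [sub_mul, mul_sub, one_mul, mul_one, mul_assoc] at this ⊢
  rw [this]
  abel

end Contracts

theorem contracts_zero (d : A) : Contracts d 0 1 := by
  constructor <;> simp

/-- The homotopy `X` of the second contraction is transported to the retract left over by the first,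
where the projection π = 1 - dh - hd takes the place of `E`. The two projections have the same
kernel (πE = π and Eπ = E), so identities for `X` and `E'`, which commute with `E` as far as needed,
carry over. -/
theorem Contracts.step {d h E X E' : A} (hd : ∀ a, d * d * a = a * (d * d))
    (H : Contracts d h E) (H' : Contracts d X E') (hE : E * E' = E' * E) (hX : E * X = X * E) :
    Contracts d (h + (1 - d * h - h * d) * X * E) (E' * E) := by
  set π := 1 - d * h - h * d with hπ
  have e1 : E * π = E := H.proj_mul_homotopy
  have e2 : h * π = 0 := H.mul_homotopy
  have e3 : π * h = 0 := H.homotopy_mul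
  have e4 : π * d = d * π := Contracts.commute_d hd
  have e5 : π * E = π := H.homotopy
  have h1 := H.proj_mul
  have h2 := H.mul_proj
  have h3 := H.idem
  have h4 := H.proj_d
  have h5 := H.proj_d_mul
  have s1 := H.sq
  have s2 := H.mul_d_mul
  have x1 := H'.sq
  have x2 := H'.mul_d_mul
  have x3 := H'.proj_mul
  have x4 := H'.mul_proj
  have x5 := H'.idem
  have x6 := H'.proj_d
  have x7 := H'.homotopy
  -- The last factor `E` is redundant: it moves past `X` and is absorbed by π.
  have hXE : π * X * E = π * X := by rw [mul_assoc, ← hX, ← mul_assoc, e5]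
  rw [hXE]
  have eXh : π * X * h = 0 := by rw [← hXE, mul_assoc, h1, mul_zero]
  have eXπ : π * X * π = π * X := by
    rw [← hXE, mul_assoc, e1]
  have eXd : π * X * d * h = 0 := by
    rw [← hXE]
    calc π * X * E * d * h = π * X * (E * d * h) := by simp only [mul_assoc]
      _ = 0 := by rw [h5, mul_zero]
  constructor
  · calc (h + π * X) * (h + π * X) = h * h + h * π * X + π * X * h + π * X * π * X := by
          noncomm_ring
      _ = 0 := by rw [s1, e2, eXh, eXπ, mul_assoc, x1]; simp
  · calc (h + π * X) * d * (h + π * X)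
        = h * d * h + h * (d * π) * X + π * X * d * h + π * X * (d * π) * X := by noncomm_ring
      _ = h + h * π * d * X + 0 + π * X * π * d * X := by
          rw [s2, ← e4, eXd]; noncomm_ring
      _ = h + π * (X * d * X) := by rw [e2, eXπ]; noncomm_ring
      _ = h + π * X := by rw [x2]
  · calc E' * E * (h + π * X) = E' * (E * h) + E' * (E * π) * X := by noncomm_ring
      _ = 0 := by rw [h1, e1, mul_assoc, hX, mul_zero, zero_add, ← mul_assoc, x3, zero_mul]
  · calc (h + π * X) * (E' * E) = h * (E' * E) + π * (X * E') * E := by noncomm_ring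
      _ = 0 := by rw [← hE, ← mul_assoc, h2, x4]; simp
  · calc E' * E * (E' * E) = E' * (E * E') * E := by noncomm_ring
      _ = E' * E' * (E * E) := by rw [hE]; noncomm_ring
      _ = E' * E := by rw [x5, h3]
  · have : E' * E * d * (E' * E) = E * (E' * d * E') * E := by
      calc E' * E * d * (E' * E) = E' * (E * d) * (E * E') := by rw [hE]; noncomm_ring
        _ = E' * (E * d * E) * E' := by noncomm_ring
        _ = (E' * E) * d * E' := by rw [h4]; noncomm_ring
        _ = E * (E' * d * E') := by rw [← hE]; noncomm_ring
        _ = E * (E' * d) := by rw [x6]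
        _ = E' * (E * d) := by rw [← mul_assoc, hE]; noncomm_ring
        _ = E' * (E * d * E) := by rw [h4]
        _ = E * (E' * d) * E := by rw [← mul_assoc, ← mul_assoc, ← mul_assoc, hE]
        _ = E * (E' * d * E') * E := by rw [x6]
    rw [this, x6]
    calc E * (E' * d) * E = E' * (E * d * E) := by
          rw [← mul_assoc, hE]; noncomm_ring
      _ = E' * E * d := by rw [h4]; noncomm_ring
  · have hπ' : 1 - d * (h + π * X) - (h + π * X) * d = π * (1 - d * X - X * d) := by
      calc 1 - d * (h + π * X) - (h + π * X) * d = (1 - d * h - h * d) - d * π * X - π * X * d := by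
            noncomm_ring
        _ = π - π * d * X - π * X * d := by rw [← hπ, e4]
        _ = _ := by noncomm_ring
    rw [hπ', ← mul_assoc, mul_assoc π, x7]
    have eXdE : π * X * d * E = π * X * d := by
      calc π * X * d * E = π * X * E * d * E := by rw [hXE]
        _ = π * X * (E * d * E) := by noncomm_ring
        _ = π * X * E * d := by rw [h4]; noncomm_ring
        _ = π * X * d := by rw [hXE]
    calc π * (1 - d * X - X * d) * E = π * E - π * d * X * E - π * X * d * E := by noncomm_ring
      _ = π - d * (π * X * E) - π * X * d := by rw [e5, e4, eXdE]; noncomm_ring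
      _ = π - π * d * X - π * X * d := by rw [hXE, e4]; noncomm_ring
      _ = _ := by noncomm_ring

/-- Successive cancellation. -/
theorem exists_contracts {d : A} (hd : ∀ a, d * d * a = a * (d * d)) (X E : ι → A)
    (deg : ℤ → AddSubgroup A) (hone : 1 ∈ deg 0)
    (hmul : ∀ {m n : ℤ} {a b : A}, a ∈ deg m → b ∈ deg n → a * b ∈ deg (m + n))
    (hdeg : d ∈ deg (-3)) (l : List ι) (hl : l.Nodup)
    (H : ∀ j ∈ l, Contracts d (X j) (E j)) (hX : ∀ j ∈ l, X j ∈ deg 3) (hE : ∀ j ∈ l, E j ∈ deg 0)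
    (hEE : ∀ i ∈ l, ∀ j ∈ l, E i * E j = E j * E i)
    (hEX : ∀ i ∈ l, ∀ j ∈ l, i ≠ j → E i * X j = X j * E i) :
    ∃ h ∈ deg 3, Contracts d h (l.map E).prod := by
  -- The induction also needs the degree of the product of the projections, which occurs as a factor
  -- in the new homotopy.
  suffices ∃ h ∈ deg 3, Contracts d h (l.map E).prod ∧ (l.map E).prod ∈ deg 0 by
    obtain ⟨h, h1, h2, -⟩ := this
    exact ⟨h, h1, h2⟩
  induction l with
  | nil => exact ⟨0, (deg 3).zero_mem, by simpa using contracts_zero d, by simpa using hone⟩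
  | cons j l ih =>
    obtain ⟨hj, hl⟩ := List.nodup_cons.mp hl
    simp only [List.mem_cons, forall_eq_or_imp] at H hX hE hEE hEX
    obtain ⟨h, h3, hc, h0⟩ := ih hl H.2 hX.2 hE.2 (fun i hi => (hEE.2 i hi).2)
      (fun i hi => (hEX.2 i hi).2)
    rw [List.map_cons, List.prod_cons]
    refine ⟨_, ?_, hc.step hd H.1 ?_ ?_, ?_⟩
    · refine (deg 3).add_mem h3 ?_
      have hπ : 1 - d * h - h * d ∈ deg 0 :=
        (deg 0).sub_mem ((deg 0).sub_mem hone (by simpa using hmul hdeg h3))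
          (by simpa using hmul h3 hdeg)
      simpa using hmul (hmul hπ hX.1) h0
    · refine (Commute.list_prod_left _ _ fun a ha => ?_ : Commute (l.map E).prod (E j))
      obtain ⟨i, hi, rfl⟩ := List.mem_map.mp ha
      exact (hEE.1.2 i hi).symm
    · refine (Commute.list_prod_left _ _ fun a ha => ?_ : Commute (l.map E).prod (X j))
      obtain ⟨i, hi, rfl⟩ := List.mem_map.mp ha
      exact (hEX.2 i hi).1 (fun h => hj (h ▸ hi))
    · simpa using hmul hE.1 h0

end Cancellation

/-! ## Cancellation in tensor products of two-term factorizations -/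

namespace Crossingless

variable {V : Type*} [DecidableEq V] (G : Gluing V)

theorem localMap_apply (v : V) (α β : G.ReducedRing) (m : TensorModule G) (s : V → Bool) :
    localMap G v α β m s = (if s v then β else α) * m (Function.update s v (!s v)) := rfl

/-- The partial homotopy that cancels the factor of `v`, given by a partial inverse `δ` of the
entry that lands in the copy `τ`. -/
def cancelHtpy (v : V) (τ : Bool) (δ : Module.End BoundaryRing G.ReducedRing) :
    Module.End BoundaryRing (TensorModule G) :=
  LinearMap.pi fun s => if s v = τ then 0 else δ ∘ₗ LinearMap.proj (Function.update s v τ)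

/-- The projection to the cokernel of the entry `b` that lands in the copy `τ`. -/
def cancelProj (v : V) (τ : Bool) (e : Module.End BoundaryRing G.ReducedRing) :
    Module.End BoundaryRing (TensorModule G) :=
  LinearMap.pi fun s => if s v = τ then e ∘ₗ LinearMap.proj s else 0

theorem cancelHtpy_apply (v : V) (τ : Bool) (δ : Module.End BoundaryRing G.ReducedRing)
    (m : TensorModule G) (s : V → Bool) :
    cancelHtpy G v τ δ m s = if s v = τ then 0 else δ (m (Function.update s v τ)) := by
  rw [cancelHtpy, LinearMap.pi_apply]
  split_ifs <;> rfl

theorem cancelProj_apply (v : V) (τ : Bool) (e : Module.End BoundaryRing G.ReducedRing)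
    (m : TensorModule G) (s : V → Bool) :
    cancelProj G v τ e m s = if s v = τ then e (m s) else 0 := by
  rw [cancelProj, LinearMap.pi_apply]
  split_ifs <;> rfl

variable [Fintype V]

/-- The differential of a tensor product of two-term factorizations. -/
def koszul (a b : V → G.ReducedRing) : Module.End BoundaryRing (TensorModule G) :=
  ∑ v, localMap G v (a v) (b v)

theorem koszul_apply (a b : V → G.ReducedRing) (m : TensorModule G) (s : V → Bool) :
    koszul G a b m s =
      ∑ v, (if s v then b v else a v) * m (Function.update s v (!s v)) := by
  rw [koszul, LinearMap.sum_apply, Finset.sum_apply]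
  rfl

theorem koszul_erase (a b : V → G.ReducedRing) (v : V) (m : TensorModule G) (s : V → Bool) :
    koszul G a b m s = (if s v then b v else a v) * m (Function.update s v (!s v)) +
      ∑ u ∈ Finset.univ.erase v,
        (if s u then b u else a u) * m (Function.update s u (!s u)) := by
  rw [koszul_apply]
  exact (Finset.add_sum_erase _ _ (Finset.mem_univ v)).symm

variable {G}

/-- Gaussian elimination of the entry `c` in one tensor factor. The map `δ` is a left inverse of
multiplication by `c` and `e` is the remainder of division; neither needs to be linear over the
whole edge ring, because `δ` is moved past another entry only on multiples of `c`. -/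
theorem contracts_koszul {a b : V → G.ReducedRing} {v : V} {τ : Bool} {c : G.ReducedRing}
    (hc : c = if τ then b v else a v) {δ e : Module.End BoundaryRing G.ReducedRing}
    (hδ : ∀ r, δ (c * r) = r) (he : ∀ r, e r = r - c * δ r) :
    Contracts (koszul G a b) (cancelHtpy G v τ δ) (cancelProj G v τ e) := by
  have hδe : ∀ r, δ (e r) = 0 := fun r => by rw [he, map_sub, hδ, sub_self]
  have hec : ∀ r, e (c * r) = 0 := fun r => by rw [he, hδ, sub_self]
  have hee : ∀ r, e (e r) = e r := fun r => by rw [he (e r), hδe, mul_zero, sub_zero]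
  have hb : ∀ {t : Bool}, t ≠ τ → (!t) = τ := by intro t; cases t <;> cases τ <;> decide
  have hb' : ∀ {t : Bool}, t ≠ τ → t = !τ := by intro t; cases t <;> cases τ <;> decide
  have hne : (!τ) ≠ τ := by cases τ <;> decide
  have hXu : ∀ (m : TensorModule G) (s : V → Bool) (u : V), u ≠ v → s v = τ →
      cancelHtpy G v τ δ m (Function.update s u (!s u)) = 0 := by
    intro m s u hu hs
    rw [cancelHtpy_apply, if_pos]
    rwa [Function.update_of_ne hu.symm]
  constructor
  · refine LinearMap.ext fun m => funext fun s => ?_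
    change cancelHtpy G v τ δ (cancelHtpy G v τ δ m) s = 0
    rw [cancelHtpy_apply]
    split_ifs with h
    · rfl
    · rw [cancelHtpy_apply, if_pos (Function.update_self _ _ _), map_zero]
  · refine LinearMap.ext fun m => funext fun s => ?_
    change cancelHtpy G v τ δ (koszul G a b (cancelHtpy G v τ δ m)) s = _
    rw [cancelHtpy_apply, cancelHtpy_apply]
    split_ifs with h
    · rfl
    · rw [koszul_erase G a b v, Finset.sum_eq_zero, add_zero, Function.update_self,
        Function.update_idem, ← hc, hδ, cancelHtpy_apply, if_neg, Function.update_idem]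
      · rwa [Function.update_self]
      · intro u hu
        rw [hXu _ _ _ (Finset.ne_of_mem_erase hu) (Function.update_self _ _ _), mul_zero]
  · refine LinearMap.ext fun m => funext fun s => ?_
    change cancelProj G v τ e (cancelHtpy G v τ δ m) s = 0
    rw [cancelProj_apply, cancelHtpy_apply]
    split_ifs with h
    · rw [map_zero]
    · rfl
  · refine LinearMap.ext fun m => funext fun s => ?_
    change cancelHtpy G v τ δ (cancelProj G v τ e m) s = 0
    rw [cancelHtpy_apply, cancelProj_apply, if_pos (Function.update_self _ _ _), hδe, ite_self]
  · refine LinearMap.ext fun m => funext fun s => ?_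
    change cancelProj G v τ e (cancelProj G v τ e m) s = _
    rw [cancelProj_apply, cancelProj_apply]
    split_ifs with h
    · rw [hee]
    · rfl
  · refine LinearMap.ext fun m => funext fun s => ?_
    change cancelProj G v τ e (koszul G a b (cancelProj G v τ e m)) s =
      cancelProj G v τ e (koszul G a b m) s
    rw [cancelProj_apply, cancelProj_apply]
    split_ifs with h
    · rw [koszul_erase G a b v, koszul_erase G a b v, map_add, map_add, h, ← hc, hec, hec, zero_add,
        zero_add, map_sum, map_sum]
      refine Finset.sum_congr rfl fun u hu => ?_
      have hu' : Function.update s u (!s u) v = τ := by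
        rwa [Function.update_of_ne (Finset.ne_of_mem_erase hu).symm]
      rw [cancelProj_apply, if_pos hu', he (m _), mul_sub, map_sub, mul_left_comm, hec, sub_zero]
    · rfl
  · refine LinearMap.ext fun m => funext fun s => ?_
    -- It suffices that 1 - dh - hd vanishes on elements with E-part removed. In the copy `τ` the
    -- coordinates of such an element are multiples of `c`, and there `c` can be moved past the
    -- other entries before `δ` divides by it.
    have key : ∀ n : TensorModule G, n = m - cancelProj G v τ e m →
        (n - koszul G a b (cancelHtpy G v τ δ n) - cancelHtpy G v τ δ (koszul G a b n)) s = 0 := by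
      intro n hn
      have hn' : ∀ t, t v = τ → n t = c * δ (n t) := by
        intro t ht
        have h1 : n t = c * δ (m t) := by
          rw [hn, Pi.sub_apply, cancelProj_apply, if_pos ht, he]; ring
        rw [h1, hδ]
      rw [Pi.sub_apply, Pi.sub_apply, koszul_erase G a b v,
        cancelHtpy_apply G v τ δ (koszul G a b n)]
      by_cases h : s v = τ
      · have hx : cancelHtpy G v τ δ n (Function.update s v (!s v)) = δ (n s) := by
          rw [cancelHtpy_apply, Function.update_self, h, if_neg hne, Function.update_idem, ← h,
            Function.update_eq_self]
        rw [if_pos h, Finset.sum_eq_zero fun u hu => by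
            rw [hXu _ _ _ (Finset.ne_of_mem_erase hu) h, mul_zero], hx, h, ← hc, ← hn' s h]
        simp
      · have hx : cancelHtpy G v τ δ n (Function.update s v (!s v)) = 0 := by
          rw [cancelHtpy_apply, Function.update_self, if_pos (hb h)]
        rw [if_neg h, koszul_erase G a b v _ (Function.update s v τ), map_add,
          Function.update_self, ← hc, hδ, hx, mul_zero, zero_add, Function.update_idem,
          ← hb' h, Function.update_eq_self, map_sum]
        have hsum : ∀ u ∈ Finset.univ.erase v, (if s u then b u else a u) *
            cancelHtpy G v τ δ n (Function.update s u (!s u)) =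
            δ ((if Function.update s v τ u then b u else a u) *
              n (Function.update (Function.update s v τ) u (!Function.update s v τ u))) := by
          intro u hu
          have hu := Finset.ne_of_mem_erase hu
          have hu' : Function.update s u (!s u) v ≠ τ := by rwa [Function.update_of_ne hu.symm]
          rw [cancelHtpy_apply, if_neg hu', Function.update_of_ne hu, Function.update_comm hu.symm]
          have hv : Function.update (Function.update s u (!s u)) v τ v = τ :=
            Function.update_self _ _ _
          conv_rhs => rw [hn' _ hv, mul_left_comm, hδ]
        rw [Finset.sum_congr rfl hsum]
        have h2 := G.two_eq_zero
        grind
    have := key _ rfl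
    rw [← sub_eq_zero, ← neg_eq_zero]
    rw [← this]
    simp only [Module.End.mul_apply, LinearMap.sub_apply, Module.End.one_apply, map_sub,
      Pi.sub_apply]
    ring

theorem cancelProj_comm {u v : V} {τ τ' : Bool} {e e' : Module.End BoundaryRing G.ReducedRing}
    (h : e * e' = e' * e) : cancelProj G u τ e * cancelProj G v τ' e' =
      cancelProj G v τ' e' * cancelProj G u τ e := by
  refine LinearMap.ext fun m => funext fun s => ?_
  have h' : ∀ r, e (e' r) = e' (e r) := fun r => LinearMap.congr_fun h r
  change cancelProj G u τ e (cancelProj G v τ' e' m) s =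
    cancelProj G v τ' e' (cancelProj G u τ e m) s
  simp only [cancelProj_apply]
  split_ifs <;> simp [h']

theorem cancelProj_comm_cancelHtpy {u v : V} (huv : u ≠ v) {τ τ' : Bool}
    {e δ : Module.End BoundaryRing G.ReducedRing} (h : e * δ = δ * e) :
    cancelProj G u τ e * cancelHtpy G v τ' δ = cancelHtpy G v τ' δ * cancelProj G u τ e := by
  refine LinearMap.ext fun m => funext fun s => ?_
  have h' : ∀ r, e (δ r) = δ (e r) := fun r => LinearMap.congr_fun h r
  change cancelProj G u τ e (cancelHtpy G v τ' δ m) s =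
    cancelHtpy G v τ' δ (cancelProj G u τ e m) s
  simp only [cancelProj_apply, cancelHtpy_apply, Function.update_of_ne huv]
  split_ifs <;> simp [h']

theorem list_prod_cancelProj {ι : Type*} (f : ι → V) (τ : ι → Bool)
    (e : ι → Module.End BoundaryRing G.ReducedRing) (l : List ι) (m : TensorModule G)
    (s : V → Bool) :
    (l.map fun j => cancelProj G (f j) (τ j) (e j)).prod m s =
      if ∀ j ∈ l, s (f j) = τ j then (l.map e).prod (m s) else 0 := by
  induction l with
  | nil => simp
  | cons v l ih =>
    simp only [List.map_cons, List.prod_cons, Module.End.mul_apply, cancelProj_apply, ih,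
      List.mem_cons, forall_eq_or_imp]
    split_ifs <;> simp_all

/-! ### The potential -/

variable (G) in
theorem localMap_comm {u v : V} (huv : u ≠ v) (a b a' b' : G.ReducedRing) :
    localMap G u a b ∘ₗ localMap G v a' b' = localMap G v a' b' ∘ₗ localMap G u a b := by
  refine LinearMap.ext fun m => funext fun s => ?_
  simp only [LinearMap.comp_apply, localMap_apply, Function.update_of_ne huv,
    Function.update_of_ne huv.symm]
  rw [Function.update_comm huv, mul_left_comm]

variable (G) in
theorem localMap_localMap (v : V) (a b a' b' : G.ReducedRing) (m : TensorModule G)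
    (s : V → Bool) : localMap G v a b (localMap G v a' b' m) s =
      (if s v then b * a' else a * b') * m s := by
  simp only [localMap_apply, Function.update_self, Function.update_idem, Bool.not_not,
    Function.update_eq_self, ← mul_assoc]
  cases s v <;> simp

theorem sum_mul_self_of_commute {A ι : Type*} [Ring A] (h2 : ∀ a : A, a + a = 0) (f : ι → A)
    (hf : ∀ i j, i ≠ j → f i * f j = f j * f i) (F : Finset ι) :
    (∑ i ∈ F, f i) * ∑ i ∈ F, f i = ∑ i ∈ F, f i * f i := by
  classical
  induction F using Finset.induction_on with
  | empty => simp
  | insert i F hi ih =>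
    have hc : f i * ∑ j ∈ F, f j = (∑ j ∈ F, f j) * f i := by
      rw [Finset.mul_sum, Finset.sum_mul]
      exact Finset.sum_congr rfl fun j hj => hf i j fun h => hi (h ▸ hj)
    rw [Finset.sum_insert hi, Finset.sum_insert hi, add_mul, mul_add, mul_add, ih, hc, add_assoc,
      ← add_assoc ((∑ j ∈ F, f j) * f i), h2, zero_add]

variable (G) in
theorem tensor_add_self (a : Module.End BoundaryRing (TensorModule G)) : a + a = 0 :=
  LinearMap.ext fun _ => funext fun _ => G.add_self _

variable (G) in
theorem koszul_koszul (a b : V → G.ReducedRing) (m : TensorModule G) :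
    koszul G a b (koszul G a b m) = fun s => (∑ v, a v * b v) * m s := by
  have h := sum_mul_self_of_commute (tensor_add_self G) (fun v => localMap G v (a v) (b v))
    (fun u v huv => localMap_comm G huv _ _ _ _) Finset.univ
  have h' := LinearMap.congr_fun h m
  change koszul G a b (koszul G a b m) = _ at h'
  rw [h']
  funext s
  rw [LinearMap.sum_apply, Finset.sum_apply, Finset.sum_mul]
  refine Finset.sum_congr rfl fun v _ => ?_
  change localMap G v _ _ (localMap G v _ _ m) s = _
  rw [localMap_localMap, mul_comm (b v), ite_self]

/-! ### Gradings -/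

variable (G) in
/-- The elements of the reduced edge ring of polynomial degree `j / 2`. -/
def piece (j : ℤ) : AddSubgroup G.ReducedRing where
  carrier := {r | r = 0 ∨ ∃ k : ℕ, 2 * (k : ℤ) = j ∧ r ∈ G.redHomogeneous k}
  zero_mem' := Or.inl rfl
  add_mem' := by
    rintro a b (rfl | ⟨k, hk, ha⟩) (rfl | ⟨l, hl, hb⟩)
    · exact Or.inl (add_zero 0)
    · exact Or.inr ⟨l, hl, by rwa [zero_add]⟩
    · exact Or.inr ⟨k, hk, by rwa [add_zero]⟩
    · obtain rfl : k = l := by omega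
      exact Or.inr ⟨k, hk, Gluing.redHomogeneous_add ha hb⟩
  neg_mem' := by
    intro a ha
    rwa [G.neg_eq]

theorem mem_piece {k : ℕ} {r : G.ReducedRing} (hr : r ∈ G.redHomogeneous k) {j : ℤ}
    (hj : 2 * (k : ℤ) = j) : r ∈ piece G j := Or.inr ⟨k, hj, hr⟩

theorem mul_mem_piece {k : ℕ} {a r : G.ReducedRing} (ha : a ∈ G.redHomogeneous k) {i j : ℤ}
    (hr : r ∈ piece G i) (hj : i + 2 * k = j) : a * r ∈ piece G j := by
  obtain rfl | ⟨l, hl, hr⟩ := hr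
  · rw [mul_zero]; exact (piece G j).zero_mem
  · exact mem_piece (Gluing.redHomogeneous_mul ha hr) (by push_cast; omega)

/-- The elements of the boundary ring of polynomial degree `j / 2`. -/
def boundaryPiece (j : ℤ) : AddSubgroup BoundaryRing where
  carrier := {r | r = 0 ∨ ∃ k : ℕ, 2 * (k : ℤ) = j ∧ (BoundaryRing.equiv r).IsHomogeneous k}
  zero_mem' := Or.inl rfl
  add_mem' := by
    rintro a b (rfl | ⟨k, hk, ha⟩) (rfl | ⟨l, hl, hb⟩)
    · exact Or.inl (add_zero 0)
    · exact Or.inr ⟨l, hl, by rwa [zero_add]⟩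
    · exact Or.inr ⟨k, hk, by rwa [add_zero]⟩
    · obtain rfl : k = l := by omega
      exact Or.inr ⟨k, hk, by rw [map_add]; exact ha.add hb⟩
  neg_mem' := by
    rintro a (rfl | ⟨k, hk, ha⟩)
    · exact Or.inl neg_zero
    · exact Or.inr ⟨k, hk, by rw [map_neg]; exact ha.neg⟩

theorem mem_boundaryPiece {k : ℕ} {r : BoundaryRing} (hr : (BoundaryRing.equiv r).IsHomogeneous k)
    {j : ℤ} (hj : 2 * (k : ℤ) = j) : r ∈ boundaryPiece j := Or.inr ⟨k, hj, hr⟩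

theorem mul_mem_boundaryPiece {a r : BoundaryRing} {i j l : ℤ} (ha : a ∈ boundaryPiece i)
    (hr : r ∈ boundaryPiece j) (hl : i + j = l) : a * r ∈ boundaryPiece l := by
  obtain rfl | ⟨m, hm, ha⟩ := ha
  · rw [zero_mul]; exact (boundaryPiece l).zero_mem
  obtain rfl | ⟨n, hn, hr⟩ := hr
  · rw [mul_zero]; exact (boundaryPiece l).zero_mem
  · exact mem_boundaryPiece (by rw [map_mul]; exact ha.mul hr) (by push_cast; omega)

theorem smul_mem_piece {k : ℕ} {s : BoundaryRing} {r : G.ReducedRing} {i j : ℤ}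
    (hs : s ∈ boundaryPiece i) (hr : r ∈ G.redHomogeneous k) (hj : i + 2 * k = j) :
    s • r ∈ piece G j := by
  obtain rfl | ⟨l, hl, hs⟩ := hs
  · rw [zero_smul]; exact (piece G j).zero_mem
  · exact mem_piece (G.smul_mem_redHomogeneous hs hr) (by push_cast; omega)

/-- The number of factors in which the shifted generator is chosen. -/
def weight (s : V → Bool) : ℤ := ((Finset.univ.filter fun v => s v = true).card : ℤ)

theorem weight_eq_sum (s : V → Bool) : weight s = ∑ v, if s v then (1 : ℤ) else 0 := by
  rw [weight, Finset.sum_boole]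

theorem weight_update (s : V → Bool) (v : V) (t : Bool) :
    weight (Function.update s v t) =
      weight s - (if s v then 1 else 0) + (if t then 1 else 0) := by
  rw [weight_eq_sum, weight_eq_sum, ← Finset.add_sum_erase _ _ (Finset.mem_univ v),
    ← Finset.add_sum_erase _ (fun u => if s u then (1 : ℤ) else 0) (Finset.mem_univ v),
    Function.update_self, Finset.sum_congr rfl fun u hu => by
      rw [Function.update_of_ne (Finset.ne_of_mem_erase hu)]]
  ring

/-- Membership can be tested coordinate by coordinate: a coordinate at `s` in internal degree n has
polynomial degree (`weight s` - n)/2, and is zero if this is not a natural number. -/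
theorem mem_factorization_gr_iff (D : Crossingless V) (n : ℤ) (m : TensorModule D.toGluing) :
    m ∈ D.factorization.gr n ↔ ∀ s, m s ∈ piece D.toGluing (weight s - n) := by
  constructor
  · intro h
    refine AddSubgroup.closure_induction (p := fun m _ => ∀ s, m s ∈ piece D.toGluing (weight s - n))
      ?_ (fun s => AddSubgroup.zero_mem _)
      (fun a b _ _ ha hb s => AddSubgroup.add_mem _ (ha s) (hb s))
      (fun a _ ha s => AddSubgroup.neg_mem _ (ha s)) h
    rintro _ ⟨s, k, r, hr, hn, rfl⟩ t
    by_cases hts : t = s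
    · subst hts
      rw [Pi.single_eq_same]
      exact mem_piece hr (by rw [weight]; omega)
    · rw [Pi.single_eq_of_ne hts]
      exact AddSubgroup.zero_mem _
  · intro h
    have : m = ∑ s, Pi.single s (m s) := (Finset.univ_sum_single m).symm
    rw [this]
    refine AddSubgroup.sum_mem _ fun s _ => ?_
    obtain h0 | ⟨k, hk, hr⟩ := h s
    · rw [h0, Pi.single_zero]
      exact AddSubgroup.zero_mem _
    · exact AddSubgroup.subset_closure ⟨s, k, m s, hr, by rw [weight] at hk; omega, rfl⟩

end Crossingless

instance : IsDomain BoundaryRing :=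
  inferInstanceAs (IsDomain (MvPolynomial (Fin 3) (ZMod 2)))

theorem BoundaryRing.two_eq_zero : (2 : BoundaryRing) = 0 := by
  have h := map_natCast (algebraMap (ZMod 2) (MvPolynomial (Fin 3) (ZMod 2))) 2
  rw [show ((2 : ℕ) : ZMod 2) = 0 from rfl, map_zero] at h
  exact_mod_cast h.symm

theorem bx_ne_zero : bx ≠ 0 := MvPolynomial.X_ne_zero (R := ZMod 2) (0 : Fin 3)
theorem bY_ne_zero : bY ≠ 0 := MvPolynomial.X_ne_zero (R := ZMod 2) (1 : Fin 3)

theorem ArcKind.fst_mul_snd (k : ArcKind) : k.fst * k.snd = bx * bY * bz := by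
  cases k
  · exact (mul_assoc _ _ _).symm
  · change bY * (bx * bz) = _
    ring

theorem ArcKind.fst_ne_zero (k : ArcKind) : k.fst ≠ 0 := by
  cases k
  · exact bx_ne_zero
  · exact bY_ne_zero

namespace Crossingless

open Gluing

variable {V : Type*} [Fintype V] [DecidableEq V] {D : Crossingless V}

namespace Frame

variable (F : D.Frame) (κ : D.toGluing.Colouring) (hL : D.Linked) (hP : D.Planar)

/-! ### Division by the eliminating entries -/

/-- Division by `beta j` with remainder. -/
def div (j : F.Arc) : Module.End BoundaryRing D.ReducedRing :=
  (F.basis κ hL hP).constr BoundaryRing fun i =>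
    if i.1 j = 0 then 0 else F.mon κ (i.1 - Finsupp.single j 1, i.2)

theorem div_mon (j : F.Arc) (i : (F.Arc →₀ ℕ) × (D.closedComponents → Fin 2)) :
    F.div κ hL hP j (F.mon κ i) =
      if i.1 j = 0 then 0 else F.mon κ (i.1 - Finsupp.single j 1, i.2) := by
  rw [← F.basis_apply κ hL hP, div, Module.Basis.constr_basis]

theorem linearMap_ext (hL : D.Linked) (hP : D.Planar) {N : Type*} [AddCommGroup N] [Module BoundaryRing N]
    {f g : D.ReducedRing →ₗ[BoundaryRing] N} (h : ∀ i, f (F.mon κ i) = g (F.mon κ i)) :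
    f = g :=
  (F.basis κ hL hP).ext fun i => by rw [F.basis_apply κ hL hP, h]

theorem div_beta_mul (j : F.Arc) (r : D.ReducedRing) :
    F.div κ hL hP j (F.beta j * r) = r := by
  suffices F.div κ hL hP j ∘ₗ LinearMap.mulLeft BoundaryRing (F.beta j) = LinearMap.id from
    LinearMap.congr_fun this r
  refine F.linearMap_ext κ hL hP fun i => ?_
  rw [LinearMap.comp_apply, LinearMap.mulLeft_apply, beta_mul_mon, div_mon, if_neg (by simp)]
  simp

/-- Each entry acts on the monomial basis by raising one exponent and each division by lowering one.
Different arcs involve different exponents, which makes the cancellations independent of one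
another. -/
theorem div_beta_mul_of_ne {i j : F.Arc} (hij : i ≠ j) (r : D.ReducedRing) :
    F.div κ hL hP j (F.beta i * r) = F.beta i * F.div κ hL hP j r := by
  suffices F.div κ hL hP j ∘ₗ LinearMap.mulLeft BoundaryRing (F.beta i) =
      LinearMap.mulLeft BoundaryRing (F.beta i) ∘ₗ F.div κ hL hP j from
    LinearMap.congr_fun this r
  refine F.linearMap_ext κ hL hP fun n => ?_
  rw [LinearMap.comp_apply, LinearMap.comp_apply, LinearMap.mulLeft_apply, LinearMap.mulLeft_apply,
    beta_mul_mon, div_mon, div_mon]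
  have : (n.1 + Finsupp.single i 1 : F.Arc →₀ ℕ) j = n.1 j := by
    rw [Finsupp.add_apply, Finsupp.single_eq_of_ne hij.symm, add_zero]
  rw [this]
  split_ifs with h
  · rw [mul_zero]
  · rw [beta_mul_mon]
    congr 2
    ext l
    simp only [Finsupp.add_apply, Finsupp.tsub_apply]
    by_cases hl : l = j
    · subst hl
      rw [Finsupp.single_eq_of_ne hij.symm, Finsupp.single_eq_same]; omega
    · rw [Finsupp.single_eq_of_ne hl]; omega

theorem div_comm (i j : F.Arc) (r : D.ReducedRing) :
    F.div κ hL hP i (F.div κ hL hP j r) = F.div κ hL hP j (F.div κ hL hP i r) := by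
  suffices F.div κ hL hP i ∘ₗ F.div κ hL hP j = F.div κ hL hP j ∘ₗ F.div κ hL hP i from
    LinearMap.congr_fun this r
  by_cases hij : i = j
  · rw [hij]
  refine F.linearMap_ext κ hL hP fun n => ?_
  have h1 : (n.1 - Finsupp.single i 1 : F.Arc →₀ ℕ) j = n.1 j := by
    rw [Finsupp.tsub_apply, Finsupp.single_eq_of_ne (Ne.symm hij), tsub_zero]
  have h2 : (n.1 - Finsupp.single j 1 : F.Arc →₀ ℕ) i = n.1 i := by
    rw [Finsupp.tsub_apply, Finsupp.single_eq_of_ne hij, tsub_zero]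
  rw [LinearMap.comp_apply, LinearMap.comp_apply, div_mon, div_mon]
  split_ifs with ha hb hb
  · rw [map_zero, map_zero]
  · rw [map_zero, div_mon, if_pos (by rwa [h1])]
  · rw [map_zero, div_mon, if_pos (by rwa [h2])]
  · rw [div_mon, div_mon, if_neg (by rwa [h2]), if_neg (by rwa [h1])]
    dsimp only
    rw [tsub_right_comm]

/-- The remainder of division by `beta j`. -/
def rem (j : F.Arc) : Module.End BoundaryRing D.ReducedRing :=
  1 - LinearMap.mulLeft BoundaryRing (F.beta j) * F.div κ hL hP j

theorem rem_apply (j : F.Arc) (r : D.ReducedRing) :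
    F.rem κ hL hP j r = r - F.beta j * F.div κ hL hP j r := rfl

theorem rem_div_comm {i j : F.Arc} (hij : i ≠ j) :
    F.rem κ hL hP i * F.div κ hL hP j = F.div κ hL hP j * F.rem κ hL hP i := by
  refine LinearMap.ext fun r => ?_
  rw [Module.End.mul_apply, Module.End.mul_apply, rem_apply, rem_apply, map_sub,
    div_beta_mul_of_ne _ _ _ _ hij, div_comm]

theorem rem_comm (i j : F.Arc) :
    F.rem κ hL hP i * F.rem κ hL hP j = F.rem κ hL hP j * F.rem κ hL hP i := by
  by_cases hij : i = j
  · rw [hij]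
  refine LinearMap.ext fun r => ?_
  simp only [Module.End.mul_apply, rem_apply, map_sub, div_beta_mul_of_ne _ _ _ _ hij,
    div_beta_mul_of_ne _ _ _ _ (Ne.symm hij), F.div_comm κ hL hP i j]
  ring

theorem rem_mon (j : F.Arc) (i : (F.Arc →₀ ℕ) × (D.closedComponents → Fin 2)) :
    F.rem κ hL hP j (F.mon κ i) = if i.1 j = 0 then F.mon κ i else 0 := by
  rw [rem_apply, div_mon]
  split_ifs with h
  · rw [mul_zero, sub_zero]
  · rw [beta_mul_mon, sub_eq_zero]
    congr 1
    refine Prod.ext ?_ rfl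
    dsimp only
    rw [tsub_add_cancel_of_le (Finsupp.single_le_iff.mpr (Nat.one_le_iff_ne_zero.mpr h))]

theorem list_prod_rem_mon (l : List F.Arc) (i : (F.Arc →₀ ℕ) × (D.closedComponents → Fin 2)) :
    (l.map (F.rem κ hL hP)).prod (F.mon κ i) = if ∀ j ∈ l, i.1 j = 0 then F.mon κ i else 0 := by
  induction l with
  | nil => simp
  | cons j l ih =>
    simp only [List.map_cons, List.prod_cons, Module.End.mul_apply, ih, List.mem_cons,
      forall_eq_or_imp]
    by_cases h : ∀ j ∈ l, i.1 j = 0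
    · rw [if_pos h, rem_mon]
      simp only [and_iff_left h]
    · rw [if_neg h, map_zero, if_neg fun h' => h h'.2]

/-! ### Coefficients -/

/-- The coefficient of `circleMon ε`. -/
def coeff (ε : D.closedComponents → Fin 2) : D.ReducedRing →ₗ[BoundaryRing] BoundaryRing :=
  (F.basis κ hL hP).coord (0, ε)

theorem coeff_mon (ε : D.closedComponents → Fin 2)
    (i : (F.Arc →₀ ℕ) × (D.closedComponents → Fin 2)) :
    F.coeff κ hL hP ε (F.mon κ i) = if i = (0, ε) then 1 else 0 := by
  rw [coeff, ← F.basis_apply κ hL hP, Module.Basis.coord_apply, Module.Basis.repr_self,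
    Finsupp.single_apply]

theorem mon_zero (ε : D.closedComponents → Fin 2) : F.mon κ (0, ε) = circleMon κ ε := by
  simp [mon]

theorem coeff_circleMon (ε ε' : D.closedComponents → Fin 2) :
    F.coeff κ hL hP ε (circleMon κ ε') = if ε' = ε then 1 else 0 := by
  rw [← F.mon_zero, coeff_mon]
  simp

/-- The coefficients therefore factor through the quotient by the eliminating entries, in which the
circle monomials form a basis over 𝔽[x,y,z]. -/
theorem coeff_beta_mul (ε : D.closedComponents → Fin 2) (j : F.Arc) (r : D.ReducedRing) :
    F.coeff κ hL hP ε (F.beta j * r) = 0 := by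
  suffices F.coeff κ hL hP ε ∘ₗ LinearMap.mulLeft BoundaryRing (F.beta j) = 0 from
    LinearMap.congr_fun this r
  refine F.linearMap_ext κ hL hP fun i => ?_
  rw [LinearMap.comp_apply, LinearMap.mulLeft_apply, beta_mul_mon, coeff_mon, if_neg]
  · rfl
  · intro h
    have := congrArg (fun i => i.1 j) h
    simp at this

/-- The reduction modulo the eliminating entries. -/
theorem list_prod_rem (r : D.ReducedRing) :
    ((Finset.univ : Finset F.Arc).toList.map (F.rem κ hL hP)).prod r =
      ∑ ε, F.coeff κ hL hP ε r • circleMon κ ε := by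
  suffices ((Finset.univ : Finset F.Arc).toList.map (F.rem κ hL hP)).prod =
      ∑ ε, (F.coeff κ hL hP ε).smulRight (circleMon κ ε) by
    rw [this, LinearMap.sum_apply]; rfl
  refine F.linearMap_ext κ hL hP fun i => ?_
  rw [list_prod_rem_mon, LinearMap.sum_apply]
  simp only [LinearMap.smulRight_apply, coeff_mon]
  by_cases h : i.1 = 0
  · obtain ⟨n, ε⟩ := i
    dsimp only at h
    subst h
    rw [if_pos (by simp), mon_zero, Finset.sum_eq_single ε]
    · simp
    · intro ε' _ hne
      rw [if_neg (by simpa using hne.symm), zero_smul]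
    · simp
  · rw [if_neg, Finset.sum_eq_zero]
    · intro ε _
      rw [if_neg (fun h' => h (by rw [h'])), zero_smul]
    · intro h'
      exact h (Finsupp.ext fun j => h' j (by simp))

/-- Multiplication by `t` descends to the quotient by the eliminating entries, so the coefficients
of a product depend on `r` only through its own coefficients. -/
theorem coeff_mul (ε : D.closedComponents → Fin 2) (t r : D.ReducedRing) :
    F.coeff κ hL hP ε (t * r) =
      ∑ ε', F.coeff κ hL hP ε' r * F.coeff κ hL hP ε (t * circleMon κ ε') := by
  suffices F.coeff κ hL hP ε ∘ₗ LinearMap.mulLeft BoundaryRing t =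
      ∑ ε', (F.coeff κ hL hP ε').smulRight (F.coeff κ hL hP ε (t * circleMon κ ε')) by
    have := LinearMap.congr_fun this r
    rw [LinearMap.sum_apply] at this
    exact this
  refine F.linearMap_ext κ hL hP fun i => ?_
  rw [LinearMap.comp_apply, LinearMap.mulLeft_apply, LinearMap.sum_apply]
  simp only [LinearMap.smulRight_apply, coeff_mon]
  obtain ⟨n, ε'⟩ := i
  by_cases h : n = 0
  · subst h
    rw [mon_zero, Finset.sum_eq_single ε']
    · simp
    · intro ε'' _ hne
      rw [if_neg (by simpa using hne.symm), zero_smul]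
    · simp
  · obtain ⟨j, hj⟩ : ∃ j, n j ≠ 0 := by
      by_contra hcon
      push Not at hcon
      exact h (Finsupp.ext hcon)
    have hm : F.mon κ (n, ε') = F.beta j * F.mon κ (n - Finsupp.single j 1, ε') := by
      rw [beta_mul_mon]
      dsimp only
      rw [tsub_add_cancel_of_le (Finsupp.single_le_iff.mpr (Nat.one_le_iff_ne_zero.mpr hj))]
    rw [hm, mul_left_comm, coeff_beta_mul, Finset.sum_eq_zero]
    intro ε _
    rw [if_neg (fun h' => h (congrArg Prod.fst h')), zero_smul]

theorem coeff_lam_root_mul (ε : D.closedComponents → Fin 2) (r : D.ReducedRing) :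
    F.coeff κ hL hP ε (D.lam F.root * r) = D.openKind.fst * F.coeff κ hL hP ε r := by
  -- The elements whose product with `r` has coefficient zero at `ε`. Linear entries of arcs outside
  -- the tree belong to it, so the telescoping along the cut applies.
  let L : Submodule (ZMod 2) D.ReducedRing := AddSubgroup.toZModSubmodule 2
    (((F.coeff κ hL hP ε).toAddMonoidHom.comp (AddMonoidHom.mulRight r)).ker)
  have h : D.lam F.root + algebraMap BoundaryRing _ D.openKind.fst ∈ L := by
    refine F.lam_root_add_mem κ L fun v hv hr => ?_
    change F.coeff κ hL hP ε (D.lam v * r) = 0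
    rw [← F.beta_notMem hv hr, coeff_beta_mul]
  change F.coeff κ hL hP ε ((_ + _) * r) = 0 at h
  rw [add_mul, ← Algebra.smul_def, map_add, map_smul, smul_eq_mul] at h
  rw [← sub_eq_zero, ← h, sub_eq_add_neg]
  congr 1
  have := BoundaryRing.two_eq_zero
  grind

/-- No direct computation is needed. In the identity Σ `lam` `kap` = xyz every arc but the root has
an eliminating entry as a factor, so on coefficients `fst` times the action of `kap` at the root
equals `fst * snd`, and `fst` cancels in the domain 𝔽[x,y,z]. -/
theorem coeff_kap_root_mul (ε : D.closedComponents → Fin 2) (r : D.ReducedRing) :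
    F.coeff κ hL hP ε (D.kap F.root * r) = D.openKind.snd * F.coeff κ hL hP ε r := by
  have h := congrArg (fun t => F.coeff κ hL hP ε (t * r)) (D.sum_lam_mul_kap)
  rw [← Finset.add_sum_erase _ _ (Finset.mem_univ F.root), add_mul, map_add, mul_assoc,
    coeff_lam_root_mul, Finset.sum_mul, map_sum, Finset.sum_eq_zero, add_zero,
    ← Algebra.smul_def, map_smul, ← ArcKind.fst_mul_snd D.openKind, smul_eq_mul, mul_assoc] at h
  · exact mul_left_cancel₀ (ArcKind.fst_ne_zero _) h
  · intro v hv
    have hv := Finset.ne_of_mem_erase hv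
    by_cases ht : v ∈ F.tree
    · rw [← F.beta_tree ht, mul_comm (D.lam v), mul_assoc, coeff_beta_mul]
    · rw [← F.beta_notMem ht hv, mul_assoc, coeff_beta_mul]

end Frame

end Crossingless

theorem twoTerm_apply (α β : BoundaryRing) (f : Bool → BoundaryRing) (b : Bool) :
    twoTerm α β f b = (if b then β else α) * f (!b) := rfl

theorem twoTerm_single (α β r : BoundaryRing) (b : Bool) :
    twoTerm α β (Pi.single b r) = Pi.single (!b) ((if b then α else β) * r) := by
  funext c
  rw [twoTerm_apply]
  cases b <;> cases c <;> simp

theorem elementaryD_eq (k : ArcKind) : elementaryD k = twoTerm k.fst k.snd := by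
  cases k <;> rfl

namespace Crossingless

open Gluing

variable {V : Type*} [Fintype V] (D : Crossingless V)

/-! ### The basis of the delooped factorization -/

/-- The basis of `V(D) ⊗ M̃(o(D))`. -/
def deloopedBasis : Module.Basis (Bool × (D.closedComponents → Fin 2)) BoundaryRing
    D.delooped.carrier :=
  Module.Basis.tensorProduct (R := FH) (S := BoundaryRing) (Pi.basisFun BoundaryRing Bool)
    D.circlesBasis

theorem deloopedBasis_apply (b : Bool) (ε : D.closedComponents → Fin 2) :
    D.deloopedBasis (b, ε) = (Pi.single b 1 : Bool → BoundaryRing) ⊗ₜ[FH] D.circlesBasis ε := by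
  refine (Module.Basis.tensorProduct_apply (R := FH) (S := BoundaryRing) _ _ _ _).trans ?_
  rw [Pi.basisFun_apply]

theorem single_tmul (b : Bool) (r : BoundaryRing) (ε : D.closedComponents → Fin 2) :
    ((Pi.single b r : Bool → BoundaryRing) ⊗ₜ[FH] D.circlesBasis ε : D.delooped.carrier) =
      r • D.deloopedBasis (b, ε) := by
  rw [deloopedBasis_apply]
  change _ = r • ((Pi.single b 1 : Bool → BoundaryRing) ⊗ₜ[FH] D.circlesBasis ε)
  rw [TensorProduct.smul_tmul', ← Pi.single_smul, smul_eq_mul, mul_one]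

theorem delooped_d_basis (b : Bool) (ε : D.closedComponents → Fin 2) :
    D.delooped.d (D.deloopedBasis (b, ε)) =
      (if b then D.openKind.fst else D.openKind.snd) • D.deloopedBasis (!b, ε) := by
  rw [← single_tmul, deloopedBasis_apply]
  change TensorProduct.AlgebraTensorModule.map (elementaryD D.openKind) LinearMap.id _ = _
  rw [TensorProduct.AlgebraTensorModule.map_tmul, elementaryD_eq, twoTerm_single, mul_one]
  rfl

/-- The internal degree of a basis element. -/
def basisDeg (i : Bool × (D.closedComponents → Fin 2)) : ℤ :=
  (if i.1 then 1 else 0) + ∑ c, (1 - 2 * ((i.2 c : ℕ) : ℤ))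

theorem mem_delooped_gr_iff (n : ℤ) (x : D.delooped.carrier) :
    x ∈ D.delooped.gr n ↔
      ∀ i, D.deloopedBasis.repr x i ∈ boundaryPiece (D.basisDeg i - n) := by
  have hinst : ∀ (f : D.closedComponents → ℤ) (t : ℤ), t = ∑ c, f c →
      ∀ inst : Fintype D.closedComponents, @Finset.sum _ _ _ (@Finset.univ _ inst) f = t := by
    rintro f _ rfl inst
    congr!
  constructor
  · intro h
    refine AddSubgroup.closure_induction
      (p := fun x _ => ∀ i, D.deloopedBasis.repr x i ∈ boundaryPiece (D.basisDeg i - n))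
      ?_ (fun s => by rw [map_zero]; exact AddSubgroup.zero_mem _)
      (fun a b _ _ ha hb s => by rw [map_add]; exact AddSubgroup.add_mem _ (ha s) (hb s))
      (fun a _ ha s => by rw [map_neg]; exact AddSubgroup.neg_mem _ (ha s)) h
    rintro _ ⟨b, ε, k, r, hr, hn, rfl⟩ i
    rw [single_tmul, map_smul, Module.Basis.repr_self, Finsupp.smul_single, smul_eq_mul, mul_one,
      Finsupp.single_apply]
    rw [hinst _ _ rfl] at hn
    split_ifs with hi
    · subst hi
      refine mem_boundaryPiece hr ?_
      rw [basisDeg]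
      dsimp only
      linarith
    · exact AddSubgroup.zero_mem _
  · intro h
    rw [← D.deloopedBasis.sum_repr x]
    refine AddSubgroup.sum_mem _ fun i _ => ?_
    obtain ⟨b, ε⟩ := i
    rw [← single_tmul]
    obtain h0 | ⟨k, hk, hr⟩ := h (b, ε)
    · rw [h0, Pi.single_zero, TensorProduct.zero_tmul]
      exact AddSubgroup.zero_mem _
    · refine AddSubgroup.subset_closure ⟨b, ε, k, _, hr, ?_, rfl⟩
      rw [hinst _ _ rfl]
      rw [basisDeg] at hk
      dsimp only at hk
      linarith

theorem smul_basis_mem_gr {n : ℤ} {i : Bool × (D.closedComponents → Fin 2)} {r : BoundaryRing}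
    (hr : r ∈ boundaryPiece (D.basisDeg i - n)) : r • D.deloopedBasis i ∈ D.delooped.gr n := by
  rw [mem_delooped_gr_iff]
  intro j
  rw [map_smul, Module.Basis.repr_self, Finsupp.smul_single, smul_eq_mul, mul_one,
      Finsupp.single_apply]
  split_ifs with hi
  · rwa [← hi]
  · exact AddSubgroup.zero_mem _

theorem _root_.Delooping.ArcKind.fst_mem (k : ArcKind) : k.fst ∈ boundaryPiece 2 := by
  cases k
  · exact mem_boundaryPiece (k := 1) (MvPolynomial.isHomogeneous_X (ZMod 2) (0 : Fin 3)) rfl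
  · exact mem_boundaryPiece (k := 1) (MvPolynomial.isHomogeneous_X (ZMod 2) (1 : Fin 3)) rfl

theorem _root_.Delooping.ArcKind.snd_mem (k : ArcKind) : k.snd ∈ boundaryPiece 4 := by
  have h0 : bx ∈ boundaryPiece 2 := ArcKind.fst_mem ArcKind.dotted
  have h1 : bY ∈ boundaryPiece 2 := ArcKind.fst_mem ArcKind.thick
  have h2 : bz ∈ boundaryPiece 2 :=
    mem_boundaryPiece (k := 1) (MvPolynomial.isHomogeneous_X (ZMod 2) (2 : Fin 3)) rfl
  cases k
  · exact mul_mem_boundaryPiece h1 h2 rfl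
  · exact mul_mem_boundaryPiece h0 h2 rfl

/-- A linear map has degree `k` if it does so on the basis. -/
theorem hasDegree_of_basis {N : Factorization BoundaryRing}
    (f : D.delooped.carrier →ₗ[BoundaryRing] N.carrier) (k : ℤ)
    (hf : ∀ i n r, r ∈ boundaryPiece (D.basisDeg i - n) → r • f (D.deloopedBasis i) ∈ N.gr (n + k)) :
    Factorization.HasDegree (M := D.delooped) (N := N) f k := by
  intro n x hx
  rw [mem_delooped_gr_iff] at hx
  rw [← D.deloopedBasis.sum_repr x, map_sum]
  refine AddSubgroup.sum_mem _ fun i _ => ?_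
  rw [map_smul]
  exact hf i n _ (hx i)

theorem delooped_isMatrixFactorization :
    D.delooped.IsMatrixFactorization (bx * bY * bz) := by
  constructor
  · refine D.deloopedBasis.ext fun i => ?_
    obtain ⟨b, ε⟩ := i
    rw [LinearMap.comp_apply, delooped_d_basis, map_smul, delooped_d_basis, smul_smul,
      LinearMap.smul_apply, LinearMap.id_apply, Bool.not_not, ← ArcKind.fst_mul_snd D.openKind]
    cases b
    · simp only [Bool.not_false, if_true, Bool.false_eq_true, if_false]; rw [mul_comm]
    · simp
  · refine D.hasDegree_of_basis (N := D.delooped) D.delooped.d (-3) fun i n r hr => ?_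
    obtain ⟨b, ε⟩ := i
    rw [delooped_d_basis, smul_smul]
    refine D.smul_basis_mem_gr ?_
    cases b
    · refine mul_mem_boundaryPiece hr D.openKind.snd_mem ?_
      simp only [basisDeg, Bool.not_false, if_true, Bool.false_eq_true, if_false]
      ring
    · refine mul_mem_boundaryPiece hr D.openKind.fst_mem ?_
      simp only [basisDeg, Bool.not_true, if_true, Bool.false_eq_true, if_false]
      ring

variable [DecidableEq V]

theorem factorization_d : D.factorization.d = koszul D.toGluing D.lam D.kap := rfl

theorem factorization_isMatrixFactorization :
    D.factorization.IsMatrixFactorization (bx * bY * bz) := by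
  constructor
  · refine LinearMap.ext fun m => ?_
    rw [LinearMap.comp_apply, factorization_d]
    refine (koszul_koszul _ _ _ m).trans ?_
    rw [D.sum_lam_mul_kap]
    funext s
    exact (Algebra.smul_def _ _).symm
  · intro n m hm
    have hm' := (mem_factorization_gr_iff D n m).mp hm
    refine (mem_factorization_gr_iff D _ _).mpr fun s => ?_
    refine (koszul_apply D.toGluing D.lam D.kap m s) ▸ ?_
    refine AddSubgroup.sum_mem _ fun v _ => ?_
    have := hm' (Function.update s v (!s v))
    rw [weight_update] at this
    by_cases h : s v = true
    · rw [if_pos h]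
      refine mul_mem_piece (D.kap_mem v) this ?_
      simp [h]; ring
    · rw [if_neg h]
      refine mul_mem_piece (D.lam_mem v) this ?_
      simp [h]; ring

end Crossingless

namespace Crossingless

open Gluing

variable {V : Type*} [Fintype V] [DecidableEq V] {D : Crossingless V}

namespace Frame

variable (F : D.Frame) (κ : D.toGluing.Colouring) (hL : D.Linked) (hP : D.Planar)

/-! ### Degrees of the operators -/

/-- The basis consists of homogeneous monomials, so the coordinates of a homogeneous element have
complementary degrees. The degrees of division and of the projections follow from this. -/
theorem repr_mem {r : D.ReducedRing} {j : ℤ} (hr : r ∈ piece D.toGluing j)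
    (i : (F.Arc →₀ ℕ) × (D.closedComponents → Fin 2)) :
    (F.basis κ hL hP).repr r i ∈ boundaryPiece (j - 2 * F.monDeg i) := by
  obtain rfl | ⟨k, hk, hr⟩ := hr
  · rw [map_zero]; exact AddSubgroup.zero_mem _
  refine AddSubgroup.closure_induction
    (p := fun r _ => (F.basis κ hL hP).repr r i ∈ boundaryPiece (j - 2 * F.monDeg i))
    ?_ (by rw [map_zero]; exact AddSubgroup.zero_mem _)
    (fun a b _ _ ha hb => by rw [map_add]; exact AddSubgroup.add_mem _ ha hb)
    (fun a _ ha => by rw [map_neg]; exact AddSubgroup.neg_mem _ ha)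
    (F.mem_closure_of_homogeneous κ hL hr)
  rintro _ ⟨s, l, i', hs, hl, rfl⟩
  rw [map_smul, ← F.basis_apply κ hL hP, Module.Basis.repr_self, Finsupp.smul_single, smul_eq_mul,
    mul_one, Finsupp.single_apply]
  split_ifs with h
  · subst h
    exact mem_boundaryPiece hs (by omega)
  · exact AddSubgroup.zero_mem _

theorem monDeg_sub_single {i : (F.Arc →₀ ℕ) × (D.closedComponents → Fin 2)} {j : F.Arc}
    (h : i.1 j ≠ 0) : F.monDeg (i.1 - Finsupp.single j 1, i.2) + F.betaDeg j = F.monDeg i := by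
  rw [monDeg, monDeg, add_right_comm]
  congr 1
  rw [← Finset.add_sum_erase _ _ (Finset.mem_univ j),
    ← Finset.add_sum_erase _ (fun l => F.betaDeg l * i.1 l) (Finset.mem_univ j),
    Finset.sum_congr rfl fun l hl => by
      rw [Finsupp.tsub_apply, Finsupp.single_eq_of_ne (Finset.ne_of_mem_erase hl), tsub_zero],
    Finsupp.tsub_apply, Finsupp.single_eq_same]
  obtain ⟨n, hn⟩ := Nat.exists_eq_succ_of_ne_zero h
  rw [hn]
  simp only [Nat.succ_eq_add_one, add_tsub_cancel_right]
  ring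

theorem div_mem {r : D.ReducedRing} {j : ℤ} (hr : r ∈ piece D.toGluing j) (a : F.Arc) {l : ℤ}
    (hl : l + 2 * F.betaDeg a = j) : F.div κ hL hP a r ∈ piece D.toGluing l := by
  rw [← (F.basis κ hL hP).linearCombination_repr r, Finsupp.linearCombination_apply, Finsupp.sum,
    map_sum]
  refine AddSubgroup.sum_mem _ fun i _ => ?_
  rw [map_smul, F.basis_apply, div_mon]
  split_ifs with h
  · rw [smul_zero]; exact AddSubgroup.zero_mem _
  · refine smul_mem_piece (F.repr_mem κ hL hP hr i) (F.mon_mem κ _) ?_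
    have := F.monDeg_sub_single h
    omega

theorem coeff_mem {r : D.ReducedRing} {j : ℤ} (hr : r ∈ piece D.toGluing j)
    (ε : D.closedComponents → Fin 2) {l : ℤ} (hl : l + 2 * (∑ c, ((ε c : ℕ) : ℤ)) = j) :
    F.coeff κ hL hP ε r ∈ boundaryPiece l := by
  have h := F.repr_mem κ hL hP hr (0, ε)
  have : j - 2 * (F.monDeg (0, ε) : ℤ) = l := by
    rw [monDeg]
    push_cast
    simp only [Pi.zero_apply, Nat.cast_zero, mul_zero, Finset.sum_const_zero,
      zero_add]
    linarith
  rwa [this] at h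

/-- The copy in which the entry `beta j` lands. -/
def target (j : F.Arc) : Bool := decide (j.1 ∈ F.tree)

theorem beta_eq (j : F.Arc) : F.beta j = if F.target j then D.kap j.1 else D.lam j.1 := by
  rw [beta, target]
  split_ifs <;> simp_all

variable (D) in
/-- The endomorphisms of degree `k`. -/
def endDeg (k : ℤ) : AddSubgroup (Module.End BoundaryRing (TensorModule D.toGluing)) where
  carrier := {f | ∀ n (m : TensorModule D.toGluing), m ∈ D.factorization.gr n → f m ∈ D.factorization.gr (n + k)}
  zero_mem' := fun _ _ _ => AddSubgroup.zero_mem _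
  add_mem' := fun ha hb n m hm => AddSubgroup.add_mem _ (ha n m hm) (hb n m hm)
  neg_mem' := fun ha n m hm => AddSubgroup.neg_mem _ (ha n m hm)

theorem rem_mem {r : D.ReducedRing} {j : ℤ} (hr : r ∈ piece D.toGluing j) (a : F.Arc) :
    F.rem κ hL hP a r ∈ piece D.toGluing j := by
  rw [rem_apply]
  exact AddSubgroup.sub_mem _ hr (mul_mem_piece (F.beta_mem a)
    (F.div_mem κ hL hP hr a (sub_add_cancel j _)) (sub_add_cancel j _))

theorem cancelProj_mem (j : F.Arc) :
    cancelProj D.toGluing j.1 (F.target j) (F.rem κ hL hP j) ∈ endDeg D 0 := by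
  intro n m hm
  have hm := (mem_factorization_gr_iff D n m).mp hm
  refine (mem_factorization_gr_iff D _ _).mpr fun s => ?_
  rw [cancelProj_apply, add_zero]
  split_ifs
  · exact F.rem_mem κ hL hP (hm s) j
  · exact AddSubgroup.zero_mem _

theorem cancelHtpy_mem (j : F.Arc) :
    cancelHtpy D.toGluing j.1 (F.target j) (F.div κ hL hP j) ∈ endDeg D 3 := by
  intro n m hm
  have hm := (mem_factorization_gr_iff D n m).mp hm
  refine (mem_factorization_gr_iff D _ _).mpr fun s => ?_
  rw [cancelHtpy_apply]
  split_ifs with h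
  · exact AddSubgroup.zero_mem _
  · refine F.div_mem κ hL hP (hm _) j ?_
    rw [weight_update]
    by_cases ht : j.1 ∈ F.tree
    · have : s j.1 = false := by simpa [target, ht] using h
      simp [betaDeg, target, ht, this]; ring
    · have : s j.1 = true := by simpa [target, ht] using h
      simp [betaDeg, target, ht, this]; ring

/-- The projection to the part that survives all cancellations. -/
def survive : Module.End BoundaryRing (TensorModule D.toGluing) :=
  ((Finset.univ : Finset F.Arc).toList.map fun j =>
    cancelProj D.toGluing j.1 (F.target j) (F.rem κ hL hP j)).prod

theorem koszul_sq (D : Crossingless V) (a : Module.End BoundaryRing (TensorModule D.toGluing)) :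
    koszul D.toGluing D.lam D.kap * koszul D.toGluing D.lam D.kap * a =
      a * (koszul D.toGluing D.lam D.kap * koszul D.toGluing D.lam D.kap) := by
  have h : koszul D.toGluing D.lam D.kap * koszul D.toGluing D.lam D.kap =
      (bx * bY * bz) • 1 := D.factorization_isMatrixFactorization.1
  rw [h, smul_one_mul, mul_smul_one]

theorem exists_htpy : ∃ h ∈ endDeg D 3,
    Contracts (koszul D.toGluing D.lam D.kap) h (F.survive κ hL hP) := by
  refine exists_contracts (koszul_sq D)
    (fun j : F.Arc => cancelHtpy D.toGluing j.1 (F.target j) (F.div κ hL hP j))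
    (fun j : F.Arc => cancelProj D.toGluing j.1 (F.target j) (F.rem κ hL hP j))
    (endDeg D) ?_ ?_ ?_ _ (Finset.nodup_toList _) ?_ ?_ ?_ ?_ ?_
  · intro n m hm
    rw [add_zero]; exact hm
  · intro k l a b ha hb n m hm
    have := ha _ _ (hb n m hm)
    rwa [add_assoc, add_comm l k] at this
  · exact D.factorization_isMatrixFactorization.2
  · intro j _
    exact contracts_koszul (F.beta_eq j) (F.div_beta_mul κ hL hP j) (F.rem_apply κ hL hP j)
  · exact fun j _ => F.cancelHtpy_mem κ hL hP j
  · exact fun j _ => F.cancelProj_mem κ hL hP j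
  · exact fun i _ j _ => cancelProj_comm (F.rem_comm κ hL hP i j)
  · exact fun i _ j _ hij => cancelProj_comm_cancelHtpy (fun h => hij (Subtype.ext h))
      (F.rem_div_comm κ hL hP hij)

/-- The total homotopy. -/
def htpy : Module.End BoundaryRing (TensorModule D.toGluing) :=
  (F.exists_htpy κ hL hP).choose

theorem htpy_mem : F.htpy κ hL hP ∈ endDeg D 3 := (F.exists_htpy κ hL hP).choose_spec.1

theorem contracts_htpy :
    Contracts (koszul D.toGluing D.lam D.kap) (F.htpy κ hL hP) (F.survive κ hL hP) :=
  (F.exists_htpy κ hL hP).choose_spec.2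

/-! ### The surviving part -/

/-- The generators that survive. -/
def position (b : Bool) : V → Bool := fun v => if v = F.root then b else decide (v ∈ F.tree)

theorem position_root (b : Bool) : F.position b F.root = b := if_pos rfl

theorem eq_position_iff (s : V → Bool) :
    (∀ j : F.Arc, s j.1 = F.target j) ↔ s = F.position (s F.root) := by
  constructor
  · intro h
    funext v
    by_cases hv : v = F.root
    · rw [hv, position_root]
    · rw [position, if_neg hv]; exact h ⟨v, hv⟩
  · intro h j
    rw [h, position, if_neg j.2]; rfl

theorem survive_apply (m : TensorModule D.toGluing) (s : V → Bool) :
    F.survive κ hL hP m s = if s = F.position (s F.root) then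
      ∑ ε, F.coeff κ hL hP ε (m s) • circleMon κ ε else 0 := by
  rw [survive, list_prod_cancelProj (fun j : F.Arc => j.1) F.target]
  simp only [Finset.mem_toList, Finset.mem_univ, forall_true_left, eq_position_iff]
  split_ifs
  · rw [list_prod_rem]
  · rfl

/-- The projection to the delooped factorization, in terms of coefficients. -/
def project : TensorModule D.toGluing →ₗ[BoundaryRing] D.delooped.carrier :=
  ∑ i : Bool × (D.closedComponents → Fin 2),
    (F.coeff κ hL hP i.2 ∘ₗ LinearMap.proj (F.position i.1)).smulRight (D.deloopedBasis i)

theorem project_apply (m : TensorModule D.toGluing) : F.project κ hL hP m =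
    ∑ i : Bool × (D.closedComponents → Fin 2),
      F.coeff κ hL hP i.2 (m (F.position i.1)) • D.deloopedBasis i := by
  rw [project, LinearMap.sum_apply]; rfl

theorem repr_project (m : TensorModule D.toGluing) (i : Bool × (D.closedComponents → Fin 2)) :
    D.deloopedBasis.repr (F.project κ hL hP m) i =
      F.coeff κ hL hP i.2 (m (F.position i.1)) := by
  rw [project_apply, D.deloopedBasis.repr_sum_self]

theorem project_apply_single (b : Bool) (r : D.ReducedRing) :
    F.project κ hL hP (Pi.single (F.position b) r) =
      ∑ ε, F.coeff κ hL hP ε r • D.deloopedBasis (b, ε) := by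
  rw [project_apply, Fintype.sum_prod_type, Fintype.sum_bool]
  have h : ∀ {b b' : Bool}, b ≠ b' → F.position b ≠ F.position b' := fun hb h =>
    hb (by
      have := congrFun h F.root
      rwa [F.position_root, F.position_root] at this)
  cases b
  · rw [Finset.sum_eq_zero, zero_add]
    · simp only [Pi.single_eq_same]
    · intro ε _
      rw [Pi.single_eq_of_ne (h (by simp)), map_zero, zero_smul]
  · rw [add_comm, Finset.sum_eq_zero, zero_add]
    · simp only [Pi.single_eq_same]
    · intro ε _
      rw [Pi.single_eq_of_ne (h (by simp)), map_zero, zero_smul]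

/-- The section of the projection given by the products of circle variables. -/
def embed : D.delooped.carrier →ₗ[BoundaryRing] TensorModule D.toGluing :=
  D.deloopedBasis.constr BoundaryRing fun i =>
    (Pi.single (F.position i.1) (circleMon κ i.2) : TensorModule D.toGluing)

theorem embed_basis (i : Bool × (D.closedComponents → Fin 2)) :
    F.embed κ (D.deloopedBasis i) = Pi.single (F.position i.1) (circleMon κ i.2) := by
  rw [embed, Module.Basis.constr_basis]

theorem project_mul_embed (r : D.ReducedRing) (b : Bool) (ε : D.closedComponents → Fin 2) :
    F.project κ hL hP (r • F.embed κ (D.deloopedBasis (b, ε))) =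
      ∑ ε', F.coeff κ hL hP ε' (r * circleMon κ ε) • D.deloopedBasis (b, ε') := by
  rw [embed_basis, ← Pi.single_smul, smul_eq_mul, project_apply_single]

theorem project_embed : F.project κ hL hP ∘ₗ F.embed κ = LinearMap.id := by
  refine D.deloopedBasis.ext fun i => ?_
  obtain ⟨b, ε⟩ := i
  have h := F.project_mul_embed κ hL hP 1 b ε
  simp only [one_smul, one_mul, coeff_circleMon, ite_smul, zero_smul, Finset.sum_ite_eq,
    Finset.mem_univ, if_true] at h
  exact h

theorem embed_project (m : TensorModule D.toGluing) :
    F.embed κ (F.project κ hL hP m) = F.survive κ hL hP m := by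
  funext s
  rw [project_apply, map_sum, Finset.sum_apply, survive_apply]
  simp only [map_smul, embed_basis, Pi.smul_apply]
  rw [Fintype.sum_prod_type, Finset.sum_eq_single (s F.root)]
  · split_ifs with h
    · refine Finset.sum_congr rfl fun ε _ => ?_
      dsimp only
      rw [← h, Pi.single_eq_same]
    · exact Finset.sum_eq_zero fun ε _ => by rw [Pi.single_eq_of_ne h, smul_zero]
  · intro b _ hb
    refine Finset.sum_eq_zero fun ε _ => ?_
    rw [Pi.single_eq_of_ne, smul_zero]
    intro h
    exact hb (by rw [h, position_root])
  · simp

theorem update_position (v : V) (b : Bool) (s : V → Bool)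
    (h : Function.update (F.position b) v (!F.position b v) = F.position (s F.root)) : v = F.root := by
  by_contra hv
  have := congrFun h v
  rw [Function.update_self, position, position, if_neg hv, if_neg hv] at this
  revert this
  cases decide (v ∈ F.tree) <;> decide

/-- Changing the choice in any factor but that of the root leaves the surviving positions, so only
the root contributes to the compressed differential. There `lam` and `kap` act as the two entries of
the open factorization. -/
theorem project_d_embed : F.project κ hL hP ∘ₗ koszul D.toGluing D.lam D.kap ∘ₗ F.embed κ =
    D.delooped.d := by
  refine D.deloopedBasis.ext fun i => ?_
  obtain ⟨b, ε⟩ := i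
  rw [LinearMap.comp_apply, LinearMap.comp_apply, embed_basis, delooped_d_basis]
  refine D.deloopedBasis.repr.injective (Finsupp.ext fun i => ?_)
  obtain ⟨b', ε'⟩ := i
  rw [repr_project, koszul_erase _ _ _ F.root, Finset.sum_eq_zero, add_zero, position_root,
    map_smul, Module.Basis.repr_self, Finsupp.smul_single, smul_eq_mul, mul_one]
  · dsimp only
    have hu : Function.update (F.position b') F.root (!b') = F.position (!b') := by
      funext v
      by_cases hv : v = F.root
      · rw [hv, Function.update_self, position_root]
      · rw [Function.update_of_ne hv, position, position, if_neg hv, if_neg hv]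
    rw [hu]
    by_cases hb : b' = !b
    · subst hb
      rw [Bool.not_not, Pi.single_eq_same]
      have : ∀ s : BoundaryRing, (Finsupp.single ((!b, ε) : Bool × (D.closedComponents → Fin 2)) s)
          (!b, ε') = s * F.coeff κ hL hP ε' (circleMon κ ε) := by
        intro s
        rw [coeff_circleMon, Finsupp.single_apply]
        simp
      rw [this]
      cases b
      · simp [coeff_kap_root_mul]
      · simp [coeff_lam_root_mul]
    · rw [Pi.single_eq_of_ne, mul_zero, map_zero, Finsupp.single_eq_of_ne]
      · exact fun h => hb (congrArg Prod.fst h)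
      · intro h
        have := congrFun h F.root
        rw [position_root, position_root] at this
        exact hb (by rw [← this, Bool.not_not])
  · intro v hv
    rw [Pi.single_eq_of_ne, mul_zero]
    intro h
    refine Finset.ne_of_mem_erase hv (F.update_position v b' (fun _ => b) h)

theorem project_survive : F.project κ hL hP ∘ₗ F.survive κ hL hP = F.project κ hL hP := by
  have : F.survive κ hL hP = F.embed κ ∘ₗ F.project κ hL hP :=
    LinearMap.ext fun m => (F.embed_project κ hL hP m).symm
  rw [this, ← LinearMap.comp_assoc, project_embed, LinearMap.id_comp]

theorem survive_embed : F.survive κ hL hP ∘ₗ F.embed κ = F.embed κ := by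
  have : F.survive κ hL hP = F.embed κ ∘ₗ F.project κ hL hP :=
    LinearMap.ext fun m => (F.embed_project κ hL hP m).symm
  rw [this, LinearMap.comp_assoc, project_embed, LinearMap.comp_id]

/-- The projection of the Koszul complex to its retract. -/
def perturb : Module.End BoundaryRing (TensorModule D.toGluing) :=
  1 - koszul D.toGluing D.lam D.kap * F.htpy κ hL hP -
    F.htpy κ hL hP * koszul D.toGluing D.lam D.kap

theorem weight_position (κ : D.toGluing.Colouring) (b : Bool) :
    weight (F.position b) = (if b then 1 else 0) + Nat.card D.closedComponents := by
  rw [weight_eq_sum, ← Finset.add_sum_erase _ _ (Finset.mem_univ F.root), position_root,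
    ← F.card_tree κ]
  congr 1
  rw [Finset.sum_congr rfl (g := fun v => if v ∈ F.tree then (1 : ℤ) else 0) fun v hv => by
    rw [position, if_neg (Finset.ne_of_mem_erase hv)]; simp, Finset.sum_boole]
  congr 2
  ext v
  simp only [Finset.mem_filter, Finset.mem_erase, Finset.mem_univ, and_true, and_iff_right_iff_imp]
  exact fun hv h => F.root_notMem (h ▸ hv)

theorem project_mem {n : ℤ} {m : TensorModule D.toGluing} (hm : m ∈ D.factorization.gr n) :
    F.project κ hL hP m ∈ D.delooped.gr n := by
  rw [mem_delooped_gr_iff]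
  rintro ⟨b, ε⟩
  rw [repr_project]
  refine F.coeff_mem κ hL hP ((mem_factorization_gr_iff D n m).mp hm _) _ ?_
  rw [basisDeg, F.weight_position κ, Finset.sum_sub_distrib, ← Finset.mul_sum, Finset.sum_const,
    Finset.card_univ, ← Nat.card_eq_fintype_card]
  simp only [nsmul_eq_mul, mul_one]
  ring

theorem embed_hasDegree :
    Factorization.HasDegree (M := D.delooped) (N := D.factorization) (F.embed κ) 0 := by
  refine D.hasDegree_of_basis _ _ fun i n r hr => ?_
  obtain ⟨b, ε⟩ := i
  refine (mem_factorization_gr_iff D _ _).mpr fun s => ?_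
  change r • (F.embed κ (D.deloopedBasis (b, ε)) s) ∈ _
  rw [F.embed_basis κ (b, ε)]
  by_cases hs : s = F.position b
  · rw [hs, Pi.single_eq_same, F.weight_position κ]
    refine smul_mem_piece hr (circleMon_mem κ ε) ?_
    rw [basisDeg, Finset.sum_sub_distrib, ← Finset.mul_sum, Finset.sum_const,
      Finset.card_univ, ← Nat.card_eq_fintype_card]
    simp only [nsmul_eq_mul, mul_one]
    push_cast
    ring
  · rw [Pi.single_eq_of_ne hs, smul_zero]
    exact AddSubgroup.zero_mem _

theorem perturb_mem : F.perturb κ hL hP ∈ endDeg D 0 := by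
  have hd : koszul D.toGluing D.lam D.kap ∈ endDeg D (-3) :=
    D.factorization_isMatrixFactorization.2
  have hh := F.htpy_mem κ hL hP
  refine AddSubgroup.sub_mem _ (AddSubgroup.sub_mem _ ?_ ?_) ?_
  · intro n m hm
    rw [add_zero]; exact hm
  · intro n m hm
    have := hd _ _ (hh n m hm)
    rwa [add_assoc] at this
  · intro n m hm
    have := hh _ _ (hd n m hm)
    rwa [add_assoc] at this

theorem project_perturb_embed :
    F.project κ hL hP ∘ₗ F.perturb κ hL hP ∘ₗ F.embed κ = LinearMap.id := by
  rw [← F.project_survive, LinearMap.comp_assoc, ← LinearMap.comp_assoc _ _ (F.survive κ hL hP)]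
  have h : F.survive κ hL hP ∘ₗ F.perturb κ hL hP = F.survive κ hL hP :=
    (F.contracts_htpy κ hL hP).proj_mul_homotopy
  rw [h, survive_embed, project_embed]

theorem perturb_embed_project :
    (F.perturb κ hL hP ∘ₗ F.embed κ) ∘ₗ F.project κ hL hP = F.perturb κ hL hP := by
  refine (LinearMap.ext fun m => ?_ : _ = F.perturb κ hL hP * F.survive κ hL hP).trans
    (F.contracts_htpy κ hL hP).homotopy
  change F.perturb κ hL hP (F.embed κ _) = F.perturb κ hL hP _
  rw [embed_project]

theorem delooped_d_project (m : TensorModule D.toGluing) :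
    D.delooped.d (F.project κ hL hP m) = F.project κ hL hP (koszul D.toGluing D.lam D.kap m) := by
  rw [← F.project_d_embed κ hL hP, LinearMap.comp_apply, LinearMap.comp_apply, embed_project,
    ← F.project_survive, LinearMap.comp_apply, LinearMap.comp_apply]
  exact congrArg _ (LinearMap.congr_fun (F.contracts_htpy κ hL hP).proj_d m)

theorem d_perturb_embed (x : D.delooped.carrier) :
    koszul D.toGluing D.lam D.kap (F.perturb κ hL hP (F.embed κ x)) =
      F.perturb κ hL hP (F.embed κ (D.delooped.d x)) := by
  have h1 := LinearMap.congr_fun (Contracts.commute_d (h := F.htpy κ hL hP) (koszul_sq D))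
    (F.embed κ x)
  have h2 := LinearMap.congr_fun (F.contracts_htpy κ hL hP).homotopy
    (koszul D.toGluing D.lam D.kap (F.embed κ x))
  rw [← F.project_d_embed κ hL hP, LinearMap.comp_apply, LinearMap.comp_apply, embed_project]
  exact h1.symm.trans h2.symm

theorem _root_.Delooping.BoundaryRing.module_add_self {N : Type*} [AddCommGroup N]
    [Module BoundaryRing N] (x : N) : x + x = 0 := by
  rw [← two_smul BoundaryRing, BoundaryRing.two_eq_zero, zero_smul]

/-- The special deformation retract onto the delooped factorization. -/
def retract : Factorization.SpecialDeformationRetract D.factorization D.delooped where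
  proj := F.project κ hL hP
  -- The section `embed` need not commute with the differentials. Composing it with 1 - dh - hd
  -- corrects this and does not affect its projection.
  incl := F.perturb κ hL hP ∘ₗ F.embed κ
  htpy := F.htpy κ hL hP
  boundary_proj := by
    refine LinearMap.ext fun m : TensorModule D.toGluing => ?_
    change D.delooped.d (F.project κ hL hP m) + F.project κ hL hP (koszul _ _ _ m) = 0
    rw [delooped_d_project, BoundaryRing.module_add_self]
  boundary_incl := by
    refine LinearMap.ext fun x => ?_
    change koszul _ _ _ (F.perturb κ hL hP (F.embed κ x)) + F.perturb κ hL hP _ = 0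
    rw [d_perturb_embed]
    exact BoundaryRing.module_add_self _
  proj_degree := by
    intro n m hm
    rw [add_zero]
    exact F.project_mem κ hL hP hm
  incl_degree := by
    intro n x hx
    have := F.perturb_mem κ hL hP _ _ (F.embed_hasDegree κ n x hx)
    rwa [add_zero] at this
  htpy_degree := F.htpy_mem κ hL hP
  proj_incl := F.project_perturb_embed κ hL hP
  incl_proj := by
    have h := congrArg (1 - ·) (F.perturb_embed_project κ hL hP)
    refine h.trans ?_
    change 1 - (1 - koszul D.toGluing D.lam D.kap * F.htpy κ hL hP -
      F.htpy κ hL hP * koszul D.toGluing D.lam D.kap) =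
      koszul D.toGluing D.lam D.kap * F.htpy κ hL hP +
      F.htpy κ hL hP * koszul D.toGluing D.lam D.kap
    abel
  htpy_htpy := (F.contracts_htpy κ hL hP).sq
  htpy_incl := by
    have h : F.htpy κ hL hP ∘ₗ F.perturb κ hL hP = 0 := (F.contracts_htpy κ hL hP).mul_homotopy
    refine LinearMap.ext fun x => ?_
    exact LinearMap.congr_fun h (F.embed κ x)
  proj_htpy := by
    have h : F.survive κ hL hP ∘ₗ F.htpy κ hL hP = 0 := (F.contracts_htpy κ hL hP).proj_mul
    change F.project κ hL hP ∘ₗ F.htpy κ hL hP = 0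
    rw [← F.project_survive, LinearMap.comp_assoc, h, LinearMap.comp_zero]

variable (D) in
/-- Multiplication by an element of the reduced edge ring. -/
def _root_.Delooping.Crossingless.act (r : D.ReducedRing) :
    D.factorization.carrier →ₗ[BoundaryRing] D.factorization.carrier :=
  (LinearMap.pi fun s => LinearMap.mulLeft BoundaryRing r ∘ₗ LinearMap.proj s :
    TensorModule D.toGluing →ₗ[BoundaryRing] TensorModule D.toGluing)

/-- The inclusion differs from `embed` only by a term in the image of the homotopy h, since h itself
vanishes on the image of `embed`. The projection kills h, and even r·h, because the coefficients of
a multiple depend only on the coefficients. So the induced action is multiplication of circle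
monomials modulo the eliminating entries. -/
theorem retract_proj_act_incl (r : D.ReducedRing) (b : Bool) (ε : D.closedComponents → Fin 2) :
    (F.retract κ hL hP).proj (D.act r ((F.retract κ hL hP).incl (D.deloopedBasis (b, ε)))) =
      ∑ ε', F.coeff κ hL hP ε' (r * circleMon κ ε) • D.deloopedBasis (b, ε') := by
  rw [← F.project_mul_embed]
  change F.project κ hL hP _ = F.project κ hL hP _
  set x := F.embed κ (D.deloopedBasis (b, ε)) with hx
  have hE : F.survive κ hL hP x = x := LinearMap.congr_fun (F.survive_embed κ hL hP) _
  have hh : F.htpy κ hL hP x = 0 := by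
    rw [← hE]
    exact LinearMap.congr_fun (F.contracts_htpy κ hL hP).mul_proj x
  have h0 : ∀ y, F.project κ hL hP (r • F.htpy κ hL hP y) = 0 := by
    intro y
    have h1 : F.project κ hL hP (F.htpy κ hL hP y) = 0 :=
      LinearMap.congr_fun (F.retract κ hL hP).proj_htpy y
    refine D.deloopedBasis.repr.injective (Finsupp.ext fun i => ?_)
    rw [repr_project, Pi.smul_apply, smul_eq_mul, coeff_mul, map_zero, Finset.sum_eq_zero]
    · rfl
    · intro ε' _
      rw [← F.repr_project κ hL hP _ (i.1, ε'), h1, map_zero]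
      exact zero_mul _
  have hp : F.perturb κ hL hP x = x - F.htpy κ hL hP (koszul D.toGluing D.lam D.kap x) := by
    change x - koszul D.toGluing D.lam D.kap (F.htpy κ hL hP x) - _ = _
    rw [hh, map_zero, sub_zero]
    rfl
  change F.project κ hL hP (r • F.perturb κ hL hP x) = _
  rw [hp, smul_sub, map_sub, h0, sub_zero]

end Frame

end Crossingless

/-! ## The change of components under a saddle -/

/-- The crossingless diagram with a given gluing and given kinds of arcs. -/
abbrev Gluing.dress {V : Type*} (G : Gluing V) (k : V → ArcKind) : Crossingless V := ⟨G, k⟩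

namespace Crossingless

open Gluing

section Through

variable {V : Type*} (D : Crossingless V)

theorem through_iff_incident {c : Set D.Edge} {v : V} :
    D.Through c v ↔ ∃ e, D.Incident e v ∧ e ∈ c := by
  constructor
  · rintro ⟨s, h | h⟩
    · exact ⟨_, ⟨s, Or.inl rfl⟩, h⟩
    · exact ⟨_, ⟨s, Or.inr rfl⟩, h⟩
  · rintro ⟨e, ⟨s, rfl | rfl⟩, h⟩
    · exact ⟨s, Or.inl h⟩
    · exact ⟨s, Or.inr h⟩

variable {D}

theorem through_component_of_incident {e : D.Edge} {v : V} (h : D.Incident e v) :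
    D.Through (D.component e) v :=
  D.through_iff_incident.mpr ⟨e, h, self_mem_component e⟩

theorem component_eq_strand {e : D.Edge} {v : V} (h : D.Through (D.component e) v) :
    D.component e = D.component (D.firstStrand v) ∨
      D.component e = D.component (D.secondStrand v) := by
  obtain ⟨x, hx, hxe⟩ := D.through_iff_incident.mp h
  rw [← component_eq hxe]
  exact invariant_component.incident_eq hx

/-- At most two components run through a vertex. -/
theorem component_eq_of_through {e₁ e₂ e : D.Edge} {v : V} (h₁ : D.Through (D.component e₁) v)
    (h₂ : D.Through (D.component e₂) v) (h₁₂ : D.component e₁ ≠ D.component e₂)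
    (h : D.Through (D.component e) v) :
    D.component e = D.component e₁ ∨ D.component e = D.component e₂ := by
  rcases component_eq_strand h₁ with h1 | h1 <;> rcases component_eq_strand h₂ with h2 | h2 <;>
    rcases component_eq_strand h with h3 | h3 <;> rw [h1, h2, h3] <;> simp_all

theorem through_component_iff_of_mem {e e' : D.Edge} {v : V} (h : e' ∈ D.component e) :
    D.Through (D.component e') v ↔ D.Through (D.component e) v := by
  rw [component_eq h]

variable (D) in
open Classical in
/-- The closed components that run through a vertex. -/
def circlesThrough [Fintype V] (v : V) : Finset D.closedComponents :=
  Finset.univ.filter fun c => D.Through c.1 v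

variable (D) in
open Classical in
/-- The closed components that do not run through a vertex. -/
def circlesAway [Fintype V] (v : V) : Finset D.closedComponents :=
  Finset.univ.filter fun c => ¬ D.Through c.1 v

theorem mem_circlesAway [Fintype V] {v : V} {c : D.closedComponents} :
    c ∈ D.circlesAway v ↔ ¬ D.Through c.1 v := by
  simp [circlesAway]

theorem mem_circlesThrough [Fintype V] {v : V} {c : D.closedComponents} :
    c ∈ D.circlesThrough v ↔ D.Through c.1 v := by
  simp [circlesThrough]

theorem circlesAt_eq [Fintype V] (v : V) : D.circlesAt v = (D.circlesThrough v).card := by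
  classical
  rw [circlesAt, Nat.card_eq_fintype_card, Fintype.card_subtype]
  congr!

theorem card_closedComponents [Fintype V] (v : V) :
    Nat.card D.closedComponents = D.circlesAt v + (D.circlesAway v).card := by
  rw [circlesAt_eq, circlesThrough, circlesAway, Finset.card_filter_add_card_filter_not,
    Nat.card_eq_fintype_card, Finset.card_univ]

theorem ysAt_eq [Fintype V] (v : V) (ε : D.closedComponents → Fin 2) :
    D.ysAt v ε = ∑ c ∈ D.circlesThrough v, (ε c : ℕ) := by
  classical
  have h : ∀ a : Fin 2, (a : ℕ) = if a = 1 then 1 else 0 := by decide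
  rw [ysAt, Nat.card_eq_fintype_card, Fintype.card_subtype, Finset.sum_congr rfl fun c _ => h (ε c),
    Finset.sum_boole, circlesThrough, Finset.filter_filter]
  simp

theorem mem_iff_of_joined {c : Set D.Edge} (hc : c ∈ D.closedComponents) {e e' : D.Edge}
    (h : D.Joined e e') : e ∈ c ↔ e' ∈ c := by
  obtain ⟨⟨x, rfl⟩, -⟩ := hc
  rw [mem_component_comm, invariant_component e e' h, mem_component_comm]

/-- A closed component is not an open one. -/
theorem component_ne_of_closed {c : Set D.Edge} (hc : c ∈ D.closedComponents) (s : Side) :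
    D.component (D.topEnd s) ≠ c ∧ D.component (D.bottomEnd s) ≠ c :=
  ⟨fun h => (hc.2 s).2 (h ▸ self_mem_component _), fun h => (hc.2 s).1 (h ▸ self_mem_component _)⟩

theorem through_rep [Fintype V] {c : Set D.Edge} (hc : c ∈ D.closedComponents) {v : V} :
    D.Through (D.component (D.rep c)) v ↔ D.Through c v := by rw [component_rep hc]

theorem circlesAt_le_two [Fintype V] (v : V) : D.circlesAt v ≤ 2 := by
  classical
  rw [circlesAt_eq]
  refine le_trans (Finset.card_le_card_of_injOn (t := {D.component (D.firstStrand v),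
    D.component (D.secondStrand v)}) (fun c => c.1) ?_ fun a _ b _ h => Subtype.ext h)
    Finset.card_le_two
  intro c hc
  have hc' := (through_rep c.2).mpr (mem_circlesThrough.mp hc)
  have := component_eq_strand hc'
  rw [component_rep c.2] at this
  simpa using this

/-- If the ends are away from a vertex, the components at the vertex are closed. -/
theorem component_closed_of_through (κ : D.toGluing.Colouring) [Fintype V] {v : V} {e : D.Edge}
    (h : D.Through (D.component e) v) (h1 : ¬ D.Through (D.component (D.topEnd Side.left)) v)
    (h2 : ¬ D.Through (D.component (D.bottomEnd Side.right)) v) :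
    D.component e ∈ D.closedComponents := by
  refine component_mem_closedComponents κ (fun hm => h1 ?_) (fun hm => h2 ?_)
  · rwa [component_eq hm]
  · rwa [component_eq hm]

end Through

section Change

variable {V : Type*} {G : Gluing V} {k k' : V → ArcKind} {v : V}

theorem joined_of_ne (hk : ∀ u, u ≠ v → k u = k' u) {e e' : G.Edge}
    (h : (G.dress k').Joined e e') :
    (G.dress k).Joined e e' ∨ (G.Incident e v ∧ G.Incident e' v) := by
  cases h with
  | dotted u s h =>
    by_cases hu : u = v
    · subst hu; exact Or.inr ⟨⟨s, Or.inl rfl⟩, ⟨s, Or.inr rfl⟩⟩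
    · exact Or.inl (Joined.dotted (D := G.dress k) u s ((hk u hu).trans h))
  | thickIn u h =>
    by_cases hu : u = v
    · subst hu; exact Or.inr ⟨⟨_, Or.inl rfl⟩, ⟨_, Or.inl rfl⟩⟩
    · exact Or.inl (Joined.thickIn (D := G.dress k) u ((hk u hu).trans h))
  | thickOut u h =>
    by_cases hu : u = v
    · subst hu; exact Or.inr ⟨⟨_, Or.inr rfl⟩, ⟨_, Or.inr rfl⟩⟩
    · exact Or.inl (Joined.thickOut (D := G.dress k) u ((hk u hu).trans h))

/-- Changing the kind of one arc only rejoins edges at `v` among themselves, so an invariant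
function that is constant on the edges at `v` stays invariant. -/
theorem Invariant.change (hk : ∀ u, u ≠ v → k u = k' u) {α : Type*} {g : G.Edge → α}
    (hg : (G.dress k).Invariant g)
    (h : ∀ e e', G.Incident e v → G.Incident e' v → g e = g e') : (G.dress k').Invariant g := by
  intro e e' hj
  rcases joined_of_ne hk hj with hj | ⟨h1, h2⟩
  · exact hg e e' hj
  · exact h e e' h1 h2

/-- Running through `v` is an invariant property that holds for all edges at `v`, so it does not
depend on the kind of the arc there. -/
theorem through_of_through (hk : ∀ u, u ≠ v → k u = k' u) {e : G.Edge}
    (h : (G.dress k').Through ((G.dress k').component e) v) :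
    (G.dress k).Through ((G.dress k).component e) v := by
  have hinv : (G.dress k).Invariant fun e => (G.dress k).Through ((G.dress k).component e) v :=
    fun e e' hj => by dsimp only; rw [invariant_component e e' hj]
  have hinv' := hinv.change hk fun e e' he he' => by
    rw [eq_iff_iff]
    exact iff_of_true (through_component_of_incident (D := G.dress k) he)
      (through_component_of_incident (D := G.dress k) he')
  obtain ⟨x, hx, hxe⟩ := (through_iff_incident _).mp h
  rw [hinv'.eq_of_mem hxe]
  exact through_component_of_incident (D := G.dress k) hx

theorem through_congr (hk : ∀ u, u ≠ v → k u = k' u) (e : G.Edge) :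
    (G.dress k').Through ((G.dress k').component e) v ↔
      (G.dress k).Through ((G.dress k).component e) v :=
  ⟨through_of_through hk, through_of_through fun u hu => (hk u hu).symm⟩

/-- The characteristic function of such a component is zero on all edges at `v`, hence stays
invariant; by symmetry the two components contain each other. -/
theorem component_eq_of_not_through (hk : ∀ u, u ≠ v → k u = k' u) {e : G.Edge}
    (h : ¬ (G.dress k).Through ((G.dress k).component e) v) :
    (G.dress k').component e = (G.dress k).component e := by
  have key : ∀ {k k' : V → ArcKind}, (∀ u, u ≠ v → k u = k' u) →
      ¬ (G.dress k).Through ((G.dress k).component e) v →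
      (G.dress k').component e ⊆ (G.dress k).component e := by
    intro k k' hk h x hx
    have hinv : (G.dress k).Invariant fun x => x ∈ (G.dress k).component e := by
      intro a b hj
      have := invariant_component a b hj
      dsimp only
      rw [eq_iff_iff, mem_component_comm, this, mem_component_comm]
    have hinv' := hinv.change hk fun a b ha hb => by
      rw [eq_iff_iff]
      exact iff_of_false (fun hm => h ((through_iff_incident _).mpr ⟨a, ha, hm⟩))
        (fun hm => h ((through_iff_incident _).mpr ⟨b, hb, hm⟩))
    rw [← hinv'.eq_of_mem hx]
    exact self_mem_component e
  exact (key hk h).antisymm (key (fun u hu => (hk u hu).symm) fun h' => h (through_of_through hk h'))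

/-- A closed component away from the saddle is common to both diagrams. -/
theorem closed_of_not_through (hk : ∀ u, u ≠ v → k u = k' u) {c : Set G.Edge}
    (hc : c ∈ (G.dress k).closedComponents) (h : ¬ (G.dress k).Through c v) :
    c ∈ (G.dress k').closedComponents := by
  obtain ⟨⟨e, rfl⟩, hc⟩ := hc
  exact ⟨⟨e, (component_eq_of_not_through hk h).symm⟩, hc⟩

open Classical in
/-- If the open components are connected differently, they run through the saddle. -/
theorem through_of_openKind_ne [Fintype V] (κ : G.Colouring) (hk : ∀ u, u ≠ v → k u = k' u)
    (h : (G.dress k).openKind ≠ (G.dress k').openKind) :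
    (G.dress k).Through ((G.dress k).component (G.topEnd Side.left)) v ∧
      (G.dress k).Through ((G.dress k).component (G.bottomEnd Side.right)) v := by
  constructor
  · by_contra ht
    have := component_eq_of_not_through hk ht
    refine h ?_
    rw [openKind, openKind]
    refine if_congr ?_ rfl rfl
    change G.bottomEnd Side.left ∈ (G.dress k).component (G.topEnd Side.left) ↔
      G.bottomEnd Side.left ∈ (G.dress k').component (G.topEnd Side.left)
    rw [this]
  · by_contra ht
    have heq := component_eq_of_not_through hk ht
    have hne : ∀ e ∈ (G.dress k').component (G.bottomEnd Side.right),
        e ∉ (G.dress k').special := by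
      intro e he hs
      refine bottomEnd_right_notMem_special (D := G.dress k') κ ?_
      have h1 := component_eq he
      have h2 := component_eq hs
      rw [special, ← h2, h1]
      exact self_mem_component _
    refine h ?_
    rcases hd : (G.dress k).openKind with _ | _
    · have h1 := topEnd_right_mem (D := G.dress k) κ hd
      change _ ∈ (G.dress k).component (G.bottomEnd Side.right) at h1
      rw [← heq] at h1
      rcases hd' : (G.dress k').openKind with _ | _
      · rfl
      · exact absurd (topEnd_right_mem_special (D := G.dress k') κ hd') (hne _ h1)
    · have h1 := bottomEnd_left_mem (D := G.dress k) κ hd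
      change _ ∈ (G.dress k).component (G.bottomEnd Side.right) at h1
      rw [← heq] at h1
      rcases hd' : (G.dress k').openKind with _ | _
      · exact absurd (bottomEnd_left_mem_special (D := G.dress k') hd') (hne _ h1)
      · rfl

/-- Both open components run through the saddle, and there is no room for a third component. -/
theorem circlesAt_eq_zero_of_openKind_ne [Fintype V] (κ : G.Colouring)
    (hk : ∀ u, u ≠ v → k u = k' u) (h : (G.dress k).openKind ≠ (G.dress k').openKind) :
    (G.dress k).circlesAt v = 0 := by
  rw [circlesAt_eq, Finset.card_eq_zero, Finset.eq_empty_iff_forall_notMem]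
  intro c hc
  rw [mem_circlesThrough] at hc
  obtain ⟨h1, h2⟩ := through_of_openKind_ne κ hk h
  have hne : (G.dress k).component (G.topEnd Side.left) ≠
      (G.dress k).component (G.bottomEnd Side.right) := fun h' =>
    bottomEnd_right_notMem_special (D := G.dress k) κ (by
      rw [special]
      change _ ∈ (G.dress k).component (G.topEnd Side.left)
      rw [h']
      exact self_mem_component _)
  have := component_eq_of_through h1 h2 hne ((through_rep c.2).mpr hc)
  rw [component_rep c.2] at this
  rcases this with h | h
  · exact (component_ne_of_closed c.2 Side.left).1 h.symm
  · exact (component_ne_of_closed c.2 Side.right).2 h.symm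

variable [Fintype V]

theorem card_circlesAway (hk : ∀ u, u ≠ v → k u = k' u) :
    ((G.dress k).circlesAway v).card = ((G.dress k').circlesAway v).card := by
  refine Finset.card_bij
    (fun c hc => ⟨c.1, closed_of_not_through hk c.2 (mem_circlesAway.mp hc)⟩) ?_ ?_ ?_
  · exact fun c hc => mem_circlesAway.mpr (mem_circlesAway (D := G.dress k).mp hc)
  · exact fun c _ c' _ h => Subtype.ext (congrArg (fun x => x.1) h)
  · intro c hc
    exact ⟨⟨c.1, closed_of_not_through (fun u hu => (hk u hu).symm) c.2 (mem_circlesAway.mp hc)⟩,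
      mem_circlesAway.mpr (mem_circlesAway (D := G.dress k').mp hc), rfl⟩

/-- A closed component of both diagrams that runs through the saddle is the only one. -/
theorem circlesAt_eq_one (hv : k v ≠ k' v) {c : Set G.Edge}
    (hc : c ∈ (G.dress k).closedComponents) (hc' : c ∈ (G.dress k').closedComponents)
    (h : (G.dress k).Through c v) : (G.dress k).circlesAt v = 1 := by
  -- A set that is closed under the joining rules of both the dotted and the thick arc contains all
  -- four edge ends at `v` as soon as it contains one.
  have hall : ∀ e, G.Incident e v → e ∈ c := by
    have key : ∀ {k k' : V → ArcKind}, c ∈ (G.dress k).closedComponents →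
        c ∈ (G.dress k').closedComponents → k v = ArcKind.dotted → k' v = ArcKind.thick →
        (G.dress k).Through c v → ∀ e, G.Incident e v → e ∈ c := by
      intro k k' hc hc' hd ht h
      have h1 := fun s => mem_iff_of_joined hc (Joined.dotted (D := G.dress k) v s hd)
      have h2 := mem_iff_of_joined hc' (Joined.thickIn (D := G.dress k') v ht)
      have h3 := h1 Side.left
      have h4 := h1 Side.right
      have h0 : G.inEdge v Side.left ∈ c := by
        obtain ⟨s, hs⟩ := h
        cases s <;> rcases hs with hs | hs
        · exact hs
        · exact h3.mpr hs
        · exact h2.mpr hs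
        · exact h2.mpr (h4.mpr hs)
      rintro e ⟨s, rfl | rfl⟩ <;> cases s
      · exact h0
      · exact h2.mp h0
      · exact h3.mp h0
      · exact h4.mp (h2.mp h0)
    rcases kind_eq (G.dress k) v with h1 | h1 <;> rcases kind_eq (G.dress k') v with h2 | h2
    · exact absurd (h1.trans h2.symm) hv
    · exact key hc hc' h1 h2 h
    · exact key hc' hc h2 h1 h
    · exact absurd (h1.trans h2.symm) hv
  rw [circlesAt_eq, Finset.card_eq_one]
  refine ⟨⟨c, hc⟩, Finset.eq_singleton_iff_unique_mem.mpr ⟨mem_circlesThrough.mpr h, ?_⟩⟩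
  intro c₁ hc₁
  obtain ⟨e, he, hec⟩ := (through_iff_incident _).mp (mem_circlesThrough.mp hc₁)
  exact Subtype.ext ((eq_component_of_mem_closed c₁.2 hec).trans
    (eq_component_of_mem_closed hc (hall e he)).symm)

end Change

end Crossingless

/-! ### Calculations modulo an ideal `Q` of the boundary ring. -/

/-- The evaluation at `x = y = 0`. -/
def evalZ : BoundaryRing →+* Polynomial (ZMod 2) :=
  (MvPolynomial.aeval (R := ZMod 2) ![0, 0, Polynomial.X]).toRingHom.comp
    BoundaryRing.equiv.toRingHom

theorem evalZ_bx : evalZ bx = 0 := by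
  change MvPolynomial.aeval _ (MvPolynomial.X 0) = _
  rw [MvPolynomial.aeval_X]; rfl

theorem evalZ_bY : evalZ bY = 0 := by
  change MvPolynomial.aeval _ (MvPolynomial.X 1) = _
  rw [MvPolynomial.aeval_X]; rfl

theorem evalZ_bz : evalZ bz = Polynomial.X := by
  change MvPolynomial.aeval _ (MvPolynomial.X 2) = _
  rw [MvPolynomial.aeval_X]; rfl

theorem evalZ_bH : evalZ bH = Polynomial.X := by
  rw [bH, map_add, map_add, evalZ_bx, evalZ_bY, evalZ_bz, add_zero, zero_add]

theorem ArcKind.evalZ_fst (k : ArcKind) : evalZ k.fst = 0 := by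
  cases k
  · exact evalZ_bx
  · exact evalZ_bY

theorem ArcKind.evalZ_snd (k : ArcKind) : evalZ k.snd = 0 := by
  cases k
  · change evalZ (bY * bz) = 0
    rw [map_mul, evalZ_bY, zero_mul]
  · change evalZ (bx * bz) = 0
    rw [map_mul, evalZ_bx, zero_mul]

namespace Crossingless

open Gluing

variable {V : Type*} [Fintype V] [DecidableEq V] {D : Crossingless V}

theorem circleMon_zero (κ : D.toGluing.Colouring) : Frame.circleMon (D := D) κ 0 = 1 := by
  simp [Frame.circleMon]

theorem circleMon_single [DecidableEq D.closedComponents] (κ : D.toGluing.Colouring)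
    (c : D.closedComponents) :
    Frame.circleMon (D := D) κ (Pi.single c 1) = κ.circleVar c.1 := by
  rw [Frame.circleMon, Finset.prod_eq_single c]
  · simp
  · intro c' _ h
    rw [Pi.single_eq_of_ne h]
    simp
  · simp

namespace Frame

variable (F : D.Frame) (κ : D.toGluing.Colouring) (hL : D.Linked) (hP : D.Planar)
variable (Q : Ideal BoundaryRing)

/-- The elements whose coefficients lie in the ideal `Q`. -/
def residue : Ideal D.ReducedRing where
  carrier := {r | ∀ ε, F.coeff κ hL hP ε r ∈ Q}
  zero_mem' := fun ε => by rw [map_zero]; exact Q.zero_mem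
  add_mem' := fun ha hb ε => by rw [map_add]; exact Q.add_mem (ha ε) (hb ε)
  smul_mem' := fun t r hr ε => by
    rw [smul_eq_mul, coeff_mul]
    exact Q.sum_mem fun ε' _ => Q.mul_mem_right _ (hr ε')

theorem mem_residue {r : D.ReducedRing} :
    r ∈ F.residue κ hL hP Q ↔ ∀ ε, F.coeff κ hL hP ε r ∈ Q := Iff.rfl

variable {Q}

theorem beta_mem_residue (j : F.Arc) : F.beta j ∈ F.residue κ hL hP Q := fun ε => by
  rw [← mul_one (F.beta j), coeff_beta_mul]
  exact Q.zero_mem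

theorem smul_mem_residue {s : BoundaryRing} (hs : s ∈ Q) (r : D.ReducedRing) :
    s • r ∈ F.residue κ hL hP Q := fun ε => by
  rw [map_smul]
  exact Q.mul_mem_right _ hs

theorem algebraMap_mem_residue {s : BoundaryRing} (hs : s ∈ Q) :
    algebraMap BoundaryRing _ s ∈ F.residue κ hL hP Q := by
  rw [Algebra.algebraMap_eq_smul_one]
  exact F.smul_mem_residue κ hL hP hs 1

variable (Q) in
/-- The reduction modulo `residue`. -/
abbrev mkResidue : D.ReducedRing →+* D.ReducedRing ⧸ F.residue κ hL hP Q :=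
  Ideal.Quotient.mk _

theorem mkResidue_eq_iff {a b : D.ReducedRing} :
    F.mkResidue κ hL hP Q a = F.mkResidue κ hL hP Q b ↔ a + b ∈ F.residue κ hL hP Q := by
  rw [Ideal.Quotient.eq, D.sub_eq]

theorem mkResidue_two : (2 : D.ReducedRing ⧸ F.residue κ hL hP Q) = 0 := by
  rw [← map_ofNat (F.mkResidue κ hL hP Q) 2, D.two_eq_zero, map_zero]

/-- Modulo `residue` every element is represented by its combination of circle monomials, and this
remains true for every choice of `Q`. -/
theorem mkResidue_sum_coeff (r : D.ReducedRing) : F.mkResidue κ hL hP Q r =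
    F.mkResidue κ hL hP Q (∑ ε, F.coeff κ hL hP ε r • circleMon κ ε) := by
  rw [mkResidue_eq_iff]
  intro ε
  rw [map_add, map_sum]
  simp only [map_smul, coeff_circleMon, smul_eq_mul, mul_ite, mul_one, mul_zero, Finset.sum_ite_eq',
    Finset.mem_univ, if_true]
  rw [BoundaryRing.module_add_self]
  exact Q.zero_mem

theorem lam_mem_residue (hp : D.openKind.fst ∈ Q) (v : V) : D.lam v ∈ F.residue κ hL hP Q := by
  refine F.lam_mem_of_mem κ
    (AddSubgroup.toZModSubmodule 2 (F.residue κ hL hP Q).toAddSubgroup) ?_ ?_ v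
  · intro v hv h
    have := F.beta_mem_residue κ hL hP (Q := Q) ⟨v, h⟩
    rwa [F.beta_notMem hv h] at this
  · exact F.algebraMap_mem_residue κ hL hP hp

theorem mkResidue_edgeVar (hp : D.openKind.fst ∈ Q) {e e' : D.Edge} (h : e' ∈ D.component e) :
    F.mkResidue κ hL hP Q (κ.edgeVar e) = F.mkResidue κ hL hP Q (κ.edgeVar e') := by
  rw [mkResidue_eq_iff]
  exact edgeVar_add_mem κ
    (AddSubgroup.toZModSubmodule 2 (F.residue κ hL hP Q).toAddSubgroup)
    (F.lam_mem_residue κ hL hP hp) h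

theorem mkResidue_edgeVar_top (hp : D.openKind.fst ∈ Q) {e : D.Edge}
    (h : D.topEnd Side.left ∈ D.component e) :
    F.mkResidue κ hL hP Q (κ.edgeVar e) = F.mkResidue κ hL hP Q (algebraMap _ _ bH) := by
  rw [F.mkResidue_edgeVar κ hL hP hp h, κ.edgeVar_topEnd_left, algebraMap_bH]

theorem mkResidue_edgeVar_bottom (hp : D.openKind.fst ∈ Q) {e : D.Edge}
    (h : D.bottomEnd Side.right ∈ D.component e) :
    F.mkResidue κ hL hP Q (κ.edgeVar e) = F.mkResidue κ hL hP Q (algebraMap _ _ bz) := by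
  rw [F.mkResidue_edgeVar κ hL hP hp h, κ.edgeVar_bottomEnd_right]

theorem mkResidue_edgeVar_circle (hp : D.openKind.fst ∈ Q) {e : D.Edge} {c : Set D.Edge}
    (hc : c ∈ D.closedComponents) (h : e ∈ c) :
    F.mkResidue κ hL hP Q (κ.edgeVar e) = F.mkResidue κ hL hP Q (κ.circleVar c) := by
  refine F.mkResidue_edgeVar κ hL hP hp ?_
  rw [← eq_component_of_mem_closed hc h]
  exact rep_mem hc

theorem mkResidue_altSum (hp : D.openKind.fst ∈ Q) (v : V) :
    F.mkResidue κ hL hP Q (altSum D.toGluing v) =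
      F.mkResidue κ hL hP Q (κ.edgeVar (D.firstStrand v)) +
      F.mkResidue κ hL hP Q (κ.edgeVar (D.secondStrand v)) +
      F.mkResidue κ hL hP Q (algebraMap _ _ bH) := by
  rw [D.altSum_eq_edgeVar κ, map_add, map_add, map_add,
    Ideal.Quotient.eq_zero_iff_mem.mpr (F.lam_mem_residue κ hL hP hp v), add_zero, algebraMap_bH]

theorem _root_.Delooping.ArcKind.bz_mul_mem {k : ArcKind} (hp : k.fst ∈ Q) (hq : k.snd ∈ Q) :
    bz * (bx + bY) ∈ Q := by
  cases k
  · have : bz * (bx + bY) = bz * bx + bY * bz := by ring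
    rw [this]
    exact Q.add_mem (Q.mul_mem_left _ hp) hq
  · have : bz * (bx + bY) = bx * bz + bz * bY := by ring
    rw [this]
    exact Q.add_mem hq (Q.mul_mem_left _ hp)

/-- The argument of `edgeVar_sq_mem_linMod`, now with an exact result: at the bottom right end y² +
Hy is z² + Hz = z(x + y), which lies in `Q` together with both entries of the differential. So the
quotient has the Frobenius algebra relation on every component. -/
theorem mkResidue_edgeVar_sq (hp : D.openKind.fst ∈ Q) (hq : D.openKind.snd ∈ Q) (e : D.Edge) :
    F.mkResidue κ hL hP Q (κ.edgeVar e) ^ 2 =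
      F.mkResidue κ hL hP Q (algebraMap _ _ bH) * F.mkResidue κ hL hP Q (κ.edgeVar e) := by
  have h2 := D.two_eq_zero
  rw [← map_pow, ← map_mul, mkResidue_eq_iff]
  set I := F.residue κ hL hP Q with hI
  let L : Submodule (ZMod 2) D.ReducedRing := AddSubgroup.toZModSubmodule 2 I.toAddSubgroup
  have hmk : ∀ a b : D.ReducedRing, a + b ∈ I → L.mkQ a = L.mkQ b := by
    intro a b h
    rw [← sub_eq_zero, ← map_sub, D.sub_eq]
    exact (Submodule.Quotient.mk_eq_zero L).mpr h
  have hmk0 : ∀ a : D.ReducedRing, a ∈ I → L.mkQ a = 0 := fun a h =>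
    (Submodule.Quotient.mk_eq_zero L).mpr h
  have hl := F.lam_mem_residue κ hL hP hp
  rw [algebraMap_bH]
  have := F.vanish (fun e => L.mkQ (κ.edgeVar e ^ 2 + D.redH * κ.edgeVar e)) ?_ ?_ ?_ ?_ e
  · exact (Submodule.Quotient.mk_eq_zero L).mp this
  · intro e e' h
    obtain ⟨v, hv⟩ := D.exists_lam_of_joined κ h
    apply hmk
    have : κ.edgeVar e ^ 2 + D.redH * κ.edgeVar e + (κ.edgeVar e' ^ 2 + D.redH * κ.edgeVar e') =
        (D.lam v + D.redH) * D.lam v := by rw [← hv]; grind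
    rw [this]
    exact I.mul_mem_left _ (hl v)
  · apply hmk0
    rw [κ.edgeVar_topEnd_left]
    have : D.redH ^ 2 + D.redH * D.redH = 0 := by grind
    rw [this]
    exact I.zero_mem
  · apply hmk0
    rw [κ.edgeVar_bottomEnd_right, ← algebraMap_bH, ← map_pow, ← map_mul, ← map_add]
    have : bz ^ 2 + bH * bz = bz * (bx + bY) := by
      have := BoundaryRing.two_eq_zero
      rw [bH]; grind
    rw [this]
    exact F.algebraMap_mem_residue κ hL hP (ArcKind.bz_mul_mem hp hq)
  · intro a ha
    apply hmk
    have hk := D.kap_eq_edgeVar κ a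
    have hs := D.altSum_eq_edgeVar κ a
    have : κ.edgeVar (D.firstStrand a) ^ 2 + D.redH * κ.edgeVar (D.firstStrand a) +
        (κ.edgeVar (D.secondStrand a) ^ 2 + D.redH * κ.edgeVar (D.secondStrand a)) =
        D.kap a + (κ.edgeVar (D.firstStrand a) + κ.edgeVar (D.secondStrand a)) * D.lam a := by
      rw [hk, hs]; grind
    rw [this, ← F.beta_tree ha]
    exact I.add_mem (F.beta_mem_residue κ hL hP _) (I.mul_mem_left _ (hl a))

theorem edgeVar_cases (hp : D.openKind.fst ∈ Q) (e : D.Edge) :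
    (∃ s, evalZ s = Polynomial.X ∧
      F.mkResidue κ hL hP Q (κ.edgeVar e) = F.mkResidue κ hL hP Q (algebraMap _ _ s)) ∨
    ∃ c : D.closedComponents, F.mkResidue κ hL hP Q (κ.edgeVar e) =
      F.mkResidue κ hL hP Q (κ.circleVar c.1) := by
  by_cases h1 : D.topEnd Side.left ∈ D.component e
  · exact Or.inl ⟨bH, evalZ_bH, F.mkResidue_edgeVar_top κ hL hP hp h1⟩
  by_cases h2 : D.bottomEnd Side.right ∈ D.component e
  · exact Or.inl ⟨bz, evalZ_bz, F.mkResidue_edgeVar_bottom κ hL hP hp h2⟩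
  have hc := component_mem_closedComponents κ h1 h2
  exact Or.inr ⟨⟨_, hc⟩, F.mkResidue_edgeVar_circle κ hL hP hp hc (self_mem_component e)⟩

/-- The square of a saddle is not null-homotopic. -/
theorem altSum_notMem_residue (hp : D.openKind.fst ∈ Q) (hQ : ∀ s ∈ Q, evalZ s = 0) (v : V) :
    altSum D.toGluing v ∉ F.residue κ hL hP Q := by
  classical
  intro h
  rw [← Ideal.Quotient.eq_zero_iff_mem, F.mkResidue_altSum κ hL hP hp] at h
  have hX : (2 : Polynomial (ZMod 2)) = 0 := by
    have := CharP.cast_eq_zero (Polynomial (ZMod 2)) 2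
    exact_mod_cast this
  have hX0 : (Polynomial.X : Polynomial (ZMod 2)) ≠ 0 := Polynomial.X_ne_zero
  -- Two ways to detect a nonzero class: by the coefficient of 1, for an element of the boundary
  -- ring with nonzero evaluation, and by the coefficient of a single circle variable.
  have hs : ∀ s, evalZ s = Polynomial.X → algebraMap _ _ s ∉ F.residue κ hL hP Q := by
    intro s hs hm
    have := hQ _ (hm 0)
    rw [Algebra.algebraMap_eq_smul_one, ← circleMon_zero κ, map_smul, coeff_circleMon, if_pos rfl,
      smul_eq_mul, mul_one, hs] at this
    exact hX0 this
  have hc : ∀ (c : D.closedComponents) (r : D.ReducedRing),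
      F.coeff κ hL hP (Pi.single c 1) r = 0 → κ.circleVar c.1 + r ∉ F.residue κ hL hP Q := by
    intro c r hr hm
    have := hQ _ (hm (Pi.single c 1))
    rw [map_add, hr, ← circleMon_single κ, coeff_circleMon, if_pos rfl, add_zero, map_one] at this
    exact one_ne_zero this
  have hcs : ∀ (c : D.closedComponents) (s : BoundaryRing),
      F.coeff κ hL hP (Pi.single c 1) (algebraMap _ _ s) = 0 := by
    intro c s
    rw [Algebra.algebraMap_eq_smul_one, ← circleMon_zero κ, map_smul, coeff_circleMon, if_neg,
      smul_zero]
    intro h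
    have := congrFun h c
    rw [Pi.single_eq_same, Pi.zero_apply] at this
    exact absurd this (by decide)
  -- H and z have the same evaluation X. So y + y' + H evaluates to X + X + X = X for two open
  -- strands, contains a circle variable with coefficient 1 if one strand is a circle or both are
  -- different circles, and is H if both lie on the same circle.
  rcases F.edgeVar_cases κ hL hP hp (D.firstStrand v) with ⟨s, hs1, h1⟩ | ⟨c, h1⟩ <;>
    rcases F.edgeVar_cases κ hL hP hp (D.secondStrand v) with ⟨s', hs2, h2⟩ | ⟨c', h2⟩ <;>
    rw [h1, h2, ← map_add, ← map_add, Ideal.Quotient.eq_zero_iff_mem] at h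
  · rw [← map_add, ← map_add] at h
    refine hs _ ?_ h
    rw [map_add, map_add, hs1, hs2, evalZ_bH]
    linear_combination Polynomial.X * hX
  · rw [add_comm (algebraMap _ _ s), add_assoc, ← map_add] at h
    exact hc c' _ (hcs _ _) h
  · rw [add_assoc, ← map_add] at h
    exact hc c _ (hcs _ _) h
  · by_cases hcc : c = c'
    · rw [hcc, D.add_self, zero_add] at h
      exact hs _ evalZ_bH h
    · rw [add_assoc] at h
      refine hc c _ ?_ h
      rw [map_add, hcs, add_zero, ← circleMon_single κ, coeff_circleMon, if_neg]
      intro h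
      have := congrFun h c
      rw [Pi.single_eq_same, Pi.single_eq_of_ne hcc] at this
      exact absurd this (by decide)

end Frame

end Crossingless

namespace Factorization

/-! ## Maps between retracts -/

theorem d_comp_eq {M N : Factorization BoundaryRing} {f : M.carrier →ₗ[BoundaryRing] N.carrier}
    (hf : boundary f = 0) (x : M.carrier) : N.d (f x) = f (M.d x) := by
  have := LinearMap.congr_fun hf x
  change N.d (f x) + f (M.d x) = 0 at this
  rw [← sub_eq_zero, ← this, sub_eq_add_neg]
  congr 1
  rw [neg_eq_iff_add_eq_zero]
  exact BoundaryRing.module_add_self _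

theorem boundary_eq_zero {M N : Factorization BoundaryRing}
    {f : M.carrier →ₗ[BoundaryRing] N.carrier} (hf : ∀ x, N.d (f x) = f (M.d x)) :
    boundary f = 0 := by
  refine LinearMap.ext fun x => ?_
  change N.d (f x) + f (M.d x) = 0
  rw [hf]
  exact BoundaryRing.module_add_self _

theorem boundary_comp_eq_zero {L M N : Factorization BoundaryRing}
    {f : M.carrier →ₗ[BoundaryRing] N.carrier} {g : L.carrier →ₗ[BoundaryRing] M.carrier}
    (hf : boundary f = 0) (hg : boundary g = 0) :
    boundary (M := L) (N := N) (f ∘ₗ g) = 0 :=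
  boundary_eq_zero fun x => by
    rw [LinearMap.comp_apply, d_comp_eq hf, d_comp_eq hg, LinearMap.comp_apply]

theorem Homotopic.trans {M N : Factorization BoundaryRing}
    {f g h : M.carrier →ₗ[BoundaryRing] N.carrier} (hfg : Homotopic f g) (hgh : Homotopic g h) :
    Homotopic f h := by
  obtain ⟨a, ha⟩ := hfg
  obtain ⟨b, hb⟩ := hgh
  refine ⟨a + b, ?_⟩
  rw [← sub_add_sub_cancel f g h, ha, hb, boundary, boundary, boundary, LinearMap.comp_add,
    LinearMap.add_comp]
  abel

theorem Homotopic.symm {M N : Factorization BoundaryRing}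
    {f g : M.carrier →ₗ[BoundaryRing] N.carrier} (hfg : Homotopic f g) : Homotopic g f := by
  obtain ⟨a, ha⟩ := hfg
  refine ⟨-a, ?_⟩
  rw [← neg_sub, ha, boundary, boundary, LinearMap.comp_neg, LinearMap.neg_comp]
  abel

/-- A deformation retract may be inserted between two closed maps. -/
theorem SpecialDeformationRetract.homotopic {L M N P : Factorization BoundaryRing}
    (ρ : SpecialDeformationRetract M N) {f : M.carrier →ₗ[BoundaryRing] P.carrier}
    {g : L.carrier →ₗ[BoundaryRing] M.carrier} (hf : boundary f = 0) (hg : boundary g = 0) :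
    Homotopic (M := L) (N := P) (f ∘ₗ ρ.incl ∘ₗ ρ.proj ∘ₗ g) (f ∘ₗ g) := by
  refine Homotopic.symm ⟨f ∘ₗ ρ.htpy ∘ₗ g, LinearMap.ext fun x => ?_⟩
  have h := congrArg f (LinearMap.congr_fun ρ.incl_proj (g x))
  change f (g x - ρ.incl (ρ.proj (g x))) = f (M.d (ρ.htpy (g x)) + ρ.htpy (M.d (g x))) at h
  change f (g x) - f (ρ.incl (ρ.proj (g x))) = P.d (f (ρ.htpy (g x))) + f (ρ.htpy (g (L.d x)))
  rw [← map_sub, h, map_add, d_comp_eq hf, d_comp_eq hg]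

end Factorization

/-! ### The action of the reduced edge ring on the retract. -/

namespace Crossingless

open Gluing Factorization

section Block

variable {V : Type*} [Fintype V] [DecidableEq V] {D : Crossingless V}

/-- The part of an element of the delooped factorization in one of the two copies, as an element
of the reduced edge ring. -/
def block (κ : D.toGluing.Colouring) (b : Bool) :
    D.delooped.carrier →ₗ[BoundaryRing] D.ReducedRing :=
  D.deloopedBasis.constr BoundaryRing fun i =>
    if i.1 = b then Frame.circleMon (D := D) κ i.2 else 0

theorem block_basis (κ : D.toGluing.Colouring) (b b' : Bool) (ε : D.closedComponents → Fin 2) :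
    block κ b (D.deloopedBasis (b', ε)) = if b' = b then Frame.circleMon (D := D) κ ε else 0 := by
  rw [block, Module.Basis.constr_basis]

theorem block_apply (κ : D.toGluing.Colouring) (b : Bool) (x : D.delooped.carrier) :
    block κ b x = ∑ ε, D.deloopedBasis.repr x (b, ε) • Frame.circleMon (D := D) κ ε := by
  conv_lhs => rw [← D.deloopedBasis.sum_repr x]
  rw [map_sum, Fintype.sum_prod_type, Finset.sum_eq_single b]
  · exact Finset.sum_congr rfl fun ε _ => by rw [map_smul, block_basis, if_pos rfl]
  · intro b' _ hb
    refine Finset.sum_eq_zero fun ε _ => ?_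
    rw [map_smul, block_basis, if_neg hb, smul_zero]
  · simp

theorem coeff_block (F : D.Frame) (κ : D.toGluing.Colouring) (hL : D.Linked) (hP : D.Planar)
    (b : Bool) (x : D.delooped.carrier) (ε : D.closedComponents → Fin 2) :
    F.coeff κ hL hP ε (block κ b x) = D.deloopedBasis.repr x (b, ε) := by
  rw [block_apply, map_sum]
  simp only [map_smul, Frame.coeff_circleMon, smul_eq_mul, mul_ite, mul_one, mul_zero,
    Finset.sum_ite_eq', Finset.mem_univ, if_true]

/-- Linear maps to a module take boundaries to multiples of the entries of the differential. -/
theorem map_d_mem {Z : Type*} [AddCommGroup Z] [Module BoundaryRing Z]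
    (g : D.delooped.carrier →ₗ[BoundaryRing] Z) {I : AddSubgroup Z} {Q : Ideal BoundaryRing}
    (hI : ∀ s ∈ Q, ∀ z, s • z ∈ I) (hp : D.openKind.fst ∈ Q) (hq : D.openKind.snd ∈ Q)
    (x : D.delooped.carrier) : g (D.delooped.d x) ∈ I := by
  rw [← D.deloopedBasis.sum_repr x, map_sum, map_sum]
  refine AddSubgroup.sum_mem _ fun i _ => ?_
  obtain ⟨b, ε⟩ := i
  rw [map_smul, delooped_d_basis, map_smul, map_smul, smul_smul]
  refine hI _ (Q.mul_mem_left _ ?_) _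
  split_ifs
  · exact hp
  · exact hq

theorem act_closed (r : D.ReducedRing) :
    boundary (M := D.factorization) (N := D.factorization) (D.act r) = 0 := by
  refine boundary_eq_zero fun m : TensorModule D.toGluing => ?_
  refine funext fun s => ?_
  have h1 : D.factorization.d (D.act r m) s = koszul D.toGluing D.lam D.kap (r • m) s := rfl
  have h2 : D.act r (D.factorization.d m) s = r * koszul D.toGluing D.lam D.kap m s := rfl
  refine h1.trans (Eq.trans ?_ h2.symm)
  rw [koszul_apply, koszul_apply, Finset.mul_sum]
  refine Finset.sum_congr rfl fun v _ => ?_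
  rw [Pi.smul_apply, smul_eq_mul, mul_left_comm]

namespace Frame

variable (F : D.Frame) (κ : D.toGluing.Colouring) (hL : D.Linked) (hP : D.Planar)

/-- Multiplication by an element of the reduced edge ring, on the delooped factorization. -/
def actRetract (r : D.ReducedRing) : D.delooped.carrier →ₗ[BoundaryRing] D.delooped.carrier :=
  (F.retract κ hL hP).proj ∘ₗ D.act r ∘ₗ (F.retract κ hL hP).incl

theorem actRetract_basis (r : D.ReducedRing) (b : Bool) (ε : D.closedComponents → Fin 2) :
    F.actRetract κ hL hP r (D.deloopedBasis (b, ε)) =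
      ∑ ε', F.coeff κ hL hP ε' (r * circleMon κ ε) • D.deloopedBasis (b, ε') :=
  F.retract_proj_act_incl κ hL hP r b ε

theorem actRetract_circleMon (b : Bool) (ε : D.closedComponents → Fin 2) :
    F.actRetract κ hL hP (circleMon κ ε) (D.deloopedBasis (b, 0)) = D.deloopedBasis (b, ε) := by
  rw [actRetract_basis, circleMon_zero, mul_one]
  simp only [coeff_circleMon, ite_smul, one_smul, zero_smul, Finset.sum_ite_eq, Finset.mem_univ,
    if_true]

/-- In general the induced action multiplies coefficients in the quotient by the eliminating
entries; after reduction to `residue` it is ordinary multiplication. -/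
theorem mkResidue_block_actRetract (Q : Ideal BoundaryRing) (r : D.ReducedRing) (b : Bool)
    (x : D.delooped.carrier) :
    F.mkResidue κ hL hP Q (block κ b (F.actRetract κ hL hP r x)) =
      F.mkResidue κ hL hP Q r * F.mkResidue κ hL hP Q (block κ b x) := by
  rw [← map_mul, ← D.deloopedBasis.sum_repr x, map_sum, map_sum, map_sum, map_sum, Finset.mul_sum,
    map_sum]
  refine Finset.sum_congr rfl fun i _ => ?_
  obtain ⟨b', ε⟩ := i
  rw [(F.actRetract κ hL hP r).map_smul, (block κ b).map_smul, (block κ b).map_smul,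
    actRetract_basis, map_sum, mul_smul_comm,
    Algebra.smul_def, Algebra.smul_def, map_mul, map_mul]
  congr 1
  simp only [map_smul, block_basis]
  split_ifs
  · exact (F.mkResidue_sum_coeff κ hL hP _).symm
  · simp

end Frame

end Block

/-! ### The edge map of the cube and its reverse. -/

section EdgeMap

variable {V : Type*} [DecidableEq V] {G : Gluing V} {k k' : V → ArcKind} {v : V}

theorem lam_congr {u : V} (h : k u = k' u) : (G.dress k).lam u = (G.dress k').lam u := by
  unfold lam; dsimp only; rw [h]

theorem kap_congr {u : V} (h : k u = k' u) : (G.dress k).kap u = (G.dress k').kap u := by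
  unfold kap; dsimp only; rw [h]

/-- The linear factors of the two kinds of arcs are exchanged while the factor σ is common. This is
what makes the edge map commute with the differentials. -/
theorem kap_eq_lam_mul (hv : k v ≠ k' v) :
    (G.dress k').kap v = (G.dress k).lam v * altSum G v := by
  rcases kind_eq (G.dress k) v with h1 | h1 <;> rcases kind_eq (G.dress k') v with h2 | h2
  · exact absurd (h1.trans h2.symm) hv
  · rw [lam_dotted h1, kap_thick h2]
  · rw [lam_thick h1, kap_dotted h2]
  · exact absurd (h1.trans h2.symm) hv

variable [Fintype V]

variable (G k k' v) in
/-- The edge map of the cube of resolutions. -/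
def edgeMap : (G.dress k).factorization.carrier →ₗ[BoundaryRing]
    (G.dress k').factorization.carrier :=
  localMap G v (-1) (altSum G v)

theorem koszul_localMap (hk : ∀ u, u ≠ v → k u = k' u) (hv : k v ≠ k' v) (m : TensorModule G) :
    koszul G (G.dress k').lam (G.dress k').kap (localMap G v (-1) (altSum G v) m) =
      localMap G v (-1) (altSum G v) (koszul G (G.dress k).lam (G.dress k).kap m) := by
  rw [koszul, koszul, LinearMap.sum_apply, LinearMap.sum_apply, map_sum]
  refine Finset.sum_congr rfl fun u _ => ?_
  by_cases hu : u = v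
  · subst hu
    funext s
    rw [localMap_localMap, localMap_localMap, kap_eq_lam_mul hv, kap_eq_lam_mul hv.symm, G.neg_eq]
    split_ifs <;> ring
  · rw [lam_congr (hk u hu), kap_congr (hk u hu)]
    exact LinearMap.congr_fun (localMap_comm G hu _ _ _ _) m

theorem edgeMap_closed (hk : ∀ u, u ≠ v → k u = k' u) (hv : k v ≠ k' v) :
    boundary (M := (G.dress k).factorization) (N := (G.dress k').factorization)
      (edgeMap G k k' v) = 0 :=
  boundary_eq_zero fun m => koszul_localMap hk hv m

theorem edgeMap_act (r : G.ReducedRing) :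
    edgeMap G k k' v ∘ₗ (G.dress k).act r = (G.dress k').act r ∘ₗ edgeMap G k k' v := by
  refine LinearMap.ext fun m : TensorModule G => funext fun s => ?_
  change localMap G v (-1) (altSum G v) (r • m) s = r * localMap G v (-1) (altSum G v) m s
  rw [localMap_apply, localMap_apply, Pi.smul_apply, smul_eq_mul, mul_left_comm]

/-- The same formula defines a map in the reverse direction, of which one entry is again a unit and
the other σ. Through this identity a splitting is computed from the merging that reverses it. -/
theorem edgeMap_edgeMap :
    edgeMap G k' k v ∘ₗ edgeMap G k k' v = (G.dress k).act (altSum G v) := by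
  refine LinearMap.ext fun m : TensorModule G => funext fun s => ?_
  change localMap G v (-1) (altSum G v) (localMap G v (-1) (altSum G v) m) s = altSum G v * m s
  rw [localMap_localMap, G.neg_eq, mul_one, one_mul, ite_self]

theorem edgeMap_hasDegree : HasDegree (M := (G.dress k).factorization)
    (N := (G.dress k').factorization) (edgeMap G k k' v) (-1) := by
  intro n m hm
  have hm' := (mem_factorization_gr_iff (G.dress k) n m).mp hm
  refine (mem_factorization_gr_iff (G.dress k') _ _).mpr fun s => ?_
  refine (localMap_apply G v (-1) (altSum G v) m s) ▸ ?_
  have := hm' (Function.update s v (!s v))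
  rw [weight_update] at this
  by_cases h : s v = true
  · rw [if_pos h]
    refine mul_mem_piece (altSum_mem G v) this ?_
    simp [h]; ring
  · rw [if_neg h, G.neg_eq]
    refine mul_mem_piece G.redHomogeneous_one this ?_
    simp [h]; ring

end EdgeMap

/-! ### The induced map and its values up to homotopy. -/

section Transfer

variable {V : Type*} [DecidableEq V] [Fintype V] {G : Gluing V} {k k' : V → ArcKind}
variable (F : (G.dress k).Frame) (F' : (G.dress k').Frame) (κ : G.Colouring)
  (hL : G.Linked) (hP : G.Planar) (v : V)

/-- The map of delooped factorizations induced by the edge map. -/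
def transfer : (G.dress k).delooped.carrier →ₗ[BoundaryRing] (G.dress k').delooped.carrier :=
  (F'.retract κ hL hP).proj ∘ₗ edgeMap G k k' v ∘ₗ (F.retract κ hL hP).incl

variable {v}

theorem transfer_closed (hk : ∀ u, u ≠ v → k u = k' u) (hv : k v ≠ k' v) :
    boundary (M := (G.dress k).delooped) (N := (G.dress k').delooped)
      (transfer F F' κ hL hP v) = 0 :=
  boundary_comp_eq_zero (F'.retract κ hL hP).boundary_proj
    (boundary_comp_eq_zero (edgeMap_closed hk hv) (F.retract κ hL hP).boundary_incl)

theorem repr_transfer_mem (i : Bool × ((G.dress k).closedComponents → Fin 2))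
    (j : Bool × ((G.dress k').closedComponents → Fin 2)) :
    (G.dress k').deloopedBasis.repr
      (transfer F F' κ hL hP v ((G.dress k).deloopedBasis i)) j ∈
      boundaryPiece ((G.dress k').basisDeg j - (G.dress k).basisDeg i + 1) := by
  have h1 : (G.dress k).deloopedBasis i ∈ (G.dress k).delooped.gr ((G.dress k).basisDeg i) := by
    rw [← one_smul BoundaryRing ((G.dress k).deloopedBasis i)]
    refine smul_basis_mem_gr _ (mem_boundaryPiece (k := 0) ?_ (by ring))
    rw [map_one]
    exact MvPolynomial.isHomogeneous_one _ _
  have h2 := (F'.retract κ hL hP).proj_degree _ _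
    (edgeMap_hasDegree (k' := k') (v := v) _ _ ((F.retract κ hL hP).incl_degree _ _ h1))
  have h3 := (mem_delooped_gr_iff (G.dress k') _ _).mp h2 j
  have : (G.dress k').basisDeg j - ((G.dress k).basisDeg i + 0 + -1 + 0) =
    (G.dress k').basisDeg j - (G.dress k).basisDeg i + 1 := by ring
  rwa [this] at h3

/-- The transfer map commutes with multiplication up to homotopy. -/
theorem transfer_act (hk : ∀ u, u ≠ v → k u = k' u) (hv : k v ≠ k' v) (r : G.ReducedRing) :
    Homotopic (M := (G.dress k).delooped) (N := (G.dress k').delooped)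
      (transfer F F' κ hL hP v ∘ₗ F.actRetract κ hL hP r)
      (F'.actRetract κ hL hP r ∘ₗ transfer F F' κ hL hP v) := by
  have h1 := (F.retract κ hL hP).homotopic (P := (G.dress k').delooped)
    (boundary_comp_eq_zero (F'.retract κ hL hP).boundary_proj (edgeMap_closed hk hv))
    (boundary_comp_eq_zero (act_closed (D := G.dress k) r) (F.retract κ hL hP).boundary_incl)
  have h2 := (F'.retract κ hL hP).homotopic (L := (G.dress k).delooped)
    (boundary_comp_eq_zero (F'.retract κ hL hP).boundary_proj (act_closed (D := G.dress k') r))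
    (boundary_comp_eq_zero (edgeMap_closed hk hv) (F.retract κ hL hP).boundary_incl)
  have h3 : ((F'.retract κ hL hP).proj ∘ₗ edgeMap G k k' v) ∘ₗ
      ((G.dress k).act r ∘ₗ (F.retract κ hL hP).incl) =
      ((F'.retract κ hL hP).proj ∘ₗ (G.dress k').act r) ∘ₗ
      (edgeMap G k k' v ∘ₗ (F.retract κ hL hP).incl) := by
    have := edgeMap_act (G := G) (k := k) (k' := k') (v := v) r
    rw [LinearMap.comp_assoc, LinearMap.comp_assoc, ← LinearMap.comp_assoc _ _ (edgeMap G k k' v),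
      this, LinearMap.comp_assoc]
  rw [h3] at h1
  exact h1.trans h2.symm

/-- The square of the transfer map. -/
theorem transfer_transfer (hk : ∀ u, u ≠ v → k u = k' u) (hv : k v ≠ k' v) :
    Homotopic (M := (G.dress k).delooped) (N := (G.dress k).delooped)
      (transfer F' F κ hL hP v ∘ₗ transfer F F' κ hL hP v)
      (F.actRetract κ hL hP (altSum G v)) := by
  have h1 := (F'.retract κ hL hP).homotopic (P := (G.dress k).delooped)
    (boundary_comp_eq_zero (F.retract κ hL hP).boundary_proj
      (edgeMap_closed (fun u hu => (hk u hu).symm) hv.symm))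
    (boundary_comp_eq_zero (edgeMap_closed hk hv) (F.retract κ hL hP).boundary_incl)
  have h3 : ((F.retract κ hL hP).proj ∘ₗ edgeMap G k' k v) ∘ₗ
      (edgeMap G k k' v ∘ₗ (F.retract κ hL hP).incl) =
      F.actRetract κ hL hP (altSum G v) := by
    have := edgeMap_edgeMap (G := G) (k := k) (k' := k') (v := v)
    rw [LinearMap.comp_assoc, ← LinearMap.comp_assoc _ _ (edgeMap G k' k v), this]
    rfl
  rw [h3] at h1
  exact h1

variable {Q : Ideal BoundaryRing}

/-- The entries of a boundary are combinations of the entries of the two differentials, all of which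
lie in `Q`. -/
theorem mkResidue_eq_of_homotopic {f g : (G.dress k).delooped.carrier →ₗ[BoundaryRing]
      (G.dress k').delooped.carrier}
    (h : Homotopic (M := (G.dress k).delooped) (N := (G.dress k').delooped) f g)
    (hp : (G.dress k).openKind.fst ∈ Q) (hq : (G.dress k).openKind.snd ∈ Q)
    (hp' : (G.dress k').openKind.fst ∈ Q) (hq' : (G.dress k').openKind.snd ∈ Q)
    (b : Bool) (x : (G.dress k).delooped.carrier) :
    F'.mkResidue κ hL hP Q (block (D := G.dress k') κ b (f x)) = F'.mkResidue κ hL hP Q (block (D := G.dress k') κ b (g x)) := by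
  obtain ⟨a, ha⟩ := h
  have ha := LinearMap.congr_fun ha x
  change f x - g x = (G.dress k').delooped.d (a x) + a ((G.dress k).delooped.d x) at ha
  have hI : ∀ s ∈ Q, ∀ z, s • z ∈ (F'.residue κ hL hP Q).toAddSubgroup :=
    fun s hs z => F'.smul_mem_residue κ hL hP hs z
  rw [Ideal.Quotient.eq, ← map_sub, ha, map_add]
  refine (F'.residue κ hL hP Q).add_mem ?_ ?_
  · exact map_d_mem (block (D := G.dress k') κ b) hI hp' hq' (a x)
  · exact map_d_mem (block (D := G.dress k') κ b ∘ₗ a) hI hp hq x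

/-- A basis element arises from the generator 1 by the action of its circle monomial, and transfer
commutes with this action up to homotopy. Hence the transfer map is known modulo `residue` once its
values on the two generators are. -/
theorem mkResidue_transfer_basis (hk : ∀ u, u ≠ v → k u = k' u) (hv : k v ≠ k' v)
    (hp : (G.dress k).openKind.fst ∈ Q) (hq : (G.dress k).openKind.snd ∈ Q)
    (hp' : (G.dress k').openKind.fst ∈ Q) (hq' : (G.dress k').openKind.snd ∈ Q)
    (b b' : Bool) (ε : (G.dress k).closedComponents → Fin 2) :
    F'.mkResidue κ hL hP Q
        (block (D := G.dress k') κ b' (transfer F F' κ hL hP v ((G.dress k).deloopedBasis (b, ε)))) =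
      F'.mkResidue κ hL hP Q (Frame.circleMon (D := G.dress k) κ ε) * F'.mkResidue κ hL hP Q
        (block (D := G.dress k') κ b' (transfer F F' κ hL hP v ((G.dress k).deloopedBasis (b, 0)))) := by
  have h1 := F'.mkResidue_block_actRetract κ hL hP Q (Frame.circleMon (D := G.dress k) κ ε) b'
    (transfer F F' κ hL hP v ((G.dress k).deloopedBasis (b, 0)))
  refine Eq.trans ?_ h1
  rw [← F.actRetract_circleMon κ hL hP b ε]
  exact mkResidue_eq_of_homotopic F' κ hL hP
    (transfer_act F F' κ hL hP hk hv (Frame.circleMon (D := G.dress k) κ ε))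
    hp hq hp' hq' b' ((G.dress k).deloopedBasis (b, 0))

theorem mkResidue_transfer_transfer (hk : ∀ u, u ≠ v → k u = k' u) (hv : k v ≠ k' v)
    (hp : (G.dress k).openKind.fst ∈ Q) (hq : (G.dress k).openKind.snd ∈ Q) (b : Bool) :
    F.mkResidue κ hL hP Q (block (D := G.dress k) κ b (transfer F' F κ hL hP v
      (transfer F F' κ hL hP v ((G.dress k).deloopedBasis (b, 0))))) =
    F.mkResidue κ hL hP Q (altSum G v) := by
  refine (mkResidue_eq_of_homotopic F κ hL hP (transfer_transfer F F' κ hL hP hk hv)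
    hp hq hp hq b _).trans ?_
  rw [F.mkResidue_block_actRetract, block_basis, if_pos rfl, circleMon_zero, map_one, mul_one]

end Transfer

end Crossingless

/-! ### What degrees and parity say about the transfer map. -/

namespace Crossingless

open Gluing Factorization

theorem eq_zero_of_mem_boundaryPiece_neg {r : BoundaryRing} {j : ℤ} (hr : r ∈ boundaryPiece j)
    (hj : j < 0) : r = 0 := by
  obtain h | ⟨k, hk, -⟩ := hr
  · exact h
  · omega

theorem eq_zero_of_mem_boundaryPiece_odd {r : BoundaryRing} {j : ℤ} (hr : r ∈ boundaryPiece j)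
    (hj : Odd j) : r = 0 := by
  obtain h | ⟨k, hk, -⟩ := hr
  · exact h
  · obtain ⟨l, hl⟩ := hj
    omega

theorem eq_of_mem_boundaryPiece_zero {r : BoundaryRing} (hr : r ∈ boundaryPiece 0) :
    r = 0 ∨ r = 1 := by
  obtain h | ⟨k, hk, h⟩ := hr
  · exact Or.inl h
  · obtain rfl : k = 0 := by omega
    have h1 := MvPolynomial.totalDegree_eq_zero_iff_eq_C.mp
      (Nat.le_zero.mp h.totalDegree_le)
    generalize MvPolynomial.coeff 0 (BoundaryRing.equiv r) = c at h1
    fin_cases c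
    · left
      apply BoundaryRing.equiv.injective
      rw [map_zero, h1]
      exact MvPolynomial.C_0
    · right
      apply BoundaryRing.equiv.injective
      rw [map_one, h1]
      exact MvPolynomial.C_1

theorem fst_mem_ker (k : ArcKind) : k.fst ∈ RingHom.ker evalZ := k.evalZ_fst
theorem snd_mem_ker (k : ArcKind) : k.snd ∈ RingHom.ker evalZ := k.evalZ_snd

theorem _root_.Delooping.ArcKind.fst_prime (k : ArcKind) : Prime k.fst := by
  cases k
  · exact MvPolynomial.X_prime (R := ZMod 2) (i := (0 : Fin 3))
  · exact MvPolynomial.X_prime (R := ZMod 2) (i := (1 : Fin 3))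

theorem _root_.Delooping.ArcKind.not_fst_dvd_snd (k : ArcKind) : ¬ k.fst ∣ k.snd := by
  intro h
  cases k
  · rcases (ArcKind.fst_prime ArcKind.dotted).dvd_or_dvd (h : _ ∣ bY * bz) with h | h
    · exact absurd ((MvPolynomial.X_dvd_X (R := ZMod 2) (i := (0 : Fin 3)) (j := 1)).mp h) (by decide)
    · exact absurd ((MvPolynomial.X_dvd_X (R := ZMod 2) (i := (0 : Fin 3)) (j := 2)).mp h) (by decide)
  · rcases (ArcKind.fst_prime ArcKind.thick).dvd_or_dvd (h : _ ∣ bx * bz) with h | h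
    · exact absurd ((MvPolynomial.X_dvd_X (R := ZMod 2) (i := (1 : Fin 3)) (j := 0)).mp h) (by decide)
    · exact absurd ((MvPolynomial.X_dvd_X (R := ZMod 2) (i := (1 : Fin 3)) (j := 2)).mp h) (by decide)

section

variable {V : Type*} [Fintype V] (D : Crossingless V)

theorem basisDeg_eq (b : Bool) (ε : D.closedComponents → Fin 2) : D.basisDeg (b, ε) =
    (if b then 1 else 0) + Nat.card D.closedComponents - 2 * ∑ c, ((ε c : ℕ) : ℤ) := by
  rw [basisDeg, Finset.sum_sub_distrib, ← Finset.mul_sum, Finset.sum_const, Finset.card_univ,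
    ← Nat.card_eq_fintype_card]
  simp only [nsmul_eq_mul, mul_one]
  ring

theorem repr_delooped_d (x : D.delooped.carrier) (b : Bool) (ε : D.closedComponents → Fin 2) :
    D.deloopedBasis.repr (D.delooped.d x) (b, ε) =
      (if b then D.openKind.snd else D.openKind.fst) * D.deloopedBasis.repr x (!b, ε) := by
  suffices D.deloopedBasis.coord (b, ε) ∘ₗ D.delooped.d =
      (if b then D.openKind.snd else D.openKind.fst) • D.deloopedBasis.coord (!b, ε) from
    LinearMap.congr_fun this x
  refine D.deloopedBasis.ext fun i => ?_
  obtain ⟨b', ε'⟩ := i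
  rw [LinearMap.comp_apply, delooped_d_basis, map_smul, LinearMap.smul_apply,
    Module.Basis.coord_apply, Module.Basis.coord_apply, Module.Basis.repr_self,
    Module.Basis.repr_self, Finsupp.single_apply, Finsupp.single_apply]
  cases b <;> cases b' <;> simp

end

section Determination

variable {V : Type*} [DecidableEq V] [Fintype V] {G : Gluing V} {k k' : V → ArcKind} {v : V}

/-- The lower triangular entries of a closed map are divisible. -/
theorem repr_mem_ker_of_closed (ho : (G.dress k).openKind = (G.dress k').openKind)
    {f : (G.dress k).delooped.carrier →ₗ[BoundaryRing] (G.dress k').delooped.carrier}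
    (hf : boundary (M := (G.dress k).delooped) (N := (G.dress k').delooped) f = 0)
    (ε : (G.dress k).closedComponents → Fin 2) (ε' : (G.dress k').closedComponents → Fin 2) :
    (G.dress k').deloopedBasis.repr (f ((G.dress k).deloopedBasis (true, ε))) (false, ε') ∈
      RingHom.ker evalZ := by
  have h := congrArg (fun x => (G.dress k').deloopedBasis.repr x (false, ε'))
    (d_comp_eq hf ((G.dress k).deloopedBasis (false, ε)))
  simp only [repr_delooped_d, delooped_d_basis, map_smul, Finsupp.smul_apply, smul_eq_mul,
    Bool.not_false, Bool.false_eq_true, if_false, ho] at h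
  -- Closedness says that `snd` times the entry is a multiple of `fst`, which is prime and does not
  -- divide `snd`.
  have hd := (ArcKind.fst_prime _).dvd_or_dvd (Dvd.intro _ h)
  obtain ⟨t, ht⟩ := hd.resolve_left (ArcKind.not_fst_dvd_snd _)
  rw [ht]
  exact Ideal.mul_mem_right _ _ (fst_mem_ker _)

variable (F : (G.dress k).Frame) (F' : (G.dress k').Frame) (κ : G.Colouring)
  (hL : G.Linked) (hP : G.Planar)

theorem altSum_ne (F : (G.dress k).Frame) :
    F.mkResidue κ hL hP (RingHom.ker evalZ) (altSum G v) ≠ 0 := fun h =>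
  F.altSum_notMem_residue κ hL hP (fst_mem_ker _) (fun _ hs => hs) v
    (Ideal.Quotient.eq_zero_iff_mem.mp h)

theorem sum_val_pos {K : Type*} [Fintype K] {ε : K → Fin 2} (h : ε ≠ 0) :
    0 < ∑ c, ((ε c : ℕ) : ℤ) := by
  obtain ⟨c, hc⟩ := Function.ne_iff.mp h
  refine Finset.sum_pos' (fun c _ => Int.natCast_nonneg _) ⟨c, Finset.mem_univ c, ?_⟩
  have : (ε c : ℕ) ≠ 0 := fun h' => hc (Fin.ext h')
  omega

/-- The transfer map takes the generator to the generator if it lowers the degree by one. -/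
theorem transfer_generator (hk : ∀ u, u ≠ v → k u = k' u) (hv : k v ≠ k' v) (b : Bool)
    (hcard : (Nat.card (G.dress k).closedComponents : ℤ) + (if b then 1 else 0) =
      Nat.card (G.dress k').closedComponents + 1) :
    transfer F F' κ hL hP v ((G.dress k).deloopedBasis (b, 0)) =
      (G.dress k').deloopedBasis (false, 0) := by
  set y := transfer F F' κ hL hP v ((G.dress k).deloopedBasis (b, 0)) with hy
  -- With `hcard`, twice the polynomial degree of an entry would be negative in the copy `false` and
  -- odd in the copy `true`. The entry that remains has degree 0, so it is 0 or 1.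
  have h0 : ∀ i, i ≠ (false, 0) → (G.dress k').deloopedBasis.repr y i = 0 := by
    rintro ⟨b', ε'⟩ hne
    have h := repr_transfer_mem F F' κ hL hP (v := v) (b, 0) (b', ε')
    rw [basisDeg_eq, basisDeg_eq] at h
    simp only [Pi.zero_apply, Fin.val_zero, Nat.cast_zero, Finset.sum_const_zero, mul_zero] at h
    cases b'
    · have hε : ε' ≠ 0 := fun h => hne (by rw [h])
      have := sum_val_pos hε
      refine eq_zero_of_mem_boundaryPiece_neg h ?_
      simp only [Bool.false_eq_true, if_false] at hcard ⊢
      linarith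
    · refine eq_zero_of_mem_boundaryPiece_odd h ⟨- ∑ c, ((ε' c : ℕ) : ℤ), ?_⟩
      simp only [if_true] at hcard ⊢
      linarith
  have h1 := repr_transfer_mem F F' κ hL hP (v := v) (b, 0) (false, 0)
  rw [basisDeg_eq, basisDeg_eq] at h1
  simp only [Pi.zero_apply, Fin.val_zero, Nat.cast_zero, Finset.sum_const_zero, mul_zero,
    Bool.false_eq_true, if_false, ← hy] at h1
  have hz : (0 : ℤ) + (Nat.card (G.dress k').closedComponents : ℤ) - 0 -
      ((if b then 1 else 0) + (Nat.card (G.dress k).closedComponents : ℤ) - 0) + 1 = 0 := by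
    linarith
  rw [hz] at h1
  have hsum : y = (G.dress k').deloopedBasis.repr y (false, 0) •
      (G.dress k').deloopedBasis (false, 0) := by
    conv_lhs => rw [← (G.dress k').deloopedBasis.sum_repr y]
    refine Finset.sum_eq_single _ (fun i _ hi => ?_) (by simp)
    rw [h0 i hi, zero_smul]
  rcases eq_of_mem_boundaryPiece_zero h1 with h | h
  · exfalso
    rw [h, zero_smul] at hsum
    -- If the generator went to 0, so would its image under going forth and back; but that image is
    -- σ, which does not vanish at x = y = 0.
    have h2 := mkResidue_transfer_transfer F F' κ hL hP hk hv
      (Q := RingHom.ker evalZ) (fst_mem_ker _) (snd_mem_ker _) b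
    rw [← hy, hsum, map_zero, map_zero, map_zero] at h2
    exact altSum_ne κ hL hP F h2.symm
  · rw [hsum, h, one_smul]

/-- If the open components are connected in the same way, the number of closed components changes
its parity. -/
theorem odd_card_closedComponents (κ : G.Colouring) (hL : G.Linked) (hP : G.Planar)
    (hk : ∀ u, u ≠ v → k u = k' u) (hv : k v ≠ k' v)
    (ho : (G.dress k).openKind = (G.dress k').openKind) :
    Odd ((Nat.card (G.dress k').closedComponents : ℤ) - Nat.card (G.dress k).closedComponents) := by
  obtain ⟨F⟩ := nonempty_frame (D := G.dress k) κ hL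
  obtain ⟨F'⟩ := nonempty_frame (D := G.dress k') κ hL
  by_contra heven
  rw [Int.not_odd_iff_even] at heven
  obtain ⟨l, hl⟩ := heven
  set y := transfer F F' κ hL hP v ((G.dress k).deloopedBasis (false, 0)) with hy
  -- This topological fact is obtained algebraically. If the number of circles changed by an even
  -- number, all entries from `false` to `false` would have odd degree and vanish. Going forth and
  -- back would then pass through entries from `true` to `false`, which vanish at x = y = 0, whereas
  -- the result is σ.
  have h0 : ∀ ε', (G.dress k').deloopedBasis.repr y (false, ε') = 0 := by
    intro ε'
    have h := repr_transfer_mem F F' κ hL hP (v := v) (false, 0) (false, ε')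
    rw [basisDeg_eq, basisDeg_eq] at h
    simp only [Pi.zero_apply, Fin.val_zero, Nat.cast_zero, Finset.sum_const_zero, mul_zero,
      Bool.false_eq_true, if_false] at h
    exact eq_zero_of_mem_boundaryPiece_odd h ⟨l - ∑ c, ((ε' c : ℕ) : ℤ), by linarith⟩
  have h2 := mkResidue_transfer_transfer F F' κ hL hP hk hv
      (Q := RingHom.ker evalZ) (fst_mem_ker _) (snd_mem_ker _) false
  refine altSum_ne κ hL hP F (v := v) ?_
  rw [← h2, ← hy, Ideal.Quotient.eq_zero_iff_mem]
  intro ε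
  refine (coeff_block F κ hL hP false _ ε) ▸ ?_
  rw [← (G.dress k').deloopedBasis.sum_repr y, map_sum, map_sum, Finsupp.finsetSum_apply]
  refine Ideal.sum_mem _ fun i _ => ?_
  obtain ⟨b, ε'⟩ := i
  rw [map_smul, map_smul, Finsupp.smul_apply]
  cases b
  · rw [h0, zero_smul]; exact Ideal.zero_mem _
  · exact Ideal.mul_mem_left _ _ (repr_mem_ker_of_closed ho.symm
      (transfer_closed F' F κ hL hP (fun u hu => (hk u hu).symm) hv.symm) ε' ε)

end Determination

end Crossingless

/-! ### Criteria for null-homotopy in terms of matrix entries. -/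

namespace Crossingless

open Gluing Factorization

section Homotopy

variable {V V' : Type*} [Fintype V] [Fintype V'] {D : Crossingless V} {D' : Crossingless V'}

/-- The matrix entries of a map between delooped factorizations. -/
def entry (f : D.delooped.carrier →ₗ[BoundaryRing] D'.delooped.carrier) (b b' : Bool)
    (ε : D.closedComponents → Fin 2) (ε' : D'.closedComponents → Fin 2) : BoundaryRing :=
  D'.deloopedBasis.repr (f (D.deloopedBasis (b, ε))) (b', ε')

theorem entry_sub (f g : D.delooped.carrier →ₗ[BoundaryRing] D'.delooped.carrier) (b b' : Bool)
    (ε : D.closedComponents → Fin 2) (ε' : D'.closedComponents → Fin 2) :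
    entry (f - g) b b' ε ε' = entry f b b' ε ε' - entry g b b' ε ε' := by
  rw [entry, LinearMap.sub_apply, map_sub, Finsupp.sub_apply, entry, entry]

theorem eq_of_entry {f g : D.delooped.carrier →ₗ[BoundaryRing] D'.delooped.carrier}
    (h : ∀ b b' ε ε', entry f b b' ε ε' = entry g b b' ε ε') : f = g :=
  D.deloopedBasis.ext fun i => D'.deloopedBasis.ext_elem fun j => h i.1 j.1 i.2 j.2

theorem entry_d_comp (f : D.delooped.carrier →ₗ[BoundaryRing] D'.delooped.carrier) (b b' : Bool)
    (ε : D.closedComponents → Fin 2) (ε' : D'.closedComponents → Fin 2) :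
    entry (D'.delooped.d ∘ₗ f) b b' ε ε' =
      (if b' then D'.openKind.snd else D'.openKind.fst) * entry f b (!b') ε ε' := by
  rw [entry, LinearMap.comp_apply, repr_delooped_d, entry]

theorem entry_comp_d (f : D.delooped.carrier →ₗ[BoundaryRing] D'.delooped.carrier) (b b' : Bool)
    (ε : D.closedComponents → Fin 2) (ε' : D'.closedComponents → Fin 2) :
    entry (f ∘ₗ D.delooped.d) b b' ε ε' =
      (if b then D.openKind.fst else D.openKind.snd) * entry f (!b) b' ε ε' := by
  rw [entry, LinearMap.comp_apply, delooped_d_basis, map_smul, map_smul, Finsupp.smul_apply,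
    smul_eq_mul, entry]

theorem entry_boundary (f : D.delooped.carrier →ₗ[BoundaryRing] D'.delooped.carrier) (b b' : Bool)
    (ε : D.closedComponents → Fin 2) (ε' : D'.closedComponents → Fin 2) :
    entry (boundary (M := D.delooped) (N := D'.delooped) f) b b' ε ε' =
      (if b' then D'.openKind.snd else D'.openKind.fst) * entry f b (!b') ε ε' +
      (if b then D.openKind.fst else D.openKind.snd) * entry f (!b) b' ε ε' := by
  rw [← entry_d_comp, ← entry_comp_d, boundary, entry, LinearMap.add_apply, map_add,
    Finsupp.add_apply, entry, entry]

theorem boundary_eq_zero_iff {f : D.delooped.carrier →ₗ[BoundaryRing] D'.delooped.carrier} :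
    boundary (M := D.delooped) (N := D'.delooped) f = 0 ↔ ∀ b b' ε ε',
      (if b' then D'.openKind.snd else D'.openKind.fst) * entry f b (!b') ε ε' =
      (if b then D.openKind.fst else D.openKind.snd) * entry f (!b) b' ε ε' := by
  constructor
  · intro h b b' ε ε'
    rw [← entry_d_comp, ← entry_comp_d, entry, entry, LinearMap.comp_apply, LinearMap.comp_apply,
      d_comp_eq h]
  · intro h
    refine eq_of_entry fun b b' ε ε' => ?_
    rw [entry_boundary, h, BoundaryRing.module_add_self, entry, LinearMap.zero_apply, map_zero,
      Finsupp.zero_apply]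

/-- A map with prescribed entries. -/
theorem exists_entry (A : Bool → Bool → (D.closedComponents → Fin 2) →
      (D'.closedComponents → Fin 2) → BoundaryRing) :
    ∃ h : D.delooped.carrier →ₗ[BoundaryRing] D'.delooped.carrier,
      ∀ b b' ε ε', entry h b b' ε ε' = A b b' ε ε' := by
  refine ⟨D.deloopedBasis.constr BoundaryRing fun i =>
    ∑ j, A i.1 j.1 i.2 j.2 • D'.deloopedBasis j, fun b b' ε ε' => ?_⟩
  rw [entry, Module.Basis.constr_basis, Module.Basis.repr_sum_self]

/-- Closedness makes the two diagonal entries equal, as `fst` can be cancelled. Writing the common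
value as α `fst` + β `snd`, the homotopy has the entries α and β off the diagonal. -/
theorem homotopic_of_openKind_eq (ho : D.openKind = D'.openKind)
    {f : D.delooped.carrier →ₗ[BoundaryRing] D'.delooped.carrier}
    (hf : boundary (M := D.delooped) (N := D'.delooped) f = 0)
    (h0 : ∀ b ε ε', entry f b (!b) ε ε' = 0)
    (h1 : ∀ ε ε', entry f false false ε ε' ∈ Ideal.span {D'.openKind.fst, D'.openKind.snd}) :
    ∃ h, f = boundary (M := D.delooped) (N := D'.delooped) h := by
  choose α β hαβ using fun ε ε' => Ideal.mem_span_pair.mp (h1 ε ε')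
  have htt : ∀ ε ε', entry f true true ε ε' = entry f false false ε ε' := by
    intro ε ε'
    have := boundary_eq_zero_iff.mp hf true false ε ε'
    simp only [Bool.false_eq_true, if_false, if_true, ho, Bool.not_false, Bool.not_true] at this
    exact mul_left_cancel₀ (ArcKind.fst_ne_zero _) this
  obtain ⟨h, hh⟩ := exists_entry (D := D) (D' := D') fun b b' ε ε' =>
    if b = b' then 0 else if b then β ε ε' else α ε ε'
  refine ⟨h, eq_of_entry fun b b' ε ε' => ?_⟩
  rw [entry_boundary, hh, hh, ho]
  have h2 := h0 b ε ε'
  cases b <;> cases b' <;>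
    simp only [Bool.false_eq_true, if_false, if_true, Bool.not_false, Bool.not_true, mul_zero,
      add_zero, reduceCtorEq, htt, ← hαβ] at h2 ⊢
  · ring
  · exact h2
  · exact h2
  · ring

theorem _root_.Delooping.ArcKind.snd_eq {k k' : ArcKind} (h : k ≠ k') : k.snd = k'.fst * bz := by
  cases k <;> cases k' <;> first | exact absurd rfl h | rfl

/-- Now each second entry is z times the first entry of the other differential, and closedness makes
the entry from `false` to `true` equal to z times the one from `true` to `false`. The homotopy is
diagonal, with entries α and β from the expression of the latter by x and y. -/
theorem homotopic_of_openKind_ne (ho : D.openKind ≠ D'.openKind)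
    {f : D.delooped.carrier →ₗ[BoundaryRing] D'.delooped.carrier}
    (hf : boundary (M := D.delooped) (N := D'.delooped) f = 0)
    (h0 : ∀ b ε ε', entry f b b ε ε' = 0)
    (h1 : ∀ ε ε', entry f true false ε ε' ∈ Ideal.span {D.openKind.fst, D'.openKind.fst}) :
    ∃ h, f = boundary (M := D.delooped) (N := D'.delooped) h := by
  choose α β hαβ using fun ε ε' => Ideal.mem_span_pair.mp (h1 ε ε')
  have htt : ∀ ε ε', entry f false true ε ε' = bz * entry f true false ε ε' := by
    intro ε ε'
    have := boundary_eq_zero_iff.mp hf true true ε ε'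
    simp only [if_true, Bool.not_true, ArcKind.snd_eq ho.symm] at this
    refine mul_left_cancel₀ (ArcKind.fst_ne_zero D.openKind) ?_
    rw [← this, mul_assoc]
  obtain ⟨h, hh⟩ := exists_entry (D := D) (D' := D') fun b b' ε ε' =>
    if b ≠ b' then 0 else if b then β ε ε' else α ε ε'
  refine ⟨h, eq_of_entry fun b b' ε ε' => ?_⟩
  rw [entry_boundary, hh, hh, ArcKind.snd_eq ho, ArcKind.snd_eq ho.symm]
  have h2 := h0 b ε ε'
  cases b <;> cases b' <;>
    simp only [Bool.false_eq_true, if_false, if_true, Bool.not_false, Bool.not_true, mul_zero,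
      add_zero, ne_eq, not_true_eq_false, not_false_eq_true, reduceCtorEq, htt, ← hαβ] at h2 ⊢
  · exact h2
  · ring
  · ring
  · exact h2

end Homotopy

/-! ### Matrix entries of the explicit saddle maps. -/

section Saddle

variable {V : Type*} [Fintype V] {G : Gluing V} {k k' : V → ArcKind} {v : V}

variable (G k k' v) in
/-- The saddle map for the diagrams with a common gluing. -/
abbrev saddleBetween : (G.dress k).delooped.carrier →ₗ[BoundaryRing] (G.dress k').delooped.carrier :=
  (G.dress k).saddleMap k' v

/-- The term of the saddle map for a pair of basis elements. -/
def saddleTerm (D : Crossingless V) (k' : V → ArcKind) (v : V) (ε : D.closedComponents → Fin 2)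
    (ε' : (D.withKind k').closedComponents → Fin 2) :
    D.delooped.carrier →ₗ[BoundaryRing] (D.withKind k').delooped.carrier :=
  TensorProduct.AlgebraTensorModule.map (D.saddleEntry k' v ε ε')
      ((D.circlesBasis.coord ε).smulRight ((D.withKind k').circlesBasis ε'))

open Classical in
theorem saddleMap_eq (D : Crossingless V) (k' : V → ArcKind) (v : V) :
    D.saddleMap k' v = ∑ ε : D.closedComponents → Fin 2,
      ∑ ε' : (D.withKind k').closedComponents → Fin 2, D.saddleTerm k' v ε ε' := by
  have h : ∀ {α : Type _} (i j : Fintype α), @Finset.univ α i = @Finset.univ α j :=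
    fun i j => by congr!
  unfold saddleMap
  exact Finset.sum_congr (h _ _) fun ε _ => Finset.sum_congr (h _ _) fun ε' _ => rfl

/-- The tensor product of an element and a basis element, in the delooped factorization. -/
def tmulBasis (D : Crossingless V) (u : Bool → BoundaryRing) (ε : D.closedComponents → Fin 2) :
    D.delooped.carrier :=
  u ⊗ₜ[FH] D.circlesBasis ε

theorem tmulBasis_eq_sum (D : Crossingless V) (u : Bool → BoundaryRing)
    (ε : D.closedComponents → Fin 2) :
    D.tmulBasis u ε = ∑ b, u b • D.deloopedBasis (b, ε) := by
  rw [Fintype.sum_bool, ← single_tmul, ← single_tmul]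
  refine Eq.trans ?_ (TensorProduct.add_tmul _ _ _)
  rw [tmulBasis]
  congr 1
  funext c
  cases c <;> simp

open Classical in
theorem saddleTerm_tmulBasis (D : Crossingless V) (k' : V → ArcKind) (v : V)
    (u : Bool → BoundaryRing) (ε δ : D.closedComponents → Fin 2)
    (δ' : (D.withKind k').closedComponents → Fin 2) :
    D.saddleTerm k' v δ δ' (D.tmulBasis u ε) =
      if δ = ε then (D.withKind k').tmulBasis (D.saddleEntry k' v ε δ' u) δ' else 0 := by
  refine (TensorProduct.AlgebraTensorModule.map_tmul _ _ _ _).trans ?_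
  rw [LinearMap.smulRight_apply, Module.Basis.coord_apply, Module.Basis.repr_self]
  split_ifs with hδ
  · rw [hδ, Finsupp.single_eq_same, one_smul]
    rfl
  · rw [Finsupp.single_eq_of_ne hδ, zero_smul]
    exact TensorProduct.tmul_zero _ _

theorem saddleMap_tmulBasis (D : Crossingless V) (k' : V → ArcKind) (v : V)
    (u : Bool → BoundaryRing) (ε : D.closedComponents → Fin 2) :
    D.saddleMap k' v (D.tmulBasis u ε) =
      ∑ ε', (D.withKind k').tmulBasis (D.saddleEntry k' v ε ε' u) ε' := by
  classical
  rw [saddleMap_eq, LinearMap.sum_apply, Finset.sum_eq_single ε, LinearMap.sum_apply]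
  · exact Finset.sum_congr rfl fun δ' _ => (D.saddleTerm_tmulBasis k' v u ε ε δ').trans (if_pos rfl)
  · intro δ _ hδ
    rw [LinearMap.sum_apply]
    exact Finset.sum_eq_zero fun δ' _ => (D.saddleTerm_tmulBasis k' v u ε δ δ').trans (if_neg hδ)
  · exact fun h => absurd (Finset.mem_univ _) h

theorem entry_saddleMap (b b' : Bool) (ε : (G.dress k).closedComponents → Fin 2)
    (ε' : (G.dress k').closedComponents → Fin 2) :
    entry (saddleBetween G k k' v) b b' ε ε' =
      (G.dress k).saddleEntry k' v ε ε' (Pi.single b 1) b' := by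
  have h : saddleBetween G k k' v ((G.dress k).deloopedBasis (b, ε)) =
      ∑ δ', ∑ c, (G.dress k).saddleEntry k' v ε δ' (Pi.single b 1) c •
        (G.dress k').deloopedBasis (c, δ') := by
    rw [deloopedBasis_apply]
    refine (saddleMap_tmulBasis (G.dress k) k' v (Pi.single b 1) ε).trans ?_
    exact Finset.sum_congr rfl fun δ' _ => tmulBasis_eq_sum (G.dress k') _ δ'
  rw [entry, h, Finset.sum_comm]
  have h2 := congrFun ((G.dress k').deloopedBasis.repr_sum_self
    fun j => (G.dress k).saddleEntry k' v ε j.2 (Pi.single b 1) j.1) (b', ε')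
  rw [Fintype.sum_prod_type] at h2
  exact h2

theorem saddle_eq (o : ArcKind) : saddle o = twoTerm 1 bz := by cases o <;> rfl

theorem saddle_comp_saddle (o o' : ArcKind) : saddle o' ∘ₗ saddle o = bz • LinearMap.id := by
  refine LinearMap.ext fun u => funext fun b => ?_
  rw [saddle_eq, saddle_eq, LinearMap.comp_apply, twoTerm_apply, twoTerm_apply]
  cases b <;> simp

/-- The entries of the saddle map are scalars if the open components are connected in the same
way. -/
theorem exists_saddleEntry_eq_smul (ho : (G.dress k).openKind = (G.dress k').openKind)
    (ε : (G.dress k).closedComponents → Fin 2) (ε' : (G.dress k').closedComponents → Fin 2) :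
    ∃ s : BoundaryRing, (G.dress k).saddleEntry k' v ε ε' = s • LinearMap.id := by
  have h0 : ∃ s : BoundaryRing, (0 : (Bool → BoundaryRing) →ₗ[BoundaryRing] _) =
    s • LinearMap.id := ⟨0, by simp⟩
  have h1 : ∃ s : BoundaryRing, (LinearMap.id : (Bool → BoundaryRing) →ₗ[BoundaryRing] _) =
    s • LinearMap.id := ⟨1, by simp⟩
  have h2 : ∃ s : BoundaryRing, dot (G.dress k).openKind = s • LinearMap.id := by
    rcases (G.dress k).openKind with _ | _ <;> exact ⟨_, rfl⟩
  have h3 := saddle_comp_saddle (G.dress k).openKind (G.dress k).openKind.other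
  unfold saddleEntry
  split
  · exact h0
  · split
    · exact absurd ho ‹_›
    · split
      all_goals first | assumption | exact ⟨_, rfl⟩ | skip
      all_goals split
      all_goals first | assumption | exact ⟨_, rfl⟩ | exact ⟨_, h3⟩

theorem entry_saddleMap_of_openKind_eq (ho : (G.dress k).openKind = (G.dress k').openKind)
    (ε : (G.dress k).closedComponents → Fin 2) (ε' : (G.dress k').closedComponents → Fin 2) :
    (∀ b, entry (saddleBetween G k k' v) b (!b) ε ε' = 0) ∧
      entry (saddleBetween G k k' v) true true ε ε' =
        entry (saddleBetween G k k' v) false false ε ε' := by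
  obtain ⟨s, hs⟩ := exists_saddleEntry_eq_smul (v := v) ho ε ε'
  constructor
  · intro b
    rw [entry_saddleMap, hs]
    cases b <;> simp
  · rw [entry_saddleMap, entry_saddleMap, hs]
    simp

open Classical in
theorem entry_saddleMap_of_openKind_ne (ho : (G.dress k).openKind ≠ (G.dress k').openKind)
    (b b' : Bool) (ε : (G.dress k).closedComponents → Fin 2)
    (ε' : (G.dress k').closedComponents → Fin 2) :
    entry (saddleBetween G k k' v) b b' ε ε' = if (G.dress k).Agree k' ε ε' then
      (if b = b' then 0 else if b then 1 else bz) else 0 := by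
  rw [entry_saddleMap]
  unfold saddleEntry
  by_cases ha : (G.dress k).Agree k' ε ε'
  · rw [if_pos ha, if_neg (not_not.mpr ha)]
    refine (congrArg (fun f : (Bool → BoundaryRing) →ₗ[BoundaryRing] (Bool → BoundaryRing) => f (Pi.single b 1) b')
      (if_pos ho)).trans ?_
    rw [saddle_eq, twoTerm_apply]
    cases b <;> cases b' <;> simp
  · rw [if_neg ha, if_pos ha]
    rfl

theorem saddleMap_closed :
    boundary (M := (G.dress k).delooped) (N := (G.dress k').delooped) (saddleBetween G k k' v) = 0 := by
  rw [boundary_eq_zero_iff]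
  intro b b' ε ε'
  by_cases ho : (G.dress k).openKind = (G.dress k').openKind
  · obtain ⟨h1, h2⟩ := entry_saddleMap_of_openKind_eq (v := v) ho ε ε'
    have h3 := h1 true
    have h4 := h1 false
    rw [ho]
    cases b <;> cases b' <;>
      simp only [Bool.not_true, Bool.not_false] at h3 h4 ⊢ <;> simp [h2, h3, h4]
  · rw [entry_saddleMap_of_openKind_ne ho, entry_saddleMap_of_openKind_ne ho, ArcKind.snd_eq ho,
      ArcKind.snd_eq (Ne.symm ho)]
    split_ifs <;> cases b <;> cases b' <;> simp at *

end Saddle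

end Crossingless

/-! ### Sums over exponents in which all but one or two are fixed. -/

section SumUpdate

variable {K M : Type*} [Fintype K] [DecidableEq K] [AddCommMonoid M]

theorem sum_eq_sum_update (e : K → Fin 2) (c : K) (f : (K → Fin 2) → M)
    (h : ∀ ε, f ε ≠ 0 → ∀ a, a ≠ c → ε a = e a) :
    ∑ ε, f ε = f (Function.update e c 0) + f (Function.update e c 1) := by
  rw [← Fin.sum_univ_two fun i => f (Function.update e c i)]
  refine (Finset.sum_of_injOn (fun i => Function.update e c i) ?_ (fun _ _ => Finset.mem_univ _)
    ?_ fun _ _ => rfl).symm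
  · exact fun i _ j _ hij => Function.update_injective e c hij
  · intro ε _ hε
    by_contra hf
    refine hε ⟨ε c, Finset.mem_coe.mpr (Finset.mem_univ _), funext fun a => ?_⟩
    by_cases ha : a = c
    · subst ha; exact Function.update_self _ _ _
    · exact (Function.update_of_ne ha _ _).trans (h ε hf a ha).symm

theorem sum_eq_sum_update_update (e : K → Fin 2) {c c' : K} (hc : c ≠ c') (f : (K → Fin 2) → M)
    (h : ∀ ε, f ε ≠ 0 → ∀ a, a ≠ c → a ≠ c' → ε a = e a) :
    ∑ ε, f ε = ∑ i, ∑ j, f (Function.update (Function.update e c i) c' j) := by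
  rw [← Fintype.sum_prod_type' fun i j => f (Function.update (Function.update e c i) c' j)]
  refine (Finset.sum_of_injOn
    (fun i : Fin 2 × Fin 2 => Function.update (Function.update e c i.1) c' i.2) ?_
    (fun _ _ => Finset.mem_univ _) ?_ fun _ _ => rfl).symm
  · intro i _ j _ hij
    have h1 := congrFun hij c
    have h2 := congrFun hij c'
    simp only [Function.update_self, Function.update_of_ne hc] at h1 h2
    exact Prod.ext h1 h2
  · intro ε _ hε
    by_contra hf
    refine hε ⟨(ε c, ε c'), Finset.mem_coe.mpr (Finset.mem_univ _), funext fun a => ?_⟩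
    by_cases ha' : a = c'
    · subst ha'; exact Function.update_self _ _ _
    · refine (Function.update_of_ne ha' _ _).trans ?_
      by_cases ha : a = c
      · subst ha; exact Function.update_self _ _ _
      · exact (Function.update_of_ne ha _ _).trans (h ε hf a ha ha').symm

end SumUpdate

/-! ### Components at the saddle and components common to both diagrams. -/

namespace Crossingless

open Gluing Factorization

section Local

variable {V : Type*} [DecidableEq V] [Fintype V] {D : Crossingless V} {v : V}

theorem circleMon_eq_mul (κ : D.toGluing.Colouring) (v : V) (ε : D.closedComponents → Fin 2) :
    Frame.circleMon (D := D) κ ε =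
      (∏ c ∈ D.circlesThrough v, κ.circleVar c.1 ^ (ε c : ℕ)) *
        ∏ c ∈ D.circlesAway v, κ.circleVar c.1 ^ (ε c : ℕ) := by
  classical
  exact (Finset.prod_filter_mul_prod_filter_not _ _ _).symm

theorem topEnd_component_ne (κ : D.toGluing.Colouring) :
    D.component (D.topEnd Side.left) ≠ D.component (D.bottomEnd Side.right) := fun h' =>
  bottomEnd_right_notMem_special (D := D) κ (by
    rw [special, h']
    exact self_mem_component _)

/-- At most two components run through a vertex, and both places are taken by circles. -/
theorem ends_away (h : D.circlesAt v = 2) (s : Side) :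
    ¬ D.Through (D.component (D.topEnd s)) v ∧ ¬ D.Through (D.component (D.bottomEnd s)) v := by
  rw [circlesAt_eq, Finset.card_eq_two] at h
  obtain ⟨c₁, c₂, hne, hT⟩ := h
  have h1 : D.Through c₁.1 v := mem_circlesThrough.mp (hT ▸ by simp)
  have h2 : D.Through c₂.1 v := mem_circlesThrough.mp (hT ▸ by simp)
  have key : ∀ e, D.Through (D.component e) v → D.component e = c₁.1 ∨ D.component e = c₂.1 := by
    intro e he
    have := component_eq_of_through ((through_rep c₁.2).mpr h1) ((through_rep c₂.2).mpr h2)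
      (by rw [component_rep c₁.2, component_rep c₂.2]; exact fun h => hne (Subtype.ext h)) he
    rwa [component_rep c₁.2, component_rep c₂.2] at this
  constructor <;> intro h <;> rcases key _ h with h | h
  · exact (component_ne_of_closed c₁.2 s).1 h
  · exact (component_ne_of_closed c₂.2 s).1 h
  · exact (component_ne_of_closed c₁.2 s).2 h
  · exact (component_ne_of_closed c₂.2 s).2 h

theorem mkResidue_altSum_of_through (F : D.Frame) (κ : D.toGluing.Colouring) (hL : D.Linked)
    (hP : D.Planar) {Q : Ideal BoundaryRing} (hp : D.openKind.fst ∈ Q) {e e' : D.Edge}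
    (h : D.Through (D.component e) v) (h' : D.Through (D.component e') v)
    (hne : D.component e ≠ D.component e') :
    F.mkResidue κ hL hP Q (altSum D.toGluing v) =
      F.mkResidue κ hL hP Q (κ.edgeVar e) + F.mkResidue κ hL hP Q (κ.edgeVar e') +
      F.mkResidue κ hL hP Q (algebraMap _ _ bH) := by
  have hy : ∀ {a b : D.Edge}, D.component a = D.component b →
      F.mkResidue κ hL hP Q (κ.edgeVar a) = F.mkResidue κ hL hP Q (κ.edgeVar b) := fun hab =>
    F.mkResidue_edgeVar κ hL hP hp (hab ▸ self_mem_component _)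
  rw [F.mkResidue_altSum κ hL hP hp]
  rcases component_eq_strand h with h1 | h1 <;> rcases component_eq_strand h' with h2 | h2
  · exact absurd (h1.trans h2.symm) hne
  · rw [hy h1, hy h2]
  · rw [hy h1, hy h2, add_comm (F.mkResidue κ hL hP Q (κ.edgeVar (D.secondStrand v)))]
  · exact absurd (h1.trans h2.symm) hne

end Local

section Common

variable {V : Type*} [DecidableEq V] [Fintype V] {G : Gluing V} {k k' : V → ArcKind} {v : V}

open Classical in
variable (k') in
/-- The exponents on the common closed components, extended by zero. -/
def extendExp (ε : (G.dress k).closedComponents → Fin 2) :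
    (G.dress k').closedComponents → Fin 2 := fun c =>
  if h : c.1 ∈ (G.dress k).closedComponents then ε ⟨c.1, h⟩ else 0

/-- A common closed component could run through the saddle, but then each diagram would have exactly
one circle there, which `hn` excludes. Agreement is thus a condition on the circles away from `v`
only. -/
theorem agree_iff (hk : ∀ u, u ≠ v → k u = k' u) (hv : k v ≠ k' v)
    (hn : (G.dress k).circlesAt v ≠ (G.dress k').circlesAt v ∨ (G.dress k).circlesAt v = 0)
    (ε : (G.dress k).closedComponents → Fin 2) (ε' : (G.dress k').closedComponents → Fin 2) :
    (G.dress k).Agree k' ε ε' ↔ ∀ c ∈ (G.dress k').circlesAway v, ε' c = extendExp k' ε c := by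
  constructor
  · intro h c hc
    have hc' := closed_of_not_through (fun u hu => (hk u hu).symm) c.2 (mem_circlesAway.mp hc)
    rw [extendExp, dif_pos hc']
    exact (h c.1 hc' c.2).symm
  · intro h c hc hc'
    change c ∈ (G.dress k').closedComponents at hc'
    by_cases ht : (G.dress k).Through c v
    · have h1 := circlesAt_eq_one hv hc hc' ht
      have h2 := circlesAt_eq_one hv.symm hc' hc ht
      omega
    · have h3 := h ⟨c, hc'⟩ (mem_circlesAway.mpr ht)
      rw [extendExp, dif_pos hc] at h3
      exact h3.symm

theorem prod_circlesAway (κ : G.Colouring) (hk : ∀ u, u ≠ v → k u = k' u)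
    {ε : (G.dress k).closedComponents → Fin 2} {ε' : (G.dress k').closedComponents → Fin 2}
    (h : (G.dress k).Agree k' ε ε') :
    ∏ c ∈ (G.dress k').circlesAway v, κ.circleVar c.1 ^ (ε' c : ℕ) =
      ∏ c ∈ (G.dress k).circlesAway v, κ.circleVar c.1 ^ (ε c : ℕ) := by
  refine (Finset.prod_bij
    (fun c hc => ⟨c.1, closed_of_not_through hk c.2 (mem_circlesAway.mp hc)⟩) ?_ ?_ ?_ ?_).symm
  · exact fun c hc => mem_circlesAway.mpr (mem_circlesAway (D := G.dress k).mp hc)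
  · exact fun c _ c' _ h => Subtype.ext (congrArg (fun x => x.1) h)
  · intro c hc
    exact ⟨⟨c.1, closed_of_not_through (fun u hu => (hk u hu).symm) c.2 (mem_circlesAway.mp hc)⟩,
      mem_circlesAway.mpr (mem_circlesAway (D := G.dress k').mp hc), rfl⟩
  · intro c hc
    rw [h c.1 c.2 (closed_of_not_through hk c.2 (mem_circlesAway.mp hc))]
    rfl

end Common

end Crossingless

/-! ### Values of the saddle map modulo `residue`. -/

namespace Crossingless

open Gluing Factorization

section Values

variable {V : Type*} [DecidableEq V] [Fintype V] {G : Gluing V} {k k' : V → ArcKind} {v : V}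

variable (v) in
/-- The matrix entries of the saddle map. -/
def saddleCoeff (b b' : Bool) (ε : (G.dress k).closedComponents → Fin 2)
    (ε' : (G.dress k').closedComponents → Fin 2) : BoundaryRing :=
  entry (saddleBetween G k k' v) b b' ε ε'

theorem saddleCoeff_of_not_agree (b b' : Bool) {ε : (G.dress k).closedComponents → Fin 2}
    {ε' : (G.dress k').closedComponents → Fin 2} (h : ¬ (G.dress k).Agree k' ε ε') :
    saddleCoeff v b b' ε ε' = 0 := by
  rw [saddleCoeff, entry_saddleMap]
  unfold saddleEntry
  rw [if_pos h]
  rfl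

/-- The scalar by which the dot map multiplies. -/
def _root_.Delooping.ArcKind.dotScalar : ArcKind → BoundaryRing
  | ArcKind.dotted => bY
  | ArcKind.thick => bx

theorem dot_eq (o : ArcKind) : dot o = o.dotScalar • LinearMap.id := by cases o <;> rfl

open Classical in
theorem saddleCoeff_of_agree {ε : (G.dress k).closedComponents → Fin 2}
    {ε' : (G.dress k').closedComponents → Fin 2} (h : (G.dress k).Agree k' ε ε')
    (ho : (G.dress k).openKind = (G.dress k').openKind) {n n' a a' : ℕ}
    (hn : (G.dress k).circlesAt v = n) (hn' : (G.dress k').circlesAt v = n')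
    (ha : (G.dress k).ysAt v ε = a) (ha' : (G.dress k').ysAt v ε' = a') :
    saddleCoeff v false false ε ε' = match (generalizing := false) n, n', a, a' with
    | 2, 1, 0, 0 => 1
    | 2, 1, 1, 1 => 1
    | 2, 1, 2, 1 => bH
    | 1, 2, 0, 1 => 1
    | 1, 2, 0, 0 => bH
    | 1, 2, 1, 2 => 1
    | 1, 0, 0, 0 => 1
    | 1, 0, 1, 0 => if (G.dress k).Through (G.dress k).special v then bH else bz
    | 0, 1, 0, 0 =>
        if (G.dress k).Through (G.dress k).special v then 0 else (G.dress k).openKind.dotScalar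
    | 0, 1, 0, 1 => 1
    | _, _, _, _ => 0 := by
  have hn₂ : ((G.dress k).withKind k').circlesAt v = n' := hn'
  have ha₂ : ((G.dress k).withKind k').ysAt v ε' = a' := ha'
  rw [saddleCoeff, entry_saddleMap]
  unfold saddleEntry
  rw [if_neg (not_not.mpr h),
    if_neg (not_not.mpr ho : ¬ (G.dress k).openKind ≠ ((G.dress k).withKind k').openKind),
    saddle_comp_saddle, dot_eq, hn, hn₂, ha, ha₂]
  clear hn hn₂ ha ha₂ hn' ha' h
  generalize (G.dress k).Through (G.dress k).special v = t
  split
  any_goals simp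
  any_goals split_ifs <;> simp

variable (F' : (G.dress k').Frame) (κ : G.Colouring) (hL : G.Linked) (hP : G.Planar)
  (Q : Ideal BoundaryRing)

/-- The circles away from the saddle contribute a common factor. What remains is a sum over
exponents at the circles through `v`, which is evaluated below for zero, one and two such circles in
the target. -/
theorem mkResidue_block_saddleMap (hk : ∀ u, u ≠ v → k u = k' u) (b b' : Bool)
    (ε : (G.dress k).closedComponents → Fin 2) :
    F'.mkResidue κ hL hP Q (block (D := G.dress k') κ b'
        (saddleBetween G k k' v ((G.dress k).deloopedBasis (b, ε)))) =
      (∑ ε', F'.mkResidue κ hL hP Q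
        (algebraMap _ _ (saddleCoeff v b b' ε ε')) *
          ∏ c ∈ (G.dress k').circlesThrough v,
            F'.mkResidue κ hL hP Q (κ.circleVar c.1) ^ (ε' c : ℕ)) *
        F'.mkResidue κ hL hP Q (∏ c ∈ (G.dress k).circlesAway v, κ.circleVar c.1 ^ (ε c : ℕ)) := by
  rw [block_apply, map_sum, Finset.sum_mul]
  refine Finset.sum_congr rfl fun ε' _ => ?_
  change F'.mkResidue κ hL hP Q (saddleCoeff v b b' ε ε' • _) = _
  by_cases h : (G.dress k).Agree k' ε ε'
  · rw [Algebra.smul_def, map_mul, circleMon_eq_mul (D := G.dress k') κ v, map_mul, prod_circlesAway κ hk h, mul_assoc,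
      map_prod (F'.mkResidue κ hL hP Q) _ ((G.dress k').circlesThrough v)]
    simp only [map_pow]
  · rw [saddleCoeff_of_not_agree _ _ h]
    simp

variable {Q}

theorem agree_of_coeff_ne_zero {ε : (G.dress k).closedComponents → Fin 2}
    {ε' : (G.dress k').closedComponents → Fin 2} {b b' : Bool} {r : (G.dress k').ReducedRing ⧸ F'.residue κ hL hP Q}
    (h : F'.mkResidue κ hL hP Q (algebraMap _ _ (saddleCoeff v b b' ε ε')) * r ≠ 0) :
    (G.dress k).Agree k' ε ε' := by
  by_contra h'
  exact h (by rw [saddleCoeff_of_not_agree _ _ h', map_zero, map_zero, zero_mul])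

theorem mkResidue_saddleMap_none (hk : ∀ u, u ≠ v → k u = k' u) (hv : k v ≠ k' v)
    (hn : (G.dress k).circlesAt v ≠ (G.dress k').circlesAt v ∨ (G.dress k).circlesAt v = 0)
    (hT : (G.dress k').circlesThrough v = ∅) (b b' : Bool)
    (ε : (G.dress k).closedComponents → Fin 2) :
    ∃ ε', (G.dress k).Agree k' ε ε' ∧ (G.dress k').ysAt v ε' = 0 ∧
      F'.mkResidue κ hL hP Q (block (D := G.dress k') κ b'
        (saddleBetween G k k' v ((G.dress k).deloopedBasis (b, ε)))) =
      F'.mkResidue κ hL hP Q (algebraMap _ _ (saddleCoeff v b b' ε ε')) *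
        F'.mkResidue κ hL hP Q (∏ c ∈ (G.dress k).circlesAway v, κ.circleVar c.1 ^ (ε c : ℕ)) := by
  have hag := agree_iff hk hv hn ε
  refine ⟨extendExp k' ε, (hag _).mpr fun _ _ => rfl, ?_, ?_⟩
  · rw [ysAt_eq, hT, Finset.sum_empty]
  · rw [mkResidue_block_saddleMap F' κ hL hP Q hk]
    simp only [hT, Finset.prod_empty]
    congr 1
    refine (Finset.sum_eq_single (extendExp k' ε) (fun ε' _ hne => ?_)
      fun h => absurd (Finset.mem_univ _) h).trans (mul_one _)
    by_contra h
    exact hne (funext fun a => (hag ε').mp (agree_of_coeff_ne_zero F' κ hL hP h) a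
      (mem_circlesAway.mpr fun h => Finset.notMem_empty a (hT ▸ mem_circlesThrough.mpr h)))

theorem mkResidue_saddleMap_one (hk : ∀ u, u ≠ v → k u = k' u) (hv : k v ≠ k' v)
    (hn : (G.dress k).circlesAt v ≠ (G.dress k').circlesAt v ∨ (G.dress k).circlesAt v = 0)
    {c : (G.dress k').closedComponents} (hT : (G.dress k').circlesThrough v = {c}) (b b' : Bool)
    (ε : (G.dress k).closedComponents → Fin 2) :
    ∃ δ : Fin 2 → (G.dress k').closedComponents → Fin 2,
      (∀ i, (G.dress k).Agree k' ε (δ i) ∧ (G.dress k').ysAt v (δ i) = i) ∧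
      F'.mkResidue κ hL hP Q (block (D := G.dress k') κ b'
        (saddleBetween G k k' v ((G.dress k).deloopedBasis (b, ε)))) =
      (F'.mkResidue κ hL hP Q (algebraMap _ _ (saddleCoeff v b b' ε (δ 0))) +
        F'.mkResidue κ hL hP Q (algebraMap _ _ (saddleCoeff v b b' ε (δ 1))) *
          F'.mkResidue κ hL hP Q (κ.circleVar c.1)) *
        F'.mkResidue κ hL hP Q (∏ c ∈ (G.dress k).circlesAway v, κ.circleVar c.1 ^ (ε c : ℕ)) := by
  classical
  have hag := agree_iff hk hv hn ε
  have hc : ∀ a, a ∈ (G.dress k').circlesAway v ↔ a ≠ c := fun a => by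
    rw [mem_circlesAway, ← mem_circlesThrough, hT, Finset.mem_singleton]
  refine ⟨fun i => Function.update (extendExp k' ε) c i, fun i => ⟨(hag _).mpr fun a ha =>
    Function.update_of_ne ((hc a).mp ha) _ _, ?_⟩, ?_⟩
  · dsimp only
    rw [ysAt_eq, hT, Finset.sum_singleton, Function.update_self]
  · rw [mkResidue_block_saddleMap F' κ hL hP Q hk, sum_eq_sum_update (extendExp k' ε) c]
    · simp only [hT, Finset.prod_singleton, Function.update_self, Fin.val_zero, Fin.val_one,
        pow_zero, pow_one, mul_one]
    · exact fun ε' h a ha => (hag ε').mp (agree_of_coeff_ne_zero F' κ hL hP h) a ((hc a).mpr ha)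

theorem mkResidue_saddleMap_two (hk : ∀ u, u ≠ v → k u = k' u) (hv : k v ≠ k' v)
    (hn : (G.dress k).circlesAt v ≠ (G.dress k').circlesAt v ∨ (G.dress k).circlesAt v = 0)
    {c c' : (G.dress k').closedComponents} (hne : c ≠ c')
    (hT : (G.dress k').circlesThrough v = {c, c'}) (b b' : Bool)
    (ε : (G.dress k).closedComponents → Fin 2) :
    ∃ δ : Fin 2 → Fin 2 → (G.dress k').closedComponents → Fin 2,
      (∀ i j, (G.dress k).Agree k' ε (δ i j) ∧ (G.dress k').ysAt v (δ i j) = (i : ℕ) + (j : ℕ)) ∧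
      F'.mkResidue κ hL hP Q (block (D := G.dress k') κ b'
        (saddleBetween G k k' v ((G.dress k).deloopedBasis (b, ε)))) =
      (∑ i, ∑ j, F'.mkResidue κ hL hP Q (algebraMap _ _ (saddleCoeff v b b' ε (δ i j))) *
        (F'.mkResidue κ hL hP Q (κ.circleVar c.1) ^ (i : ℕ) *
          F'.mkResidue κ hL hP Q (κ.circleVar c'.1) ^ (j : ℕ))) *
        F'.mkResidue κ hL hP Q (∏ c ∈ (G.dress k).circlesAway v, κ.circleVar c.1 ^ (ε c : ℕ)) := by
  classical
  have hag := agree_iff hk hv hn ε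
  have hc : ∀ a, a ∈ (G.dress k').circlesAway v ↔ a ≠ c ∧ a ≠ c' := fun a => by
    rw [mem_circlesAway, ← mem_circlesThrough, hT, Finset.mem_insert, Finset.mem_singleton, not_or]
  refine ⟨fun i j => Function.update (Function.update (extendExp k' ε) c i) c' j,
    fun i j => ⟨(hag _).mpr fun a ha => ?_, ?_⟩, ?_⟩
  · dsimp only
    rw [Function.update_of_ne ((hc a).mp ha).2, Function.update_of_ne ((hc a).mp ha).1]
  · dsimp only
    rw [ysAt_eq, hT, Finset.sum_pair hne, Function.update_self, Function.update_of_ne hne,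
      Function.update_self]
  · rw [mkResidue_block_saddleMap F' κ hL hP Q hk,
      sum_eq_sum_update_update (extendExp k' ε) hne]
    · simp only [hT, Finset.prod_pair hne, Function.update_self, Function.update_of_ne hne]
    · exact fun ε' h a ha ha' =>
        (hag ε').mp (agree_of_coeff_ne_zero F' κ hL hP h) a ((hc a).mpr ⟨ha, ha'⟩)

end Values

end Crossingless

/-! ### The types of saddles, compared with multiplication by 1 or by σ. -/

namespace Crossingless

open Gluing Factorization

section Arithmetic

variable {A : Type*} [CommRing A] (φ : BoundaryRing →+* A) {a b y : A}

theorem merge_arith (ha : a ^ 2 = φ bH * a) : φ 0 + φ bH * a = a ^ 1 * a ^ 1 := by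
  rw [map_zero, zero_add, ← ha, sq, pow_one]

theorem split_arith_zero :
    φ bH * (a ^ 0 * b ^ 0) + φ 1 * (a ^ 0 * b ^ 1) + (φ 1 * (a ^ 1 * b ^ 0) + φ 0 * (a ^ 1 * b ^ 1)) =
      y ^ 0 * (a + b + φ bH) := by
  rw [map_zero, map_one]
  ring

/-- The coproduct of y: since y² = Hy, multiplying y + y' + H by y leaves yy', and likewise for y'.
-/
theorem split_arith_one (h2 : (2 : A) = 0) (ha : a ^ 2 = φ bH * a) (hb : b ^ 2 = φ bH * b)
    (hy : y = a ∨ y = b) :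
    φ 0 * (a ^ 0 * b ^ 0) + φ 0 * (a ^ 0 * b ^ 1) + (φ 0 * (a ^ 1 * b ^ 0) + φ 1 * (a ^ 1 * b ^ 1)) =
      y ^ 1 * (a + b + φ bH) := by
  rw [map_zero, map_one]
  rcases hy with rfl | rfl
  · linear_combination (-1 : A) * ha - y * φ bH * h2
  · linear_combination (-1 : A) * hb - y * φ bH * h2

end Arithmetic

section Cases

variable {V : Type*} [DecidableEq V] [Fintype V] {G : Gluing V} {k k' : V → ArcKind} {v : V}
variable (F' : (G.dress k').Frame) (κ : G.Colouring) (hL : G.Linked) (hP : G.Planar)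
  {Q : Ideal BoundaryRing}

theorem closed_of_circlesAt_two (κ : G.Colouring) (hn : (G.dress k).circlesAt v = 2) {e : G.Edge}
    (he : (G.dress k).Through ((G.dress k).component e) v) :
    (G.dress k).component e ∈ (G.dress k).closedComponents :=
  component_closed_of_through (D := G.dress k) κ he (ends_away (D := G.dress k) hn _).1
    (ends_away (D := G.dress k) hn _).2

/-- Two circles merge. -/
theorem mkResidue_saddleMap_two_one (hk : ∀ u, u ≠ v → k u = k' u) (hv : k v ≠ k' v)
    (ho : (G.dress k).openKind = (G.dress k').openKind)
    (hp : (G.dress k').openKind.fst ∈ Q) (hq : (G.dress k').openKind.snd ∈ Q)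
    (hn : (G.dress k).circlesAt v = 2) (hn' : (G.dress k').circlesAt v = 1)
    (ε : (G.dress k).closedComponents → Fin 2) :
    F'.mkResidue κ hL hP Q (block (D := G.dress k') κ false
        (saddleBetween G k k' v ((G.dress k).deloopedBasis (false, ε)))) =
      F'.mkResidue κ hL hP Q (Frame.circleMon (D := G.dress k) κ ε) := by
  obtain ⟨c₁, c₂, hne, hT⟩ := Finset.card_eq_two.mp ((circlesAt_eq (D := G.dress k) v).symm.trans hn)
  obtain ⟨c, hT'⟩ := Finset.card_eq_one.mp ((circlesAt_eq (D := G.dress k') v).symm.trans hn')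
  -- Both circles become part of the merged circle, so their variables coincide there and a product
  -- of circle monomials is multiplied out in the algebra of that circle.
  have hy : ∀ a ∈ (G.dress k).circlesThrough v, F'.mkResidue κ hL hP Q (κ.circleVar a.1) =
      F'.mkResidue κ hL hP Q (κ.circleVar c.1) := by
    intro a ha
    have h1 := (through_congr hk _).mpr ((through_rep a.2).mpr (mem_circlesThrough.mp ha))
    have h2 := component_closed_of_through (D := G.dress k') κ h1
      (mt (through_congr hk _).mp (ends_away (D := G.dress k) hn _).1)
      (mt (through_congr hk _).mp (ends_away (D := G.dress k) hn _).2)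
    have h3 : (⟨_, h2⟩ : (G.dress k').closedComponents) ∈ (G.dress k').circlesThrough v :=
      mem_circlesThrough.mpr h1
    rw [hT', Finset.mem_singleton] at h3
    refine F'.mkResidue_edgeVar_circle κ hL hP hp c.2 ?_
    rw [← h3]
    exact self_mem_component (D := G.dress k') _
  have hsq := F'.mkResidue_edgeVar_sq κ hL hP hp hq (G.rep c.1)
  change F'.mkResidue κ hL hP Q (κ.circleVar c.1) ^ 2 = _ * F'.mkResidue κ hL hP Q (κ.circleVar c.1)
    at hsq
  obtain ⟨δ, hδ, heq⟩ := mkResidue_saddleMap_one F' κ hL hP (Q := Q) hk hv (Or.inl (by omega)) hT'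
    false false ε
  have ha := (G.dress k).ysAt_eq v ε
  rw [hT, Finset.sum_pair hne] at ha
  rw [heq, circleMon_eq_mul (D := G.dress k) κ v, map_mul, hT,
    Finset.prod_pair hne, map_mul, map_pow, map_pow, hy c₁ (by simp [hT]), hy c₂ (by simp [hT]),
    saddleCoeff_of_agree (hδ 0).1 ho hn hn' ha (hδ 0).2,
    saddleCoeff_of_agree (hδ 1).1 ho hn hn' ha (hδ 1).2]
  congr 1
  obtain ⟨φ, hφ⟩ : ∃ φ : BoundaryRing →+* (G.dress k').ReducedRing ⧸ F'.residue κ hL hP Q,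
      ∀ s, F'.mkResidue κ hL hP Q (algebraMap _ _ s) = φ s :=
    ⟨(F'.mkResidue κ hL hP Q).comp (algebraMap _ _), fun _ => rfl⟩
  rw [hφ] at hsq
  rw [hφ, hφ]
  generalize ε c₁ = a
  generalize ε c₂ = b
  fin_cases a <;> fin_cases b
  · simp
  · simp
  · simp
  · exact merge_arith φ hsq

/-- A circle splits. -/
theorem mkResidue_saddleMap_one_two (hk : ∀ u, u ≠ v → k u = k' u) (hv : k v ≠ k' v)
    (ho : (G.dress k).openKind = (G.dress k').openKind)
    (hp : (G.dress k').openKind.fst ∈ Q) (hq : (G.dress k').openKind.snd ∈ Q)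
    (hn : (G.dress k).circlesAt v = 1) (hn' : (G.dress k').circlesAt v = 2)
    (ε : (G.dress k).closedComponents → Fin 2) :
    F'.mkResidue κ hL hP Q (block (D := G.dress k') κ false
        (saddleBetween G k k' v ((G.dress k).deloopedBasis (false, ε)))) =
      F'.mkResidue κ hL hP Q (Frame.circleMon (D := G.dress k) κ ε) *
        F'.mkResidue κ hL hP Q (altSum G v) := by
  obtain ⟨c₁, c₂, hne, hT'⟩ :=
    Finset.card_eq_two.mp ((circlesAt_eq (D := G.dress k') v).symm.trans hn')
  obtain ⟨c, hT⟩ := Finset.card_eq_one.mp ((circlesAt_eq (D := G.dress k) v).symm.trans hn)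
  have ht₁ : (G.dress k').Through c₁.1 v := mem_circlesThrough.mp (hT' ▸ by simp)
  have ht₂ : (G.dress k').Through c₂.1 v := mem_circlesThrough.mp (hT' ▸ by simp)
  have hσ := mkResidue_altSum_of_through (D := G.dress k') F' κ hL hP hp
    ((through_rep c₁.2).mpr ht₁) ((through_rep c₂.2).mpr ht₂)
    (by rw [component_rep c₁.2, component_rep c₂.2]; exact fun h => hne (Subtype.ext h))
  change F'.mkResidue κ hL hP Q (altSum G v) = F'.mkResidue κ hL hP Q (κ.circleVar c₁.1) +
    F'.mkResidue κ hL hP Q (κ.circleVar c₂.1) + _ at hσ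
  have hsq : ∀ a : Set G.Edge, F'.mkResidue κ hL hP Q (κ.circleVar a) ^ 2 =
      F'.mkResidue κ hL hP Q (algebraMap _ _ bH) * F'.mkResidue κ hL hP Q (κ.circleVar a) :=
    fun a => F'.mkResidue_edgeVar_sq κ hL hP hp hq (G.rep a)
  -- The edge chosen to define the variable of the splitting circle lies on one of the two new
  -- circles; which one is irrelevant by `split_arith_one`.
  have hy : F'.mkResidue κ hL hP Q (κ.circleVar c.1) = F'.mkResidue κ hL hP Q (κ.circleVar c₁.1) ∨
      F'.mkResidue κ hL hP Q (κ.circleVar c.1) = F'.mkResidue κ hL hP Q (κ.circleVar c₂.1) := by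
    have h0 : (G.dress k).Through c.1 v := mem_circlesThrough.mp (hT ▸ by simp)
    have h1 := (through_congr hk _).mpr ((through_rep c.2).mpr h0)
    have h2 := closed_of_circlesAt_two κ hn' h1
    have h3 : (⟨_, h2⟩ : (G.dress k').closedComponents) ∈ (G.dress k').circlesThrough v :=
      mem_circlesThrough.mpr h1
    rw [hT', Finset.mem_insert, Finset.mem_singleton] at h3
    refine h3.imp (fun h => ?_) fun h => ?_
    · refine F'.mkResidue_edgeVar_circle κ hL hP hp c₁.2 ?_
      rw [← h]
      exact self_mem_component (D := G.dress k') _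
    · refine F'.mkResidue_edgeVar_circle κ hL hP hp c₂.2 ?_
      rw [← h]
      exact self_mem_component (D := G.dress k') _
  obtain ⟨δ, hδ, heq⟩ := mkResidue_saddleMap_two F' κ hL hP (Q := Q) hk hv (Or.inl (by omega)) hne
    hT' false false ε
  have ha := (G.dress k).ysAt_eq v ε
  rw [hT, Finset.sum_singleton] at ha
  have h2 := F'.mkResidue_two κ hL hP (Q := Q)
  rw [heq, circleMon_eq_mul (D := G.dress k) κ v, map_mul, hT, Finset.prod_singleton, map_pow,
    mul_right_comm, hσ]
  refine congrArg (· * _) ?_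
  obtain ⟨φ, hφ⟩ : ∃ φ : BoundaryRing →+* (G.dress k').ReducedRing ⧸ F'.residue κ hL hP Q,
      ∀ s, F'.mkResidue κ hL hP Q (algebraMap _ _ s) = φ s :=
    ⟨(F'.mkResidue κ hL hP Q).comp (algebraMap _ _), fun _ => rfl⟩
  have hs₁ := hsq c₁.1
  have hs₂ := hsq c₂.1
  rw [hφ] at hs₁ hs₂
  simp only [hφ, Fin.sum_univ_two]
  rcases (by decide : ∀ a : Fin 2, a = 0 ∨ a = 1) (ε c) with he | he <;> rw [he] at ha ⊢
  · have h00 := saddleCoeff_of_agree (hδ 0 0).1 ho hn hn' ha (hδ 0 0).2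
    have h01 := saddleCoeff_of_agree (hδ 0 1).1 ho hn hn' ha (hδ 0 1).2
    have h10 := saddleCoeff_of_agree (hδ 1 0).1 ho hn hn' ha (hδ 1 0).2
    have h11 := saddleCoeff_of_agree (hδ 1 1).1 ho hn hn' ha (hδ 1 1).2
    rw [h00, h01, h10, h11]
    exact split_arith_zero φ
  · have h00 := saddleCoeff_of_agree (hδ 0 0).1 ho hn hn' ha (hδ 0 0).2
    have h01 := saddleCoeff_of_agree (hδ 0 1).1 ho hn hn' ha (hδ 0 1).2
    have h10 := saddleCoeff_of_agree (hδ 1 0).1 ho hn hn' ha (hδ 1 0).2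
    have h11 := saddleCoeff_of_agree (hδ 1 1).1 ho hn hn' ha (hδ 1 1).2
    rw [h00, h01, h10, h11]
    exact split_arith_one φ h2 hs₁ hs₂ hy

theorem end_mem_of_not_closed {D : Crossingless V} (κ : D.toGluing.Colouring) {e : D.Edge}
    (h : D.component e ∉ D.closedComponents) :
    D.topEnd Side.left ∈ D.component e ∨ D.bottomEnd Side.right ∈ D.component e := by
  by_contra h'
  rw [not_or] at h'
  exact h (component_mem_closedComponents κ h'.1 h'.2)

/-- The circle becomes part of an open component, so its variable turns into H or z, which is the
value of the saddle map on y. -/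
theorem mkResidue_saddleMap_one_zero (hk : ∀ u, u ≠ v → k u = k' u) (hv : k v ≠ k' v)
    (ho : (G.dress k).openKind = (G.dress k').openKind)
    (hp : (G.dress k').openKind.fst ∈ Q)
    (hn : (G.dress k).circlesAt v = 1) (hn' : (G.dress k').circlesAt v = 0)
    (ε : (G.dress k).closedComponents → Fin 2) :
    F'.mkResidue κ hL hP Q (block (D := G.dress k') κ false
        (saddleBetween G k k' v ((G.dress k).deloopedBasis (false, ε)))) =
      F'.mkResidue κ hL hP Q (Frame.circleMon (D := G.dress k) κ ε) := by
  classical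
  obtain ⟨c, hT⟩ := Finset.card_eq_one.mp ((circlesAt_eq (D := G.dress k) v).symm.trans hn)
  have hT' := Finset.card_eq_zero.mp ((circlesAt_eq (D := G.dress k') v).symm.trans hn')
  have h0 : (G.dress k).Through c.1 v := mem_circlesThrough.mp (hT ▸ by simp)
  have h0' := (through_rep c.2).mpr h0
  have h1 := (through_congr hk _).mpr h0'
  have h2 : (G.dress k').component (G.rep c.1) ∉ (G.dress k').closedComponents := by
    intro h
    have : (⟨_, h⟩ : (G.dress k').closedComponents) ∈ (G.dress k').circlesThrough v :=
      mem_circlesThrough.mpr h1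
    rw [hT'] at this
    exact Finset.notMem_empty _ this
  have hy : F'.mkResidue κ hL hP Q (κ.circleVar c.1) = F'.mkResidue κ hL hP Q (algebraMap _ _
      (if (G.dress k).Through (G.dress k).special v then bH else bz)) := by
    rcases end_mem_of_not_closed (D := G.dress k') κ h2 with h | h
    · have h3 := (through_congr hk _).mp ((through_component_iff_of_mem h).mpr h1)
      rw [if_pos (show (G.dress k).Through (G.dress k).special v from h3)]
      exact F'.mkResidue_edgeVar_top κ hL hP hp h
    · have h3 := (through_congr hk _).mp ((through_component_iff_of_mem h).mpr h1)
      rw [if_neg]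
      · exact F'.mkResidue_edgeVar_bottom κ hL hP hp h
      -- If the special component ran through the saddle as well, there would be three components at
      -- it.
      · intro h4
        have h5 := component_eq_of_through h4 h3 (topEnd_component_ne (D := G.dress k) κ) h0'
        rw [component_rep c.2] at h5
        rcases h5 with h5 | h5
        · exact (component_ne_of_closed c.2 _).1 h5.symm
        · exact (component_ne_of_closed c.2 _).2 h5.symm
  obtain ⟨δ, hδ, hδ', heq⟩ := mkResidue_saddleMap_none F' κ hL hP (Q := Q) hk hv
    (Or.inl (by omega)) hT' false false ε
  have ha := (G.dress k).ysAt_eq v ε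
  rw [hT, Finset.sum_singleton] at ha
  rw [heq, circleMon_eq_mul (D := G.dress k) κ v, map_mul, hT, Finset.prod_singleton, map_pow, hy]
  refine congrArg (· * _) ?_
  rcases (by decide : ∀ a : Fin 2, a = 0 ∨ a = 1) (ε c) with he | he <;> rw [he] at ha ⊢ <;>
    rw [saddleCoeff_of_agree hδ ho hn hn' ha hδ']
  · simp
  · simp

/-- Here σ = y_c + H + w, where w is the variable of the open component. For the special one w = H
and the sum is y_c; for the other w = z, and z + H = x + y is the dot scalar modulo the first entry
of the differential. -/
theorem mkResidue_saddleMap_zero_one (hk : ∀ u, u ≠ v → k u = k' u) (hv : k v ≠ k' v)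
    (ho : (G.dress k).openKind = (G.dress k').openKind)
    (hp : (G.dress k').openKind.fst ∈ Q)
    (hn : (G.dress k).circlesAt v = 0) (hn' : (G.dress k').circlesAt v = 1)
    (ε : (G.dress k).closedComponents → Fin 2) :
    F'.mkResidue κ hL hP Q (block (D := G.dress k') κ false
        (saddleBetween G k k' v ((G.dress k).deloopedBasis (false, ε)))) =
      F'.mkResidue κ hL hP Q (Frame.circleMon (D := G.dress k) κ ε) *
        F'.mkResidue κ hL hP Q (altSum G v) := by
  classical
  obtain ⟨c, hT'⟩ := Finset.card_eq_one.mp ((circlesAt_eq (D := G.dress k') v).symm.trans hn')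
  have hT := Finset.card_eq_zero.mp ((circlesAt_eq (D := G.dress k) v).symm.trans hn)
  have h0 : (G.dress k').Through c.1 v := mem_circlesThrough.mp (hT' ▸ by simp)
  have h0' := (through_rep c.2).mpr h0
  have h1 := (through_congr hk _).mp h0'
  have h2 : (G.dress k).component (G.rep c.1) ∉ (G.dress k).closedComponents := by
    intro h
    have : (⟨_, h⟩ : (G.dress k).closedComponents) ∈ (G.dress k).circlesThrough v :=
      mem_circlesThrough.mpr h1
    rw [hT] at this
    exact Finset.notMem_empty _ this
  have h2' := F'.mkResidue_two κ hL hP (Q := Q)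
  have hσ : F'.mkResidue κ hL hP Q (altSum G v) = F'.mkResidue κ hL hP Q (algebraMap _ _
      (if (G.dress k).Through (G.dress k).special v then 0 else (G.dress k).openKind.dotScalar)) +
        F'.mkResidue κ hL hP Q (κ.circleVar c.1) := by
    by_cases hs : (G.dress k).Through (G.dress k).special v
    · rw [if_pos hs]
      refine (mkResidue_altSum_of_through (D := G.dress k') F' κ hL hP hp h0'
        ((through_congr hk _).mpr hs) ?_).trans ?_
      · rw [component_rep c.2]
        exact (component_ne_of_closed c.2 _).1.symm
      · rw [F'.mkResidue_edgeVar_top κ hL hP hp (self_mem_component (D := G.dress k') _)]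
        change F'.mkResidue κ hL hP Q (κ.circleVar c.1) + _ + _ = _
        rw [map_zero, map_zero]
        grind
    · rw [if_neg hs]
      have h3 : (G.dress k).Through ((G.dress k).component (G.bottomEnd Side.right)) v := by
        rcases end_mem_of_not_closed (D := G.dress k) κ h2 with h | h
        · exact absurd ((through_component_iff_of_mem h).mpr h1) hs
        · exact (through_component_iff_of_mem h).mpr h1
      refine (mkResidue_altSum_of_through (D := G.dress k') F' κ hL hP hp h0'
        ((through_congr hk _).mpr h3) ?_).trans ?_
      · rw [component_rep c.2]
        exact (component_ne_of_closed c.2 _).2.symm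
      · rw [F'.mkResidue_edgeVar_bottom κ hL hP hp (self_mem_component (D := G.dress k') _)]
        change F'.mkResidue κ hL hP Q (κ.circleVar c.1) + _ + _ = _
        rw [add_assoc, add_comm]
        congr 1
        rw [← map_add, ← map_add]
        refine (F'.mkResidue_eq_iff κ hL hP).mpr ?_
        rw [← map_add]
        refine F'.algebraMap_mem_residue κ hL hP ?_
        have h4 : bz + bH + (G.dress k).openKind.dotScalar = (G.dress k').openKind.fst := by
          have := BoundaryRing.two_eq_zero
          rw [ho, bH]
          rcases (G.dress k').openKind with _ | _
          · change bz + (bx + bY + bz) + bY = bx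
            grind
          · change bz + (bx + bY + bz) + bx = bY
            grind
        rw [h4]
        exact hp
  obtain ⟨δ, hδ, heq⟩ := mkResidue_saddleMap_one F' κ hL hP (Q := Q) hk hv (Or.inl (by omega)) hT'
    false false ε
  have ha := (G.dress k).ysAt_eq v ε
  rw [hT, Finset.sum_empty] at ha
  rw [heq, circleMon_eq_mul (D := G.dress k) κ v, map_mul, hT, Finset.prod_empty, map_one, one_mul,
    saddleCoeff_of_agree (hδ 0).1 ho hn hn' ha (hδ 0).2,
    saddleCoeff_of_agree (hδ 1).1 ho hn hn' ha (hδ 1).2, hσ, mul_comm]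
  congr 2
  simp

theorem mkResidue_saddleMap_zero_zero (hk : ∀ u, u ≠ v → k u = k' u) (hv : k v ≠ k' v)
    (ho : (G.dress k).openKind ≠ (G.dress k').openKind)
    (hn : (G.dress k).circlesAt v = 0) (hn' : (G.dress k').circlesAt v = 0)
    (ε : (G.dress k).closedComponents → Fin 2) :
    F'.mkResidue κ hL hP Q (block (D := G.dress k') κ false
        (saddleBetween G k k' v ((G.dress k).deloopedBasis (true, ε)))) =
      F'.mkResidue κ hL hP Q (Frame.circleMon (D := G.dress k) κ ε) := by
  have hT' := Finset.card_eq_zero.mp ((circlesAt_eq (D := G.dress k') v).symm.trans hn')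
  have hT := Finset.card_eq_zero.mp ((circlesAt_eq (D := G.dress k) v).symm.trans hn)
  obtain ⟨δ, hδ, hδ', heq⟩ := mkResidue_saddleMap_none F' κ hL hP (Q := Q) hk hv
    (Or.inr hn) hT' true false ε
  rw [heq, circleMon_eq_mul (D := G.dress k) κ v, map_mul, hT, Finset.prod_empty, map_one,
    show saddleCoeff v true false ε δ = 1 from
      (entry_saddleMap_of_openKind_ne ho true false ε δ).trans (if_pos hδ), map_one, map_one]

end Cases

end Crossingless

/-! ### Comparison of the transfer map with the saddle map. -/

namespace Crossingless

open Gluing Factorization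

section Comparison

variable {V : Type*} [DecidableEq V] [Fintype V] {G : Gluing V} {k k' : V → ArcKind} {v : V}
variable (F : (G.dress k).Frame) (F' : (G.dress k').Frame) (κ : G.Colouring)
  (hL : G.Linked) (hP : G.Planar)

theorem boundary_transfer_sub_saddleMap (hk : ∀ u, u ≠ v → k u = k' u) (hv : k v ≠ k' v) :
    boundary (M := (G.dress k).delooped) (N := (G.dress k').delooped)
      (transfer F F' κ hL hP v - saddleBetween G k k' v) = 0 :=
  boundary_eq_zero fun x => by
    rw [LinearMap.sub_apply, LinearMap.sub_apply, map_sub,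
      d_comp_eq (transfer_closed F F' κ hL hP hk hv), d_comp_eq saddleMap_closed]

theorem entry_sub_mem {Q : Ideal BoundaryRing} {b b' : Bool}
    {f g : (G.dress k).delooped.carrier →ₗ[BoundaryRing] (G.dress k').delooped.carrier}
    {ε : (G.dress k).closedComponents → Fin 2}
    (h : F'.mkResidue κ hL hP Q (block (D := G.dress k') κ b' (f ((G.dress k).deloopedBasis (b, ε)))) =
      F'.mkResidue κ hL hP Q (block (D := G.dress k') κ b' (g ((G.dress k).deloopedBasis (b, ε)))))
    (ε' : (G.dress k').closedComponents → Fin 2) : entry (f - g) b b' ε ε' ∈ Q := by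
  have h1 := (F'.mem_residue κ hL hP Q).mp (Ideal.Quotient.eq.mp h) ε'
  rw [map_sub, coeff_block F' κ hL hP, coeff_block F' κ hL hP] at h1
  rwa [entry_sub]

/-- A merging sends 1 to 1 by `transfer_generator`. For a splitting the reverse map is a merging, so
1 is the image of 1 under the reverse map, and going back gives σ. Multiplying by circle monomials
yields the values found above for the saddle maps. -/
theorem mkResidue_transfer_eq_saddleMap (hk : ∀ u, u ≠ v → k u = k' u) (hv : k v ≠ k' v)
    (ho : (G.dress k).openKind = (G.dress k').openKind) {Q : Ideal BoundaryRing}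
    (hp : (G.dress k').openKind.fst ∈ Q) (hq : (G.dress k').openKind.snd ∈ Q)
    (ε : (G.dress k).closedComponents → Fin 2) :
    F'.mkResidue κ hL hP Q (block (D := G.dress k') κ false
        (transfer F F' κ hL hP v ((G.dress k).deloopedBasis (false, ε)))) =
      F'.mkResidue κ hL hP Q (block (D := G.dress k') κ false
        (saddleBetween G k k' v ((G.dress k).deloopedBasis (false, ε)))) := by
  rw [mkResidue_transfer_basis F F' κ hL hP hk hv (ho ▸ hp) (ho ▸ hq) hp hq]
  have hodd := odd_card_closedComponents κ hL hP hk hv ho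
  have hc := card_closedComponents (D := G.dress k) v
  have hc' := card_closedComponents (D := G.dress k') v
  have haway := card_circlesAway (G := G) hk
  have h2 := circlesAt_le_two (D := G.dress k) v
  have h2' := circlesAt_le_two (D := G.dress k') v
  have hmerge : (G.dress k).circlesAt v = (G.dress k').circlesAt v + 1 →
      F'.mkResidue κ hL hP Q (block (D := G.dress k') κ false
        (transfer F F' κ hL hP v ((G.dress k).deloopedBasis (false, 0)))) = 1 := by
    intro h
    rw [transfer_generator F F' κ hL hP hk hv false (by
      simp only [Bool.false_eq_true, if_false]; omega), block_basis, if_pos rfl, circleMon_zero,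
      map_one]
  have hsplit : (G.dress k').circlesAt v = (G.dress k).circlesAt v + 1 →
      F'.mkResidue κ hL hP Q (block (D := G.dress k') κ false
        (transfer F F' κ hL hP v ((G.dress k).deloopedBasis (false, 0)))) =
      F'.mkResidue κ hL hP Q (altSum G v) := by
    intro h
    have hk' : ∀ u, u ≠ v → k' u = k u := fun u hu => (hk u hu).symm
    rw [← mkResidue_transfer_transfer F' F κ hL hP hk' hv.symm hp hq false,
      transfer_generator F' F κ hL hP hk' hv.symm false (by
      simp only [Bool.false_eq_true, if_false]; omega)]
  -- At most two circles run through `v` in each diagram, and by the change of parity the numbers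
  -- differ by one.
  have hcases : ((G.dress k).circlesAt v = 2 ∧ (G.dress k').circlesAt v = 1) ∨
      ((G.dress k).circlesAt v = 1 ∧ (G.dress k').circlesAt v = 2) ∨
      ((G.dress k).circlesAt v = 1 ∧ (G.dress k').circlesAt v = 0) ∨
      ((G.dress k).circlesAt v = 0 ∧ (G.dress k').circlesAt v = 1) := by
    obtain ⟨l, hl⟩ := hodd
    omega
  rcases hcases with ⟨hn, hn'⟩ | ⟨hn, hn'⟩ | ⟨hn, hn'⟩ | ⟨hn, hn'⟩
  · rw [hmerge (by omega), mul_one,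
      mkResidue_saddleMap_two_one F' κ hL hP hk hv ho hp hq hn hn']
  · rw [hsplit (by omega), mkResidue_saddleMap_one_two F' κ hL hP hk hv ho hp hq hn hn']
  · rw [hmerge (by omega), mul_one, mkResidue_saddleMap_one_zero F' κ hL hP hk hv ho hp hn hn']
  · rw [hsplit (by omega), mkResidue_saddleMap_zero_one F' κ hL hP hk hv ho hp hn hn']

/-- The transfer map is homotopic to the saddle map. -/
theorem transfer_homotopic_saddleMap (hk : ∀ u, u ≠ v → k u = k' u) (hv : k v ≠ k' v) :
    Homotopic (M := (G.dress k).delooped) (N := (G.dress k').delooped)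
      (transfer F F' κ hL hP v) (saddleBetween G k k' v) := by
  have hcl := boundary_transfer_sub_saddleMap F F' κ hL hP hk hv
  by_cases ho : (G.dress k).openKind = (G.dress k').openKind
  · refine homotopic_of_openKind_eq ho hcl (fun b ε ε' => ?_) fun ε ε' => ?_
    · rw [entry_sub, (entry_saddleMap_of_openKind_eq ho ε ε').1 b, sub_zero, entry]
      refine eq_zero_of_mem_boundaryPiece_odd (repr_transfer_mem F F' κ hL hP _ _) ?_
      obtain ⟨l, hl⟩ := odd_card_closedComponents κ hL hP hk hv ho
      rw [basisDeg_eq, basisDeg_eq]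
      cases b
      · refine ⟨l + 1 - ∑ c, ((ε' c : ℕ) : ℤ) + ∑ c, ((ε c : ℕ) : ℤ), ?_⟩
        simp only [Bool.not_false, Bool.false_eq_true, if_false, if_true]
        linarith
      · refine ⟨l - ∑ c, ((ε' c : ℕ) : ℤ) + ∑ c, ((ε c : ℕ) : ℤ), ?_⟩
        simp only [Bool.not_true, Bool.false_eq_true, if_false, if_true]
        linarith
    -- Take `Q` generated by the two entries of the differential, the ideal in the criterion for
    -- null-homotopy.
    · exact entry_sub_mem F' κ hL hP (mkResidue_transfer_eq_saddleMap F F' κ hL hP hk hv ho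
        (Ideal.subset_span (by simp)) (Ideal.subset_span (by simp)) ε) ε'
  · have hk' : ∀ u, u ≠ v → k' u = k u := fun u hu => (hk u hu).symm
    have hn := circlesAt_eq_zero_of_openKind_ne κ hk ho
    have hn' := circlesAt_eq_zero_of_openKind_ne κ hk' (Ne.symm ho)
    have hc := card_closedComponents (D := G.dress k) v
    have hc' := card_closedComponents (D := G.dress k') v
    have haway := card_circlesAway (G := G) hk
    refine homotopic_of_openKind_ne ho hcl (fun b ε ε' => ?_) fun ε ε' => ?_
    · rw [entry_sub, entry_saddleMap_of_openKind_ne ho, if_pos rfl, ite_self, sub_zero, entry]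
      refine eq_zero_of_mem_boundaryPiece_odd (repr_transfer_mem F F' κ hL hP _ _) ?_
      rw [basisDeg_eq, basisDeg_eq]
      refine ⟨- ∑ c, ((ε' c : ℕ) : ℤ) + ∑ c, ((ε c : ℕ) : ℤ), ?_⟩
      have : (Nat.card (G.dress k).closedComponents : ℤ) = Nat.card (G.dress k').closedComponents := by
        omega
      linarith
    -- The two kinds of open strands differ, so this ideal is (x, y); it contains all entries of
    -- both differentials. The numbers of circles agree, which is the case of `transfer_generator`
    -- that starts in the copy `true`.
    · have hp : (G.dress k).openKind.fst ∈
          Ideal.span {(G.dress k).openKind.fst, (G.dress k').openKind.fst} :=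
        Ideal.subset_span (by simp)
      have hp' : (G.dress k').openKind.fst ∈
          Ideal.span {(G.dress k).openKind.fst, (G.dress k').openKind.fst} :=
        Ideal.subset_span (by simp)
      refine entry_sub_mem F' κ hL hP ?_ ε'
      rw [mkResidue_transfer_basis F F' κ hL hP hk hv hp
        (ArcKind.snd_eq ho ▸ Ideal.mul_mem_right _ _ hp') hp'
        (ArcKind.snd_eq (Ne.symm ho) ▸ Ideal.mul_mem_right _ _ hp),
        transfer_generator F F' κ hL hP hk hv true (by simp only [if_true]; omega), block_basis,
        if_pos rfl, circleMon_zero, map_one, mul_one,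
        mkResidue_saddleMap_zero_zero F' κ hL hP hk hv ho hn hn']

end Comparison

end Crossingless

/-! ### Application to the cube of resolutions. -/

theorem TangleDiagram.Standing.linked {C : Type*} [Fintype C] {T : TangleDiagram C}
    (hT : T.Standing) : T.toGluing.Linked := by
  intro e e'
  refine (hT.connected e e').mono fun a b h => ?_
  cases h with
  | crossing c _ _ h h' => exact ⟨some c, h, h'⟩
  | strand s => exact ⟨none, ⟨s, Or.inl rfl⟩, ⟨s, Or.inr rfl⟩⟩

theorem TangleDiagram.resolveCrossing_ne (s : Sign) :
    resolveCrossing s false ≠ resolveCrossing s true := by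
  cases s <;> exact fun h => ArcKind.noConfusion h

end Delooping

end

open Delooping in
theorem mainTheorem5 {C : Type*} [Fintype C] [DecidableEq C] (T : TangleDiagram C)
    (hT : T.Standing) :
    (∀ r : C → Bool,
      (T.resolution r).factorization.IsMatrixFactorization (bx * bY * bz) ∧
      (T.resolution r).delooped.IsMatrixFactorization (bx * bY * bz)) ∧
    ∃ φ : ∀ r : C → Bool, Factorization.SpecialDeformationRetract
        (T.resolution r).factorization (T.resolution r).delooped,
      ∀ (r : C → Bool) (c : C), r c = false →
        Factorization.Homotopic
          (M := (T.resolution r).delooped)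
          (N := (T.resolution (Function.update r c true)).delooped)
          ((φ (Function.update r c true)).proj ∘ₗ
            T.edgeMap c r (Function.update r c true) ∘ₗ (φ r).incl)
          ((T.resolution r).saddleMap
            (T.resolvedKind (Function.update r c true)) (some c)) := by
  refine ⟨fun r => ⟨Crossingless.factorization_isMatrixFactorization _,
    Crossingless.delooped_isMatrixFactorization _⟩, ?_⟩
  have hL : T.toGluing.Linked := hT.linked
  -- Regions and edges are the same for all resolutions, so one colouring serves the whole cube. A
  -- frame, on the other hand, is chosen separately at each vertex of the cube; the comparison of
  -- induced maps allows arbitrary choices.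
  obtain ⟨κ⟩ := Gluing.nonempty_colouring hL hT.planar
  have F : ∀ r : C → Bool, (T.toGluing.dress (T.resolvedKind r)).Frame := fun r =>
    (Crossingless.nonempty_frame (D := T.toGluing.dress (T.resolvedKind r)) κ hL).some
  refine ⟨fun r => (F r).retract κ hL hT.planar, fun r c hr => ?_⟩
  refine Crossingless.transfer_homotopic_saddleMap (v := some c) (F r)
    (F (Function.update r c true)) κ hL hT.planar ?_ ?_
  · rintro (_ | u) hu
    · rfl
    · have hne : u ≠ c := fun h => hu (congrArg some h)
      simp only [TangleDiagram.resolvedKind, Function.update_of_ne hne]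
  · simp only [TangleDiagram.resolvedKind, Function.update_self, hr]
    exact TangleDiagram.resolveCrossing_ne _
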